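/- Let $n\ge 4$, let $H_0$ be an $n\times n$ complex Ginibre matrix (i.i.d. complex Gaussian entries with $\mathbb E h=0$, $\mathbb E|h|^2=1/n$, $\mathbb E h^2=0$), let $A_0$ be a complex $n\times n$ matrix, $H=A_0+H_0$, $Y(z)=(H-z)(H-z)^*$. If $A_0$ is random, it is independent of $H_0$ and $\mathbb E$ below is the conditional expectation given $A_0$. Let $z_0,\zeta_j,\zeta_j'\in\mathbb C$, $\epsilon_j\in\mathbb R$ $(j=1,2)$, $\epsilon'>0$, $z_j=z_0+\zeta_j/\sqrt n$, $z_j'=z_0+\zeta_j'/\sqrt n$, $\zeta=\mathrm{diag}(\zeta_1,\zeta_2)$, $\zeta'=\mathrm{diag}(\zeta_1',\zeta_2')$, $\hat\epsilon=\mathrm{diag}(\epsilon_1,\epsilon_2)$, $\hat\epsilon'=\epsilon' I_2$, and $$\mathcal Z(\zeta,\zeta',\hat\epsilon/n,\hat\epsilon'/n)=\mathbb E\Big\{\prod_{j=1}^2\frac{\det(Y(z_j)+(\epsilon_j/n)^2)}{\det(Y(z_j')+(\epsilon'/n)^2)}\Big\}.$$ Put $A_z=A_0-z_0$ and suppose that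 $u_*>0$ solves $n^{-1}\mathrm{Tr}(A_zA_z^*+u_*^2)^{-1}=1$. Then $$\mathcal Z(\zeta,\zeta',\hat\epsilon/n,\hat\epsilon'/n)=\frac{16\,n^{12}}{\pi^9}\int_{\mathcal H_2^+}dR\,dR_2\int_{\Im T=u_*}dT\int_{\mathcal H_2}dS\int_{\mathcal H_2^+}d\Lambda\int_{U(2)}dU\int d\nu\; e^{\mathcal L}\,E_{*1}(\hat\epsilon,\Lambda,U)\,E_{*2}(\epsilon',R,R_2),$$ where the integrand, after the Berezin integration $\int d\nu$, is absolutely integrable in $(R,R_2,T,S,\Lambda,U)$. Here $\mathcal H_2$ is the set of Hermitian $2\times2$ matrices and $\mathcal H_2^+$ that of positive definite ones, with the Lebesgue measure $dM=dM_{11}\,dM_{22}\,d\Re M_{12}\,d\Im M_{12}$; $T=iu_*I_2+T'$ with $T'\in\mathcal H_2$, $dT=dT'$; $dU$ is the Haar probability measure on $U(2)$; $\nu_l=\{\nu^{(l)}_{jk}\}$, $\nu_l^*=\{\bar\nu^{(l)}_{kj}\}$, $l=1,2$, are $2\times2$ matrices of independent Grassmann variables, $d\nu=\prod_{l=1}^2\prod_{j,k=1}^2d\nu^{(l)}_{kj}\,d\bar\nu^{(l)}_{jk}$,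 and the Berezin integral has $\int d\psi=0$, $\int\psi\,d\psi=1$, $\int\psi_1\cdots\psi_m\,d\psi_m\cdots d\psi_1=1$. Further, $$\mathcal L=\log\mathrm{Sdet}\,\hat Q-n\,\mathrm{Tr}[R^2+2iRT+\Lambda^2]-\mathrm{Tr}(\nu_1\nu_1^*+\nu_2\nu_2^*),$$ $$\hat Q=\begin{pmatrix}\Lambda\otimes I_n&i\mathcal A(\zeta)&n^{-1/2}\nu_1\otimes I_n&0\\ i\mathcal A(\zeta_U)^*&\Lambda\otimes I_n&0&n^{-1/2}\nu_2\otimes I_n\\ n^{-1/2}\nu_2^*\otimes I_n&0&i(T+S)\otimes I_n&i\mathcal A(\zeta_J')\\ 0&n^{-1/2}\nu_1^*\otimes I_n&i\mathcal A(\zeta_J')^*&i(T-S)\otimes I_n\end{pmatrix},$$ $\mathrm{Sdet}\begin{pmatrix}A&\chi\\ \eta&B\end{pmatrix}=\det(A-\chi B^{-1}\eta)/\det B$ for the $4n\times4n$ blocks $A,\chi,\eta,B$ (and $e^{\log\mathrm{Sdet}\,\hat Q}$ means $\mathrm{Sdet}\,\hat Q$), $\mathcal A(\xi)=I_2\otimes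 A_z-n^{-1/2}\xi\otimes I_n$, $\zeta_U=U\zeta U^*$, $\zeta_J'=J^{-1}\zeta'J$, $J=R_2^{1/2}R^{-1/2}$, and $$E_{*1}(\hat\epsilon,\Lambda,U)=(\mathrm{Tr}\,\Lambda)^2\det\Lambda\;\exp\{-\mathrm{Tr}(\Lambda U\hat\epsilon+\hat\epsilon U^*\Lambda)-n^{-1}\mathrm{Tr}\,\hat\epsilon^2\},$$ $$E_{*2}(\epsilon',R,R_2)=\frac{(\mathrm{Tr}\,R)^2\det R}{\det^2R_2}\exp\{-\epsilon'\,\mathrm{Tr}(R_2+R_2^{-1}R^2)\}.$$ -/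

import Mathlib

open MeasureTheory ProbabilityTheory
open scoped Matrix Kronecker ComplexConjugate NNReal ComplexOrder

noncomputable section

namespace DeformedGinibre

/-! ### The complex Ginibre matrix and the averaged ratio of determinants -/

/-- Matrices carry the product sigma-algebra of their entries. -/
instance matrixMeasurableSpace {m k : Type*} : MeasurableSpace (Matrix m k ℂ) :=
  MeasurableSpace.pi

instance matrixBorelSpace {m k : Type*} [Countable m] [Countable k] :
    BorelSpace (Matrix m k ℂ) :=
  inferInstanceAs (BorelSpace (m → k → ℂ))

/-- The law of a complex Gaussian variable `h` with `E h = 0`, `E |h|^2 = v`, `E h^2 = 0`: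
real and imaginary parts are independent centred Gaussians of variance `v / 2`. -/
def complexGaussian (v : ℝ≥0) : Measure ℂ :=
  ((gaussianReal 0 (v / 2)).prod (gaussianReal 0 (v / 2))).map
    Complex.measurableEquivRealProd.symm

/-- `H₀` is a complex Ginibre matrix: its entries are i.i.d. complex Gaussian
with mean `0`, `E |h|^2 = 1 / n` and `E h^2 = 0`. -/
structure IsGinibre {Ω : Type*} [MeasurableSpace Ω] (P : Measure Ω) {n : ℕ}
    (H₀ : Ω → Matrix (Fin n) (Fin n) ℂ) : Prop where
  measurable : Measurable H₀
  indep : iIndepFun (fun (p : Fin n × Fin n) (ω : Ω) => H₀ ω p.1 p.2) P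
  law : ∀ i j, P.map (fun ω => H₀ ω i j) = complexGaussian ((n : ℝ≥0)⁻¹)

/-- `Y(z) + ε^2`, where `Y(z) = (H - z)(H - z)^*`. -/
def Yreg {n : ℕ} (H : Matrix (Fin n) (Fin n) ℂ) (z : ℂ) (ε : ℝ) :
    Matrix (Fin n) (Fin n) ℂ :=
  (H - z • 1) * (H - z • 1)ᴴ + ((ε : ℂ) ^ 2) • 1

/-- `z_j = z₀ + ζ_j / √n`. -/
def point (n : ℕ) (z₀ : ℂ) (ζ : Fin 2 → ℂ) (j : Fin 2) : ℂ := z₀ + ζ j / (Real.sqrt n : ℂ)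

/-- `∏_j det (Y(z_j) + ε_j^2) / det (Y(z'_j) + ε'^2)`. -/
def detRatio {n : ℕ} (z₀ : ℂ) (ζ ζ' : Fin 2 → ℂ) (ε : Fin 2 → ℝ) (ε' : ℝ)
    (H : Matrix (Fin n) (Fin n) ℂ) : ℂ :=
  ∏ j : Fin 2, (Yreg H (point n z₀ ζ j) (ε j)).det / (Yreg H (point n z₀ ζ' j) ε').det

/-- The generating functional `Z(ζ, ζ', ε̂, ε̂')` of `H = A₀ + H₀`, for a fixed matrix `A₀`. -/
def genZ {Ω : Type*} [MeasurableSpace Ω] (P : Measure Ω) {n : ℕ}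
    (H₀ : Ω → Matrix (Fin n) (Fin n) ℂ) (A₀ : Matrix (Fin n) (Fin n) ℂ)
    (z₀ : ℂ) (ζ ζ' : Fin 2 → ℂ) (ε : Fin 2 → ℝ) (ε' : ℝ) : ℂ :=
  ∫ ω, detRatio z₀ ζ ζ' ε ε' (A₀ + H₀ ω) ∂P

/-- `u` is a positive solution of `n⁻¹ Tr (A_z A_z^* + u^2)⁻¹ = 1`. -/
def IsUStar {n : ℕ} (Az : Matrix (Fin n) (Fin n) ℂ) (u : ℝ) : Prop :=
  0 < u ∧ (n : ℂ)⁻¹ * ((Az * Azᴴ + ((u : ℂ) ^ 2) • 1)⁻¹).trace = 1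

/-! ### The Grassmann algebra of the 16 generators `ν^{(l)}_{jk}`, `ν̄^{(l)}_{jk}` -/

/-- Labels of the generators: `(l, j, k, false)` stands for `ν^{(l)}_{jk}` and
`(l, j, k, true)` for `ν̄^{(l)}_{jk}`. -/
abbrev Gen : Type := Fin 2 × Fin 2 × Fin 2 × Bool

/-- The Grassmann algebra. -/
abbrev Grass : Type := ExteriorAlgebra ℂ (Gen → ℂ)

/-- Its subalgebra of even elements. -/
abbrev GrassEven : Subalgebra ℂ Grass := CliffordAlgebra.even (0 : QuadraticForm ℂ (Gen → ℂ))

/-- Its subspace of odd elements. -/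
abbrev GrassOdd : Submodule ℂ Grass := CliffordAlgebra.evenOdd (0 : QuadraticForm ℂ (Gen → ℂ)) 1

theorem even_commute (x y : Grass) (hx : x ∈ GrassEven) : x * y = y * x := by
  have key : ∀ a b c : Gen → ℂ,
      Commute (ExteriorAlgebra.ι ℂ a * ExteriorAlgebra.ι ℂ b) (ExteriorAlgebra.ι ℂ c) := by
    intro a b c
    have h1 := eq_neg_of_add_eq_zero_left (ExteriorAlgebra.ι_add_mul_swap (R := ℂ) b c)
    have h2 := eq_neg_of_add_eq_zero_left (ExteriorAlgebra.ι_add_mul_swap (R := ℂ) a c)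
    show _ * _ * _ = _ * (_ * _)
    rw [mul_assoc, h1, mul_neg, ← mul_assoc, h2, neg_mul, neg_neg, mul_assoc]
  have key2 : ∀ (a b : Gen → ℂ) (z : Grass),
      Commute (ExteriorAlgebra.ι ℂ a * ExteriorAlgebra.ι ℂ b) z := by
    intro a b z
    induction z using ExteriorAlgebra.induction with
    | algebraMap r => exact (Algebra.commutes r _).symm
    | ι c => exact key a b c
    | mul u v hu hv => exact hu.mul_right hv
    | add u v hu hv => exact hu.add_right hv
  have hx' : x ∈ CliffordAlgebra.evenOdd (0 : QuadraticForm ℂ (Gen → ℂ)) 0 := hx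
  induction x, hx' using CliffordAlgebra.even_induction with
  | algebraMap r => exact Algebra.commutes r y
  | add u v hu hv ihu ihv => rw [add_mul, mul_add, ihu hu, ihv hv]
  | ι_mul_ι_mul a b u hu ih => exact Commute.mul_left (key2 a b y) (ih hu)

instance evenCommRing : CommRing GrassEven :=
  { (inferInstance : Ring GrassEven) with
    mul_comm := fun x y => Subtype.ext (even_commute x y x.2) }

theorem odd_mul_even_mul_odd_mem (a : GrassOdd) (e : GrassEven) (b : GrassOdd) :
    (a : Grass) * (e : Grass) * (b : Grass) ∈ GrassEven := by
  have he : (e : Grass) ∈ CliffordAlgebra.evenOdd (0 : QuadraticForm ℂ (Gen → ℂ)) 0 := e.2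
  have h := SetLike.mul_mem_graded (SetLike.mul_mem_graded a.2 he) b.2
  have h2 : (1 + 0 + 1 : ZMod 2) = 0 := by decide
  rw [h2] at h
  exact h

/-- The product `a e b` of an odd, an even and an odd element, which is even. -/
def oddEvenOdd (a : GrassOdd) (e : GrassEven) (b : GrassOdd) : GrassEven :=
  ⟨(a : Grass) * (e : Grass) * (b : Grass), odd_mul_even_mul_odd_mem a e b⟩

/-- A generator, as an odd element. -/
def gen (g : Gen) : GrassOdd :=
  ⟨ExteriorAlgebra.ι ℂ (Pi.single g 1), CliffordAlgebra.ι_mem_evenOdd_one _ _⟩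

/-- The matrix `ν_l`. -/
def nu (l : Fin 2) : Matrix (Fin 2) (Fin 2) GrassOdd := fun j k => gen (l, j, k, false)

/-- The matrix `ν_l^*`, with entries `(ν_l^*)_{jk} = ν̄^{(l)}_{kj}`. -/
def nuStar (l : Fin 2) : Matrix (Fin 2) (Fin 2) GrassOdd := fun j k => gen (l, k, j, true)

/-- `Tr (ν_1 ν_1^* + ν_2 ν_2^*)`. -/
def traceNuNuStar : Grass :=
  ∑ l : Fin 2, ∑ j : Fin 2, ∑ k : Fin 2, (nu l j k : Grass) * (nuStar l k j : Grass)

/-- The Berezin integral `∫ f dg` over one generator `g`: it is linear, kills the elements that do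
not contain `g`, and sends `a * g` to `a` for such `a` (that is, it is the right derivative). -/
def berezinOne (g : Gen) (f : Grass) : Grass :=
  CliffordAlgebra.contractRight f (LinearMap.proj g : (Gen → ℂ) →ₗ[ℂ] ℂ)

/-- The order of the differentials in
`dν = ∏_{l=1}^2 ∏_{j,k=1}^2 dν^{(l)}_{kj} dν̄^{(l)}_{jk}`. -/
def dnu : List Gen :=
  (List.finRange 2).flatMap fun l => (List.finRange 2).flatMap fun j =>
    (List.finRange 2).flatMap fun k => [(l, k, j, false), (l, j, k, true)]

/-- The repeated Berezin integral `∫ f dν`, a complex number. -/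
def berezin (f : Grass) : ℂ :=
  ExteriorAlgebra.algebraMapInv (dnu.foldl (fun h g => berezinOne g h) f)

/-- A supermatrix `[[A, χ], [η, B]]` with even diagonal and odd off-diagonal blocks. -/
structure SuperMatrix (m k : Type*) where
  A : Matrix m m GrassEven
  χ : Matrix m k GrassOdd
  η : Matrix k m GrassOdd
  B : Matrix k k GrassEven

/-- `Sdet F = det (A - χ B⁻¹ η) / det B`. -/
def SuperMatrix.sdet {m k : Type*} [Fintype m] [DecidableEq m] [Fintype k] [DecidableEq k]
    (F : SuperMatrix m k) : GrassEven :=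
  (F.A - Matrix.of fun i j => ∑ p, ∑ q, oddEvenOdd (F.χ i p) (F.B⁻¹ p q) (F.η q j)).det
    * Ring.inverse F.B.det

/-! ### Integration over Hermitian and unitary `2 × 2` matrices -/

/-- Independent entries `(M₁₁, M₂₂, M₁₂)` of a Hermitian `2 × 2` matrix `M`. The volume on this
space is the Lebesgue measure `dM = dM₁₁ dM₂₂ d(Re M₁₂) d(Im M₁₂)`. -/
abbrev Herm2 : Type := ℝ × ℝ × ℂ

/-- The Hermitian matrix with the given independent entries. -/
def Herm2.mat (p : Herm2) : Matrix (Fin 2) (Fin 2) ℂ :=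
  !![(p.1 : ℂ), p.2.2; conj p.2.2, (p.2.1 : ℂ)]

/-- The unitary group `U(2)`. -/
abbrev U2 : Type := Matrix.unitaryGroup (Fin 2) ℂ

instance compactSpaceU2 : CompactSpace U2 := by
  refine isCompact_iff_compactSpace.mp ?_
  have hK : IsCompact (Set.pi Set.univ fun _ : Fin 2 => Set.pi Set.univ fun _ : Fin 2 =>
      Metric.closedBall (0 : ℂ) 1) :=
    isCompact_univ_pi fun _ => isCompact_univ_pi fun _ => isCompact_closedBall 0 1
  refine hK.of_isClosed_subset (isClosed_unitary (R := Matrix (Fin 2) (Fin 2) ℂ)) ?_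
  intro M hM i _ j _
  rw [mem_closedBall_zero_iff]
  exact entry_norm_bound_of_unitary hM i j

/-- The Haar measure on `U(2)`, of total mass one. -/
def haarU2 : Measure U2 := Measure.haarMeasure ⊤

/-- The positive square root of a positive definite matrix. -/
def msqrt (M : Matrix (Fin 2) (Fin 2) ℂ) : Matrix (Fin 2) (Fin 2) ℂ := cfc Real.sqrt M

/-! ### The integrand -/

/-- `𝒜(ζ) = I_2 ⊗ A_z - n^{-1/2} ζ ⊗ I_n`. -/
def calA {n : ℕ} (Az : Matrix (Fin n) (Fin n) ℂ) (ζ : Matrix (Fin 2) (Fin 2) ℂ) :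
    Matrix (Fin 2 × Fin n) (Fin 2 × Fin n) ℂ :=
  (1 : Matrix (Fin 2) (Fin 2) ℂ) ⊗ₖ Az
    - ((Real.sqrt n : ℂ)⁻¹) • (ζ ⊗ₖ (1 : Matrix (Fin n) (Fin n) ℂ))

/-- `ζ_U = U ζ U^*`. -/
def zetaU (ζ : Fin 2 → ℂ) (U : U2) : Matrix (Fin 2) (Fin 2) ℂ :=
  (U : Matrix (Fin 2) (Fin 2) ℂ) * Matrix.diagonal ζ * (U : Matrix (Fin 2) (Fin 2) ℂ)ᴴ

/-- `J = R_2^{1/2} R^{-1/2}`. -/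
def matJ (R R₂ : Matrix (Fin 2) (Fin 2) ℂ) : Matrix (Fin 2) (Fin 2) ℂ :=
  msqrt R₂ * (msqrt R)⁻¹

/-- `ζ'_J = J⁻¹ ζ' J`. -/
def zetaJ (ζ' : Fin 2 → ℂ) (R R₂ : Matrix (Fin 2) (Fin 2) ℂ) : Matrix (Fin 2) (Fin 2) ℂ :=
  (matJ R R₂)⁻¹ * Matrix.diagonal ζ' * matJ R R₂

/-- `n^{-1/2} ν ⊗ I_n`, for a matrix `ν` of odd elements. -/
def oddTensor (n : ℕ) (ν : Matrix (Fin 2) (Fin 2) GrassOdd) :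
    Matrix (Fin 2 × Fin n) (Fin 2 × Fin n) GrassOdd :=
  ((Real.sqrt n : ℂ)⁻¹) •
    Matrix.kroneckerMap (fun (a : GrassOdd) (c : ℂ) => c • a) ν (1 : Matrix (Fin n) (Fin n) ℂ)

/-- The supermatrix `Q̂`; `Λ, T, S` are arbitrary matrices here. -/
def Qhat {n : ℕ} (Az : Matrix (Fin n) (Fin n) ℂ) (ζ ζ' : Fin 2 → ℂ)
    (R R₂ T S Λ : Matrix (Fin 2) (Fin 2) ℂ) (U : U2) :
    SuperMatrix ((Fin 2 × Fin n) ⊕ (Fin 2 × Fin n)) ((Fin 2 × Fin n) ⊕ (Fin 2 × Fin n)) where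
  A := (Matrix.fromBlocks
      (Λ ⊗ₖ (1 : Matrix (Fin n) (Fin n) ℂ)) (Complex.I • calA Az (Matrix.diagonal ζ))
      (Complex.I • (calA Az (zetaU ζ U))ᴴ) (Λ ⊗ₖ (1 : Matrix (Fin n) (Fin n) ℂ))).map
    (algebraMap ℂ GrassEven)
  χ := Matrix.fromBlocks (oddTensor n (nu 0)) 0 0 (oddTensor n (nu 1))
  η := Matrix.fromBlocks (oddTensor n (nuStar 1)) 0 0 (oddTensor n (nuStar 0))
  B := (Matrix.fromBlocks
      (Complex.I • ((T + S) ⊗ₖ (1 : Matrix (Fin n) (Fin n) ℂ)))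
      (Complex.I • calA Az (zetaJ ζ' R R₂))
      (Complex.I • (calA Az (zetaJ ζ' R R₂))ᴴ)
      (Complex.I • ((T - S) ⊗ₖ (1 : Matrix (Fin n) (Fin n) ℂ)))).map
    (algebraMap ℂ GrassEven)

/-- `exp 𝓛`, where
`𝓛 = log Sdet Q̂ - n Tr (R^2 + 2 i R T + Λ^2) - Tr (ν_1 ν_1^* + ν_2 ν_2^*)`. Since
`exp (log Sdet Q̂) = Sdet Q̂`, no branch of the logarithm is needed; the Grassmann part of the
exponent is nilpotent and its exponential is the finite exponential sum. -/
def expL {n : ℕ} (Az : Matrix (Fin n) (Fin n) ℂ) (ζ ζ' : Fin 2 → ℂ)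
    (R R₂ T S Λ : Matrix (Fin 2) (Fin 2) ℂ) (U : U2) : Grass :=
  Complex.exp (-(n : ℂ) * (R ^ 2 + (2 * Complex.I) • (R * T) + Λ ^ 2).trace) •
    (((Qhat Az ζ ζ' R R₂ T S Λ U).sdet : Grass) * IsNilpotent.exp (-traceNuNuStar))

/-- `E_{*1} = (Tr Λ)^2 det Λ exp (- Tr (Λ U ε̂ + ε̂ U^* Λ) - n⁻¹ Tr ε̂^2)`. -/
def Estar1 (n : ℕ) (ε : Fin 2 → ℝ) (Λ : Matrix (Fin 2) (Fin 2) ℂ) (U : U2) : ℂ :=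
  let εh : Matrix (Fin 2) (Fin 2) ℂ := Matrix.diagonal fun j => (ε j : ℂ)
  let V : Matrix (Fin 2) (Fin 2) ℂ := U
  Λ.trace ^ 2 * Λ.det *
    Complex.exp (-(Λ * V * εh + εh * Vᴴ * Λ).trace - (n : ℂ)⁻¹ * (εh ^ 2).trace)

/-- `E_{*2} = (Tr R)^2 det R (det R_2)^{-2} exp (- Tr (ε' R_2 + ε' R_2⁻¹ R^2))`. -/
def Estar2 (ε' : ℝ) (R R₂ : Matrix (Fin 2) (Fin 2) ℂ) : ℂ :=
  R.trace ^ 2 * R.det / R₂.det ^ 2 *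
    Complex.exp (-((ε' : ℂ) • R₂ + (ε' : ℂ) • (R₂⁻¹ * R ^ 2)).trace)

/-- The commuting integration variables. -/
structure Vars where
  R : Herm2
  R₂ : Herm2
  T' : Herm2
  S : Herm2
  Λ : Herm2
  U : U2

/-- The variables `(R, R_2, T', S, Λ, U)` from a tuple. -/
def Vars.ofTuple (x : Herm2 × Herm2 × Herm2 × Herm2 × Herm2 × U2) : Vars :=
  ⟨x.1, x.2.1, x.2.2.1, x.2.2.2.1, x.2.2.2.2.1, x.2.2.2.2.2⟩

/-- The integrand `∫ dν exp 𝓛 E_{*1} E_{*2}` on the contour `T = i u + T'`. -/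
def integrand {n : ℕ} (Az : Matrix (Fin n) (Fin n) ℂ) (ζ ζ' : Fin 2 → ℂ) (ε : Fin 2 → ℝ)
    (ε' : ℝ) (u : ℝ) (v : Vars) : ℂ :=
  berezin (expL Az ζ ζ' v.R.mat v.R₂.mat ((Complex.I * (u : ℂ)) • 1 + v.T'.mat) v.S.mat v.Λ.mat v.U)
    * Estar1 n ε v.Λ.mat v.U * Estar2 ε' v.R.mat v.R₂.mat

/-- The measure `dR dR_2 dT' dS dΛ dU` on `R, R_2, Λ > 0`, `T', S` Hermitian, `U ∈ U(2)`. -/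
def reprMeasure : Measure (Herm2 × Herm2 × Herm2 × Herm2 × Herm2 × U2) :=
  ((volume : Measure Herm2).prod ((volume : Measure Herm2).prod ((volume : Measure Herm2).prod
    ((volume : Measure Herm2).prod ((volume : Measure Herm2).prod haarU2))))).restrict
    {x | (Vars.ofTuple x).R.mat.PosDef ∧ (Vars.ofTuple x).R₂.mat.PosDef ∧
      (Vars.ofTuple x).Λ.mat.PosDef}

/-- The integral converges absolutely. -/
def ReprIntegrable {n : ℕ} (Az : Matrix (Fin n) (Fin n) ℂ) (ζ ζ' : Fin 2 → ℂ) (ε : Fin 2 → ℝ)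
    (ε' : ℝ) (u : ℝ) : Prop :=
  Integrable (fun x => integrand Az ζ ζ' ε ε' u (Vars.ofTuple x)) reprMeasure

/-- The integral representation. -/
def reprIntegral {n : ℕ} (Az : Matrix (Fin n) (Fin n) ℂ) (ζ ζ' : Fin 2 → ℂ) (ε : Fin 2 → ℝ)
    (ε' : ℝ) (u : ℝ) : ℂ :=
  (16 * (n : ℂ) ^ 12 / (Real.pi : ℂ) ^ 9) *
    ∫ x, integrand Az ζ ζ' ε ε' u (Vars.ofTuple x) ∂reprMeasure

end DeformedGinibre

end

open DeformedGinibre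

/-!
The representation is obtained by replacing the `n²` Gaussian variables of the Ginibre matrix with
finitely many matrices of size `2`, without supersymmetric integration theorems: both sides are
reduced to ordinary Gaussian integrals, and the Grassmann integral enters only through its Wick
formula.

*Averaging over the Ginibre matrix.* The product of the denominators is the determinant of a
`4n × 4n` matrix `s + i X` with `X` Hermitian, so its inverse is a Gaussian integral over
`φ ∈ ℂ^{4n}`. For fixed `φ` the Ginibre matrix `h` occurs linearly in the exponent and in the
entries of the determinant in the numerator. Completing the square with a complex translation
(`gaussian_shift`) turns the linear exponent into a quartic weight in `φ` and a bilinear perturbation of the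
determinant. The remaining average of a determinant that is linear in `h` depends only on the
covariance of `h`, and only up to antisymmetry in the row indices, so `h` may be exchanged for a
complex `2 × 2` matrix `q` (`integral_det_duality`). This gives `genZ_eq_integral`.

*The Grassmann integral.* For a Gaussian weight in `φ` with inverse covariance `B`, the average of
`det (C - n⁻¹ ∑ u φ v φ̄)` is a sum of permanents of entries of `B⁻¹`; the Berezin integral of
`Sdet Q̂` expands into the same sum, its moments being determinants and the signs being absorbed by
the antisymmetry of `det C` (`integral_det_sub_bilinear`, `gInt_det_sub_bilinear`, whence
`berezin_expL`). It remains to reduce the quartic weight to Gaussian ones.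

*Gram matrices.* The quartic weight depends on `φ` only through a pair of `2 × 2` Gram matrices. The
image of the oscillating part of the integrand under the Gram map has a continuous density, namely
the inverse Fourier integral over pairs of Hermitian matrices `X₁ = T + S`, `X₂ = T - S` of a
Gaussian integral with sources (`integral_mul_comp_eq_hermPair`). The shift `i u` of the contour of
`T` is the Laplace weight that makes `φ` integrable. The Fourier integral converges because the
inverse of `det (u + i X)` is integrable in `X`, uniformly in the source: by the maximum principle
for products of linear factors and Schur complements it is dominated by negative powers of products
of linear factors in the diagonal and off-diagonal coordinates, with exponents beyond the respective
dimensions when `4 ≤ n` (`exists_lintegral_inv_det_fromBlocks_le`).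

*Coordinates.* A linear substitution of `φ` acts on the density by congruence and conjugates the
source `ζ'` (`gramDensity_covariant`). By such a substitution every pair of positive definite
matrices is brought to the form `(R, R)`, which leads to the coordinates `(R, R₂)`, the conjugated
source `J⁻¹ ζ' J` and the factor `E_{*2}` (`integral_bosonWeight_eq_bosonPart`). The polar
decomposition `q = Λ U` yields the source `U ζ U^*` and the factor `E_{*1}` (`integral_polar`,
`det_blockC_polar`).

*Convergence.* The uniform bound on the inverse determinant and the exponential factors in `R`, `R₂`
and `Λ` dominate the whole integrand (`integrable_groupedIntegrand`), so that Fubini's theorem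
assembles `genZ_eq_reprIntegral`. For a random deformation the ratio of determinants is bounded
uniformly in the matrix (`exists_norm_detRatio_le`), and by independence the conditional expectation
is the average over the Ginibre matrix with the deformation frozen (`condExp_detRatio`).
-/

noncomputable section

namespace DeformedGinibre

open Matrix Finset Filter Complex
open Equiv (Perm)

/-- Complex `n × n` matrices. -/
local notation:max "𝕄" n:max => Matrix (Fin n) (Fin n) ℂ

/-- The sign of a permutation as a complex number. -/
local notation:max "sgn" σ:max => ((Perm.sign σ : ℤ) : ℂ)

/-! ### Continuous functions of exponential growth and Gaussian weights -/

section ExpGrowth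

variable {X : Type*} [NormedAddCommGroup X]

/-- `F` is continuous and `F x = O(exp (b ‖x‖))` for some `b`; these functions form an algebra
and are integrable against every Gaussian weight. -/
structure ExpGrowth (F : X → ℂ) : Prop where
  continuous : Continuous F
  bound : ∃ C b : ℝ, 0 ≤ C ∧ 0 ≤ b ∧ ∀ x, ‖F x‖ ≤ C * Real.exp (b * ‖x‖)

namespace ExpGrowth

theorem const (c : ℂ) : ExpGrowth (fun _ : X => c) :=
  ⟨continuous_const, ‖c‖, 0, norm_nonneg _, le_rfl, fun x => by simp⟩

theorem of_linear_bound {F : X → ℂ} (hF : Continuous F) (c : ℝ) (h : ∀ x, ‖F x‖ ≤ c * ‖x‖) :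
    ExpGrowth F := by
  refine ⟨hF, |c|, 1, abs_nonneg _, zero_le_one, fun x => (h x).trans ?_⟩
  have h1 : ‖x‖ ≤ Real.exp (1 * ‖x‖) := by
    rw [one_mul]; linarith [Real.add_one_le_exp ‖x‖]
  exact (mul_le_mul_of_nonneg_right (le_abs_self c) (norm_nonneg _)).trans
    (mul_le_mul_of_nonneg_left h1 (abs_nonneg _))

theorem add {F G : X → ℂ} (hF : ExpGrowth F) (hG : ExpGrowth G) :
    ExpGrowth (fun x => F x + G x) := by
  obtain ⟨C, b, hC, hb, h⟩ := hF.bound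
  obtain ⟨C', b', hC', hb', h'⟩ := hG.bound
  refine ⟨hF.continuous.add hG.continuous, C + C', b + b', by positivity, by positivity,
    fun x => (norm_add_le _ _).trans ?_⟩
  rw [add_mul]
  gcongr
  · exact (h x).trans (by gcongr; linarith)
  · exact (h' x).trans (by gcongr; linarith)

theorem mul {F G : X → ℂ} (hF : ExpGrowth F) (hG : ExpGrowth G) :
    ExpGrowth (fun x => F x * G x) := by
  obtain ⟨C, b, hC, hb, h⟩ := hF.bound
  obtain ⟨C', b', hC', hb', h'⟩ := hG.bound
  refine ⟨hF.continuous.mul hG.continuous, C * C', b + b', by positivity, by positivity,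
    fun x => ?_⟩
  rw [norm_mul, add_mul, Real.exp_add]
  calc ‖F x‖ * ‖G x‖ ≤ (C * Real.exp (b * ‖x‖)) * (C' * Real.exp (b' * ‖x‖)) := by
        gcongr; exacts [h x, h' x]
    _ = _ := by ring

theorem neg {F : X → ℂ} (hF : ExpGrowth F) : ExpGrowth (fun x => - F x) := by
  simpa using (const (X := X) (-1)).mul hF

theorem sub {F G : X → ℂ} (hF : ExpGrowth F) (hG : ExpGrowth G) :
    ExpGrowth (fun x => F x - G x) := by
  simpa [sub_eq_add_neg] using hF.add hG.neg

theorem conjugate {F : X → ℂ} (hF : ExpGrowth F) : ExpGrowth (fun x => conj (F x)) := by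
  obtain ⟨C, b, hC, hb, h⟩ := hF.bound
  exact ⟨continuous_conj.comp hF.continuous, C, b, hC, hb, fun x => by simpa using h x⟩

theorem sum {α : Type*} (s : Finset α) {F : α → X → ℂ} (h : ∀ i ∈ s, ExpGrowth (F i)) :
    ExpGrowth (fun x => ∑ i ∈ s, F i x) := by
  classical
  induction s using Finset.induction_on with
  | empty => simpa using const (X := X) 0
  | insert a s ha ih =>
    simp only [sum_insert ha]
    exact (h a (by simp)).add (ih fun i hi => h i (by simp [hi]))

theorem prod {α : Type*} (s : Finset α) {F : α → X → ℂ} (h : ∀ i ∈ s, ExpGrowth (F i)) :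
    ExpGrowth (fun x => ∏ i ∈ s, F i x) := by
  classical
  induction s using Finset.induction_on with
  | empty => simpa using const (X := X) 1
  | insert a s ha ih =>
    simp only [prod_insert ha]
    exact (h a (by simp)).mul (ih fun i hi => h i (by simp [hi]))

theorem det {α : Type*} [Fintype α] [DecidableEq α] {A : X → Matrix α α ℂ}
    (h : ∀ i j, ExpGrowth (fun x => A x i j)) : ExpGrowth (fun x => (A x).det) := by
  simp only [det_apply']
  exact sum _ fun σ _ => (const _).mul (prod _ fun i _ => h _ _)

end ExpGrowth

end ExpGrowth

section Gaussian

variable {κ : Type*} [Fintype κ]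

theorem ExpGrowth.coord (i : κ) : ExpGrowth (fun φ : κ → ℂ => φ i) :=
  .of_linear_bound (continuous_apply i) 1 fun x => by simpa using norm_le_pi_norm x i

/-- `∑ i, |φ i|^2`. -/
def sqn (φ : κ → ℂ) : ℝ := ∑ i, ‖φ i‖ ^ 2

theorem sqn_nonneg (φ : κ → ℂ) : 0 ≤ sqn φ := sum_nonneg fun _ _ => by positivity

theorem continuous_sqn : Continuous (sqn : (κ → ℂ) → ℝ) := by
  unfold sqn; fun_prop

theorem norm_sq_le_sqn (φ : κ → ℂ) : ‖φ‖ ^ 2 ≤ sqn φ := by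
  have h : ‖φ‖ ≤ Real.sqrt (sqn φ) := by
    refine (pi_norm_le_iff_of_nonneg (Real.sqrt_nonneg _)).mpr fun i => ?_
    refine Real.le_sqrt_of_sq_le ?_
    exact single_le_sum (f := fun i => ‖φ i‖ ^ 2) (fun i _ => by positivity) (mem_univ i)
  calc ‖φ‖ ^ 2 ≤ Real.sqrt (sqn φ) ^ 2 := by gcongr
    _ = sqn φ := Real.sq_sqrt (sqn_nonneg φ)

theorem integrable_exp_neg_sqn {a : ℝ} (ha : 0 < a) :
    Integrable (fun φ : κ → ℂ => Real.exp (-a * sqn φ)) := by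
  have h : Integrable (fun z : ℂ => Real.exp (-a * ‖z‖ ^ 2)) := by
    have := (GaussianFourier.integrable_cexp_neg_mul_sq_norm_add (V := ℂ) (b := (a : ℂ))
      (by simpa using ha) 0 0).norm
    refine this.congr (.of_forall fun z => ?_)
    simp [norm_exp, ← ofReal_pow]
  have h2 : Integrable (fun φ : κ → ℂ => ∏ i, Real.exp (-a * ‖φ i‖ ^ 2)) :=
    Integrable.fintype_prod (f := fun _ z => Real.exp (-a * ‖z‖ ^ 2)) fun _ => h
  refine h2.congr (.of_forall fun φ => ?_)
  simp [sqn, mul_sum, ← Real.exp_sum]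

theorem exp_norm_mul_gaussian_le {a b : ℝ} (ha : 0 < a) (φ : κ → ℂ) :
    Real.exp (b * ‖φ‖) * Real.exp (-a * sqn φ)
      ≤ Real.exp (b ^ 2 / (2 * a)) * Real.exp (-(a / 2) * sqn φ) := by
  rw [← Real.exp_add, ← Real.exp_add]
  refine Real.exp_le_exp.mpr ?_
  have h1 := norm_sq_le_sqn φ
  have h2 : b * ‖φ‖ ≤ b ^ 2 / (2 * a) + a / 2 * ‖φ‖ ^ 2 := by
    have : 0 ≤ (b - a * ‖φ‖) ^ 2 / (2 * a) := by positivity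
    have e : (b - a * ‖φ‖) ^ 2 / (2 * a) = b ^ 2 / (2 * a) + a / 2 * ‖φ‖ ^ 2 - b * ‖φ‖ := by
      field_simp; ring
    linarith
  nlinarith

theorem integrable_norm_mul_gaussian_of_expGrowth {F : (κ → ℂ) → ℂ} (hF : ExpGrowth F) {a : ℝ}
    (ha : 0 < a) : Integrable (fun φ => ‖F φ‖ * Real.exp (-a * sqn φ)) := by
  obtain ⟨C, b, hC, hb, h⟩ := hF.bound
  refine ((integrable_exp_neg_sqn (κ := κ) (half_pos ha)).const_mul
    (C * Real.exp (b ^ 2 / (2 * a)))).mono' ?_ (.of_forall fun φ => ?_)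
  · exact (hF.continuous.norm.mul
      (Real.continuous_exp.comp (continuous_const.mul continuous_sqn))).aestronglyMeasurable
  · rw [Real.norm_of_nonneg (by positivity)]
    calc ‖F φ‖ * Real.exp (-a * sqn φ) ≤ (C * Real.exp (b * ‖φ‖)) * Real.exp (-a * sqn φ) := by
          gcongr; exact h φ
      _ = C * (Real.exp (b * ‖φ‖) * Real.exp (-a * sqn φ)) := by ring
      _ ≤ C * (Real.exp (b ^ 2 / (2 * a)) * Real.exp (-(a / 2) * sqn φ)) :=
          mul_le_mul_of_nonneg_left (exp_norm_mul_gaussian_le ha φ) hC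
      _ = _ := by ring

theorem integrable_mul_gaussian_of_expGrowth {F : (κ → ℂ) → ℂ} (hF : ExpGrowth F) {g : (κ → ℂ) → ℂ}
    (hg : Continuous g) {a : ℝ} (ha : 0 < a) (hga : ∀ φ, (g φ).re ≤ -a * sqn φ) :
    Integrable (fun φ => F φ * exp (g φ)) := by
  refine (integrable_norm_mul_gaussian_of_expGrowth hF ha).mono'
    (hF.continuous.mul (continuous_exp.comp hg)).aestronglyMeasurable
    (.of_forall fun φ => ?_)
  rw [norm_mul, norm_exp]
  gcongr
  exact hga φ

/-- The quadratic form `φ^* M φ`. -/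
def qf (M : Matrix κ κ ℂ) (φ : κ → ℂ) : ℂ := star φ ⬝ᵥ M *ᵥ φ

theorem qf_apply (M : Matrix κ κ ℂ) (φ : κ → ℂ) : qf M φ = ∑ i, ∑ j, conj (φ i) * M i j * φ j := by
  simp [qf, dotProduct, mulVec, mul_sum, mul_assoc]

theorem continuous_qf (M : Matrix κ κ ℂ) : Continuous (qf M) := by
  simp only [funext (qf_apply M)]
  fun_prop

theorem expGrowth_qf (M : Matrix κ κ ℂ) : ExpGrowth (qf M) := by
  simp only [funext (qf_apply M)]
  exact .sum _ fun i _ => .sum _ fun j _ =>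
    ((ExpGrowth.coord i).conjugate.mul (.const _)).mul (.coord j)

theorem qf_add (M N : Matrix κ κ ℂ) (φ : κ → ℂ) : qf (M + N) φ = qf M φ + qf N φ := by
  simp [qf, add_mulVec]

theorem qf_smul (c : ℂ) (M : Matrix κ κ ℂ) (φ : κ → ℂ) : qf (c • M) φ = c * qf M φ := by
  simp [qf, smul_mulVec]

theorem qf_neg (M : Matrix κ κ ℂ) (φ : κ → ℂ) : qf (-M) φ = - qf M φ := by
  simp [qf, neg_mulVec]

theorem qf_mulVec (M A : Matrix κ κ ℂ) (φ : κ → ℂ) : qf M (A *ᵥ φ) = qf (Aᴴ * M * A) φ := by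
  simp [qf, star_mulVec, dotProduct_mulVec, vecMul_vecMul, Matrix.mul_assoc]

theorem qf_im_of_isHermitian {X : Matrix κ κ ℂ} (hX : X.IsHermitian) (φ : κ → ℂ) :
    (qf X φ).im = 0 := hX.im_star_dotProduct_mulVec_self φ

theorem integral_exp_neg_mul_norm_sq {m : ℂ} (hm : 0 < m.re) :
    ∫ z : ℂ, exp (-m * (‖z‖ : ℂ) ^ 2) = Real.pi / m := by
  rw [GaussianFourier.integral_cexp_neg_mul_sq_norm hm]
  simp

variable [DecidableEq κ]

theorem det_toLin'_restrictScalars (A : Matrix κ κ ℂ) :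
    LinearMap.det ((toLin' A).restrictScalars ℝ) = ‖A.det‖ ^ 2 := by
  rw [LinearMap.det_restrictScalars, LinearMap.det_toLin', Algebra.norm_complex_apply,
    normSq_eq_norm_sq]

theorem map_mulVec_volume (A : Matrix κ κ ℂ) (hA : A.det ≠ 0) :
    Measure.map (fun φ : κ → ℂ => A *ᵥ φ) volume
      = ENNReal.ofReal ((‖A.det‖ ^ 2)⁻¹) • (volume : Measure (κ → ℂ)) := by
  have h := Measure.map_linearMap_addHaar_eq_smul_addHaar (volume : Measure (κ → ℂ))
    (f := (toLin' A).restrictScalars ℝ)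
    (by rw [det_toLin'_restrictScalars]; positivity)
  rw [det_toLin'_restrictScalars, abs_of_nonneg (by positivity)] at h
  exact h

theorem measurePreserving_mulVec (A : Matrix κ κ ℂ) (hA : ‖A.det‖ = 1) :
    MeasurePreserving (fun φ : κ → ℂ => A *ᵥ φ) volume volume := by
  refine ⟨(toLin' A).continuous_of_finiteDimensional.measurable, ?_⟩
  rw [map_mulVec_volume A (by intro h; simp [h] at hA), hA]
  simp

/-- The equivalence of `κ → ℂ` given by an invertible matrix. -/
def mulVecHomeo (A : Matrix κ κ ℂ) (hA : A.det ≠ 0) : (κ → ℂ) ≃ₜ (κ → ℂ) where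
  toFun φ := A *ᵥ φ
  invFun φ := A⁻¹ *ᵥ φ
  left_inv φ := by
    simp [mulVec_mulVec, nonsing_inv_mul A (isUnit_iff_ne_zero.mpr hA)]
  right_inv φ := by
    simp [mulVec_mulVec, mul_nonsing_inv A (isUnit_iff_ne_zero.mpr hA)]
  continuous_toFun := (toLin' A).continuous_of_finiteDimensional
  continuous_invFun := (toLin' A⁻¹).continuous_of_finiteDimensional

theorem integral_comp_mulVec (A : Matrix κ κ ℂ) (hA : ‖A.det‖ = 1) (F : (κ → ℂ) → ℂ) :
    ∫ φ, F (A *ᵥ φ) = ∫ φ, F φ :=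
  (measurePreserving_mulVec A hA).integral_comp
    (mulVecHomeo A (by intro h; simp [h] at hA)).measurableEmbedding F

theorem qf_one (φ : κ → ℂ) : qf 1 φ = (sqn φ : ℂ) := by
  simp [qf, sqn, dotProduct, conj_mul']

/-- The Gaussian integral `∫ exp (-φ^* (u + i X) φ) dφ = π^N / det (u + i X)`. -/
theorem integral_gaussian {u : ℝ} (hu : 0 < u) {X : Matrix κ κ ℂ} (hX : X.IsHermitian) :
    (∫ φ : κ → ℂ, exp (-qf ((u : ℂ) • 1 + I • X) φ)) =
      (Real.pi : ℂ) ^ Fintype.card κ / ((u : ℂ) • 1 + I • X).det ∧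
    ((u : ℂ) • 1 + I • X).det ≠ 0 := by
  set V : Matrix κ κ ℂ := (hX.eigenvectorUnitary : Matrix κ κ ℂ)
  set D : Matrix κ κ ℂ := diagonal (RCLike.ofReal ∘ hX.eigenvalues) with hD
  have hVV : Vᴴ * V = 1 := Unitary.coe_star_mul_self hX.eigenvectorUnitary
  have hVV' : V * Vᴴ = 1 := Unitary.coe_mul_star_self hX.eigenvectorUnitary
  have hXV : X = V * D * Vᴴ := by
    conv_lhs => rw [hX.spectral_theorem]
    rfl
  set m : κ → ℂ := fun i => u + I * (hX.eigenvalues i : ℂ) with hm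
  have hM : (u : ℂ) • (1 : Matrix κ κ ℂ) + I • X = V * diagonal m * Vᴴ := by
    have : diagonal m = (u : ℂ) • (1 : Matrix κ κ ℂ) + I • D := by
      ext i j
      by_cases h : i = j
      · subst h; simp [hm, hD]
      · simp [h, hD]
    rw [this, hXV]
    simp [Matrix.mul_add, Matrix.add_mul, hVV']
  have hmre : ∀ i, 0 < (m i).re := fun i => by simpa [hm] using hu
  have hm0 : ∀ i, m i ≠ 0 := fun i h => by have := hmre i; simp [h] at this
  have hdet : ((u : ℂ) • 1 + I • X).det = ∏ i, m i := by
    rw [hM, det_mul, det_mul, mul_right_comm, ← det_mul, hVV']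
    simp
  have hVn : ‖V.det‖ = 1 := by
    have h := congrArg det hVV
    rw [det_mul, det_conjTranspose, det_one] at h
    have h2 := congrArg norm h
    rw [norm_mul, norm_star, norm_one] at h2
    nlinarith [norm_nonneg V.det]
  refine ⟨?_, by rw [hdet]; exact prod_ne_zero_iff.mpr fun i _ => hm0 i⟩
  rw [← integral_comp_mulVec V hVn, hdet]
  have h1 : ∀ φ : κ → ℂ, exp (-qf ((u : ℂ) • 1 + I • X) (V *ᵥ φ))
      = ∏ i, exp (-m i * (‖φ i‖ : ℂ) ^ 2) := by
    intro φ
    rw [qf_mulVec, hM, ← exp_sum]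
    have : Vᴴ * (V * diagonal m * Vᴴ) * V = diagonal m := by
      rw [Matrix.mul_assoc, Matrix.mul_assoc, Matrix.mul_assoc, hVV, ← Matrix.mul_assoc, hVV]
      simp
    rw [this]
    congr 1
    simp only [qf, dotProduct, mulVec_diagonal, Pi.star_apply, RCLike.star_def]
    rw [← sum_neg_distrib]
    refine sum_congr rfl fun i _ => ?_
    rw [← conj_mul']
    ring
  simp only [h1]
  rw [integral_fintype_prod_volume_eq_prod (fun i (z : ℂ) => exp (-m i * (‖z‖ : ℂ) ^ 2))]
  simp only [integral_exp_neg_mul_norm_sq (hmre _)]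
  rw [prod_div_distrib]
  simp

end Gaussian
/-! ### Wick's formula for complex Gaussian integrals -/

section Wick

/-- Sums over the permutations of `Option σ`, expanded along the image and the preimage of `none`;
`m = 0` is the case of permanents and `m = 1` the case of determinants. -/
theorem sum_perm_option {σ R : Type*} [Fintype σ] [DecidableEq σ] [CommRing R] (m : ℕ)
    (Γ : Option σ → Option σ → R) :
    ∑ ρ : Perm (Option σ), ((Perm.sign ρ : ℤ) : R) ^ m * ∏ i, Γ i (ρ i) =
      Γ none none * ∑ ρ : Perm σ, ((Perm.sign ρ : ℤ) : R) ^ m * ∏ i, Γ (some i) (some (ρ i)) +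
        (-1) ^ m * ∑ ρ : Perm σ, ((Perm.sign ρ : ℤ) : R) ^ m *
          ∑ j, Γ none (some (ρ j)) * Γ (some j) none *
            ∏ i ∈ univ.erase j, Γ (some i) (some (ρ i)) := by
  rw [← Equiv.sum_comp (Perm.decomposeOption (α := σ)).symm, Fintype.sum_prod_type,
    Fintype.sum_option]
  congr 1
  · rw [mul_sum]
    refine sum_congr rfl fun ρ _ => ?_
    rw [Fintype.prod_option]
    simp
    ring
  · rw [sum_comm, mul_sum]
    refine sum_congr rfl fun ρ _ => ?_
    rw [← Equiv.sum_comp ρ, mul_sum, mul_sum]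
    refine sum_congr rfl fun j _ => ?_
    rw [Fintype.prod_option, ← mul_prod_erase univ _ (mem_univ j)]
    have h1 : ∀ i ∈ univ.erase j, Γ (some i) (Perm.decomposeOption.symm (some (ρ j), ρ) (some i)) =
          Γ (some i) (some (ρ i)) := by
      intro i hi
      have hij : i ≠ j := ne_of_mem_erase hi
      have : (Perm.decomposeOption.symm (some (ρ j), ρ)) (some i) = some (ρ i) := by
        simp only [Perm.decomposeOption_symm_apply, Perm.coe_mul, Function.comp_apply,
          Equiv.optionCongr_apply, Option.map_some]
        rw [Equiv.swap_apply_of_ne_of_ne (by simp) (by simpa using hij)]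
      rw [this]
    rw [prod_congr rfl h1]
    simp
    ring

variable {κ : Type*} [Fintype κ] [DecidableEq κ]

theorem hasDerivAt_det_add_smul (M Z : Matrix κ κ ℂ) (hM : M.det ≠ 0) :
    HasDerivAt (fun t : ℂ => (M + t • Z).det) (M.det * (M⁻¹ * Z).trace) 0 := by
  have hu : IsUnit M.det := isUnit_iff_ne_zero.mpr hM
  set q : Polynomial ℂ := (1 + (Polynomial.X : Polynomial ℂ) •
    (M⁻¹ * Z).map ⇑Polynomial.C).det.divX.divX
  have h : ∀ t : ℂ, (M + t • Z).det = M.det * (1 + (M⁻¹ * Z).trace * t + q.eval t * t ^ 2) := by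
    intro t
    have : M + t • Z = M * (1 + t • (M⁻¹ * Z)) := by
      rw [Matrix.mul_add, Matrix.mul_smul, ← Matrix.mul_assoc, mul_nonsing_inv M hu]
      simp
    rw [this, det_mul, det_one_add_smul]
  simp only [h]
  have h2 : HasDerivAt (fun t : ℂ => M.det * (1 + (M⁻¹ * Z).trace * t + q.eval t * t ^ 2))
      (M.det * ((M⁻¹ * Z).trace * 1 + (q.derivative.eval 0 * 0 ^ 2
        + q.eval 0 * (((2 : ℕ) : ℂ) * 0 ^ (2 - 1) * 1)))) 0 := by
    refine HasDerivAt.const_mul _ ?_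
    refine HasDerivAt.add (((hasDerivAt_id (0 : ℂ)).const_mul _).const_add 1) ?_
    exact (q.hasDerivAt 0).mul ((hasDerivAt_id (0 : ℂ)).pow 2)
  simpa using h2

theorem hasDerivAt_inv_add_smul (M Z : Matrix κ κ ℂ) (hM : M.det ≠ 0) (i j : κ) :
    HasDerivAt (fun t : ℂ => (M + t • Z)⁻¹ i j) (-(M⁻¹ * Z * M⁻¹) i j) 0 := by
  let _ : NormedRing (Matrix κ κ ℂ) := Matrix.linftyOpNormedRing
  let _ : NormedAlgebra ℂ (Matrix κ κ ℂ) := Matrix.linftyOpNormedAlgebra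
  have hU : IsUnit M := (isUnit_iff_isUnit_det M).mpr (isUnit_iff_ne_zero.mpr hM)
  obtain ⟨U, hU⟩ := hU
  have h1 := ((hasDerivAt_id (0 : ℂ)).smul_const Z).const_add M
  have h2 := hasFDerivAt_ringInverse (𝕜 := ℂ) U
  have h3 : HasFDerivAt Ring.inverse
      (-((ContinuousLinearMap.mulLeftRight ℂ (Matrix κ κ ℂ)) ↑U⁻¹) ↑U⁻¹) (M + id (0 : ℂ) • Z) := by
    simpa [hU] using h2
  have h4 := h3.comp_hasDerivAt (0 : ℂ) h1
  let ev : Matrix κ κ ℂ →L[ℂ] ℂ := LinearMap.toContinuousLinearMap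
    ((LinearMap.proj j : (κ → ℂ) →ₗ[ℂ] ℂ) ∘ₗ (LinearMap.proj i : (κ → κ → ℂ) →ₗ[ℂ] (κ → ℂ)))
  have h5 := ev.hasFDerivAt.comp_hasDerivAt (0 : ℂ) h4
  have hinv : (↑U⁻¹ : Matrix κ κ ℂ) = M⁻¹ := by
    rw [← hU, coe_units_inv]
  refine (h5.congr_deriv ?_).congr_of_eventuallyEq (.of_forall fun t => ?_)
  · simp [hinv, ev]
    rfl
  · simp [ev, nonsing_inv_eq_ringInverse]
    rfl

/-- `u + i X`, whose Hermitian part is the scalar `u` when `X` is Hermitian. -/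
def accr (u : ℝ) (X : Matrix κ κ ℂ) : Matrix κ κ ℂ := (u : ℂ) • 1 + I • X

theorem qf_accr_re (u : ℝ) {X : Matrix κ κ ℂ} (hX : X.IsHermitian) (φ : κ → ℂ) :
    (qf (accr u X) φ).re = u * sqn φ := by
  rw [accr, qf_add, qf_smul, qf_smul, qf_one]
  simp [qf_im_of_isHermitian hX]

theorem det_accr_ne_zero {u : ℝ} (hu : 0 < u) {X : Matrix κ κ ℂ} (hX : X.IsHermitian) :
    (accr u X).det ≠ 0 := (integral_gaussian hu hX).2

theorem integrable_wick {F : (κ → ℂ) → ℂ} (hF : ExpGrowth F) {u : ℝ} (hu : 0 < u) {X : Matrix κ κ ℂ}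
    (hX : X.IsHermitian) :
    Integrable (fun φ => F φ * exp (-qf (accr u X) φ)) := by
  refine integrable_mul_gaussian_of_expGrowth hF (continuous_qf _).neg hu fun φ => ?_
  rw [neg_re, qf_accr_re u hX, neg_mul]

/-- Differentiation of a Gaussian average in a Hermitian direction inserts its quadratic form. -/
theorem hasDerivAt_integral_wick {F : (κ → ℂ) → ℂ} (hF : ExpGrowth F) {u : ℝ} (hu : 0 < u)
    {X Y : Matrix κ κ ℂ} (hX : X.IsHermitian) (hY : Y.IsHermitian) :
    HasDerivAt (fun t : ℝ => ∫ φ, F φ * exp (-qf (accr u (X + (t : ℂ) • Y)) φ))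
      (-I * ∫ φ, F φ * qf Y φ * exp (-qf (accr u X) φ)) 0 := by
  have hXt : ∀ t : ℝ, (X + (t : ℂ) • Y).IsHermitian := fun t => hX.add (by
    rw [IsHermitian, conjTranspose_smul, hY.eq]; simp)
  have e : ∀ (t : ℝ) φ, -qf (accr u (X + (t : ℂ) • Y)) φ
      = -qf (accr u X) φ + (t : ℂ) * (-(I * qf Y φ)) := by
    intro t φ
    simp only [accr, qf_add, qf_smul]
    ring
  have hFY : ExpGrowth (fun φ => F φ * (-(I * qf Y φ))) :=
    hF.mul ((ExpGrowth.const _).mul (expGrowth_qf Y)).neg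
  have key := hasDerivAt_integral_of_dominated_loc_of_deriv_le (μ := (volume : Measure (κ → ℂ)))
    (F := fun (t : ℝ) φ => F φ * exp (-qf (accr u (X + (t : ℂ) • Y)) φ))
    (F' := fun (t : ℝ) φ => F φ * (-(I * qf Y φ)) * exp (-qf (accr u (X + (t : ℂ) • Y)) φ))
    (bound := fun φ => ‖F φ * (-(I * qf Y φ))‖ * Real.exp (-u * sqn φ))
    (x₀ := 0) (s := Set.univ) univ_mem
    (.of_forall fun t => (integrable_wick hF hu (hXt t)).aestronglyMeasurable)
    (integrable_wick hF hu (hXt 0))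
    (integrable_wick hFY hu (hXt 0)).aestronglyMeasurable
    (.of_forall fun φ t _ => by
      rw [norm_mul, norm_exp, neg_re, qf_accr_re u (hXt t), neg_mul])
    (integrable_norm_mul_gaussian_of_expGrowth hFY hu)
    (.of_forall fun φ t _ => by
      simp only [e]
      have h1 : HasDerivAt (fun t : ℝ => -qf (accr u X) φ + (t : ℂ) * (-(I * qf Y φ)))
          (-(I * qf Y φ)) t := by
        simpa using ((ofRealCLM.hasDerivAt (x := t)).mul_const
          (-(I * qf Y φ))).const_add (-qf (accr u X) φ)
      refine (h1.cexp.const_mul (F φ)).congr_deriv ?_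
      ring)
  refine key.2.congr_deriv ?_
  rw [← integral_const_mul]
  refine integral_congr_ae (.of_forall fun φ => ?_)
  simp
  ring

/-- The right-hand side of Wick's formula. -/
def wickSum {σ : Type*} [Fintype σ] [DecidableEq σ] (G : Matrix κ κ ℂ) (p q : σ → κ) : ℂ :=
  ∑ ρ : Perm σ, ∏ i, G (p i) (q (ρ i))

/-- The derivative of the right-hand side of Wick's formula, by Jacobi's formula and the derivative
of the inverse. -/
theorem hasDerivAt_wick_rhs {σ : Type*} [Fintype σ] [DecidableEq σ] {u : ℝ} (hu : 0 < u)
    {X : Matrix κ κ ℂ} (hX : X.IsHermitian) (Y : Matrix κ κ ℂ) (p q : σ → κ) :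
    HasDerivAt (fun t : ℝ => ((accr u (X + (t : ℂ) • Y)).det)⁻¹
        * wickSum (accr u (X + (t : ℂ) • Y))⁻¹ p q)
      (-I * (((accr u X).det)⁻¹ * (((accr u X)⁻¹ * Y).trace * wickSum (accr u X)⁻¹ p q
        + ∑ ρ : Perm σ, ∑ j, ((accr u X)⁻¹ * Y * (accr u X)⁻¹) (p j) (q (ρ j)) *
            ∏ i ∈ univ.erase j, (accr u X)⁻¹ (p i) (q (ρ i))))) 0 := by
  set M := accr u X with hM
  have hdet : M.det ≠ 0 := det_accr_ne_zero hu hX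
  have e : ∀ t : ℝ, accr u (X + (t : ℂ) • Y) = M + (t : ℂ) • (I • Y) := by
    intro t
    simp only [hM, accr, smul_add, smul_smul, add_assoc]
    rw [mul_comm]
  have h1 := hasDerivAt_det_add_smul M (I • Y) hdet
  have h2 := h1.inv (by simpa using hdet)
  have h3 : HasDerivAt (fun t : ℂ => wickSum (M + t • (I • Y))⁻¹ p q)
      (∑ ρ : Perm σ, ∑ j, (∏ i ∈ univ.erase j, M⁻¹ (p i) (q (ρ i))) *
        (-(M⁻¹ * (I • Y) * M⁻¹) (p j) (q (ρ j)))) 0 := by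
    refine HasDerivAt.fun_sum fun ρ _ => ?_
    refine (HasDerivAt.fun_finsetProd (u := univ)
      (fun i _ => hasDerivAt_inv_add_smul M (I • Y) hdet (p i) (q (ρ i)))).congr_deriv ?_
    simp
  have h4 := h2.mul h3
  have h5 := h4.comp_ofReal (z := 0)
  refine (h5.congr_deriv ?_).congr_of_eventuallyEq (.of_forall fun t => ?_)
  · simp only [zero_smul, add_zero, Matrix.mul_smul, smul_mul,
      Matrix.smul_apply, trace_smul, smul_eq_mul, Pi.inv_apply]
    rw [mul_add, mul_add]
    congr 1
    · field_simp
    · rw [mul_sum, mul_sum, mul_sum]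
      refine sum_congr rfl fun ρ _ => ?_
      rw [mul_sum, mul_sum, mul_sum]
      refine sum_congr rfl fun j _ => ?_
      ring
  · beta_reduce
    rw [e t]
    rfl

/-- **Wick's formula**: for Hermitian `X`, the moments of the complex Gaussian weight
`exp (-φ^* (u + i X) φ)` are permanents of the entries of `(u + i X)⁻¹`. -/
theorem gaussian_wick {u : ℝ} (hu : 0 < u) (σ : Type) [Fintype σ] :
    ∀ [DecidableEq σ] {X : Matrix κ κ ℂ} (_ : X.IsHermitian) (p q : σ → κ),
    ∫ φ : κ → ℂ, (∏ i, φ (p i) * conj (φ (q i))) * exp (-qf (accr u X) φ) =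
      (Real.pi : ℂ) ^ Fintype.card κ * (((accr u X).det)⁻¹ * wickSum (accr u X)⁻¹ p q) := by
  refine Fintype.induction_empty_option (P := fun σ _ => ∀ [DecidableEq σ] {X : Matrix κ κ ℂ}
    (_ : X.IsHermitian) (p q : σ → κ),
    ∫ φ : κ → ℂ, (∏ i, φ (p i) * conj (φ (q i))) * exp (-qf (accr u X) φ) =
      (Real.pi : ℂ) ^ Fintype.card κ * (((accr u X).det)⁻¹ * wickSum (accr u X)⁻¹ p q))
    ?_ ?_ ?_ σ
  · intro α β _ e ih _ X hX p q
    classical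
    let _ := Fintype.ofEquiv β e.symm
    have := ih hX (p ∘ e) (q ∘ e)
    have h1 : ∀ φ : κ → ℂ, ∏ i, φ ((p ∘ e) i) * conj (φ ((q ∘ e) i)) =
        ∏ i, φ (p i) * conj (φ (q i)) := fun φ =>
      Equiv.prod_comp e (fun i => φ (p i) * conj (φ (q i)))
    simp only [h1] at this
    have h2 : wickSum (accr u X)⁻¹ (p ∘ e) (q ∘ e) = wickSum (accr u X)⁻¹ p q := by
      unfold wickSum
      rw [← Equiv.sum_comp (Equiv.permCongr e.symm)]
      refine sum_congr (by ext; simp) fun ρ _ => ?_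
      rw [← Equiv.prod_comp e.symm]
      refine prod_congr (by ext; simp) fun i _ => ?_
      simp [Equiv.permCongr_apply]
    rw [this, h2]
  · intro _ X hX p q
    simp only [univ_eq_empty, prod_empty, one_mul, wickSum]
    rw [show accr u X = (u : ℂ) • 1 + I • X from rfl, (integral_gaussian hu hX).1]
    simp [div_eq_mul_inv]
  · intro α _ ih inst X hX p q
    classical
    obtain rfl : inst = (fun a b => Option.instDecidableEq a b) := Subsingleton.elim _ _
    set F : (κ → ℂ) → ℂ := fun φ => ∏ i : α, φ (p (some i)) * conj (φ (q (some i)))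
    have hFg : ExpGrowth F :=
      .prod _ fun i _ => (ExpGrowth.coord _).mul (ExpGrowth.coord _).conjugate
    set p' := fun i : α => p (some i)
    set q' := fun i : α => q (some i)
    set G := (accr u X)⁻¹
    set c : ℂ := (Real.pi : ℂ) ^ Fintype.card κ
    -- the induction hypothesis holds for all Hermitian `X` and is differentiated at `X` along `Y`
    have herm : ∀ Y : Matrix κ κ ℂ, Y.IsHermitian → ∫ φ, F φ * qf Y φ * exp (-qf (accr u X) φ) =
          c * (((accr u X).det)⁻¹ * ((G * Y).trace * wickSum G p' q'
            + ∑ ρ : Perm α, ∑ j, (G * Y * G) (p' j) (q' (ρ j)) *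
                ∏ i ∈ univ.erase j, G (p' i) (q' (ρ i)))) := by
      intro Y hY
      have h1 := hasDerivAt_integral_wick hFg hu hX hY
      have h2 := (hasDerivAt_wick_rhs hu hX Y p' q').const_mul c
      have h3 : (fun t : ℝ => ∫ φ, F φ * exp (-qf (accr u (X + (t : ℂ) • Y)) φ)) =
          fun t : ℝ => c * (((accr u (X + (t : ℂ) • Y)).det)⁻¹
            * wickSum (accr u (X + (t : ℂ) • Y))⁻¹ p' q') := by
        funext t
        exact ih (hX.add (by rw [IsHermitian, conjTranspose_smul, hY.eq]; simp)) p' q'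
      rw [h3] at h1
      have h4 := h1.unique h2
      rw [mul_left_comm] at h4
      exact mul_left_cancel₀ (by simp) h4
    -- both sides are linear in `Y`, and every matrix is `A + i B` with `A`, `B` Hermitian
    have lin : ∀ Y : Matrix κ κ ℂ, ∫ φ, F φ * qf Y φ * exp (-qf (accr u X) φ) =
          c * (((accr u X).det)⁻¹ * ((G * Y).trace * wickSum G p' q'
            + ∑ ρ : Perm α, ∑ j, (G * Y * G) (p' j) (q' (ρ j)) *
                ∏ i ∈ univ.erase j, G (p' i) (q' (ρ i)))) := by
      intro Y
      set A : Matrix κ κ ℂ := (1 / 2 : ℂ) • (Y + Yᴴ) with hA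
      set B : Matrix κ κ ℂ := (-I / 2) • (Y - Yᴴ) with hB
      have hAh : A.IsHermitian := by
        rw [IsHermitian, hA, conjTranspose_smul, conjTranspose_add,
          conjTranspose_conjTranspose, add_comm]
        simp
      have hBh : B.IsHermitian := by
        rw [IsHermitian, hB, conjTranspose_smul, conjTranspose_sub,
          conjTranspose_conjTranspose, ← neg_sub Y, smul_neg, ← neg_smul]
        congr 1
        simp [neg_div]
      have hY : Y = A + I • B := by
        ext i j
        simp only [hA, hB, Matrix.add_apply, Matrix.smul_apply, Matrix.sub_apply, smul_eq_mul]
        linear_combination (Y i j - Yᴴ i j) / 2 * I_mul_I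
      clear_value A B
      rw [hY]
      have e1 : ∀ φ, F φ * qf (A + I • B) φ * exp (-qf (accr u X) φ) =
          F φ * qf A φ * exp (-qf (accr u X) φ) + I * (F φ * qf B φ * exp (-qf (accr u X) φ)) := by
        intro φ; rw [qf_add, qf_smul]; ring
      simp only [e1]
      rw [integral_add (integrable_wick (hFg.mul (expGrowth_qf A)) hu hX)
        ((integrable_wick (hFg.mul (expGrowth_qf B)) hu hX).const_mul _), integral_const_mul,
        herm A hAh, herm B hBh]
      simp only [Matrix.mul_add, Matrix.mul_smul, smul_mul,
        trace_add, trace_smul, Matrix.add_apply, Matrix.smul_apply, smul_eq_mul,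
        add_mul, sum_add_distrib, mul_assoc, ← mul_sum]
      ring
    -- a matrix unit inserts the additional pair of factors
    have hmain := lin (single (q none) (p none) 1)
    have e2 : ∀ φ : κ → ℂ, qf (single (q none) (p none) 1) φ = φ (p none) * conj (φ (q none)) := by
      intro φ
      rw [qf_apply, sum_eq_single (q none), sum_eq_single (p none)]
      · simp [mul_comm]
      · intro j _ hj; simp [single, hj.symm]
      · simp
      · intro i _ hi; simp [single, hi.symm]
      · simp
    have e3 : (G * single (q none) (p none) 1).trace = G (p none) (q none) := by
      rw [trace_mul_single]; simp
    have e4 : ∀ a b, (G * single (q none) (p none) (1 : ℂ) * G : Matrix κ κ ℂ) a b =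
        G a (q none) * G (p none) b := by
      intro a b
      rw [Matrix.mul_assoc, Matrix.mul_apply, sum_eq_single (q none)]
      · simp
      · intro i _ hi; rw [single_mul_apply_of_ne _ _ _ _ _ hi]; simp
      · simp
    simp only [e2, e3, e4] at hmain
    have e5 : ∀ φ : κ → ℂ, (∏ i, φ (p i) * conj (φ (q i)))
        = F φ * (φ (p none) * conj (φ (q none))) := by
      intro φ; rw [Fintype.prod_option, mul_comm]
    simp only [e5]
    rw [hmain]
    congr 2
    have e6 := sum_perm_option 0 (fun i j : Option α => G (p i) (q j))
    simp only [pow_zero, one_mul] at e6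
    refine Eq.trans ?_ e6.symm
    congr 1
    refine sum_congr rfl fun ρ _ => sum_congr rfl fun j _ => ?_
    ring

end Wick
/-! ### Berezin integration against a Grassmann Gaussian weight -/

section Fermi

/-- Labels `(l, j, k)` of the pairs `ν^{(l)}_{jk}`, `ν̄^{(l)}_{jk}`. -/
abbrev PairIdx : Type := Fin 2 × Fin 2 × Fin 2

/-- A generator as an element of the Grassmann algebra. -/
def gi (x : Gen) : Grass := (gen x : Grass)

/-- The label of `ν_g`. -/
def lab (g : PairIdx) : Gen := (g.1, g.2.1, g.2.2, false)

/-- The label of `ν̄_g`. -/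
def labBar (g : PairIdx) : Gen := (g.1, g.2.1, g.2.2, true)

theorem gi_anticomm (x y : Gen) : gi x * gi y = -(gi y * gi x) :=
  eq_neg_of_add_eq_zero_left (ExteriorAlgebra.ι_add_mul_swap (R := ℂ) _ _)

theorem gi_sq (x : Gen) : gi x * gi x = 0 := ExteriorAlgebra.ι_sq_zero _

/-- `berezinOne` as a linear map. -/
def bz (x : Gen) : Grass →ₗ[ℂ] Grass :=
  CliffordAlgebra.contractRight.flip (LinearMap.proj x : (Gen → ℂ) →ₗ[ℂ] ℂ)

theorem bz_apply (x : Gen) (f : Grass) : bz x f = berezinOne x f := rfl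

theorem bz_mul_gi (x y : Gen) (a : Grass) :
    bz x (a * gi y) = (if x = y then a else 0) - bz x a * gi y := by
  have h := CliffordAlgebra.contractRight_mul_ι (Q := (0 : QuadraticForm ℂ (Gen → ℂ)))
    (d := (LinearMap.proj x : (Gen → ℂ) →ₗ[ℂ] ℂ)) (Pi.single y 1) a
  refine h.trans ?_
  congr 1
  by_cases hxy : x = y
  · subst hxy; simp
  · simp [hxy]

theorem bz_bz (x : Gen) (a : Grass) : bz x (bz x a) = 0 :=
  CliffordAlgebra.contractRight_contractRight _ _

theorem bz_comm (x y : Gen) (a : Grass) : bz x (bz y a) = -bz y (bz x a) :=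
  CliffordAlgebra.contractRight_comm _ _ _

theorem bz_one (x : Gen) : bz x 1 = 0 := CliffordAlgebra.contractRight_one _ _

/-- The iterated Berezin integral along a list of generators. -/
def bzList : List Gen → Grass →ₗ[ℂ] Grass
  | [] => LinearMap.id
  | x :: l => bzList l ∘ₗ bz x

theorem bzList_apply (l : List Gen) (f : Grass) :
    bzList l f = l.foldl (fun h g => berezinOne g h) f := by
  induction l generalizing f with
  | nil => rfl
  | cons x l ih => simp [bzList, ih, bz_apply]

/-- A derivative along a variable of integration integrates to zero. -/
theorem bzList_bz (l : List Gen) (x : Gen) (hx : x ∈ l) (f : Grass) : bzList l (bz x f) = 0 := by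
  induction l generalizing f with
  | nil => simp at hx
  | cons y l ih =>
    simp only [bzList, LinearMap.comp_apply]
    by_cases hxy : x = y
    · subst hxy; rw [bz_bz, map_zero]
    · rw [bz_comm, map_neg, ih ((List.mem_cons.mp hx).resolve_left hxy), neg_zero]

theorem bz_prod_gi (l : List Gen) (x : Gen) (hx : x ∉ l) : bz x (l.map gi).prod = 0 := by
  induction l using List.reverseRecOn with
  | nil => simpa using bz_one x
  | append_singleton l y ih =>
    simp only [List.mem_append, List.mem_singleton, not_or] at hx
    simp [bz_mul_gi, hx.2, ih hx.1]

theorem bzList_prod_reverse (l : List Gen) (hl : l.Nodup) :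
    bzList l (l.reverse.map gi).prod = 1 := by
  induction l with
  | nil => simp [bzList]
  | cons x l ih =>
    rw [List.nodup_cons] at hl
    simp only [bzList, LinearMap.comp_apply, List.reverse_cons, List.map_append, List.map_cons,
      List.map_nil, List.prod_append, List.prod_singleton]
    rw [bz_mul_gi, if_pos rfl, bz_prod_gi _ _ (by simpa using hl.1), zero_mul, sub_zero, ih hl.2]

theorem gi_mul_gi_mem_even (x y : Gen) : gi x * gi y ∈ GrassEven := by
  have h := odd_mul_even_mul_odd_mem (gen x) 1 (gen y)
  simpa [gi] using h

/-- The inclusion of the even subalgebra. -/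
def evenVal : GrassEven →+* Grass where
  toFun := Subtype.val
  map_one' := rfl
  map_mul' _ _ := rfl
  map_zero' := rfl
  map_add' _ _ := rfl

theorem evenVal_apply (x : GrassEven) : evenVal x = (x : Grass) := rfl

/-- The even element `ν_g ν̄_h`. -/
def pr (g h : PairIdx) : GrassEven := ⟨gi (lab g) * gi (labBar h), gi_mul_gi_mem_even _ _⟩

theorem evenVal_pr (g h : PairIdx) : evenVal (pr g h) = gi (lab g) * gi (labBar h) := rfl

theorem lab_ne_labBar (g h : PairIdx) : lab g ≠ labBar h := by
  simp [lab, labBar]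

theorem labBar_inj (g h : PairIdx) : labBar g = labBar h ↔ g = h := by
  constructor
  · intro e
    simp only [labBar, Prod.mk.injEq] at e
    exact Prod.ext e.1 (Prod.ext e.2.1 e.2.2.1)
  · rintro rfl; rfl

theorem even_comm' (x : GrassEven) (y : Grass) : evenVal x * y = y * evenVal x :=
  even_commute _ _ x.2

theorem bz_mul_pr (k g h : PairIdx) (a : Grass) : bz (labBar k) (a * evenVal (pr g h)) =
      bz (labBar k) a * evenVal (pr g h) + (if k = h then a * gi (lab g) else 0) := by
  rw [evenVal_pr, ← mul_assoc, bz_mul_gi, bz_mul_gi, if_neg (lab_ne_labBar g k).symm]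
  simp only [labBar_inj, zero_sub, neg_mul, sub_neg_eq_add, mul_assoc]
  rw [add_comm]

theorem bz_mul_prod_pr {σ : Type*} [DecidableEq σ] (k : PairIdx) (g h : σ → PairIdx) (s : Finset σ)
    (a : Grass) :
    bz (labBar k) (a * evenVal (∏ i ∈ s, pr (g i) (h i))) =
      bz (labBar k) a * evenVal (∏ i ∈ s, pr (g i) (h i)) +
        ∑ j ∈ s, if k = h j then a * gi (lab (g j)) * evenVal (∏ i ∈ s.erase j, pr (g i) (h i))
          else 0 := by
  induction s using Finset.induction_on generalizing a with
  | empty => simp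
  | insert b s hb ih =>
    rw [prod_insert hb, map_mul evenVal, ← mul_assoc, ih, bz_mul_pr, sum_insert hb,
      erase_insert hb, add_mul, add_assoc]
    congr 1
    · rw [mul_assoc]
    · congr 1
      · split_ifs <;> simp
      · refine sum_congr rfl fun j hj => ?_
        split_ifs with hk
        · have hbj : b ≠ j := fun e => hb (e ▸ hj)
          rw [erase_insert_of_ne hbj, prod_insert (by simp [hb]), map_mul,
            ← mul_assoc, mul_assoc a, mul_assoc a, even_comm']
          simp only [← mul_assoc]
        · rfl

/-- `Tr (ν_1 ν_1^* + ν_2 ν_2^*)` as an even element. -/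
def trEven : GrassEven := ∑ g : PairIdx, pr g g

theorem evenVal_trEven : evenVal trEven = traceNuNuStar := by
  simp only [trEven, traceNuNuStar, map_sum, evenVal_pr, Fintype.sum_prod_type]
  rfl

theorem pr_mul_pr_left (g h h' : PairIdx) : pr g h * pr g h' = 0 := by
  apply Subtype.ext
  change gi (lab g) * gi (labBar h) * (gi (lab g) * gi (labBar h')) = 0
  rw [← mul_assoc, mul_assoc (gi (lab g)), gi_anticomm (labBar h), mul_neg, ← mul_assoc, gi_sq]
  simp

theorem isNilpotent_trEven : IsNilpotent trEven :=
  isNilpotent_sum fun g _ => ⟨2, by rw [pow_two, pr_mul_pr_left]⟩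

theorem isNilpotent_neg_trace : IsNilpotent (-traceNuNuStar) := by
  rw [← evenVal_trEven]
  exact (isNilpotent_trEven.map evenVal).neg

theorem trace_comm (y : Grass) : traceNuNuStar * y = y * traceNuNuStar := by
  rw [← evenVal_trEven, even_comm']

theorem bz_mul_trace (k : PairIdx) (a : Grass) : bz (labBar k) (a * traceNuNuStar) =
      bz (labBar k) a * traceNuNuStar + a * gi (lab k) := by
  rw [← evenVal_trEven, trEven, map_sum, mul_sum, map_sum]
  simp only [bz_mul_pr, sum_add_distrib, mul_sum]
  simp

theorem bz_mul_trace_pow (k : PairIdx) (a : Grass) (m : ℕ) :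
    bz (labBar k) (a * (-traceNuNuStar) ^ (m + 1)) = bz (labBar k) a * (-traceNuNuStar) ^ (m + 1)
        - ((m + 1 : ℕ) : ℂ) • (a * gi (lab k) * (-traceNuNuStar) ^ m) := by
  induction m generalizing a with
  | zero => simp [bz_mul_trace]; abel
  | succ m ih =>
    have hc : gi (lab k) * -traceNuNuStar = -traceNuNuStar * gi (lab k) := by
      rw [mul_neg, neg_mul, trace_comm]
    rw [pow_succ' _ (m + 1), ← mul_assoc, ih, mul_neg, map_neg, bz_mul_trace]
    have e : -(a * traceNuNuStar) * gi (lab k) * (-traceNuNuStar) ^ m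
        = a * gi (lab k) * (-traceNuNuStar) ^ (m + 1) := by
      rw [pow_succ', ← mul_neg, mul_assoc a, ← hc]
      simp only [mul_assoc]
    rw [e, neg_add, add_mul, mul_assoc, neg_mul, sub_eq_add_neg, ← mul_assoc]
    rw [Nat.cast_add (m + 1) 1, add_smul, Nat.cast_one, one_smul]
    simp only [mul_assoc, neg_mul, mul_neg]
    abel

/-- The Grassmann Gaussian weight `exp (-Tr (ν_1 ν_1^* + ν_2 ν_2^*))`. -/
def gw : Grass := IsNilpotent.exp (-traceNuNuStar)

/-- The Leibniz rule with the Gaussian weight, whose derivative along `ν̄_k` involves `ν_k`. -/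
theorem bz_mul_gw (k : PairIdx) (a : Grass) :
    bz (labBar k) (a * gw) = bz (labBar k) a * gw - a * gi (lab k) * gw := by
  obtain ⟨K, hK⟩ := isNilpotent_neg_trace
  have h1 : gw = ∑ i ∈ range (K + 1), (i.factorial : ℚ)⁻¹ • (-traceNuNuStar) ^ i :=
    IsNilpotent.exp_eq_sum (by rw [pow_succ, hK, zero_mul])
  have h2 : gw = ∑ i ∈ range K, (i.factorial : ℚ)⁻¹ • (-traceNuNuStar) ^ i :=
    IsNilpotent.exp_eq_sum hK
  have hq : ∀ (i : ℕ) (y : Grass), (i.factorial : ℚ)⁻¹ • y = ((i.factorial : ℂ)⁻¹) • y := by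
    intro i y
    rw [← Rat.cast_smul_eq_qsmul ℂ]
    simp
  conv_lhs => rw [h1]
  conv_rhs => rw [h1]
  rw [sub_eq_add_neg]
  conv_rhs => rw [← h1]
  conv_rhs => enter [2]; rw [h2]
  rw [h1]
  simp only [hq, mul_sum, map_sum, mul_smul_comm, map_smul]
  rw [sum_range_succ', sum_range_succ' (fun i => ((i.factorial : ℂ)⁻¹) •
    (bz (labBar k) a * (-traceNuNuStar) ^ i))]
  simp only [bz_mul_trace_pow, smul_sub, sum_sub_distrib, smul_smul]
  have h3 : ∀ i : ℕ, (((i + 1).factorial : ℂ)⁻¹ * ((i + 1 : ℕ) : ℂ)) = (i.factorial : ℂ)⁻¹ := by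
    intro i
    rw [Nat.factorial_succ]
    push_cast
    have : ((i : ℂ) + 1) ≠ 0 := by exact_mod_cast Nat.succ_ne_zero i
    field_simp
  simp only [h3]
  simp
  abel

/-- Berezin integration against the Gaussian weight. -/
def gInt : Grass →ₗ[ℂ] ℂ :=
  (ExteriorAlgebra.algebraMapInv (M := Gen → ℂ)).toLinearMap ∘ₗ bzList dnu ∘ₗ
    LinearMap.mulRight ℂ gw

theorem gInt_apply (f : Grass) : gInt f = berezin (f * IsNilpotent.exp (-traceNuNuStar)) := by
  simp [gInt, bzList_apply, berezin, gw]

set_option maxRecDepth 4000 in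
theorem mem_dnu (x : Gen) : x ∈ dnu := by
  revert x; decide

/-- Integration by parts for the Grassmann Gaussian weight. -/
theorem gInt_mul_lab (f : Grass) (k : PairIdx) :
    gInt (f * gi (lab k)) = gInt (bz (labBar k) f) := by
  have h := bzList_bz dnu (labBar k) (mem_dnu _) (f * gw)
  rw [bz_mul_gw, map_sub, sub_eq_zero] at h
  simp only [gInt, LinearMap.comp_apply, LinearMap.mulRight_apply]
  rw [h]

/-- The recursion for the moments: integration by parts contracts `ν_{g₀}` with every `ν̄`. -/
theorem gInt_pr_mul_prod {σ : Type*} [DecidableEq σ] (g h : σ → PairIdx) (s : Finset σ)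
    (g₀ h₀ : PairIdx) :
    gInt (evenVal (pr g₀ h₀ * ∏ i ∈ s, pr (g i) (h i))) =
      -(if g₀ = h₀ then gInt (evenVal (∏ i ∈ s, pr (g i) (h i))) else 0) + ∑ j ∈ s, if g₀ = h j then
          gInt (evenVal (pr (g j) h₀ * ∏ i ∈ s.erase j, pr (g i) (h i))) else 0 := by
  have e1 : evenVal (pr g₀ h₀ * ∏ i ∈ s, pr (g i) (h i)) =
      -((gi (labBar h₀) * evenVal (∏ i ∈ s, pr (g i) (h i))) * gi (lab g₀)) := by
    rw [map_mul, evenVal_pr, gi_anticomm, neg_mul, mul_assoc, mul_assoc, even_comm']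
  rw [e1, map_neg, gInt_mul_lab, bz_mul_prod_pr, map_add, neg_add, map_sum, ← sum_neg_distrib]
  refine congrArg₂ (· + ·) ?_ ?_
  · have := bz_mul_gi (labBar g₀) (labBar h₀) 1
    rw [bz_one, one_mul, zero_mul, sub_zero] at this
    rw [this]
    simp only [labBar_inj]
    split_ifs <;> simp
  · refine sum_congr rfl fun j _ => ?_
    split_ifs
    · rw [map_mul evenVal, evenVal_pr, gi_anticomm (lab (g j)), neg_mul, map_neg]
    · simp

theorem pr_mul_prod_erase {σ : Type*} [Fintype σ] [DecidableEq σ] (g h : σ → PairIdx) (j : σ)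
    (h₀ : PairIdx) : pr (g j) h₀ * ∏ i ∈ univ.erase j, pr (g i) (h i) =
      ∏ i, pr (g i) (Function.update h j h₀ i) := by
  rw [← mul_prod_erase univ _ (mem_univ j), Function.update_self]
  have : ∀ i ∈ univ.erase j, pr (g i) (h i) = pr (g i) (Function.update h j h₀ i) :=
    fun i hi => by rw [Function.update_of_ne (ne_of_mem_erase hi)]
  rw [prod_congr rfl this]

theorem gInt_prod_comp {α β : Type*} [Fintype α] [Fintype β] (e : α ≃ β) (g h : β → PairIdx) :
    gInt (evenVal (∏ i, -pr ((g ∘ e) i) ((h ∘ e) i))) = gInt (evenVal (∏ i, -pr (g i) (h i))) := by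
  rw [← Equiv.prod_comp e (fun i => -pr (g i) (h i))]
  simp only [Function.comp_apply]

/-- Wick's formula for the Grassmann Gaussian weight, up to the normalization `gInt 1`. -/
theorem gInt_prod_aux (σ : Type) [Fintype σ] : ∀ [DecidableEq σ] (g h : σ → PairIdx),
    gInt (evenVal (∏ i, -pr (g i) (h i))) = (∑ ρ : Perm σ, sgn ρ *
        ∏ i, if g i = h (ρ i) then (1 : ℂ) else 0) * gInt 1 := by
  refine Fintype.induction_empty_option (P := fun σ _ => ∀ [DecidableEq σ] (g h : σ → PairIdx),
    gInt (evenVal (∏ i, -pr (g i) (h i))) = (∑ ρ : Perm σ, sgn ρ *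
        ∏ i, if g i = h (ρ i) then (1 : ℂ) else 0) * gInt 1) ?_ ?_ ?_ σ
  · intro α β _ e ih _ g h
    classical
    let _ := Fintype.ofEquiv β e.symm
    rw [← gInt_prod_comp e g h, ih (g ∘ e) (h ∘ e)]
    refine congrArg (· * gInt 1) ?_
    rw [← Equiv.sum_comp (Equiv.permCongr e.symm)]
    refine sum_congr (by ext; simp) fun ρ _ => ?_
    rw [← Equiv.prod_comp e.symm]
    congr 1
    · rw [Equiv.Perm.sign_permCongr]
    · refine prod_congr (by ext; simp) fun i _ => ?_
      simp [Equiv.permCongr_apply]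
  · intro _ g h
    simp
  · intro α _ ih inst g h
    classical
    obtain rfl : inst = (fun a b => Option.instDecidableEq a b) := Subsingleton.elim _ _
    have hexp := sum_perm_option 1 (fun i j : Option α => if g i = h j then (1 : ℂ) else 0)
    simp only [pow_one] at hexp
    rw [hexp, Fintype.prod_option, neg_mul, map_neg, map_neg]
    have hneg : ∀ (s : Finset α) (h' : α → PairIdx),
        ∏ i ∈ s, -pr (g (some i)) (h' i) = (-1) ^ s.card * ∏ i ∈ s, pr (g (some i)) (h' i) :=
      fun s h' => prod_neg _
    set N := card (univ : Finset α)
    have hsgn : ∀ x : GrassEven, gInt (evenVal ((-1) ^ N * x)) = (-1) ^ N * gInt (evenVal x) := by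
      intro x
      rcases neg_one_pow_eq_or GrassEven N with hN | hN <;>
        rcases Nat.even_or_odd N with hN' | hN' <;> simp [hN'.neg_one_pow]
    have hsgn' : ((-1 : ℂ) ^ N) * (-1) ^ N = 1 := by rw [← mul_pow]; simp
    rw [hneg, mul_left_comm, hsgn, gInt_pr_mul_prod (fun i => g (some i)) (fun i => h (some i))]
    let D (h' : α → PairIdx) : ℂ := ∑ ρ : Perm α, sgn ρ *
      ∏ i, if g (some i) = h' (ρ i) then (1 : ℂ) else 0
    let S : ℂ := ∑ ρ : Perm α, sgn ρ * ∑ j, (if g none = h (some (ρ j)) then (1 : ℂ) else 0) *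
      (if g (some j) = h none then (1 : ℂ) else 0) *
      ∏ i ∈ univ.erase j, if g (some i) = h (some (ρ i)) then (1 : ℂ) else 0
    have ih' : ∀ h' : α → PairIdx, gInt (evenVal (∏ i, pr (g (some i)) (h' i))) =
        (-1) ^ N * (D h' * gInt 1) := by
      intro h'
      rw [← ih (fun i => g (some i)) h', hneg, hsgn, ← mul_assoc, hsgn', one_mul]
    have hj : ∀ j : α, gInt (evenVal (pr (g (some j)) (h none) *
        ∏ i ∈ univ.erase j, pr (g (some i)) (h (some i)))) =
        (-1) ^ N * (D (Function.update (fun i => h (some i)) j (h none)) * gInt 1) := by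
      intro j
      rw [← ih', ← pr_mul_prod_erase (fun i => g (some i)) (fun i => h (some i)) j (h none)]
    simp only [hj, ih' (fun i => h (some i))]
    have hρ : ∀ (ρ : Perm α) (j : α),
        (∏ i, if g (some i) = Function.update (fun i => h (some i)) (ρ j) (h none) (ρ i)
            then (1 : ℂ) else 0) = (if g (some j) = h none then (1 : ℂ) else 0) *
          ∏ i ∈ univ.erase j, if g (some i) = h (some (ρ i)) then (1 : ℂ) else 0 := by
      intro ρ j
      rw [← mul_prod_erase univ _ (mem_univ j), Function.update_self]
      congr 1
      refine prod_congr rfl fun i hi => ?_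
      rw [Function.update_of_ne (by simpa using ne_of_mem_erase hi)]
    have hsum : ∑ j : α, (if g none = h (some j) then
          (-1) ^ N * (D (Function.update (fun i => h (some i)) j (h none)) * gInt 1) else 0) =
        (-1) ^ N * (S * gInt 1) := by
      have e1 : ∀ j : α, (if g none = h (some j) then
          (-1) ^ N * (D (Function.update (fun i => h (some i)) j (h none)) * gInt 1) else 0) =
          (-1) ^ N * gInt 1 * ∑ ρ : Perm α, sgn ρ *
          ((if g none = h (some j) then (1 : ℂ) else 0) *
          ∏ i, if g (some i) = Function.update (fun i => h (some i)) j (h none) (ρ i)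
            then (1 : ℂ) else 0) := by
        intro j
        simp only [D]
        split_ifs
        · simp only [one_mul]; ring
        · simp
      simp only [e1]
      rw [← mul_sum, sum_comm]
      have e2 : ∀ ρ : Perm α, (∑ j : α, sgn ρ * ((if g none = h (some j) then (1 : ℂ) else 0) *
          ∏ i, if g (some i) = Function.update (fun i => h (some i)) j (h none) (ρ i)
            then (1 : ℂ) else 0)) = sgn ρ *
          ∑ j, (if g none = h (some (ρ j)) then (1 : ℂ) else 0) *
            (if g (some j) = h none then (1 : ℂ) else 0) *
            ∏ i ∈ univ.erase j, if g (some i) = h (some (ρ i)) then (1 : ℂ) else 0 := by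
        intro ρ
        rw [← Equiv.sum_comp ρ, ← mul_sum]
        simp only [hρ, mul_assoc]
      simp only [e2]
      ring
    rw [hsum]
    split_ifs
    · linear_combination hsgn' * D (fun i => h (some i)) * gInt 1 - hsgn' * S * gInt 1
    · linear_combination - hsgn' * S * gInt 1

/-- The involution `(l, j, k) ↦ (l, k, j)`, by which the order of the differentials in `dnu`
pairs the generators. -/
def flipIdx : Perm PairIdx := Equiv.prodCongr (Equiv.refl _) (Equiv.prodComm _ _)

/-- The normalization is read off from Wick's formula for the product of top degree, on which the
Gaussian weight acts as `1`. -/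
theorem gInt_one : gInt 1 = 1 := by
  have h1 := gInt_prod_aux PairIdx id flipIdx
  have h2 : (∑ ρ : Perm PairIdx, sgn ρ * ∏ i, if id i = flipIdx (ρ i) then (1 : ℂ) else 0) = 1 := by
    rw [sum_eq_single flipIdx]
    · have : Perm.sign flipIdx = 1 := by decide
      have h4 : ∀ x, flipIdx (flipIdx x) = x := fun x => rfl
      rw [this]
      simp [h4]
    · intro ρ _ hρ
      have : ∃ i, ¬ (id i = flipIdx (ρ i)) := by
        by_contra! h
        apply hρ
        ext1 i
        have h3 := congrArg flipIdx (h i)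
        have h4 : ∀ x, flipIdx (flipIdx x) = x := fun x => rfl
        rw [h4] at h3
        exact h3.symm
      obtain ⟨i, hi⟩ := this
      rw [prod_eq_zero (mem_univ i) (if_neg hi), mul_zero]
    · simp
  rw [h2, one_mul] at h1
  rw [← h1]
  set top : GrassEven := ∏ i, -pr (id i) (flipIdx i) with htop
  have htr : top * trEven = 0 := by
    rw [trEven, mul_sum]
    refine sum_eq_zero fun g _ => ?_
    rw [htop, ← prod_erase_mul univ _ (mem_univ g), mul_assoc, neg_mul, id,
      pr_mul_pr_left, neg_zero, mul_zero]
  have hgw : evenVal top * gw = evenVal top := by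
    obtain ⟨K, hK⟩ := isNilpotent_neg_trace
    have h1 : gw = ∑ i ∈ range (K + 1), (i.factorial : ℚ)⁻¹ • (-traceNuNuStar) ^ i :=
      IsNilpotent.exp_eq_sum (by rw [pow_succ, hK, zero_mul])
    have h0 : evenVal top * -traceNuNuStar = 0 := by
      rw [← evenVal_trEven, mul_neg, ← map_mul, htr, map_zero, neg_zero]
    rw [h1, sum_range_succ', mul_add, mul_sum, sum_eq_zero]
    · simp
    · intro i _
      rw [mul_smul_comm, pow_succ', ← mul_assoc, h0, zero_mul, smul_zero]
  have hd : evenVal top = (dnu.reverse.map gi).prod := by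
    have e : top = -pr (1, 1, 1) (1, 1, 1) * -pr (1, 0, 1) (1, 1, 0) * -pr (1, 1, 0) (1, 0, 1) *
        -pr (1, 0, 0) (1, 0, 0) * -pr (0, 1, 1) (0, 1, 1) * -pr (0, 0, 1) (0, 1, 0) *
        -pr (0, 1, 0) (0, 0, 1) * -pr (0, 0, 0) (0, 0, 0) := by
      rw [htop]
      simp only [Fintype.prod_prod_type, Fin.prod_univ_two]
      simp only [flipIdx, id, Equiv.prodCongr_apply, Equiv.coe_refl, Prod.map_apply,
        Equiv.prodComm_apply, Prod.swap_prod_mk]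
      ring
    have e2 : ∀ g h, evenVal (-pr g h) = gi (labBar h) * gi (lab g) := by
      intro g h
      rw [map_neg, evenVal_pr, gi_anticomm, neg_neg]
    rw [e]
    simp only [map_mul, e2]
    have e3 : dnu = [(0, 0, 0, false), (0, 0, 0, true), (0, 1, 0, false), (0, 0, 1, true),
      (0, 0, 1, false), (0, 1, 0, true), (0, 1, 1, false), (0, 1, 1, true),
      (1, 0, 0, false), (1, 0, 0, true), (1, 1, 0, false), (1, 0, 1, true),
      (1, 0, 1, false), (1, 1, 0, true), (1, 1, 1, false), (1, 1, 1, true)] := by decide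
    rw [e3]
    simp [lab, labBar, mul_assoc]
  rw [gInt]
  simp only [LinearMap.comp_apply, LinearMap.mulRight_apply]
  rw [hgw, hd, bzList_prod_reverse dnu (by decide)]
  simp

/-- **Wick's formula for the Grassmann Gaussian weight**: the moments are determinants. -/
theorem gInt_prod {σ : Type} [Fintype σ] [DecidableEq σ] (g h : σ → PairIdx) :
    gInt (evenVal (∏ i, -pr (g i) (h i))) = ∑ ρ : Perm σ, sgn ρ *
        ∏ i, if g i = h (ρ i) then (1 : ℂ) else 0 := by
  rw [gInt_prod_aux, gInt_one, mul_one]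

end Fermi
/-! ### Averages of determinants with a bilinear perturbation -/

section SuperWick

variable {κ : Type} [Fintype κ] [DecidableEq κ]

/-- The common value of the bosonic and the fermionic Gaussian averages of a determinant with a
bilinear perturbation, see `integral_det_sub_bilinear` and `gInt_det_sub_bilinear`. -/
def superSum (c : ℂ) (u : κ → PairIdx → κ → ℂ) (v : PairIdx → κ → κ → ℂ) (C G : Matrix κ κ ℂ) :
    ℂ :=
  ∑ σ : Perm κ, sgn σ * ∑ S : Finset κ, (∏ a ∈ univ \ S, C (σ a) a) *
      ∑ h : S → PairIdx, ∑ p : S → κ, ∑ q : S → κ,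
        (∏ i : S, c * u (σ i) (h i) (p i) * v (h i) (q i) i) * wickSum G p q

theorem prod_sum_fun {S A R : Type*} [Fintype S] [DecidableEq S] [Fintype A] [CommSemiring R]
    (f : S → A → R) : ∏ i, ∑ a, f i a = ∑ a : S → A, ∏ i, f i (a i) := by
  rw [prod_univ_sum, Fintype.piFinset_univ]

theorem sum_rotate {A B C D R : Type*} [AddCommMonoid R] (s : Finset A) (t : Finset B)
    (r : Finset C) (w : Finset D) (f : A → B → C → D → R) :
    ∑ a ∈ s, ∑ b ∈ t, ∑ c ∈ r, ∑ d ∈ w, f a b c d =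
      ∑ b ∈ t, ∑ c ∈ r, ∑ d ∈ w, ∑ a ∈ s, f a b c d := by
  rw [sum_comm]
  refine sum_congr rfl fun b _ => ?_
  rw [sum_comm]
  refine sum_congr rfl fun c _ => ?_
  rw [sum_comm]

theorem det_add_expand {R : Type*} [CommRing R] (C D : Matrix κ κ R) :
    (D + C).det = ∑ σ : Perm κ, ((Perm.sign σ : ℤ) : R) * ∑ S : Finset κ,
      (∏ a ∈ univ \ S, C (σ a) a) * ∏ i : S, D (σ i) i := by
  rw [det_apply']
  refine sum_congr rfl fun σ _ => ?_
  congr 1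
  simp only [Matrix.add_apply]
  rw [prod_add]
  simp only [powerset_univ]
  refine sum_congr rfl fun S _ => ?_
  rw [mul_comm]
  congr 1
  exact (prod_coe_sort S (fun i => D (σ i) i)).symm

/-- The perturbation `∑ u_{a g p} φ_p v_{g q b} φ̄_q`. -/
def bilPert (u : κ → PairIdx → κ → ℂ) (v : PairIdx → κ → κ → ℂ) (φ : κ → ℂ) : Matrix κ κ ℂ :=
  of fun a b => ∑ g, ∑ p, ∑ q, u a g p * v g q b * (φ p * conj (φ q))

omit [DecidableEq κ] in
theorem expGrowth_bilPert (u : κ → PairIdx → κ → ℂ) (v : PairIdx → κ → κ → ℂ) (a b : κ) :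
    ExpGrowth (fun φ => bilPert u v φ a b) := by
  simp only [bilPert, of_apply]
  exact .sum _ fun g _ => .sum _ fun p _ => .sum _ fun q _ => (ExpGrowth.const _).mul
    ((ExpGrowth.coord p).mul (ExpGrowth.coord q).conjugate)

theorem expGrowth_det_bilPert (c : ℂ) (u : κ → PairIdx → κ → ℂ) (v : PairIdx → κ → κ → ℂ)
    (C : Matrix κ κ ℂ) : ExpGrowth (fun φ => (C - c • bilPert u v φ).det) := by
  refine .det fun i j => ?_
  simp only [Matrix.sub_apply, Matrix.smul_apply, smul_eq_mul]
  exact (ExpGrowth.const _).sub ((ExpGrowth.const _).mul (expGrowth_bilPert u v i j))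

omit [Fintype κ] [DecidableEq κ] in
theorem wickSum_neg {σ : Type*} [Fintype σ] [DecidableEq σ] (G : Matrix κ κ ℂ) (p q : σ → κ) :
    wickSum (-G) p q = (-1) ^ Fintype.card σ * wickSum G p q := by
  simp only [wickSum, Matrix.neg_apply, prod_neg, mul_sum, card_univ]

/-- The bosonic average of `det (C - c ∑ u φ v φ̄)`. -/
theorem integral_det_sub_bilinear (c : ℂ) (u : κ → PairIdx → κ → ℂ) (v : PairIdx → κ → κ → ℂ)
    (C : Matrix κ κ ℂ) {s : ℝ} (hs : 0 < s) {X : Matrix κ κ ℂ} (hX : X.IsHermitian) :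
    ∫ φ : κ → ℂ, (C - c • bilPert u v φ).det * exp (-qf (accr s X) φ) =
      (Real.pi : ℂ) ^ Fintype.card κ * (((accr s X).det)⁻¹ * superSum c u v C (-(accr s X)⁻¹)) := by
  have e1 : ∀ φ : κ → ℂ, (C - c • bilPert u v φ).det * exp (-qf (accr s X) φ) =
      ∑ σ : Perm κ, ∑ S : Finset κ, ∑ h : S → PairIdx, ∑ p : S → κ, ∑ q : S → κ,
        (sgn σ * (∏ a ∈ univ \ S, C (σ a) a) *
          ∏ i : S, -(c * u (σ i) (h i) (p i) * v (h i) (q i) i)) *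
          ((∏ i : S, φ (p i) * conj (φ (q i))) * exp (-qf (accr s X) φ)) := by
    intro φ
    rw [sub_eq_add_neg, add_comm, det_add_expand, sum_mul]
    refine sum_congr rfl fun σ _ => ?_
    rw [mul_sum, sum_mul]
    refine sum_congr rfl fun S _ => ?_
    have e2 : ∏ i : S, (-(c • bilPert u v φ) : Matrix κ κ ℂ) (σ i) i =
        ∑ h : S → PairIdx, ∑ p : S → κ,
        ∑ q : S → κ, (∏ i : S, -(c * u (σ i) (h i) (p i) * v (h i) (q i) i)) *
          ∏ i : S, φ (p i) * conj (φ (q i)) := by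
      have e3 : ∀ i : S, (-(c • bilPert u v φ) : Matrix κ κ ℂ) (σ i) i =
          ∑ h, ∑ p, ∑ q, -(c * u (σ i) h p * v h q i) * (φ p * conj (φ q)) := by
        intro i
        simp only [Matrix.neg_apply, Matrix.smul_apply, bilPert, of_apply, smul_eq_mul,
          mul_sum, ← sum_neg_distrib]
        refine sum_congr rfl fun _ _ => sum_congr rfl fun _ _ =>
          sum_congr rfl fun _ _ => ?_
        ring
      rw [prod_congr rfl fun i _ => e3 i]
      simp only [prod_sum_fun, ← prod_mul_distrib]
    rw [e2]
    simp only [mul_sum, sum_mul]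
    refine sum_congr rfl fun _ _ => sum_congr rfl fun _ _ =>
        sum_congr rfl fun _ _ => ?_
    ring
  have hint : ∀ (S : Finset κ) (p q : S → κ) (w : ℂ), Integrable (fun φ : κ → ℂ =>
      w * ((∏ i : S, φ (p i) * conj (φ (q i))) * exp (-qf (accr s X) φ))) := by
    intro S p q w
    exact (integrable_wick (.prod _ fun i _ =>
      (ExpGrowth.coord _).mul (ExpGrowth.coord _).conjugate) hs hX).const_mul w
  simp only [e1]
  rw [integral_finsetSum _ fun σ _ => integrable_finsetSum _ fun S _ => integrable_finsetSum _
    fun h _ => integrable_finsetSum _ fun p _ => integrable_finsetSum _ fun q _ => hint _ _ _ _]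
  simp only [superSum, mul_sum]
  refine sum_congr rfl fun σ _ => ?_
  rw [integral_finsetSum _ fun S _ => integrable_finsetSum _
    fun h _ => integrable_finsetSum _ fun p _ => integrable_finsetSum _ fun q _ => hint _ _ _ _]
  refine sum_congr rfl fun S _ => ?_
  rw [integral_finsetSum _
    fun h _ => integrable_finsetSum _ fun p _ => integrable_finsetSum _ fun q _ => hint _ _ _ _]
  refine sum_congr rfl fun h _ => ?_
  rw [integral_finsetSum _ fun p _ => integrable_finsetSum _ fun q _ => hint _ _ _ _]
  refine sum_congr rfl fun p _ => ?_
  rw [integral_finsetSum _ fun q _ => hint _ _ _ _]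
  refine sum_congr rfl fun q _ => ?_
  rw [integral_const_mul, gaussian_wick hs S hX, prod_neg, wickSum_neg, card_univ]
  ring

/-- The scalars in the even subalgebra. -/
abbrev amap : ℂ →+* GrassEven := algebraMap ℂ GrassEven

/-- `gInt` on the even subalgebra. -/
def eInt (x : GrassEven) : ℂ := gInt (evenVal x)

theorem eInt_sum {A : Type*} (s : Finset A) (f : A → GrassEven) :
    eInt (∑ a ∈ s, f a) = ∑ a ∈ s, eInt (f a) := by
  rw [eInt, map_sum evenVal, map_sum gInt]
  rfl

theorem evenVal_amap (c : ℂ) : evenVal (amap c) = algebraMap ℂ Grass c := rfl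

theorem eInt_amap_mul (c : ℂ) (x : GrassEven) : eInt (amap c * x) = c * eInt x := by
  rw [eInt, map_mul evenVal, evenVal_amap, ← Algebra.smul_def, map_smul, smul_eq_mul, eInt]

theorem eInt_prod {σ : Type} [Fintype σ] [DecidableEq σ] (g h : σ → PairIdx) :
    eInt (∏ i, -pr (g i) (h i)) = ∑ ρ : Perm σ, sgn ρ *
        ∏ i, if g i = h (ρ i) then (1 : ℂ) else 0 := by
  rw [eInt]
  exact gInt_prod g h

/-- The even matrix `c ∑ u_{a g p} ν_g G_{pq} v_{h q b} ν̄_h`. -/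
def fermPert (c : ℂ) (u : κ → PairIdx → κ → ℂ) (v : PairIdx → κ → κ → ℂ) (G : Matrix κ κ ℂ) :
    Matrix κ κ GrassEven :=
  of fun a b => ∑ g, ∑ h, ∑ p, ∑ q, amap (c * u a g p * G p q * v h q b) * pr g h

/-- The fermionic average of `det (C - c ∑ u ν G v ν̄)`. -/
theorem gInt_det_sub_bilinear (c : ℂ) (u : κ → PairIdx → κ → ℂ) (v : PairIdx → κ → κ → ℂ)
    (C G : Matrix κ κ ℂ) :
    eInt (C.map amap - fermPert c u v G).det = superSum c u v C G := by
  rw [sub_eq_add_neg, add_comm, det_add_expand, eInt_sum, superSum]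
  have e2 : ∀ (σ : Perm κ) (S : Finset κ), ∏ i : S, (-fermPert c u v G) (σ i) i =
      ∑ g : S → PairIdx, ∑ h : S → PairIdx, ∑ p : S → κ,
        ∑ q : S → κ, amap (∏ i : S, c * u (σ i) (g i) (p i) * G (p i) (q i) * v (h i) (q i) i) *
          ∏ i : S, -pr (g i) (h i) := by
    intro σ S
    have e3 : ∀ i : S, (-fermPert c u v G) (σ i) i =
        ∑ g, ∑ h, ∑ p, ∑ q, amap (c * u (σ i) g p * G p q * v h q i) * -pr g h := by
      intro i
      simp only [Matrix.neg_apply, fermPert, of_apply, ← sum_neg_distrib, mul_neg]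
    rw [prod_congr rfl fun i _ => e3 i]
    simp only [prod_sum_fun, map_prod, ← prod_mul_distrib]
  -- Wick's formula pairs `g = h ∘ τ`
  have e3 : ∀ (σ : Perm κ) (S : Finset κ), eInt (∏ i : S, (-fermPert c u v G) (σ i) i) =
      ∑ τ : Perm S, sgn τ * ∑ h : S → PairIdx, ∑ p : S → κ,
        ∑ q : S → κ, ∏ i : S, c * u (σ i) (h (τ i)) (p i) * G (p i) (q i) * v (h i) (q i) i := by
    intro σ S
    rw [e2]
    simp only [eInt_sum, eInt_amap_mul, eInt_prod]
    simp only [mul_sum]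
    rw [sum_rotate]
    conv_rhs => rw [sum_rotate]
    refine sum_congr rfl fun h _ => sum_congr rfl fun p _ =>
      sum_congr rfl fun q _ => ?_
    rw [sum_comm]
    refine sum_congr rfl fun τ _ => ?_
    rw [sum_eq_single (h ∘ τ)]
    · simp; ring
    · intro g _ hg
      have : ∃ i, ¬ (g i = h (τ i)) := by
        by_contra! hh
        exact hg (funext hh)
      obtain ⟨i, hi⟩ := this
      rw [prod_eq_zero (f := fun i => if g i = h (τ i) then (1 : ℂ) else 0)
        (mem_univ i) (if_neg hi)]
      simp
    · simp
  have e4 : ∀ (σ : Perm κ), eInt (((Perm.sign σ : ℤ) : GrassEven) * ∑ S : Finset κ,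
      (∏ a ∈ univ \ S, (C.map amap) (σ a) a) * ∏ i : S, (-fermPert c u v G) (σ i) i) =
      ∑ S : Finset κ, sgn σ * ((∏ a ∈ univ \ S, C (σ a) a) *
        eInt (∏ i : S, (-fermPert c u v G) (σ i) i)) := by
    intro σ
    have hs : ((Perm.sign σ : ℤ) : GrassEven) = amap (sgn σ) := by
      simp
    rw [hs, eInt_amap_mul, eInt_sum, mul_sum]
    refine sum_congr rfl fun S _ => ?_
    simp only [map_apply]
    rw [← map_prod, eInt_amap_mul]
  simp only [e4, e3]
  rw [sum_comm]
  simp only [mul_sum (s := (univ : Finset (Finset κ)))]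
  rw [sum_comm (s := (univ : Finset (Perm κ)))]
  refine sum_congr rfl fun S _ => ?_
  -- `τ` permutes the rows of the columns in `S`; the determinant absorbs it
  have key : ∀ τ : Perm S, ∑ σ : Perm κ, sgn σ * ((∏ a ∈ univ \ S, C (σ a) a) *
        (sgn τ * ∑ h : S → PairIdx, ∑ p : S → κ,
        ∑ q : S → κ, ∏ i : S, c * u (σ i) (h (τ i)) (p i) * G (p i) (q i) * v (h i) (q i) i)) =
      ∑ σ : Perm κ, sgn σ * ((∏ a ∈ univ \ S, C (σ a) a) *
        ∑ h : S → PairIdx, ∑ p : S → κ, ∑ q : S → κ,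
        (∏ i : S, c * u (σ i) (h i) (p i) * v (h i) (q i) i) * ∏ i, G (p i) (q (τ⁻¹ i))) := by
    intro τ
    set t : Perm κ := Perm.ofSubtype τ with ht
    rw [← Equiv.sum_comp (Equiv.mulRight t)]
    refine sum_congr rfl fun σ _ => ?_
    have h1 : ∀ a ∈ univ \ S, (Equiv.mulRight t σ) a = σ a := by
      intro a ha
      have : a ∉ S := by simpa using ha
      simp [ht, Perm.ofSubtype_apply_of_not_mem τ this]
    have h2 : ∀ i : S, (Equiv.mulRight t σ) (i : κ) = σ (τ i) := by
      intro i
      simp [ht]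
    have h3 : sgn (Equiv.mulRight t σ) = sgn σ * sgn τ := by
      simp [ht]
    have h4 : sgn τ * sgn τ = 1 := by
      rcases Int.units_eq_one_or (Perm.sign τ) with h | h <;> simp [h]
    have h5 : ∏ a ∈ univ \ S, C ((Equiv.mulRight t σ) a) a =
        ∏ a ∈ univ \ S, C (σ a) a := prod_congr rfl fun a ha => by rw [h1 a ha]
    rw [h3, h5]
    simp only [h2]
    have h6 : ∑ h : S → PairIdx, ∑ p : S → κ, ∑ q : S → κ,
        ∏ i : S, c * u (σ (τ i)) (h (τ i)) (p i) * G (p i) (q i) * v (h i) (q i) i =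
        ∑ h : S → PairIdx, ∑ p : S → κ, ∑ q : S → κ,
        (∏ i : S, c * u (σ i) (h i) (p i) * v (h i) (q i) i) * ∏ i, G (p i) (q (τ⁻¹ i)) := by
      refine sum_congr rfl fun h _ => ?_
      rw [← Equiv.sum_comp (Equiv.arrowCongr τ (Equiv.refl κ))
        (fun p => ∑ q : S → κ, (∏ i : S, c * u (σ i) (h i) (p i) * v (h i) (q i) i) *
          ∏ i, G (p i) (q (τ⁻¹ i)))]
      refine sum_congr rfl fun p _ => sum_congr rfl fun q _ => ?_
      simp only [prod_mul_distrib]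
      rw [← Equiv.prod_comp τ (fun i : S => u (σ i) (h i)
        ((Equiv.arrowCongr τ (Equiv.refl κ)) p i)),
        ← Equiv.prod_comp τ (fun i => G ((Equiv.arrowCongr τ (Equiv.refl κ)) p i) (q (τ⁻¹ i)))]
      simp
      ring
    rw [h6]
    linear_combination sgn σ * (∏ a ∈ univ \ S, C (σ a) a) *
      (∑ h : S → PairIdx, ∑ p : S → κ, ∑ q : S → κ,
        (∏ i : S, c * u (σ i) (h i) (p i) * v (h i) (q i) i) * ∏ i, G (p i) (q (τ⁻¹ i))) * h4
  simp only [mul_sum (s := (univ : Finset (Perm S)))]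
  rw [sum_comm]
  simp only [key]
  rw [sum_comm]
  refine sum_congr rfl fun σ _ => ?_
  rw [← mul_sum, ← mul_sum]
  congr 2
  rw [sum_rotate]
  refine sum_congr rfl fun h _ => sum_congr rfl fun p _ =>
    sum_congr rfl fun q _ => ?_
  rw [← mul_sum, wickSum, ← Equiv.sum_comp (Equiv.inv (Perm S))]
  simp

end SuperWick

/-! ### The Berezin integral of the superdeterminant -/

/-- The index set of the blocks of the supermatrix. -/
abbrev Blk (n : ℕ) : Type := (Fin 2 × Fin n) ⊕ (Fin 2 × Fin n)

/-- The body of the lower right block of the supermatrix, for general diagonal blocks. -/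
def blockB {n : ℕ} (Az : 𝕄 n) (ξ X₁ X₂ : 𝕄 2) :
    Matrix (Blk n) (Blk n) ℂ :=
  fromBlocks (I • (X₁ ⊗ₖ (1 : 𝕄 n))) (I • calA Az ξ) (I • (calA Az ξ)ᴴ) (I • (X₂ ⊗ₖ (1 : 𝕄 n)))

/-- The upper left block of the supermatrix, for general diagonal blocks. -/
def blockC {n : ℕ} (Az : 𝕄 n) (ξ ξ' Λ₁ Λ₂ : 𝕄 2) :
    Matrix (Blk n) (Blk n) ℂ :=
  fromBlocks (Λ₁ ⊗ₖ (1 : 𝕄 n)) (I • calA Az ξ) (I • (calA Az ξ')ᴴ) (Λ₂ ⊗ₖ (1 : 𝕄 n))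

/-- The coefficient of `ν_g` in the entry `(a, p)` of the upper right block. -/
def uCoef {n : ℕ} : Blk n → PairIdx → Blk n → ℂ
  | .inl a, g, .inl p => if g = (0, a.1, p.1) then (if a.2 = p.2 then 1 else 0) else 0
  | .inr a, g, .inr p => if g = (1, a.1, p.1) then (if a.2 = p.2 then 1 else 0) else 0
  | _, _, _ => 0

/-- The coefficient of `ν̄_g` in the entry `(q, b)` of the lower left block. -/
def vCoef {n : ℕ} : PairIdx → Blk n → Blk n → ℂ
  | g, .inl q, .inl b => if g = (1, b.1, q.1) then (if q.2 = b.2 then 1 else 0) else 0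
  | g, .inr q, .inr b => if g = (0, b.1, q.1) then (if q.2 = b.2 then 1 else 0) else 0
  | _, _, _ => 0

theorem fermionic_upper_right {n : ℕ} (a p : Blk n) :
    (fromBlocks (oddTensor n (nu 0)) 0 0 (oddTensor n (nu 1)) :
      Matrix (Blk n) (Blk n) GrassOdd) a p =
      ∑ g, ((Real.sqrt n : ℂ)⁻¹ * uCoef a g p) • gen (lab g) := by
  rcases a with ⟨j, α⟩ | ⟨j, α⟩ <;> rcases p with ⟨k, β⟩ | ⟨k, β⟩ <;>
    simp [uCoef, oddTensor, nu, Matrix.one_apply, lab, ite_smul]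

theorem fermionic_lower_left {n : ℕ} (q b : Blk n) :
    (fromBlocks (oddTensor n (nuStar 1)) 0 0 (oddTensor n (nuStar 0)) :
      Matrix (Blk n) (Blk n) GrassOdd) q b =
      ∑ h, ((Real.sqrt n : ℂ)⁻¹ * vCoef h q b) • gen (labBar h) := by
  rcases q with ⟨j, α⟩ | ⟨j, α⟩ <;> rcases b with ⟨k, β⟩ | ⟨k, β⟩ <;>
    simp [vCoef, oddTensor, nuStar, Matrix.one_apply, labBar, ite_smul]

theorem oddEvenOdd_sum (x y : PairIdx → ℂ) (z : ℂ) :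
    oddEvenOdd (∑ g, x g • gen (lab g)) (amap z) (∑ h, y h • gen (labBar h)) =
      ∑ g, ∑ h, amap (x g * z * y h) * pr g h := by
  apply Subtype.ext
  have h1 : ((∑ g, x g • gen (lab g) : GrassOdd) : Grass) = ∑ g, x g • gi (lab g) := by
    rw [Submodule.coe_sum]; rfl
  have h2 : ((∑ g, y g • gen (labBar g) : GrassOdd) : Grass) = ∑ g, y g • gi (labBar g) := by
    rw [Submodule.coe_sum]; rfl
  have h3 : ((∑ g, ∑ h, amap (x g * z * y h) * pr g h : GrassEven) : Grass) =
      ∑ g, ∑ h, (x g * z * y h) • (gi (lab g) * gi (labBar h)) := by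
    rw [← evenVal_apply, map_sum evenVal]
    refine sum_congr rfl fun g _ => ?_
    rw [map_sum evenVal]
    refine sum_congr rfl fun h _ => ?_
    rw [map_mul evenVal, evenVal_amap, evenVal_pr, ← Algebra.smul_def]
  rw [h3]
  show ((∑ g, x g • gen (lab g) : GrassOdd) : Grass) * (algebraMap ℂ Grass z) *
    ((∑ g, y g • gen (labBar g) : GrassOdd) : Grass) = _
  rw [h1, h2, sum_mul, sum_mul]
  refine sum_congr rfl fun g _ => ?_
  rw [mul_sum]
  refine sum_congr rfl fun h _ => ?_
  rw [← Algebra.commutes, ← Algebra.smul_def, smul_smul, smul_mul_smul_comm, mul_comm z]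

theorem inv_sqrt_mul_self (n : ℕ) : (Real.sqrt n : ℂ)⁻¹ * (Real.sqrt n : ℂ)⁻¹ = (n : ℂ)⁻¹ := by
  rw [← mul_inv, ← ofReal_mul, Real.mul_self_sqrt (Nat.cast_nonneg n)]
  simp

/-- The Berezin integral of the exponential of the action is a superdeterminant average. -/
theorem berezin_expL {n : ℕ} (Az : 𝕄 n) (ζ ζ' : Fin 2 → ℂ) (R R₂ T S Λ : 𝕄 2) (U : U2)
    (hB : (blockB Az (zetaJ ζ' R R₂) (T + S) (T - S)).det ≠ 0) :
    berezin (expL Az ζ ζ' R R₂ T S Λ U) =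
      exp (-(n : ℂ) * (R ^ 2 + (2 * I) • (R * T) + Λ ^ 2).trace) *
        (((blockB Az (zetaJ ζ' R R₂) (T + S) (T - S)).det)⁻¹ *
          superSum (n : ℂ)⁻¹ uCoef vCoef (blockC Az (diagonal ζ) (zetaU ζ U) Λ Λ)
            (blockB Az (zetaJ ζ' R R₂) (T + S) (T - S))⁻¹) := by
  set B := blockB Az (zetaJ ζ' R R₂) (T + S) (T - S)
  set C := blockC Az (diagonal ζ) (zetaU ζ U) Λ Λ
  set Q := Qhat Az ζ ζ' R R₂ T S Λ U
  have hQB : Q.B = B.map amap := rfl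
  have hQA : Q.A = C.map amap := rfl
  have hinv : Q.B⁻¹ = B⁻¹.map amap := by
    rw [hQB]
    apply inv_eq_right_inv
    rw [← Matrix.map_mul, mul_nonsing_inv _ (Ne.isUnit hB), Matrix.map_one _ (map_zero _)
      (map_one _)]
  have hdet : Ring.inverse Q.B.det = amap (B.det)⁻¹ := by
    rw [hQB, show B.map amap = amap.mapMatrix B from rfl, ← RingHom.map_det]
    have h1 : amap B.det * amap (B.det)⁻¹ = 1 := by
      rw [← map_mul, mul_inv_cancel₀ hB, map_one]
    have h2 : IsUnit (amap B.det) := IsUnit.of_mul_eq_one _ h1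
    calc Ring.inverse (amap B.det)
        = Ring.inverse (amap B.det) * (amap B.det * amap (B.det)⁻¹) := by rw [h1, mul_one]
      _ = amap (B.det)⁻¹ := by rw [← mul_assoc, Ring.inverse_mul_cancel _ h2, one_mul]
  have hpert : (of fun i j => ∑ p, ∑ q, oddEvenOdd (Q.χ i p) (Q.B⁻¹ p q) (Q.η q j)) =
      fermPert (n : ℂ)⁻¹ uCoef vCoef B⁻¹ := by
    ext1 i j
    rw [of_apply, fermPert, of_apply]
    have : ∀ p q, oddEvenOdd (Q.χ i p) (Q.B⁻¹ p q) (Q.η q j) =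
        ∑ g, ∑ h, amap ((n : ℂ)⁻¹ * uCoef i g p * B⁻¹ p q * vCoef h q j) * pr g h := by
      intro p q
      rw [show Q.χ i p = _ from fermionic_upper_right i p,
        show Q.η q j = _ from fermionic_lower_left q j, hinv, map_apply, oddEvenOdd_sum]
      refine sum_congr rfl fun g _ => sum_congr rfl fun h _ => ?_
      refine congrArg (fun w => amap w * pr g h) ?_
      rw [← inv_sqrt_mul_self n]
      ring
    simp only [this]
    rw [sum_rotate, sum_rotate]
  have hs : Q.sdet = amap (B.det)⁻¹ * (C.map amap - fermPert (n : ℂ)⁻¹ uCoef vCoef B⁻¹).det := by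
    rw [SuperMatrix.sdet, hpert, hdet, hQA, mul_comm]
  have hE : berezin (expL Az ζ ζ' R R₂ T S Λ U) =
      exp (-(n : ℂ) * (R ^ 2 + (2 * I) • (R * T) + Λ ^ 2).trace) * eInt Q.sdet := by
    rw [expL, ← smul_mul_assoc, ← gInt_apply, map_smul, smul_eq_mul, eInt, evenVal_apply]
  rw [hE, hs, eInt_amap_mul, gInt_det_sub_bilinear]

section SuperSumBounds

variable {κ : Type} [Fintype κ] [DecidableEq κ]

/-- The common average grows at most polynomially in the entries of the two matrices. -/
theorem exists_bound_superSum (c : ℂ) (u : κ → PairIdx → κ → ℂ) (v : PairIdx → κ → κ → ℂ) :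
    ∃ K : ℝ, 0 ≤ K ∧ ∀ (C G : Matrix κ κ ℂ) (a b : ℝ), 1 ≤ a → 1 ≤ b → (∀ i j, ‖C i j‖ ≤ a) →
      (∀ i j, ‖G i j‖ ≤ b) →
      ‖superSum c u v C G‖ ≤ K * (a ^ Fintype.card κ * b ^ Fintype.card κ) := by
  refine ⟨∑ σ : Perm κ, ∑ S : Finset κ, ∑ h : S → PairIdx, ∑ p : S → κ, ∑ q : S → κ,
    ‖∏ i : S, c * u (σ i) (h i) (p i) * v (h i) (q i) i‖ * ∑ ρ : Perm S, 1, by positivity,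
    fun C G a b ha hb hC hG => ?_⟩
  have hwick : ∀ (S : Finset κ) (p q : S → κ), ‖wickSum G p q‖ ≤
      (∑ ρ : Perm S, (1 : ℝ)) * b ^ Fintype.card κ := by
    intro S p q
    rw [wickSum, sum_mul]
    refine (norm_sum_le _ _).trans (sum_le_sum fun ρ _ => ?_)
    rw [norm_prod, one_mul]
    calc ∏ i, ‖G (p i) (q (ρ i))‖ ≤ ∏ _i : S, b :=
          Finset.prod_le_prod (fun _ _ => norm_nonneg _) fun i _ => hG _ _
      _ = b ^ S.card := by simp
      _ ≤ b ^ Fintype.card κ := pow_le_pow_right₀ hb (card_le_univ S)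
  have hCb : ∀ (σ : Perm κ) (S : Finset κ), ‖∏ x ∈ univ \ S, C (σ x) x‖ ≤ a ^ Fintype.card κ := by
    intro σ S
    rw [norm_prod]
    calc ∏ x ∈ univ \ S, ‖C (σ x) x‖ ≤ ∏ _x ∈ univ \ S, a :=
          Finset.prod_le_prod (fun _ _ => norm_nonneg _) fun i _ => hC _ _
      _ = a ^ (univ \ S).card := by simp
      _ ≤ a ^ Fintype.card κ := pow_le_pow_right₀ ha (card_le_univ _)
  simp only [superSum, sum_mul]
  refine (norm_sum_le _ _).trans (sum_le_sum fun σ _ => ?_)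
  have hsign : ‖sgn σ‖ = 1 := by
    rcases Int.units_eq_one_or (Perm.sign σ) with h | h <;> simp [h]
  rw [norm_mul, hsign, one_mul]
  refine (norm_sum_le _ _).trans (sum_le_sum fun S _ => ?_)
  rw [norm_mul]
  refine (mul_le_mul_of_nonneg_right (hCb σ S) (norm_nonneg _)).trans ?_
  refine (mul_le_mul_of_nonneg_left (norm_sum_le _ _) (by positivity)).trans ?_
  rw [mul_sum]
  refine sum_le_sum fun h _ => ?_
  refine (mul_le_mul_of_nonneg_left (norm_sum_le _ _) (by positivity)).trans ?_
  rw [mul_sum]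
  refine sum_le_sum fun p _ => ?_
  refine (mul_le_mul_of_nonneg_left (norm_sum_le _ _) (by positivity)).trans ?_
  rw [mul_sum]
  refine sum_le_sum fun q _ => ?_
  rw [norm_mul]
  calc a ^ Fintype.card κ * (‖∏ i : S, c * u (σ i) (h i) (p i) * v (h i) (q i) i‖ *
        ‖wickSum G p q‖) ≤ a ^ Fintype.card κ *
        (‖∏ i : S, c * u (σ i) (h i) (p i) * v (h i) (q i) i‖ *
        ((∑ ρ : Perm S, (1 : ℝ)) * b ^ Fintype.card κ)) := by gcongr; exact hwick S p q
    _ = _ := by ring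

theorem continuous_superSum (c : ℂ) (u : κ → PairIdx → κ → ℂ) (v : PairIdx → κ → κ → ℂ) :
    Continuous fun x : Matrix κ κ ℂ × Matrix κ κ ℂ => superSum c u v x.1 x.2 := by
  unfold superSum wickSum
  fun_prop

end SuperSumBounds

/-! ### Duality between Gaussian averages of determinants -/

section Duality

variable {κ K : Type} [Fintype κ] [DecidableEq κ] [Fintype K] [DecidableEq K]

omit [Fintype K] in
theorem accr_zero (s : ℝ) : accr s (0 : Matrix K K ℂ) = (s : ℂ) • 1 := by
  rw [accr, smul_zero, add_zero]

/-- Wick's formula for the standard Gaussian weight, with separate index types for `φ` and `φ̄`;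
unbalanced moments vanish, in accordance with the empty sum over `α ≃ β`. -/
theorem gaussian_pairing {s : ℝ} (hs : 0 < s) {α β : Type} [Fintype α] [Fintype β] [DecidableEq α]
    [DecidableEq β] (p : α → K) (q : β → K) :
    ∫ φ : K → ℂ, ((∏ i, φ (p i)) * ∏ j, conj (φ (q j))) * exp (-qf (accr s 0) φ) =
      (Real.pi : ℂ) ^ Fintype.card K * (((accr s (0 : Matrix K K ℂ)).det)⁻¹ *
        ∑ π : α ≃ β, ∏ i, (if p i = q (π i) then (s : ℂ)⁻¹ else 0)) := by
  by_cases hc : Fintype.card α = Fintype.card β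
  · let e : α ≃ β := Fintype.equivOfCardEq hc
    have h1 := gaussian_wick hs α (X := (0 : Matrix K K ℂ)) isHermitian_zero p (q ∘ e)
    have h2 : ∀ φ : K → ℂ, (∏ i, φ (p i)) * ∏ j, conj (φ (q j)) =
        ∏ i, φ (p i) * conj (φ ((q ∘ e) i)) := by
      intro φ
      rw [prod_mul_distrib, ← Equiv.prod_comp e]
      rfl
    simp only [h2, h1]
    congr 2
    have h3 : (accr s (0 : Matrix K K ℂ))⁻¹ = (s : ℂ)⁻¹ • 1 := by
      apply inv_eq_right_inv
      have : (s : ℂ) ≠ 0 := by exact_mod_cast hs.ne'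
      rw [accr_zero, smul_mul, Matrix.one_mul, smul_smul, mul_inv_cancel₀ this, one_smul]
    rw [wickSum, h3, ← Equiv.sum_comp (Equiv.equivCongr (Equiv.refl α) e)]
    refine sum_congr rfl fun ρ _ => prod_congr rfl fun i _ => ?_
    simp only [Matrix.smul_apply, Matrix.one_apply, Equiv.equivCongr_apply_apply, smul_eq_mul,
      mul_ite, mul_one, mul_zero, Function.comp_apply, Equiv.refl_symm, Equiv.refl_apply]
    exact if_congr Iff.rfl rfl rfl
  · have hemp : IsEmpty (α ≃ β) := ⟨fun e => hc (Fintype.card_congr e)⟩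
    rw [sum_of_isEmpty, mul_zero, mul_zero]
    -- a global phase rotation multiplies the integral by `-1`
    set d : ℝ := (Fintype.card α : ℝ) - Fintype.card β with hd
    have hd0 : d ≠ 0 := by
      rw [hd, sub_ne_zero]; exact_mod_cast hc
    set z : ℂ := exp ((Real.pi / d : ℝ) * I) with hz
    have hzn : ‖z‖ = 1 := norm_exp_ofReal_mul_I _
    have hzc : conj z * z = 1 := by
      rw [mul_comm, mul_conj, normSq_eq_norm_sq, hzn]; simp
    have hphase : z ^ Fintype.card α * conj z ^ Fintype.card β = -1 := by
      have : conj z = exp (-((Real.pi / d : ℝ) * I)) := by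
        rw [hz, ← Complex.exp_conj]; simp
      rw [this, hz, ← exp_nat_mul, ← exp_nat_mul, ← exp_add, ← exp_pi_mul_I]
      congr 1
      have : ((d : ℝ) : ℂ) ≠ 0 := by exact_mod_cast hd0
      push_cast
      field_simp
      rw [hd]; push_cast; ring
    have h1 := integral_comp_mulVec (z • (1 : Matrix K K ℂ)) (by simp [hzn])
      (fun φ => ((∏ i, φ (p i)) * ∏ j, conj (φ (q j))) * exp (-qf (accr s 0) φ))
    have h2 : ∀ φ : K → ℂ, ((∏ i, ((z • (1 : Matrix K K ℂ)) *ᵥ φ) (p i)) *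
        ∏ j, conj (((z • (1 : Matrix K K ℂ)) *ᵥ φ) (q j))) *
          exp (-qf (accr s 0) ((z • (1 : Matrix K K ℂ)) *ᵥ φ)) =
        -(((∏ i, φ (p i)) * ∏ j, conj (φ (q j))) * exp (-qf (accr s 0) φ)) := by
      intro φ
      have h3 : qf (accr s 0) ((z • (1 : Matrix K K ℂ)) *ᵥ φ) = qf (accr s 0) φ := by
        rw [qf_mulVec]
        congr 1
        rw [accr_zero, conjTranspose_smul, conjTranspose_one, smul_mul,
          Matrix.one_mul, smul_smul, smul_mul, Matrix.one_mul, smul_smul, mul_right_comm,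
          star_def, hzc, one_mul]
      rw [h3]
      simp only [smul_mulVec, one_mulVec, Pi.smul_apply, smul_eq_mul, map_mul,
        prod_mul_distrib, prod_const, card_univ]
      linear_combination ((∏ i, φ (p i)) * ∏ j, conj (φ (q j))) * exp (-qf (accr s 0) φ) * hphase
    simp only [h2] at h1
    rw [integral_neg] at h1
    have h4 := neg_eq_self.mp h1
    exact h4

/-- The Gaussian average of `det (C + ∑ h_k x_k + ∑ h̄_k y_k)`, as a function of the covariance
`w_{ab,cd} = ∑ (x_k)_{ab} (y_k)_{cd}`. A column `a` is taken from `C`, from the holomorphic or from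
the antiholomorphic part when `f a` is `0`, `1` or `2`, and `π` pairs the last two kinds. -/
def pairSum (r : ℂ) (C : Matrix κ κ ℂ) (w : κ → κ → κ → κ → ℂ) : ℂ :=
  ∑ f : κ → Fin 3, ∑ π : {a // f a = 1} ≃ {a // f a = 2}, ∑ σ : Perm κ,
    sgn σ * ((∏ a : {a // f a = 0}, C (σ a) a) *
      ∏ i : {a // f a = 1}, r * w (σ i) i (σ (π i)) (π i))

/-- The involution exchanging `i` and `π i`. -/
def pairSwap (f : κ → Fin 3) (π : {a // f a = 1} ≃ {a // f a = 2}) : Perm κ where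
  toFun a := if h : f a = 1 then π ⟨a, h⟩ else if h' : f a = 2 then π.symm ⟨a, h'⟩ else a
  invFun a := if h : f a = 1 then π ⟨a, h⟩ else if h' : f a = 2 then π.symm ⟨a, h'⟩ else a
  left_inv a := by
    by_cases h : f a = 1
    · have h2 : f (π ⟨a, h⟩) = 2 := (π ⟨a, h⟩).2
      simp [h, h2]
    · by_cases h' : f a = 2
      · have h2 : f (π.symm ⟨a, h'⟩) = 1 := (π.symm ⟨a, h'⟩).2
        simp [h', h2]
      · simp [h, h']
  right_inv a := by
    by_cases h : f a = 1
    · have h2 : f (π ⟨a, h⟩) = 2 := (π ⟨a, h⟩).2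
      simp [h, h2]
    · by_cases h' : f a = 2
      · have h2 : f (π.symm ⟨a, h'⟩) = 1 := (π.symm ⟨a, h'⟩).2
        simp [h', h2]
      · simp [h, h']

omit [Fintype κ] [DecidableEq κ] in
theorem pairSwap_of_zero (f : κ → Fin 3) (π : {a // f a = 1} ≃ {a // f a = 2}) {a : κ}
    (h : f a = 0) : pairSwap f π a = a := by
  simp [pairSwap, h]

omit [Fintype κ] [DecidableEq κ] in
theorem pairSwap_left (f : κ → Fin 3) (π : {a // f a = 1} ≃ {a // f a = 2}) (i : {a // f a = 1}) :
    pairSwap f π i = π i := by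
  simp [pairSwap, i.2]

omit [Fintype κ] [DecidableEq κ] in
theorem pairSwap_right (f : κ → Fin 3) (π : {a // f a = 1} ≃ {a // f a = 2}) (i : {a // f a = 1}) :
    pairSwap f π (π i) = i := by
  have h2 : f (π i) = 2 := (π i).2
  simp [pairSwap, h2]

theorem sign_pairSwap (f : κ → Fin 3) (π : {a // f a = 1} ≃ {a // f a = 2}) :
    Perm.sign (pairSwap f π) = (-1) ^ Fintype.card {a // f a = 1} := by
  rw [Perm.sign_of_pow_two_eq_one]
  · congr 1
    have h1 : Fintype.card (Function.fixedPoints (pairSwap f π)) = Fintype.card {a // f a = 0} := by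
      refine Fintype.card_congr (Equiv.subtypeEquivRight fun a => ⟨fun h => ?_, fun h => ?_⟩)
      · by_contra h0
        have h' : pairSwap f π a = a := h
        have h12 : f a = 1 ∨ f a = 2 := by
          generalize f a = j at h0
          fin_cases j <;> simp_all
        rcases h12 with h1 | h2
        · have := (π ⟨a, h1⟩).2
          rw [← pairSwap_left f π ⟨a, h1⟩, h', h1] at this
          exact absurd this (by decide)
        · have h3 := pairSwap_right f π (π.symm ⟨a, h2⟩)
          rw [Equiv.apply_symm_apply, h'] at h3
          have := (π.symm ⟨a, h2⟩).2
          rw [← h3, h2] at this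
          exact absurd this (by decide)
      · exact pairSwap_of_zero f π h
    have h2 : Fintype.card κ = Fintype.card {a // f a = 0} + Fintype.card {a // f a = 1} +
        Fintype.card {a // f a = 2} := by
      rw [Fintype.card_congr (Equiv.sigmaFiberEquiv f).symm, Fintype.card_sigma, Fin.sum_univ_three]
    have h3 := Fintype.card_congr π
    rw [h1, h2]
    omega
  · ext a
    rw [pow_two]
    exact (pairSwap f π).left_inv a

/-- The average only depends on the covariance up to the antisymmetry in the row indices. -/
theorem pairSum_eq_of_neg_swap (r : ℂ) (C : Matrix κ κ ℂ) (w w' : κ → κ → κ → κ → ℂ)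
    (hw : ∀ a b c d, w a b c d = -w' c b a d) : pairSum r C w = pairSum r C w' := by
  unfold pairSum
  refine sum_congr rfl fun f _ => sum_congr rfl fun π _ => ?_
  rw [← Equiv.sum_comp (Equiv.mulRight (pairSwap f π))]
  refine sum_congr rfl fun σ _ => ?_
  have h0 : ∀ a : {a // f a = 0}, Equiv.mulRight (pairSwap f π) σ a = σ a := fun a => by
    simp [pairSwap_of_zero f π a.2]
  have h1 : ∀ i : {a // f a = 1}, Equiv.mulRight (pairSwap f π) σ i = σ (π i) := fun i => by
    simp [pairSwap_left]
  have h2 : ∀ i : {a // f a = 1}, Equiv.mulRight (pairSwap f π) σ (π i) = σ i := fun i => by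
    simp [pairSwap_right]
  simp only [h0, h1, h2, hw, mul_neg]
  rw [prod_neg, Equiv.coe_mulRight, Perm.sign_mul, sign_pairSwap, card_univ]
  have h4 : ((-1 : ℂ) ^ Fintype.card {a // f a = 1}) * (-1) ^ Fintype.card {a // f a = 1} = 1 := by
    rw [← mul_pow]; simp
  push_cast
  linear_combination sgn σ * ((∏ a : {a // f a = 0}, C (σ a) a) *
      ∏ i : {a // f a = 1}, r * w' (σ i) i (σ (π i)) (π i)) * h4

/-- The matrix `C + ∑ h_k x_k + ∑ h̄_k y_k`. -/
def linPert (C : Matrix κ κ ℂ) (x y : K → Matrix κ κ ℂ) (h : K → ℂ) : Matrix κ κ ℂ :=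
  of fun a b => C a b + ∑ k, h k * x k a b + ∑ k, conj (h k) * y k a b

/-- The average of a determinant that is linear in a Gaussian vector, expanded over the choice of
the part from which each column is taken and evaluated with `gaussian_pairing`. -/
theorem integral_det_linear {s : ℝ} (hs : 0 < s) (C : Matrix κ κ ℂ) (x y : K → Matrix κ κ ℂ) :
    ∫ h : K → ℂ, (linPert C x y h).det * exp (-qf (accr s 0) h) =
      (Real.pi : ℂ) ^ Fintype.card K * (((accr s (0 : Matrix K K ℂ)).det)⁻¹ *
        pairSum (s : ℂ)⁻¹ C fun a b c d => ∑ k, x k a b * y k c d) := by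
  have e1 : ∀ h : K → ℂ, (linPert C x y h).det * exp (-qf (accr s 0) h) =
      ∑ f : κ → Fin 3, ∑ σ : Perm κ, ∑ p : {a // f a = 1} → K, ∑ q : {a // f a = 2} → K,
        (sgn σ * (∏ a : {a // f a = 0}, C (σ a) a) *
          ((∏ i : {a // f a = 1}, x (p i) (σ i) i) * ∏ i : {a // f a = 2}, y (q i) (σ i) i)) *
        (((∏ i, h (p i)) * ∏ j, conj (h (q j))) * exp (-qf (accr s 0) h)) := by
    intro h
    rw [det_apply', sum_comm, sum_mul]
    refine sum_congr rfl fun σ _ => ?_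
    have e2 : ∏ i, linPert C x y h (σ i) i = ∏ i, ∑ j : Fin 3,
        (![C (σ i) i, ∑ k, h k * x k (σ i) i, ∑ k, conj (h k) * y k (σ i) i] : Fin 3 → ℂ) j := by
      refine prod_congr rfl fun i _ => ?_
      simp [linPert, Fin.sum_univ_three]
    rw [e2, prod_sum_fun, mul_sum, sum_mul]
    refine sum_congr rfl fun f _ => ?_
    rw [← Fintype.prod_fiberwise f, Fin.prod_univ_three]
    have e0 : ∀ a : {a // f a = 0}, (![C (σ a) a, ∑ k, h k * x k (σ a) a,
        ∑ k, conj (h k) * y k (σ a) a] : Fin 3 → ℂ) (f a) = C (σ a) a := fun a => by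
      rw [a.2]; rfl
    have e1 : ∀ a : {a // f a = 1}, (![C (σ a) a, ∑ k, h k * x k (σ a) a,
        ∑ k, conj (h k) * y k (σ a) a] : Fin 3 → ℂ) (f a) = ∑ k, h k * x k (σ a) a := fun a => by
      rw [a.2]; rfl
    have e2 : ∀ a : {a // f a = 2}, (![C (σ a) a, ∑ k, h k * x k (σ a) a,
        ∑ k, conj (h k) * y k (σ a) a] : Fin 3 → ℂ) (f a) = ∑ k, conj (h k) * y k (σ a) a :=
      fun a => by rw [a.2]; rfl
    simp only [e0, e1, e2, prod_sum_fun, prod_mul_distrib, mul_sum, sum_mul]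
    rw [sum_comm]
    refine sum_congr rfl fun p _ => sum_congr rfl fun q _ => ?_
    ring
  have hint : ∀ (f : κ → Fin 3) (p : {a // f a = 1} → K) (q : {a // f a = 2} → K) (w : ℂ),
      Integrable (fun h : K → ℂ =>
        w * (((∏ i, h (p i)) * ∏ j, conj (h (q j))) * exp (-qf (accr s 0) h))) := by
    intro f p q w
    exact (integrable_wick ((ExpGrowth.prod _ fun i _ => ExpGrowth.coord _).mul
      (.prod _ fun i _ => (ExpGrowth.coord _).conjugate)) hs isHermitian_zero).const_mul w
  simp only [e1]
  rw [integral_finsetSum _ fun f _ => integrable_finsetSum _ fun σ _ => integrable_finsetSum _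
    fun p _ => integrable_finsetSum _ fun q _ => hint _ _ _ _]
  simp only [pairSum]
  rw [mul_sum, mul_sum]
  refine sum_congr rfl fun f _ => ?_
  rw [integral_finsetSum _ fun σ _ => integrable_finsetSum _
    fun p _ => integrable_finsetSum _ fun q _ => hint _ _ _ _]
  rw [sum_comm (s := (univ : Finset ({a // f a = 1} ≃ {a // f a = 2})))]
  rw [mul_sum, mul_sum]
  refine sum_congr rfl fun σ _ => ?_
  rw [integral_finsetSum _ fun p _ => integrable_finsetSum _ fun q _ => hint _ _ _ _]
  have e3 : ∀ p : {a // f a = 1} → K, ∀ q : {a // f a = 2} → K, ∫ h : K → ℂ,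
      (sgn σ * (∏ a : {a // f a = 0}, C (σ a) a) *
          ((∏ i : {a // f a = 1}, x (p i) (σ i) i) * ∏ i : {a // f a = 2}, y (q i) (σ i) i)) *
        (((∏ i, h (p i)) * ∏ j, conj (h (q j))) * exp (-qf (accr s 0) h)) =
      ((Real.pi : ℂ) ^ Fintype.card K * ((accr s (0 : Matrix K K ℂ)).det)⁻¹ *
        (sgn σ * ∏ a : {a // f a = 0}, C (σ a) a)) *
        ∑ π : {a // f a = 1} ≃ {a // f a = 2},
          ((∏ i : {a // f a = 1}, x (p i) (σ i) i) * ∏ i : {a // f a = 2}, y (q i) (σ i) i) *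
          ∏ i, (if p i = q (π i) then (s : ℂ)⁻¹ else 0) := by
    intro p q
    rw [integral_const_mul, gaussian_pairing hs, ← mul_sum]
    ring
  have e4 : ∀ π : {a // f a = 1} ≃ {a // f a = 2}, ∑ p : {a // f a = 1} → K,
      ∑ q : {a // f a = 2} → K,
          ((∏ i : {a // f a = 1}, x (p i) (σ i) i) * ∏ i : {a // f a = 2}, y (q i) (σ i) i) *
          ∏ i, (if p i = q (π i) then (s : ℂ)⁻¹ else 0) =
      ∏ i : {a // f a = 1}, (s : ℂ)⁻¹ * ∑ k, x k (σ i) i * y k (σ (π i)) (π i) := by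
    intro π
    have e5 : ∀ i : {a // f a = 1}, (s : ℂ)⁻¹ * ∑ k, x k (σ i) i * y k (σ (π i)) (π i) =
        ∑ k, (s : ℂ)⁻¹ * (x k (σ i) i * y k (σ (π i)) (π i)) := fun i => by rw [mul_sum]
    rw [prod_congr rfl fun i _ => e5 i, prod_sum_fun]
    refine sum_congr rfl fun p _ => ?_
    rw [sum_eq_single (p ∘ π.symm)]
    · simp only [prod_mul_distrib]
      rw [← Equiv.prod_comp π]
      simp
      ring
    · intro q _ hq
      have : ∃ i, ¬ (p i = q (π i)) := by
        by_contra! hh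
        refine hq (funext fun j => ?_)
        have := hh (π.symm j)
        simpa using this.symm
      obtain ⟨i, hi⟩ := this
      rw [prod_eq_zero (f := fun i => if p i = q (π i) then (s : ℂ)⁻¹ else 0)
        (mem_univ i) (if_neg hi), mul_zero]
    · simp
  refine (sum_congr rfl fun p _ => (integral_finsetSum _ fun q _ => hint _ _ _ _).trans
    (sum_congr rfl fun q _ => e3 p q)).trans ?_
  rw [sum_congr rfl fun p _ => (mul_sum _ _ _).symm, ← mul_sum]
  have e7 := (sum_congr rfl fun (p : {a // f a = 1} → K) _ => sum_comm (s := univ)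
    (t := univ) (f := fun (q : {a // f a = 2} → K) (π : {a // f a = 1} ≃ {a // f a = 2}) =>
      ((∏ i : {a // f a = 1}, x (p i) (σ i) i) * ∏ i : {a // f a = 2}, y (q i) (σ i) i) *
          ∏ i, (if p i = q (π i) then (s : ℂ)⁻¹ else 0))).trans
    (sum_comm.trans (sum_congr rfl fun π _ => e4 π))
  rw [e7]
  simp only [mul_sum]
  refine sum_congr rfl fun π _ => ?_
  ring

/-- Two Gaussian averages whose covariances agree up to a transposition of the row indices. -/
theorem integral_det_duality {L : Type} [Fintype L] [DecidableEq L] {s : ℝ} (hs : 0 < s)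
    (C : Matrix κ κ ℂ) (x y : K → Matrix κ κ ℂ) (x' y' : L → Matrix κ κ ℂ)
    (hw : ∀ a b c d, ∑ k, x k a b * y k c d = -∑ k, x' k c b * y' k a d) :
    ((s / Real.pi : ℝ) : ℂ) ^ Fintype.card K *
      ∫ h : K → ℂ, (linPert C x y h).det * exp (-(s * sqn h : ℝ)) =
    ((s / Real.pi : ℝ) : ℂ) ^ Fintype.card L *
      ∫ h : L → ℂ, (linPert C x' y' h).det * exp (-(s * sqn h : ℝ)) := by
  have key : ∀ {M : Type} [Fintype M] [DecidableEq M] (x y : M → Matrix κ κ ℂ),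
      ((s / Real.pi : ℝ) : ℂ) ^ Fintype.card M *
      ∫ h : M → ℂ, (linPert C x y h).det * exp (-(s * sqn h : ℝ)) =
      pairSum (s : ℂ)⁻¹ C fun a b c d => ∑ k, x k a b * y k c d := by
    intro M _ _ x y
    have h1 : ∀ h : M → ℂ, ((-(s * sqn h : ℝ) : ℝ) : ℂ) = -qf (accr s (0 : Matrix M M ℂ)) h := by
      intro h
      rw [accr_zero, qf_smul, qf_one]
      push_cast
      ring
    have h2 := integral_det_linear hs C x y
    simp only [← h1, ofReal_neg] at h2
    rw [h2]
    have h3 : (accr s (0 : Matrix M M ℂ)).det = (s : ℂ) ^ Fintype.card M := by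
      rw [accr_zero, det_smul, det_one, mul_one]
    rw [h3]
    have : (s : ℂ) ≠ 0 := by exact_mod_cast hs.ne'
    push_cast
    rw [div_pow]
    field_simp
  rw [key, key]
  exact pairSum_eq_of_neg_swap _ _ _ _ hw

end Duality

/-! ### Complex translations of Gaussian integrals -/

section Shift

/-- An integral depending holomorphically on a parameter, with locally uniform domination. -/
theorem differentiable_integral_of_dominated {X : Type*} [MeasurableSpace X] {μ : Measure X}
    {f : ℂ → X → ℂ} (hd : ∀ x, Differentiable ℂ fun τ => f τ x)
    (hm : ∀ τ, AEStronglyMeasurable (f τ) μ)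
    (hb : ∀ r : ℝ, ∃ g : X → ℝ, Integrable g μ ∧ ∀ τ : ℂ, ‖τ‖ ≤ r → ∀ x, ‖f τ x‖ ≤ g x) :
    Differentiable ℂ fun τ => ∫ x, f τ x ∂μ := by
  intro τ₀
  obtain ⟨g, hg, hfg⟩ := hb (‖τ₀‖ + 2)
  have hder : ∀ x, ∀ τ ∈ Metric.ball τ₀ 1, ‖deriv (fun τ => f τ x) τ‖ ≤ g x := by
    intro x τ hτ
    have h1 := norm_deriv_le_of_forall_mem_sphere_norm_le (c := τ) (R := 1) (C := g x)
      zero_lt_one (hd x).diffContOnCl (fun z hz => hfg z ?_ x)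
    · simpa using h1
    · have h2 : ‖z - τ‖ = 1 := by simpa [dist_eq_norm] using hz
      have h3 : ‖τ - τ₀‖ < 1 := by simpa [dist_eq_norm] using hτ
      calc ‖z‖ = ‖(z - τ) + (τ - τ₀) + τ₀‖ := by congr 1; ring
        _ ≤ ‖z - τ‖ + ‖τ - τ₀‖ + ‖τ₀‖ := norm_add₃_le
        _ ≤ ‖τ₀‖ + 2 := by linarith
  have hdm : AEStronglyMeasurable (fun x => deriv (fun τ => f τ x) τ₀) μ := by
    have ht : Tendsto (fun k : ℕ => ((k : ℂ) + 1)⁻¹) atTop (nhdsWithin 0 {0}ᶜ) := by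
      refine tendsto_nhdsWithin_iff.mpr ⟨?_, .of_forall fun k => ?_⟩
      · have := tendsto_one_div_add_atTop_nhds_zero_nat (𝕜 := ℂ)
        simpa using this
      · have : (k : ℂ) + 1 ≠ 0 := by exact_mod_cast k.succ_ne_zero
        simpa using this
    refine aestronglyMeasurable_of_tendsto_ae atTop
      (f := fun (k : ℕ) x => ((k : ℂ) + 1)⁻¹⁻¹ • (f (τ₀ + ((k : ℂ) + 1)⁻¹) x - f τ₀ x)) 
      (fun k => ((hm (τ₀ + ((k : ℂ) + 1)⁻¹)).sub (hm τ₀)).const_smul ((k : ℂ) + 1)⁻¹⁻¹)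
      (.of_forall fun x => ?_)
    have h1 := (hasDerivAt_iff_tendsto_slope_zero.mp ((hd x) τ₀).hasDerivAt).comp ht
    exact h1
  have := hasDerivAt_integral_of_dominated_loc_of_deriv_le (μ := μ) (F := f)
    (F' := fun τ x => deriv (fun τ => f τ x) τ) (x₀ := τ₀) (bound := g)
    (Metric.ball_mem_nhds τ₀ one_pos) (.of_forall hm)
    (hg.mono' (hm τ₀) (.of_forall fun x => hfg τ₀ (by linarith) x)) hdm
    (.of_forall hder) hg
    (.of_forall fun x τ _ => ((hd x) τ).hasDerivAt)
  exact this.2.differentiableAt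

theorem eq_of_eq_on_real {f g : ℂ → ℂ} (hf : Differentiable ℂ f) (hg : Differentiable ℂ g)
    (h : ∀ t : ℝ, f t = g t) : f = g := by
  refine AnalyticOnNhd.eq_of_frequently_eq (z₀ := (0 : ℂ))
    (fun z _ => hf.analyticAt z) (fun z _ => hg.analyticAt z) ?_
  have ht : Tendsto (fun k : ℕ => ((k : ℂ) + 1)⁻¹) atTop (nhdsWithin 0 {0}ᶜ) := by
    refine tendsto_nhdsWithin_iff.mpr ⟨?_, .of_forall fun k => ?_⟩
    · have := tendsto_one_div_add_atTop_nhds_zero_nat (𝕜 := ℂ)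
      simpa using this
    · have : (k : ℂ) + 1 ≠ 0 := by exact_mod_cast k.succ_ne_zero
      simpa using this
  refine ht.frequently (Filter.Frequently.of_forall fun k => ?_)
  have := h ((k : ℝ) + 1)⁻¹
  push_cast at this
  exact this

variable {K : Type*} [Fintype K]

theorem ExpGrowth.comp_of_bound {X Y : Type*} [NormedAddCommGroup X] [NormedAddCommGroup Y]
    {F : X → ℂ} (hF : ExpGrowth F) {L : Y → X} (hL : Continuous L) (a b : ℝ) (hb : 0 ≤ b)
    (h : ∀ y, ‖L y‖ ≤ a + b * ‖y‖) : ExpGrowth fun y => F (L y) := by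
  obtain ⟨C, c, hC, hc, hF'⟩ := hF.bound
  refine ⟨hF.continuous.comp hL, C * Real.exp (c * a), c * b, by positivity, by positivity,
    fun y => (hF' _).trans ?_⟩
  rw [mul_assoc, ← Real.exp_add]
  gcongr
  nlinarith [h y]

theorem integrable_exp_norm_mul_gaussian (A b : ℝ) {s : ℝ} (hs : 0 < s) :
    Integrable (fun h : K → ℂ => A * Real.exp (b * ‖h‖) * Real.exp (-s * sqn h)) := by
  have h1 : ExpGrowth (fun h : K → ℂ => ((Real.exp (b * ‖h‖) : ℝ) : ℂ)) := by
    refine ⟨by fun_prop, 1, |b|, zero_le_one, abs_nonneg _, fun h => ?_⟩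
    rw [norm_real, Real.norm_of_nonneg (Real.exp_pos _).le, one_mul]
    gcongr
    exact le_abs_self b
  refine ((integrable_norm_mul_gaussian_of_expGrowth h1 hs).const_mul A).congr
    (.of_forall fun h => ?_)
  simp only [norm_real, Real.norm_of_nonneg (Real.exp_pos _).le]
  ring

/-- `∑ (h_k m_k + h̄_k m̄_k)`. -/
def realPairing (m h : K → ℂ) : ℂ := ∑ k, (h k * m k + conj (h k) * conj (m k))

theorem norm_realPairing_le (m h : K → ℂ) : ‖realPairing m h‖ ≤ 2 * (∑ k, ‖m k‖) * ‖h‖ := by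
  rw [realPairing, mul_assoc, sum_mul, mul_sum]
  refine (norm_sum_le _ _).trans (sum_le_sum fun k _ => ?_)
  refine (norm_add_le _ _).trans ?_
  have h1 := norm_le_pi_norm h k
  simp only [norm_mul, RCLike.norm_conj]
  nlinarith [norm_nonneg (m k)]

theorem continuous_realPairing (m : K → ℂ) : Continuous (realPairing m) := by
  unfold realPairing; fun_prop

/-- Completing the square in a Gaussian integral with a linear source along `τ`; for nonreal `τ`
the integrand is translated off the real form. -/
theorem gaussian_shift {s : ℝ} (hs : 0 < s) {P : (K → ℂ) × (K → ℂ) → ℂ} (hP : ExpGrowth P)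
    (hPd : ∀ a b c d, Differentiable ℂ fun τ : ℂ => P (a + τ • b, c + τ • d)) (m : K → ℂ) (τ : ℂ) :
    ∫ h : K → ℂ, P (h, star h) * exp (τ * realPairing m h - (s * sqn h : ℝ)) =
      exp (τ ^ 2 * (sqn m / s : ℝ)) *
        ∫ h : K → ℂ, P (h + τ • (s : ℂ)⁻¹ • star m, star h + τ • (s : ℂ)⁻¹ • m) *
          exp (-(s * sqn h : ℝ)) := by
  obtain ⟨C, b, hC, hb, hbound⟩ := hP.bound
  set M := 2 * ∑ k, ‖m k‖
  have hgauss : ∀ h : K → ℂ, ‖exp (-(s * sqn h : ℝ))‖ = Real.exp (-s * sqn h) := by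
    intro h
    rw [norm_exp]
    simp
  have hexpc : Continuous fun h : K → ℂ => exp (-(s * sqn h : ℝ)) := by
    have := continuous_sqn (κ := K)
    fun_prop
  have hd1 : Differentiable ℂ fun τ : ℂ =>
      ∫ h : K → ℂ, P (h, star h) * exp (τ * realPairing m h - (s * sqn h : ℝ)) := by
    refine differentiable_integral_of_dominated (fun h => by fun_prop) (fun τ => ?_) (fun r => ?_)
    · have := continuous_realPairing m
      have := continuous_sqn (κ := K)
      exact ((hP.continuous.comp (by fun_prop)).mul (by fun_prop)).aestronglyMeasurable
    · refine ⟨_, integrable_exp_norm_mul_gaussian C (b + r * M) hs, fun τ hτ h => ?_⟩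
      rw [sub_eq_add_neg, exp_add, norm_mul, norm_mul, hgauss, ← mul_assoc]
      refine mul_le_mul_of_nonneg_right ?_ (Real.exp_pos _).le
      rw [add_mul, Real.exp_add, ← mul_assoc]
      have h1 : ‖P (h, star h)‖ ≤ C * Real.exp (b * ‖h‖) := by
        have := hbound (h, star h)
        rwa [Prod.norm_mk, norm_star, max_self] at this
      have h2 : ‖exp (τ * realPairing m h)‖ ≤ Real.exp (r * M * ‖h‖) := by
        rw [norm_exp]
        refine Real.exp_le_exp.mpr ((re_le_norm _).trans ?_)
        rw [norm_mul, mul_assoc]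
        have := norm_realPairing_le m h
        exact mul_le_mul hτ this (norm_nonneg _) ((norm_nonneg _).trans hτ)
      exact mul_le_mul h1 h2 (norm_nonneg _) (by positivity)
  have hd2 : Differentiable ℂ fun τ : ℂ => exp (τ ^ 2 * (sqn m / s : ℝ)) *
      ∫ h : K → ℂ, P (h + τ • (s : ℂ)⁻¹ • star m, star h + τ • (s : ℂ)⁻¹ • m) *
          exp (-(s * sqn h : ℝ)) := by
    refine Differentiable.mul (by fun_prop) ?_
    refine differentiable_integral_of_dominated (fun h => (hPd _ _ _ _).mul_const _)
      (fun τ => ?_) (fun r => ?_)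
    · exact ((hP.continuous.comp (by fun_prop)).mul hexpc).aestronglyMeasurable
    · refine ⟨_, integrable_exp_norm_mul_gaussian (C * Real.exp (b * (r * (s⁻¹ * ‖m‖)))) b hs,
        fun τ hτ h => ?_⟩
      rw [norm_mul, hgauss]
      gcongr
      refine (hbound _).trans ?_
      rw [mul_assoc, ← Real.exp_add, ← mul_add]
      gcongr
      have h1 : ∀ a w : K → ℂ, ‖a‖ = ‖h‖ → ‖w‖ = ‖m‖ →
          ‖a + τ • (s : ℂ)⁻¹ • w‖ ≤ r * (s⁻¹ * ‖m‖) + ‖h‖ := by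
        intro a w ha hw
        refine (norm_add_le _ _).trans ?_
        rw [norm_smul, norm_smul, ha, hw, norm_inv, norm_real, Real.norm_of_nonneg hs.le, add_comm]
        gcongr
      rw [Prod.norm_mk]
      exact max_le (h1 _ _ rfl (norm_star _)) (h1 _ _ (norm_star _) rfl)
  refine congrFun (eq_of_eq_on_real hd1 hd2 fun t => ?_) τ
  -- for real `t` this is a translation of the integration variable
  rw [← integral_const_mul, ← integral_add_right_eq_self _ ((t : ℂ) • (s : ℂ)⁻¹ • star m)]
  congr 1
  ext h
  have hst : star (h + (t : ℂ) • (s : ℂ)⁻¹ • star m) = star h + (t : ℂ) • (s : ℂ)⁻¹ • m := by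
    ext k; simp
  rw [hst, mul_left_comm, ← exp_add]
  congr 2
  have hsq : ∀ g : K → ℂ, ((sqn g : ℝ) : ℂ) = ∑ k, g k * conj (g k) := by
    intro g
    simp [sqn, mul_conj']
  push_cast
  rw [hsq, hsq, hsq, realPairing]
  simp only [mul_sum, sum_div, ← sum_sub_distrib, ← sum_add_distrib, ← sum_neg_distrib]
  refine sum_congr rfl fun k _ => ?_
  simp
  field_simp
  ring

end Shift

/-! ### The law of the Ginibre matrix -/

section Law

theorem pi_eq_withDensity {κ : Type*} [Fintype κ] {μ : κ → Measure ℂ} {f : κ → ℂ → ℝ}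
    (hf : ∀ i z, 0 ≤ f i z) (hfi : ∀ i, Integrable (f i)) [∀ i, SigmaFinite (μ i)]
    (h : ∀ i, μ i = volume.withDensity fun z => ENNReal.ofReal (f i z)) :
    Measure.pi μ = volume.withDensity fun x : κ → ℂ => ENNReal.ofReal (∏ i, f i (x i)) := by
  refine (Measure.pi_eq fun s hs => ?_)
  rw [withDensity_apply _ (MeasurableSet.univ_pi hs), volume_pi, Measure.restrict_pi_pi,
    ← ofReal_integral_eq_lintegral_ofReal, integral_fintype_prod_eq_prod,
    ENNReal.ofReal_prod_of_nonneg fun i _ => integral_nonneg (hf i)]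
  · refine prod_congr rfl fun i _ => ?_
    rw [h, withDensity_apply _ (hs i), ofReal_integral_eq_lintegral_ofReal (hfi i).integrableOn
      (.of_forall (hf i))]
  · exact Integrable.fintype_prod fun i => (hfi i).integrableOn
  · exact .of_forall fun x => prod_nonneg fun i _ => hf i _

theorem integrable_exp_neg_norm_sq {a : ℝ} (ha : 0 < a) :
    Integrable (fun z : ℂ => Real.exp (-a * ‖z‖ ^ 2)) := by
  have := (GaussianFourier.integrable_cexp_neg_mul_sq_norm_add (V := ℂ) (b := (a : ℂ))
    (by simpa using ha) 0 0).norm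
  refine this.congr (.of_forall fun z => ?_)
  simp [norm_exp, ← ofReal_pow]

theorem complexGaussian_eq_withDensity {a : ℝ≥0} (ha : a ≠ 0) : complexGaussian a⁻¹ =
      volume.withDensity fun z : ℂ => ENNReal.ofReal (a / Real.pi * Real.exp (-a * ‖z‖ ^ 2)) := by
  have hv : (a⁻¹ / 2 : ℝ≥0) ≠ 0 := by positivity
  have ha' : (0 : ℝ) < a := by positivity
  rw [complexGaussian, gaussianReal_of_var_ne_zero _ hv,
    prod_withDensity (measurable_gaussianPDF _ _)
    (measurable_gaussianPDF _ _)]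
  ext s hs
  rw [Measure.map_apply (MeasurableEquiv.measurable _) hs, withDensity_apply _ hs,
    withDensity_apply _ (MeasurableEquiv.measurable _ hs),
    ← (volume_preserving_equiv_real_prod.symm).setLIntegral_comp_preimage_emb
      (MeasurableEquiv.measurableEmbedding _)]
  refine lintegral_congr fun x => ?_
  rw [gaussianPDF, gaussianPDF, ← ENNReal.ofReal_mul (gaussianPDFReal_nonneg _ _ _)]
  congr 1
  have hn : ‖measurableEquivRealProd.symm x‖ ^ 2 = x.1 ^ 2 + x.2 ^ 2 := by
    rw [← normSq_eq_norm_sq, normSq_apply]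
    simp [measurableEquivRealProd_symm_apply, pow_two]
  rw [hn, gaussianPDFReal, gaussianPDFReal]
  rw [show ∀ p q r t : ℝ, p * q * (r * t) = (p * r) * (q * t) from fun _ _ _ _ => by ring,
    ← mul_inv, Real.mul_self_sqrt (by positivity), ← Real.exp_add]
  push_cast
  congr 1
  · field_simp
  · congr 1
    field_simp
    ring_nf

/-- The density of the entries of a Ginibre matrix. -/
theorem map_ginibre {Ω : Type*} [MeasurableSpace Ω] (P : Measure Ω) [IsProbabilityMeasure P] {n : ℕ}
    (hn : n ≠ 0) {H₀ : Ω → 𝕄 n} (hH₀ : IsGinibre P H₀) :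
    P.map (fun ω (p : Fin n × Fin n) => H₀ ω p.1 p.2) =
      volume.withDensity fun h : Fin n × Fin n → ℂ =>
        ENNReal.ofReal ((n / Real.pi) ^ (n * n) * Real.exp (-n * sqn h)) := by
  have hm : ∀ p : Fin n × Fin n, Measurable fun ω => H₀ ω p.1 p.2 := fun p =>
    (measurable_pi_apply p.2).comp ((measurable_pi_apply p.1).comp hH₀.measurable)
  rw [(iIndepFun_iff_map_fun_eq_pi_map fun p => (hm p).aemeasurable).mp hH₀.indep]
  rw [pi_eq_withDensity (f := fun _ z => n / Real.pi * Real.exp (-n * ‖z‖ ^ 2))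
    (fun _ _ => by positivity)
    (fun _ => (integrable_exp_neg_norm_sq (by positivity)).const_mul _)]
  · congr 1
    ext h
    congr 1
    simp [prod_mul_distrib, ← Real.exp_sum, sqn, mul_sum, div_pow]
  · intro p
    rw [hH₀.law, complexGaussian_eq_withDensity (a := (n : ℝ≥0)) (by exact_mod_cast hn)]
    simp

theorem integral_ginibre {Ω : Type*} [MeasurableSpace Ω] (P : Measure Ω) [IsProbabilityMeasure P]
    {n : ℕ} (hn : n ≠ 0) {H₀ : Ω → 𝕄 n} (hH₀ : IsGinibre P H₀) {F : 𝕄 n → ℂ} (hF : Measurable F) :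
    ∫ ω, F (H₀ ω) ∂P = ((n / Real.pi : ℝ) : ℂ) ^ (n * n) *
      ∫ h : Fin n × Fin n → ℂ, F (of fun i j => h (i, j)) * exp (-(n * sqn h : ℝ)) := by
  have hm : Measurable fun ω (p : Fin n × Fin n) => H₀ ω p.1 p.2 := measurable_pi_lambda _ fun p =>
      (measurable_pi_apply p.2).comp ((measurable_pi_apply p.1).comp hH₀.measurable)
  have hm2 : Measurable fun h : Fin n × Fin n → ℂ =>
      (of fun i j => h (i, j) : 𝕄 n) :=
    measurable_pi_lambda _ fun i => measurable_pi_lambda _ fun j => measurable_pi_apply _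
  have h1 : ∫ ω, F (H₀ ω) ∂P = ∫ h, F (of fun i j => h (i, j))
      ∂(P.map (fun ω (p : Fin n × Fin n) => H₀ ω p.1 p.2)) := by
    exact (integral_map (f := fun h : Fin n × Fin n → ℂ => F (of fun i j => h (i, j)))
      hm.aemeasurable (hF.comp hm2).aestronglyMeasurable).symm
  have hmeas : Measurable fun h : Fin n × Fin n → ℂ =>
      ENNReal.ofReal ((n / Real.pi) ^ (n * n) * Real.exp (-n * sqn h)) := by
    have := (continuous_sqn (κ := Fin n × Fin n)).measurable
    fun_prop
  rw [h1, map_ginibre P hn hH₀, integral_withDensity_eq_integral_toReal_smul hmeas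
    (.of_forall fun h => ENNReal.ofReal_lt_top), ← integral_const_mul]
  congr 1
  ext h
  rw [ENNReal.toReal_ofReal (by positivity), real_smul]
  push_cast
  ring_nf

end Law

/-! ### Block determinants -/

section BlockDet

/-- Over the polynomial ring `D + X` has a nonzero determinant that can be cancelled; the formula
follows by evaluation at `0`. -/
theorem det_fromBlocks_of_commute {m : Type*} [Fintype m] [DecidableEq m] (A B C D : Matrix m m ℂ)
    (h : C * D = D * C) :
    (fromBlocks A B C D).det = (A * D - B * C).det := by
  open Polynomial in
  set c : ℂ →+* ℂ[X] := Polynomial.C with hc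
  set D' : Matrix m m ℂ[X] := (-D).charmatrix with hD'
  have hD : D' = (X : ℂ[X]) • 1 + D.map c := by
    ext i j
    simp [hD', charmatrix, hc, Matrix.one_apply, diagonal_apply]
  have hdet : D'.det ≠ 0 := (charpoly_monic (-D)).ne_zero
  have h1 : fromBlocks (A.map c) (B.map c) (C.map c) D' * fromBlocks D' 0 (-C.map c) 1 =
      fromBlocks (A.map c * D' - B.map c * C.map c) (B.map c) 0 D' := by
    rw [fromBlocks_multiply]
    congr 1
    · simp [sub_eq_add_neg]
    · simp
    · rw [hD]
      simp only [Matrix.mul_add, Matrix.add_mul, Matrix.mul_neg, Matrix.mul_smul, smul_mul,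
        Matrix.mul_one, Matrix.one_mul, ← Matrix.map_mul, h]
      abel
    · simp
  have h2 : (fromBlocks (A.map c) (B.map c) (C.map c) D').det =
      (A.map c * D' - B.map c * C.map c).det := by
    have := congrArg det h1
    rw [det_mul, det_fromBlocks_zero₁₂, det_fromBlocks_zero₂₁, det_one, mul_one] at this
    exact mul_right_cancel₀ hdet this
  have h3 := congrArg (Polynomial.evalRingHom (0 : ℂ)) h2
  rw [RingHom.map_det, RingHom.map_det] at h3
  have hA : ∀ M : Matrix m m ℂ, (Polynomial.evalRingHom (0 : ℂ)).mapMatrix (M.map c) = M := by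
    intro M; ext i j; simp [hc]
  have hD0 : (Polynomial.evalRingHom (0 : ℂ)).mapMatrix D' = D := by
    rw [hD]; ext i j; by_cases hij : i = j <;> simp [hc, hij]
  have hF : (Polynomial.evalRingHom (0 : ℂ)).mapMatrix
      (fromBlocks (A.map c) (B.map c) (C.map c) D') = fromBlocks A B C D := by
    have e := hA A
    have e2 := hA B
    have e3 := hA C
    simp only [RingHom.mapMatrix_apply, fromBlocks_map] at *
    rw [e, e2, e3, hD0]
  rw [hF, map_sub, map_mul, map_mul, hA, hA, hA, hD0] at h3
  exact h3

variable {n : ℕ}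

/-- The block diagonal matrix with blocks `F 0` and `F 1`. -/
def blockDiag₂ (F : Fin 2 → 𝕄 n) :
    Matrix (Fin 2 × Fin n) (Fin 2 × Fin n) ℂ :=
  (blockDiagonal F).submatrix Prod.swap Prod.swap

theorem blockDiag₂_apply (F : Fin 2 → 𝕄 n) (a b : Fin 2 × Fin n) :
    blockDiag₂ F a b = if a.1 = b.1 then F a.1 a.2 b.2 else 0 := by
  simp [blockDiag₂, blockDiagonal_apply]

theorem blockDiag₂_mul (F G : Fin 2 → 𝕄 n) :
    blockDiag₂ F * blockDiag₂ G = blockDiag₂ fun j => F j * G j := by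
  rw [blockDiag₂, blockDiag₂, blockDiag₂, blockDiagonal_mul F G]
  exact submatrix_mul_equiv _ _ _ (Equiv.prodComm _ _) _

theorem det_blockDiag₂ (F : Fin 2 → 𝕄 n) : (blockDiag₂ F).det = ∏ j, (F j).det := by
  rw [← det_blockDiagonal]
  exact det_submatrix_equiv_self (Equiv.prodComm _ _) _

theorem calA_diagonal (Az : 𝕄 n) (ζ : Fin 2 → ℂ) : calA Az (diagonal ζ) =
      blockDiag₂ fun j => Az - ((Real.sqrt n : ℂ)⁻¹ * ζ j) • 1 := by
  ext ⟨j, α⟩ ⟨k, β⟩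
  by_cases h : j = k
  · subst h
    simp [calA, blockDiag₂_apply, kroneckerMap_apply, mul_assoc]
  · simp [calA, blockDiag₂_apply, kroneckerMap_apply, h]

theorem conjTranspose_blockDiag₂ (F : Fin 2 → 𝕄 n) :
    (blockDiag₂ F)ᴴ = blockDiag₂ fun j => (F j)ᴴ := by
  ext ⟨j, α⟩ ⟨k, β⟩
  by_cases h : j = k
  · subst h
    simp [blockDiag₂_apply]
  · simp [blockDiag₂_apply, h, Ne.symm h]

theorem diagonal_kronecker_one (d : Fin 2 → ℂ) :
    diagonal d ⊗ₖ (1 : 𝕄 n) = blockDiag₂ fun j => d j • 1 := by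
  ext ⟨j, α⟩ ⟨k, β⟩
  by_cases h : j = k
  · subst h
    simp [blockDiag₂_apply, kroneckerMap_apply]
  · simp [blockDiag₂_apply, kroneckerMap_apply, h]

/-- The product of the regularized determinants is the determinant of one block matrix. -/
theorem prod_det_Yreg (A₀ H : 𝕄 n) (z₀ : ℂ) (ζ : Fin 2 → ℂ) (ε : Fin 2 → ℝ) :
    ∏ j, (Yreg (A₀ + H) (point n z₀ ζ j) (ε j)).det =
      (blockC (A₀ - z₀ • 1 + H) (diagonal ζ) (diagonal ζ)
        (diagonal fun j => (ε j : ℂ)) (diagonal fun j => (ε j : ℂ))).det := by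
  rw [blockC, det_fromBlocks_of_commute]
  · rw [← det_blockDiag₂, calA_diagonal, conjTranspose_blockDiag₂, diagonal_kronecker_one,
      smul_mul, Matrix.mul_smul, smul_smul, I_mul_I, neg_one_smul, sub_neg_eq_add,
      blockDiag₂_mul, blockDiag₂_mul]
    congr 1
    ext ⟨j, α⟩ ⟨k, β⟩
    rw [Matrix.add_apply, blockDiag₂_apply, blockDiag₂_apply, blockDiag₂_apply]
    dsimp only
    split_ifs with h
    · rw [← Matrix.add_apply]
      refine congrFun (congrFun ?_ α) β
      have e1 : A₀ + H - point n z₀ ζ j • 1 =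
          A₀ - z₀ • 1 + H - ((Real.sqrt n : ℂ)⁻¹ * ζ j) • 1 := by
        rw [point, add_smul, div_eq_inv_mul]
        abel
      rw [Yreg, e1, add_comm, smul_mul, Matrix.one_mul, smul_smul, pow_two]
    · simp
  · rw [calA_diagonal, conjTranspose_blockDiag₂, diagonal_kronecker_one, smul_mul,
      Matrix.mul_smul, blockDiag₂_mul, blockDiag₂_mul]
    simp

end BlockDet

/-! ### The bosonic representation of the generating functional -/

section BosonicRepresentation

variable {n : ℕ}

theorem integrable_prod_gaussian {K L : Type*} [Fintype K] [Fintype L] {G : (K → ℂ) × (L → ℂ) → ℂ}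
    (hG : ExpGrowth G) {g : (K → ℂ) × (L → ℂ) → ℂ} (hg : Continuous g) {a b : ℝ} (ha : 0 < a)
    (hb : 0 < b) (hga : ∀ x, (g x).re ≤ -a * sqn x.1 + -b * sqn x.2) :
    Integrable (fun x => G x * exp (g x)) := by
  obtain ⟨C, c, hC, hc, hbd⟩ := hG.bound
  refine ((integrable_exp_norm_mul_gaussian C c ha).mul_prod
    (integrable_exp_norm_mul_gaussian 1 c hb)).mono'
    (hG.continuous.mul (continuous_exp.comp hg)).aestronglyMeasurable
    (.of_forall fun x => ?_)
  rw [norm_mul, norm_exp]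
  have h1 : ‖G x‖ ≤ C * (Real.exp (c * ‖x.1‖) * Real.exp (c * ‖x.2‖)) := by
    refine (hbd x).trans ?_
    rw [← Real.exp_add, ← mul_add]
    gcongr
    rw [Prod.norm_def]
    exact max_le_add_of_nonneg (norm_nonneg _) (norm_nonneg _)
  have h2 : Real.exp (g x).re ≤ Real.exp (-a * sqn x.1) * Real.exp (-b * sqn x.2) := by
    rw [← Real.exp_add]
    exact Real.exp_le_exp.mpr (hga x)
  calc ‖G x‖ * Real.exp (g x).re ≤ (C * (Real.exp (c * ‖x.1‖) * Real.exp (c * ‖x.2‖))) *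
      (Real.exp (-a * sqn x.1) * Real.exp (-b * sqn x.2)) :=
        mul_le_mul h1 h2 (Real.exp_pos _).le (by positivity)
    _ = _ := by ring

/-- The Hermitian matrix with diagonal blocks `-Y₁ ⊗ 1`, `-Y₂ ⊗ 1` and off-diagonal block
`-𝒜(ξ)`. -/
def hermX (Az : 𝕄 n) (ξ Y₁ Y₂ : 𝕄 2) :
    Matrix (Blk n) (Blk n) ℂ :=
  fromBlocks (-(Y₁ ⊗ₖ (1 : 𝕄 n))) (-calA Az ξ) (-(calA Az ξ)ᴴ) (-(Y₂ ⊗ₖ (1 : 𝕄 n)))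

theorem isHermitian_hermX (Az : 𝕄 n) (ξ : 𝕄 2) {Y₁ Y₂ : 𝕄 2} (h₁ : Y₁.IsHermitian)
    (h₂ : Y₂.IsHermitian) :
    (hermX Az ξ Y₁ Y₂).IsHermitian := by
  rw [IsHermitian, hermX, fromBlocks_conjTranspose]
  simp only [conjTranspose_neg, conjTranspose_conjTranspose,
    conjTranspose_kronecker, h₁.eq, h₂.eq, conjTranspose_one]

/-- The coefficients of the source coupled to the Ginibre matrix by the bosonic variables. -/
def hop (φ : Blk n → ℂ) (p : Fin n × Fin n) : ℂ :=
  ∑ k : Fin 2, conj (φ (.inl (k, p.1))) * φ (.inr (k, p.2))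

/-- The coefficient of `h_p` in the block matrix of the Ginibre matrix `h`. -/
def xHop (p : Fin n × Fin n) : Matrix (Blk n) (Blk n) ℂ :=
  of fun
    | .inl a, .inr b => if a.1 = b.1 then (if (a.2, b.2) = p then I else 0) else 0
    | _, _ => 0

/-- The coefficient of `h̄_p` in the block matrix of the Ginibre matrix `h`. -/
def yHop (p : Fin n × Fin n) : Matrix (Blk n) (Blk n) ℂ :=
  of fun
    | .inr a, .inl b => if a.1 = b.1 then (if (b.2, a.2) = p then I else 0) else 0
    | _, _ => 0

/-- The coefficient of `q_p` in the dual block matrix. -/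
def xDual (p : Fin 2 × Fin 2) : Matrix (Blk n) (Blk n) ℂ :=
  of fun
    | .inr a, .inr b => if a.2 = b.2 then (if (b.1, a.1) = p then 1 else 0) else 0
    | _, _ => 0

/-- The coefficient of `q̄_p` in the dual block matrix. -/
def yDual (p : Fin 2 × Fin 2) : Matrix (Blk n) (Blk n) ℂ :=
  of fun
    | .inl a, .inl b => if a.2 = b.2 then (if (a.1, b.1) = p then 1 else 0) else 0
    | _, _ => 0

theorem hop_dual (a b c d : Blk n) :
    ∑ k, xHop k a b * yHop k c d = -∑ k, xDual k c b * yDual k a d := by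
  rcases a with ⟨a, α⟩ | ⟨a, α⟩ <;> rcases b with ⟨b, β⟩ | ⟨b, β⟩ <;>
    rcases c with ⟨c, γ⟩ | ⟨c, γ⟩ <;> rcases d with ⟨d, δ⟩ | ⟨d, δ⟩ <;>
    simp only [xHop, yHop, xDual, yDual, of_apply, zero_mul, mul_zero, sum_const_zero, neg_zero]
  simp only [ite_mul, zero_mul, mul_ite, mul_zero, sum_ite_irrel, sum_ite_eq,
    sum_const_zero, mem_univ, if_true, Prod.mk.injEq, I_mul_I, one_mul]
  by_cases h1 : a = b <;> by_cases h2 : c = d <;> by_cases h3 : α = δ <;> by_cases h4 : β = γ <;>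
    simp [h1, h2, h3, h4, eq_comm]

theorem linPert_hop (Az : 𝕄 n) (ξ ξ' Λ₁ Λ₂ : 𝕄 2) (h : Fin n × Fin n → ℂ) :
    linPert (blockC Az ξ ξ' Λ₁ Λ₂) xHop yHop h =
      blockC (Az + of fun i j => h (i, j)) ξ ξ' Λ₁ Λ₂ := by
  ext a b
  rcases a with ⟨a, α⟩ | ⟨a, α⟩ <;> rcases b with ⟨b, β⟩ | ⟨b, β⟩ <;>
    simp [linPert, blockC, xHop, yHop, calA, kroneckerMap_apply, Matrix.one_apply]
  · by_cases h1 : a = b <;> simp [h1]; ring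
  · by_cases h1 : a = b
    · simp [h1]; ring
    · simp [h1, Ne.symm h1]

theorem linPert_dual (Az : 𝕄 n) (ξ ξ' Λ₁ Λ₂ : 𝕄 2) (N : Matrix (Blk n) (Blk n) ℂ)
    (h : Fin 2 × Fin 2 → ℂ) :
    linPert (blockC Az ξ ξ' Λ₁ Λ₂ - N) xDual yDual h =
      blockC Az ξ ξ' (Λ₁ + of fun i j => conj (h (i, j)))
        (Λ₂ + (of fun i j => conj (h (i, j)))ᴴ) - N := by
  ext a b
  rcases a with ⟨a, α⟩ | ⟨a, α⟩ <;> rcases b with ⟨b, β⟩ | ⟨b, β⟩ <;>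
    simp [linPert, blockC, xDual, yDual, kroneckerMap_apply, Matrix.one_apply]
  · by_cases h1 : α = β <;> simp [h1]; ring
  · by_cases h1 : α = β <;> simp [h1]; ring

theorem sum_ite_eq_mul_ite_eq {A : Type*} [Fintype A] [DecidableEq A] (x y : A) (c d : ℂ) :
    ∑ g, (if g = x then c else 0) * (if g = y then d else 0) = if x = y then c * d else 0 := by
  rw [sum_eq_single x]
  · simp
  · intro g _ hg
    simp [hg]
  · simp

theorem bilPert_apply (φ : Blk n → ℂ) (a b : Blk n) : bilPert uCoef vCoef φ a b = match a, b with
    | .inl a, .inr b => if a.1 = b.1 then ∑ k, φ (.inl (k, a.2)) * conj (φ (.inr (k, b.2))) else 0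
    | .inr a, .inl b => if a.1 = b.1 then ∑ k, φ (.inr (k, a.2)) * conj (φ (.inl (k, b.2))) else 0
    | _, _ => 0 := by
  have h1 : bilPert uCoef vCoef φ a b =
      ∑ p, ∑ q, (∑ g, uCoef a g p * vCoef g q b) * (φ p * conj (φ q)) := by
    rw [bilPert, of_apply, sum_comm]
    refine sum_congr rfl fun p _ => ?_
    rw [sum_comm]
    refine sum_congr rfl fun q _ => ?_
    rw [sum_mul]
  have h2 : ∀ (a b : Fin 2 × Fin n) (x y : Fin 2) (F G : Fin 2 × Fin n → ℂ),
      ∑ p : Fin 2 × Fin n, ∑ q : Fin 2 × Fin n, (if (x, a.1, p.1) = (y, b.1, q.1) then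
        (if a.2 = p.2 then (1 : ℂ) else 0) * (if q.2 = b.2 then 1 else 0) else 0) *
          (F p * conj (G q)) =
      if x = y ∧ a.1 = b.1 then ∑ k, F (k, a.2) * conj (G (k, b.2)) else 0 := by
    intro a b x y F G
    by_cases h : x = y ∧ a.1 = b.1
    · obtain ⟨rfl, h⟩ := h
      rw [if_pos ⟨rfl, h⟩]
      simp only [Prod.mk.injEq, h, true_and, Fintype.sum_prod_type, ite_mul, one_mul, zero_mul,
        sum_ite_irrel, sum_const_zero, sum_ite_eq, sum_ite_eq',
        mem_univ, if_true]
    · rw [if_neg h]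
      refine sum_eq_zero fun p _ => sum_eq_zero fun q _ => ?_
      rw [if_neg, zero_mul]
      simp only [Prod.mk.injEq]
      tauto
  rw [h1]
  rcases a with a | a <;> rcases b with b | b <;>
    simp only [Fintype.sum_sum_type, uCoef, vCoef, zero_mul, mul_zero, sum_const_zero,
      add_zero, zero_add, sum_ite_eq_mul_ite_eq]
  · exact (h2 a b 0 1 _ _).trans (by simp)
  · exact (h2 a b 0 0 _ _).trans (by simp)
  · exact (h2 a b 1 1 _ _).trans (by simp)
  · exact (h2 a b 1 0 _ _).trans (by simp)

theorem hop_shift (φ : Blk n → ℂ) (a b : Blk n) :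
    ∑ k, conj (hop φ k) * xHop k a b + ∑ k, hop φ k * yHop k a b =
      I * bilPert uCoef vCoef φ a b := by
  rw [bilPert_apply]
  rcases a with ⟨a, α⟩ | ⟨a, α⟩ <;> rcases b with ⟨b, β⟩ | ⟨b, β⟩ <;>
    simp [xHop, yHop, hop, mul_comm]

/-- The Ginibre matrix enters the bosonic exponent linearly, with source `hop φ`. -/
theorem qf_hermX_add (s : ℝ) (Az : 𝕄 n) (ξ : 𝕄 2) (h : Fin n × Fin n → ℂ) (φ : Blk n → ℂ) :
    qf (accr s (hermX (Az + of fun i j => h (i, j)) ξ 0 0)) φ =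
      qf (accr s (hermX Az ξ 0 0)) φ - I * realPairing (hop φ) h := by
  have h1 : hermX (Az + of fun i j => h (i, j)) ξ 0 0 = hermX Az ξ 0 0 +
      fromBlocks 0 (-((1 : 𝕄 2) ⊗ₖ of fun i j => h (i, j)))
        (-((1 : 𝕄 2) ⊗ₖ of fun i j => h (i, j))ᴴ) 0 := by
    rw [hermX, hermX, fromBlocks_add]
    congr 1
    · simp
    · rw [calA, calA, kronecker_add]; abel
    · rw [calA, calA, kronecker_add]; simp only [conjTranspose_add, conjTranspose_sub]; abel
    · simp
  rw [h1, accr, accr, smul_add, ← add_assoc, qf_add, qf_smul I (fromBlocks _ _ _ _),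
    sub_eq_add_neg, ← mul_neg]
  congr 2
  rw [qf_apply]
  simp only [Fintype.sum_sum_type, fromBlocks_apply₁₁, fromBlocks_apply₁₂,
    fromBlocks_apply₂₁, fromBlocks_apply₂₂, Matrix.zero_apply, mul_zero, zero_mul,
    sum_const_zero, add_zero, zero_add, Matrix.neg_apply, conjTranspose_apply,
    kroneckerMap_apply, of_apply, Matrix.one_apply, Fintype.sum_prod_type,
    Fin.sum_univ_two, realPairing, hop, sum_add_distrib]
  simp only [Fin.isValue, if_true, zero_ne_one, one_ne_zero, if_false, one_mul, zero_mul, neg_zero,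
    mul_zero, sum_const_zero, add_zero, zero_add, map_add, map_mul, conj_conj,
    star_def, mul_add, sum_add_distrib, neg_add, map_zero]
  rw [sum_comm (f := fun x y : Fin n =>
      conj (φ (.inr (0, x))) * -conj (h (y, x)) * φ (.inl (0, y))),
    sum_comm (f := fun x y : Fin n =>
      conj (φ (.inr (1, x))) * -conj (h (y, x)) * φ (.inl (1, y)))]
  simp only [← sum_add_distrib, ← sum_neg_distrib]
  refine sum_congr rfl fun i _ => sum_congr rfl fun j _ => ?_
  ring

theorem det_blockC_eq_det_accr (s : ℝ) (Az : 𝕄 n) (ξ : 𝕄 2) :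
    (blockC Az ξ ξ (diagonal fun _ => (s : ℂ)) (diagonal fun _ => (s : ℂ))).det =
      (accr s (hermX Az ξ 0 0)).det := by
  have h0 : (diagonal fun _ : Fin 2 => (s : ℂ)) ⊗ₖ (1 : 𝕄 n) = (s : ℂ) • 1 := by
    rw [diagonal_kronecker_one]
    ext a b
    rw [blockDiag₂_apply]
    by_cases h : a.1 = b.1 <;> by_cases h' : a.2 = b.2 <;>
      simp [Matrix.one_apply, h, h', Prod.ext_iff]
  have h1 : accr s (hermX Az ξ 0 0) = fromBlocks ((s : ℂ) • 1) (-(I • calA Az ξ))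
      (-(I • (calA Az ξ)ᴴ)) ((s : ℂ) • 1) := by
    rw [accr, hermX, ← fromBlocks_one, fromBlocks_smul, fromBlocks_smul, fromBlocks_add]
    simp
  rw [h1, blockC, h0, det_fromBlocks_of_commute, det_fromBlocks_of_commute]
  · simp
  · rw [Matrix.mul_smul, Matrix.mul_one, smul_mul, Matrix.one_mul]
  · rw [Matrix.mul_smul, Matrix.mul_one, smul_mul, Matrix.one_mul]

/-- The weight of the bosonic variables. -/
def bosonWeight (Az : 𝕄 n) (ξ : 𝕄 2) (s : ℝ) (φ : Blk n → ℂ) : ℂ :=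
  exp (-qf (accr s (hermX Az ξ 0 0)) φ - ((n : ℝ)⁻¹ * sqn (hop φ) : ℝ))

theorem expGrowth_linear_det {K κ : Type} [Fintype K] [Fintype κ] [DecidableEq κ] (C : Matrix κ κ ℂ)
    (x y : K → Matrix κ κ ℂ) :
    ExpGrowth fun w : (K → ℂ) × (K → ℂ) =>
      (of fun a b => C a b + ∑ k, w.1 k * x k a b + ∑ k, w.2 k * y k a b).det := by
  refine .det fun i j => ?_
  simp only [of_apply]
  have h1 : ∀ k, ExpGrowth fun w : (K → ℂ) × (K → ℂ) => w.1 k := fun k =>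
    (ExpGrowth.coord k).comp_of_bound continuous_fst 0 1 zero_le_one fun y => by
      simpa using norm_fst_le y
  have h2 : ∀ k, ExpGrowth fun w : (K → ℂ) × (K → ℂ) => w.2 k := fun k =>
    (ExpGrowth.coord k).comp_of_bound continuous_snd 0 1 zero_le_one fun y => by
      simpa using norm_snd_le y
  exact ((ExpGrowth.const _).add (.sum _ fun k _ => (h1 k).mul (.const _))).add
    (.sum _ fun k _ => (h2 k).mul (.const _))

/-- Averaging the bosonic exponential over the Ginibre matrix and dualizing. -/
theorem integral_ginibre_boson (hn : n ≠ 0) (Az : 𝕄 n) (ξ ξ' Λ₁ Λ₂ : 𝕄 2) (s : ℝ) (φ : Blk n → ℂ) :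
    ((n / Real.pi : ℝ) : ℂ) ^ (n * n) * ∫ h : Fin n × Fin n → ℂ,
      (blockC (Az + of fun i j => h (i, j)) ξ ξ Λ₁ Λ₂).det * exp
        (-qf (accr s (hermX (Az + of fun i j => h (i, j)) ξ' 0 0)) φ - (n * sqn h : ℝ)) =
    ((n / Real.pi : ℝ) : ℂ) ^ 4 * ∫ q : Fin 2 × Fin 2 → ℂ, bosonWeight Az ξ' s φ *
      (blockC Az ξ ξ (Λ₁ + of fun i j => q (i, j))
        (Λ₂ + (of fun i j => q (i, j))ᴴ) - (n : ℂ)⁻¹ • bilPert uCoef vCoef φ).det *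
        exp (-(n * sqn q : ℝ)) := by
  have hnpos : (0 : ℝ) < n := by positivity
  set C := blockC Az ξ ξ Λ₁ Λ₂
  set P : (Fin n × Fin n → ℂ) × (Fin n × Fin n → ℂ) → ℂ := fun w =>
    (of fun a b => C a b + ∑ k, w.1 k * xHop k a b + ∑ k, w.2 k * yHop k a b).det with hP
  have hPd : ∀ a b c d, Differentiable ℂ fun τ : ℂ => P (a + τ • b, c + τ • d) := by
    intro a b c d
    simp only [hP, det_apply, of_apply, Pi.add_apply, Pi.smul_apply, smul_eq_mul]
    fun_prop
  have h1 : ∀ h : Fin n × Fin n → ℂ, (blockC (Az + of fun i j => h (i, j)) ξ ξ Λ₁ Λ₂).det * exp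
        (-qf (accr s (hermX (Az + of fun i j => h (i, j)) ξ' 0 0)) φ - (n * sqn h : ℝ)) =
      exp (-qf (accr s (hermX Az ξ' 0 0)) φ) *
        (P (h, star h) * exp (I * realPairing (hop φ) h - (n * sqn h : ℝ))) := by
    intro h
    rw [qf_hermX_add, ← linPert_hop, mul_left_comm, ← exp_add]
    congr 2
    ring
  simp only [h1]
  -- `P` is a polynomial in `h` and `h̄` as independent variables, so it can be translated by an
  -- imaginary multiple of the source
  have hshift := gaussian_shift (P := P) hnpos (expGrowth_linear_det C xHop yHop) hPd (hop φ) I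
  have h2 : ∀ h : Fin n × Fin n → ℂ, P (h + I • ((n : ℝ) : ℂ)⁻¹ • star (hop φ),
      star h + I • ((n : ℝ) : ℂ)⁻¹ • hop φ) =
      (linPert (C - (n : ℂ)⁻¹ • bilPert uCoef vCoef φ) xHop yHop h).det := by
    intro h
    simp only [hP, linPert]
    congr 1
    ext a b
    have := hop_shift φ a b
    simp only [of_apply, Pi.add_apply, Pi.smul_apply, Pi.star_apply, star_def,
      smul_eq_mul, Matrix.sub_apply, Matrix.smul_apply, add_mul, sum_add_distrib, mul_assoc,
      ← mul_sum, ofReal_natCast]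
    linear_combination I * (n : ℂ)⁻¹ * this + (n : ℂ)⁻¹ * bilPert uCoef vCoef φ a b * I_sq
  simp only [h2] at hshift
  rw [integral_const_mul, hshift]
  have h3 := integral_det_duality hnpos (C - (n : ℂ)⁻¹ • bilPert uCoef vCoef φ) xHop yHop
    xDual yDual hop_dual
  rw [Fintype.card_prod, Fintype.card_prod, Fintype.card_fin, Fintype.card_fin] at h3
  -- conjugating `q` matches the position of `q` and `q^*` in the blocks
  have h4 : MeasurePreserving (fun q : Fin 2 × Fin 2 → ℂ => fun p => conj (q p)) :=
    volume_preserving_pi fun _ => conjLIE.measurePreserving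
  have h5 := h4.integral_comp ((MeasurableEquiv.piCongrRight fun _ : Fin 2 × Fin 2 =>
    conjLIE.toHomeomorph.toMeasurableEquiv).measurableEmbedding) (fun q =>
      (linPert (C - (n : ℂ)⁻¹ • bilPert uCoef vCoef φ) xDual yDual q).det * exp (-(n * sqn q : ℝ)))
  rw [← h5] at h3
  have h6 : ∀ q : Fin 2 × Fin 2 → ℂ, bosonWeight Az ξ' s φ *
      (blockC Az ξ ξ (Λ₁ + of fun i j => q (i, j))
        (Λ₂ + (of fun i j => q (i, j))ᴴ) - (n : ℂ)⁻¹ • bilPert uCoef vCoef φ).det *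
        exp (-(n * sqn q : ℝ)) = bosonWeight Az ξ' s φ *
      ((linPert (C - (n : ℂ)⁻¹ • bilPert uCoef vCoef φ) xDual yDual fun p => conj (q p)).det *
        exp (-(n * sqn fun p => conj (q p) : ℝ))) := by
    intro q
    rw [linPert_dual]
    simp [sqn, mul_assoc]
  simp only [h6]
  rw [integral_const_mul, mul_left_comm _ (bosonWeight Az ξ' s φ)]
  rw [show 2 * 2 = 4 from rfl] at h3
  rw [← h3, bosonWeight, sub_eq_add_neg (-qf _ _), exp_add, I_sq]
  have e : (-1 : ℂ) * ((sqn (hop φ) / (n : ℝ) : ℝ) : ℂ) = -(((n : ℝ)⁻¹ * sqn (hop φ) : ℝ) : ℂ) := by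
    push_cast; ring
  rw [e]
  ring

end BosonicRepresentation

section GenZ

variable {n : ℕ}

theorem continuous_hop (p : Fin n × Fin n) : Continuous fun φ : Blk n → ℂ => hop φ p := by
  unfold hop; fun_prop

theorem measurable_detRatio (z₀ : ℂ) (ζ ζ' : Fin 2 → ℂ) (ε : Fin 2 → ℝ) (ε' : ℝ) :
    Measurable fun H : 𝕄 n => detRatio z₀ ζ ζ' ε ε' H := by
  have h : ∀ (z : ℂ) (e : ℝ), Measurable fun H : 𝕄 n => (Yreg H z e).det := by
    intro z e
    have : Continuous fun H : 𝕄 n => (Yreg H z e).det := by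
      unfold Yreg
      fun_prop
    exact this.measurable
  unfold detRatio
  exact Finset.measurable_fun_prod _ fun j _ => (h _ _).div (h _ _)

theorem detRatio_eq (A₀ H : 𝕄 n) (z₀ : ℂ) (ζ ζ' : Fin 2 → ℂ) (ε : Fin 2 → ℝ) {s : ℝ} (hs : 0 < s) :
    detRatio z₀ ζ ζ' ε s (A₀ + H) =
      ((Real.pi : ℂ) ^ Fintype.card (Blk n))⁻¹ * ∫ φ : Blk n → ℂ,
        (blockC (A₀ - z₀ • 1 + H) (diagonal ζ) (diagonal ζ)
          (diagonal fun j => (ε j : ℂ)) (diagonal fun j => (ε j : ℂ))).det *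
        exp (-qf (accr s (hermX (A₀ - z₀ • 1 + H) (diagonal ζ') 0 0)) φ) := by
  have hX := isHermitian_hermX (A₀ - z₀ • 1 + H) (diagonal ζ')
    (isHermitian_zero (n := Fin 2) (α := ℂ)) (isHermitian_zero (n := Fin 2) (α := ℂ))
  rw [detRatio, prod_div_distrib, prod_det_Yreg, prod_det_Yreg A₀ H z₀ ζ' fun _ => s,
    det_blockC_eq_det_accr, integral_const_mul, accr, (integral_gaussian hs hX).1]
  field_simp

theorem expGrowth_blockC_dual (Az : 𝕄 n) (ξ ξ' Λ₁ Λ₂ : 𝕄 2) (c : ℂ) :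
    ExpGrowth fun x : (Blk n → ℂ) × (Fin 2 × Fin 2 → ℂ) =>
      (blockC Az ξ ξ' (Λ₁ + of fun i j => x.2 (i, j))
        (Λ₂ + (of fun i j => x.2 (i, j))ᴴ) - c • bilPert uCoef vCoef x.1).det := by
  refine .det fun a b => ?_
  simp only [Matrix.sub_apply, Matrix.smul_apply, smul_eq_mul]
  have h2 : ∀ k, ExpGrowth fun w : (Blk n → ℂ) × (Fin 2 × Fin 2 → ℂ) => w.2 k := fun k =>
    (ExpGrowth.coord k).comp_of_bound continuous_snd 0 1 zero_le_one fun y => by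
      simpa using norm_snd_le y
  refine .sub ?_ ((ExpGrowth.const c).mul ((expGrowth_bilPert uCoef vCoef a b).comp_of_bound
    continuous_fst 0 1 zero_le_one fun y => by simpa using norm_fst_le y))
  rcases a with a | a <;> rcases b with b | b
  · simp only [blockC, fromBlocks_apply₁₁, kroneckerMap_apply, Matrix.add_apply, of_apply]
    exact ((ExpGrowth.const _).add (h2 _)).mul (.const _)
  · simp only [blockC, fromBlocks_apply₁₂]
    exact .const _
  · simp only [blockC, fromBlocks_apply₂₁]
    exact .const _
  · simp only [blockC, fromBlocks_apply₂₂, kroneckerMap_apply, Matrix.add_apply,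
      of_apply, conjTranspose_apply, star_def]
    exact ((ExpGrowth.const _).add (h2 _).conjugate).mul (.const _)

theorem expGrowth_blockC_hop (Az : 𝕄 n) (ξ Λ₁ Λ₂ : 𝕄 2) :
    ExpGrowth fun x : (Fin n × Fin n → ℂ) × (Blk n → ℂ) =>
      (blockC (Az + of fun i j => x.1 (i, j)) ξ ξ Λ₁ Λ₂).det := by
  simp only [← linPert_hop]
  refine .det fun a b => ?_
  have h2 : ∀ k, ExpGrowth fun w : (Fin n × Fin n → ℂ) × (Blk n → ℂ) => w.1 k := fun k =>
    (ExpGrowth.coord k).comp_of_bound continuous_fst 0 1 zero_le_one fun y => by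
      simpa using norm_fst_le y
  simp only [linPert, of_apply]
  exact ((ExpGrowth.const _).add (.sum _ fun k _ => (h2 k).mul (.const _))).add
    (.sum _ fun k _ => (h2 k).conjugate.mul (.const _))

/-- The generating functional as an integral over bosonic variables and a dual `2 × 2` matrix. -/
theorem genZ_eq_integral {Ω : Type*} [MeasurableSpace Ω] (P : Measure Ω) [IsProbabilityMeasure P]
    (hn : n ≠ 0) {H₀ : Ω → 𝕄 n} (hH₀ : IsGinibre P H₀) (A₀ : 𝕄 n) (z₀ : ℂ) (ζ ζ' : Fin 2 → ℂ)
    (ε : Fin 2 → ℝ) {s : ℝ} (hs : 0 < s) :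
    genZ P H₀ A₀ z₀ ζ ζ' ε s =
      ((n / Real.pi : ℝ) : ℂ) ^ 4 * ((Real.pi : ℂ) ^ Fintype.card (Blk n))⁻¹ *
        ∫ q : Fin 2 × Fin 2 → ℂ, exp (-(n * sqn q : ℝ)) *
          ∫ φ : Blk n → ℂ, bosonWeight (A₀ - z₀ • 1) (diagonal ζ') s φ *
            (blockC (A₀ - z₀ • 1) (diagonal ζ) (diagonal ζ)
              ((diagonal fun j => (ε j : ℂ)) + of fun i j => q (i, j))
              ((diagonal fun j => (ε j : ℂ)) + (of fun i j => q (i, j))ᴴ)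
                - (n : ℂ)⁻¹ • bilPert uCoef vCoef φ).det := by
  have hnpos : (0 : ℝ) < n := by positivity
  set Az := A₀ - z₀ • 1
  set E : 𝕄 2 := diagonal fun j => (ε j : ℂ)
  have h0 : (0 : 𝕄 2).IsHermitian := isHermitian_zero
  rw [genZ, integral_ginibre P hn hH₀ (F := fun H => detRatio z₀ ζ ζ' ε s (A₀ + H))
    ((measurable_detRatio z₀ ζ ζ' ε s).comp
    (measurable_const_add A₀ : Measurable fun H : 𝕄 n => A₀ + H))]
  have hqre : ∀ (A : 𝕄 n) (φ : Blk n → ℂ),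
      (qf (accr s (hermX A (diagonal ζ') 0 0)) φ).re = s * sqn φ := fun A φ =>
    qf_accr_re s (isHermitian_hermX A _ h0 h0) φ
  have hsc1 : Continuous (sqn : (Fin n × Fin n → ℂ) → ℝ) := continuous_sqn
  have hsc2 : Continuous (sqn : (Fin 2 × Fin 2 → ℂ) → ℝ) := continuous_sqn
  have hqc := continuous_qf (accr s (hermX Az (diagonal ζ') 0 0))
  have hhop : ∀ p, Continuous fun φ : Blk n → ℂ => hop φ p := continuous_hop
  have hhop' : Continuous fun φ : Blk n → ℂ => hop φ := continuous_pi hhop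
  -- the bosonic integral for a fixed Ginibre matrix
  have h1 : ∀ h : Fin n × Fin n → ℂ,
      detRatio z₀ ζ ζ' ε s (A₀ + of fun i j => h (i, j)) * exp (-(n * sqn h : ℝ)) =
      ((Real.pi : ℂ) ^ Fintype.card (Blk n))⁻¹ * ∫ φ : Blk n → ℂ,
        (blockC (Az + of fun i j => h (i, j)) (diagonal ζ) (diagonal ζ)
          E E).det * exp (-qf (accr s (hermX (Az + of fun i j => h (i, j))
            (diagonal ζ') 0 0)) φ - (n * sqn h : ℝ)) := by
    intro h
    rw [detRatio_eq A₀ _ z₀ ζ ζ' ε hs, mul_assoc, ← integral_mul_const]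
    congr 2
    ext φ
    rw [mul_assoc, ← exp_add, ← sub_eq_add_neg]
  simp only [h1]
  rw [integral_const_mul, integral_integral_swap]
  rotate_left
  · refine integrable_prod_gaussian (expGrowth_blockC_hop Az (diagonal ζ) E E) (g := fun x =>
      -qf (accr s (hermX (Az + of fun i j => x.1 (i, j)) (diagonal ζ') 0 0)) x.2 -
        (n * sqn x.1 : ℝ)) ?_ hnpos hs ?_
    · simp only [qf_hermX_add, realPairing]
      fun_prop
    · intro x
      rw [sub_re, neg_re, hqre, ofReal_re]
      linarith
  have h2 := integral_ginibre_boson hn Az (diagonal ζ) (diagonal ζ') E E s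
  rw [mul_left_comm, ← integral_const_mul]
  simp only [h2]
  rw [integral_const_mul, integral_integral_swap]
  rotate_left
  · have h3 := integrable_prod_gaussian
      (expGrowth_blockC_dual Az (diagonal ζ) (diagonal ζ) E E (n : ℂ)⁻¹)
      (g := fun x => -qf (accr s (hermX Az (diagonal ζ') 0 0)) x.1 -
        ((n : ℝ)⁻¹ * sqn (hop x.1) : ℝ) - (n * sqn x.2 : ℝ)) (by fun_prop) hs hnpos (by
        intro x
        rw [sub_re, sub_re, neg_re, hqre, ofReal_re, ofReal_re]
        have : 0 ≤ (n : ℝ)⁻¹ * sqn (hop x.1) := mul_nonneg (by positivity) (sqn_nonneg _)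
        linarith)
    refine h3.congr (.of_forall fun x => ?_)
    simp only [Function.uncurry, bosonWeight]
    rw [sub_eq_add_neg _ ((n * sqn x.2 : ℝ) : ℂ), exp_add]
    ring
  rw [← mul_assoc, mul_comm (((Real.pi : ℂ) ^ Fintype.card (Blk n))⁻¹)]
  congr 2
  ext q
  rw [← integral_const_mul]
  congr 1
  ext φ
  ring

end GenZ

/-! ### Determinants of matrices with positive real part -/

section DetBounds

variable {m : Type} [Fintype m] [DecidableEq m]

theorem integral_gaussian_posDef {D X : Matrix m m ℂ} (hD : D.PosDef) (hX : X.IsHermitian) :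
    (∫ φ : m → ℂ, exp (-qf (D + I • X) φ)) = (Real.pi : ℂ) ^ Fintype.card m / (D + I • X).det ∧
    (D + I • X).det ≠ 0 := by
  obtain ⟨A, hA, hDA⟩ : ∃ A : Matrix m m ℂ, A.det ≠ 0 ∧ D = Aᴴ * A := by
    obtain ⟨A, hA⟩ : ∃ A : Matrix m m ℂ, D = Aᴴ * A := by
      open scoped MatrixOrder in
      exact CStarAlgebra.nonneg_iff_eq_star_mul_self.mp (nonneg_iff_posSemidef.mpr hD.posSemidef)
    refine ⟨A, fun h => ?_, hA⟩
    have := hD.det_pos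
    rw [hA, det_mul, h, mul_zero] at this
    exact lt_irrefl _ this
  have hu : IsUnit A.det := isUnit_iff_ne_zero.mpr hA
  set Y := A⁻¹ᴴ * X * A⁻¹ with hY
  have hYh : Y.IsHermitian := by
    rw [hY]
    exact isHermitian_conjTranspose_mul_mul _ hX
  have h1 : D + I • X = Aᴴ * accr 1 Y * A := by
    have e1 : A⁻¹ * A = 1 := nonsing_inv_mul A hu
    have e2 : Aᴴ * A⁻¹ᴴ = 1 := by rw [← conjTranspose_mul, e1, conjTranspose_one]
    rw [accr, Matrix.mul_add, Matrix.add_mul, hDA, hY]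
    simp only [ofReal_one, one_smul, Matrix.mul_one, Matrix.mul_smul, smul_mul]
    congr 2
    calc X = (Aᴴ * A⁻¹ᴴ) * X * (A⁻¹ * A) := by rw [e1, e2]; simp
      _ = _ := by simp only [Matrix.mul_assoc]
  obtain ⟨h2, h3⟩ := integral_gaussian one_pos hYh
  have h3' : (accr 1 Y).det ≠ 0 := h3
  have hdet : (D + I • X).det = ((‖A.det‖ ^ 2 : ℝ) : ℂ) * (accr 1 Y).det := by
    rw [h1, det_mul, det_mul, det_conjTranspose, mul_right_comm, star_def, conj_mul']
    push_cast
    rfl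
  have hAn : ((‖A.det‖ ^ 2 : ℝ) : ℂ) ≠ 0 := by
    have := norm_pos_iff.mpr hA
    exact_mod_cast (by positivity : (‖A.det‖ ^ 2 : ℝ) ≠ 0)
  refine ⟨?_, by rw [hdet]; exact mul_ne_zero hAn h3'⟩
  have h4 : ∀ φ, qf (D + I • X) φ = qf (accr 1 Y) (A *ᵥ φ) := by
    intro φ; rw [qf_mulVec, h1]
  simp only [h4]
  have h5 : (∫ φ : m → ℂ, exp (-qf (accr 1 Y) (A *ᵥ φ))) =
      ∫ ψ, exp (-qf (accr 1 Y) ψ) ∂(volume.map (A *ᵥ ·)) :=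
    ((mulVecHomeo A hA).measurableEmbedding.integral_map (fun ψ => exp (-qf (accr 1 Y) ψ))).symm
  rw [h5, map_mulVec_volume A hA, integral_smul_measure, hdet]
  rw [show (∫ ψ : m → ℂ, exp (-qf (accr 1 Y) ψ)) = _ from h2,
    ENNReal.toReal_ofReal (by positivity), real_smul]
  push_cast
  change _ = _ / (_ * (accr 1 Y).det)
  change _ * (_ / (accr 1 Y).det) = _
  push_cast at hAn
  field_simp

/-- The determinant is monotone on matrices with positive real part. -/
theorem norm_det_le_of_re_qf_le {P M : Matrix m m ℂ} (hP : P.PosDef)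
    (h : ∀ φ, (qf P φ).re ≤ (qf M φ).re) : ‖P.det‖ ≤ ‖M.det‖ := by
  set D : Matrix m m ℂ := (2 : ℂ)⁻¹ • (M + Mᴴ) with hD
  set X : Matrix m m ℂ := (-I * (2 : ℂ)⁻¹) • (M - Mᴴ) with hXdef
  have hDh : D.IsHermitian := by
    rw [IsHermitian, hD]
    simp [add_comm]
  have hX : X.IsHermitian := by
    rw [IsHermitian, hXdef]
    simp only [conjTranspose_smul, conjTranspose_sub, conjTranspose_conjTranspose]
    rw [← neg_sub M Mᴴ, smul_neg, ← neg_smul]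
    simp
  have hM : M = D + I • X := by
    rw [hD, hXdef, smul_smul, ← mul_assoc, mul_neg, I_mul_I, neg_neg, one_mul, ← smul_add]
    rw [show M + Mᴴ + (M - Mᴴ) = (2 : ℂ) • M by rw [two_smul]; abel, smul_smul]
    norm_num
  have hconj : ∀ φ, qf Mᴴ φ = conj (qf M φ) := by
    intro φ
    rw [qf_apply, qf_apply, map_sum, sum_comm]
    refine sum_congr rfl fun i _ => ?_
    rw [map_sum]
    refine sum_congr rfl fun j _ => ?_
    simp
    ring
  have hDre : ∀ φ, qf D φ = ((qf M φ).re : ℂ) := by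
    intro φ
    rw [hD, qf_smul, qf_add, hconj, add_conj]
    push_cast
    ring
  have hDp : D.PosDef := by
    refine PosDef.of_dotProduct_mulVec_pos hDh fun x hx => ?_
    have h1 := hP.re_dotProduct_pos hx
    have h2 : (0 : ℝ) < (qf M x).re := lt_of_lt_of_le h1 (h x)
    change 0 < qf D x
    rw [hDre]
    exact_mod_cast h2
  obtain ⟨g1, g2⟩ := integral_gaussian_posDef hDp hX
  obtain ⟨g3, g4⟩ := integral_gaussian_posDef hP (isHermitian_zero (n := m) (α := ℂ))
  rw [← hM] at g1 g2
  rw [smul_zero, add_zero] at g3 g4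
  have hPim : ∀ φ, qf P φ = ((qf P φ).re : ℂ) := by
    intro φ
    have := qf_im_of_isHermitian hP.isHermitian φ
    exact Complex.ext (by simp) (by simpa using this)
  have hint : Integrable fun φ : m → ℂ => Real.exp (-(qf P φ).re) := by
    by_contra hni
    have : (∫ φ : m → ℂ, exp (-qf P φ)) = 0 := by
      apply integral_undef
      intro hi
      refine hni (hi.norm.congr (.of_forall fun φ => ?_))
      simp [norm_exp]
    rw [g3] at this
    have hpi : (Real.pi : ℂ) ≠ 0 := by exact_mod_cast Real.pi_ne_zero
    exact div_ne_zero (pow_ne_zero _ hpi) g4 this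
  have key : ‖(Real.pi : ℂ) ^ Fintype.card m / M.det‖ ≤
      ‖(Real.pi : ℂ) ^ Fintype.card m / P.det‖ := by
    rw [← g1, ← g3]
    have e : (∫ φ : m → ℂ, exp (-qf P φ)) = ((∫ φ : m → ℂ, Real.exp (-(qf P φ).re) : ℝ) : ℂ) := by
      rw [← integral_complex_ofReal]
      congr 1
      ext φ
      push_cast
      rw [← hPim]
    rw [e, norm_real, Real.norm_of_nonneg (integral_nonneg fun φ => (Real.exp_pos _).le)]
    refine norm_integral_le_of_norm_le hint (.of_forall fun φ => ?_)
    rw [norm_exp, neg_re]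
    exact Real.exp_le_exp.mpr (neg_le_neg (h φ))
  rw [norm_div, norm_div] at key
  have hpos : 0 < ‖(Real.pi : ℂ) ^ Fintype.card m‖ := by
    have := Real.pi_pos
    rw [norm_pow, norm_real, Real.norm_of_nonneg this.le]
    positivity
  exact (div_le_div_iff_of_pos_left hpos (norm_pos_iff.mpr g2) (norm_pos_iff.mpr g4)).mp key

/-- Factorization of `det (x + A)` with the eigenvalues of `A`. -/
theorem exists_det_add_smul_eq_prod {n : ℕ} (A : 𝕄 n) :
    ∃ μ : Fin n → ℂ, (∀ x : ℂ, (x • 1 + A).det = ∏ j, (x + μ j)) ∧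
      ∀ j, ∃ v : Fin n → ℂ, v ≠ 0 ∧ A *ᵥ v = μ j • v := by
  set p := (-A).charpoly with hp
  have hmonic : p.Monic := charpoly_monic _
  have hcard : p.roots.card = n := by
    rw [← (IsAlgClosed.splits p).natDegree_eq_card_roots, charpoly_natDegree_eq_dim,
      Fintype.card_fin]
  have hlen : p.roots.toList.length = n := by rw [Multiset.length_toList, hcard]
  have heval : ∀ x : ℂ, (x • 1 + A).det = p.eval x := by
    intro x
    rw [hp, eval_charpoly]
    congr 1
    ext i j
    simp [scalar_apply, Matrix.one_apply, diagonal_apply]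
  refine ⟨fun j => -(p.roots.toList.get (Fin.cast hlen.symm j)), fun x => ?_, fun j => ?_⟩
  · rw [heval, (IsAlgClosed.splits p).eval_eq_prod_roots_of_monic hmonic]
    conv_lhs => rw [← Multiset.coe_toList p.roots]
    rw [Multiset.map_coe, Multiset.prod_coe, ← List.prod_ofFn]
    congr 1
    refine List.ext_get (by simp [hlen]) fun i h1 h2 => ?_
    simp [sub_eq_add_neg]
  · set r := p.roots.toList.get (Fin.cast hlen.symm j)
    have hroot : p.eval r = 0 := by
      have : r ∈ p.roots := by
        rw [← Multiset.mem_toList]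
        exact List.get_mem _ _
      exact (Polynomial.mem_roots'.mp this).2
    rw [← heval] at hroot
    obtain ⟨v, hv, hv2⟩ := exists_mulVec_eq_zero_iff.mpr hroot
    refine ⟨v, hv, ?_⟩
    rw [add_mulVec, smul_mulVec, one_mulVec] at hv2
    rw [neg_smul]
    exact eq_neg_of_add_eq_zero_right hv2

/-- By the maximum principle, a product of linear factors is at least as large somewhere on the
unit circle as the product of the maxima of the moduli of the coefficients. -/
theorem exists_prod_max_le_prod {n : ℕ} (μ : Fin n → ℂ) {u : ℝ} (hu : 0 < u) :
    ∃ η : ℂ, ‖η‖ = 1 ∧ ∏ k, max ‖μ k‖ u ≤ ∏ k, ‖μ k + η * u‖ := by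
  -- the factors with `‖μ k‖ < u` are reflected, which preserves the modulus on the unit circle and
  -- makes the value at the centre maximal
  set q : ℂ → ℂ := fun η => ∏ k, if u ≤ ‖μ k‖ then μ k + η * u else u + η * conj (μ k) with hq
  have hd : Differentiable ℂ q := by
    rw [hq]
    refine Differentiable.fun_finsetProd fun k _ => ?_
    split_ifs <;> fun_prop
  obtain ⟨η, hη, hmax⟩ := exists_mem_frontier_isMaxOn_norm (f := q)
    (Metric.isBounded_ball (x := (0 : ℂ)) (r := 1)) ⟨0, by simp⟩ hd.diffContOnCl
  rw [frontier_ball (0 : ℂ) one_ne_zero] at hη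
  have hη1 : ‖η‖ = 1 := by simpa using hη
  refine ⟨η, hη1, ?_⟩
  have h0 : ‖q 0‖ ≤ ‖q η‖ := hmax (subset_closure (by simp))
  have h1 : ‖q 0‖ = ∏ k, max ‖μ k‖ u := by
    rw [hq, norm_prod]
    refine prod_congr rfl fun k _ => ?_
    split_ifs with h
    · simp [max_eq_left h]
    · rw [max_eq_right (not_le.mp h).le]
      simp [abs_of_pos hu]
  have h2 : ‖q η‖ = ∏ k, ‖μ k + η * u‖ := by
    rw [hq, norm_prod]
    refine prod_congr rfl fun k _ => ?_
    split_ifs with h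
    · rfl
    · have e : (u : ℂ) + η * conj (μ k) = η * conj (μ k + η * u) := by
        have hηη : η * conj η = 1 := by rw [mul_conj, normSq_eq_norm_sq, hη1]; simp
        rw [map_add, map_mul, conj_ofReal]
        linear_combination -(u : ℂ) * hηη
      rw [e, norm_mul, hη1, one_mul, RCLike.norm_conj]
  rwa [h1, h2] at h0

end DetBounds

/-! ### Integrability of inverse determinants over Hermitian `2 × 2` matrices -/

section InverseDet

/-- A bound on the integral of a negative power of a product of `n` translates of the regularized
norm, uniform in the translations. -/
theorem exists_lintegral_prod_max_le {E : Type*} [NormedAddCommGroup E] [NormedSpace ℝ E]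
    [FiniteDimensional ℝ E] [MeasureSpace E] [BorelSpace E] [(volume : Measure E).IsAddHaarMeasure]
    {n : ℕ} (hn : n ≠ 0) {u s : ℝ} (hu : 0 < u) (hs : (Module.finrank ℝ E : ℝ) < s * n) :
    ∃ J : ENNReal, J < ⊤ ∧ ∀ β : Fin n → E,
      ∫⁻ z : E, ENNReal.ofReal ((∏ j, max ‖z + β j‖ u) ^ (-s)) ≤ J := by
  have hn0 : (0 : ℝ) < n := by positivity
  set r := s * n with hr
  set c := u / (1 + u) with hc
  have hc0 : 0 < c := by positivity
  set J : ENNReal := ENNReal.ofReal (c ^ (-r)) * ∫⁻ z : E, ENNReal.ofReal ((1 + ‖z‖) ^ (-r)) with hJ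
  have hone : ∀ b : E, ∫⁻ z : E, ENNReal.ofReal ((max ‖z + b‖ u) ^ (-r)) ≤ J := by
    intro b
    rw [hJ, ← lintegral_const_mul _ (by fun_prop), ← lintegral_add_right_eq_self
      (fun z : E => ENNReal.ofReal (c ^ (-r)) * ENNReal.ofReal ((1 + ‖z‖) ^ (-r))) b]
    refine lintegral_mono fun z => ?_
    rw [← ENNReal.ofReal_mul (by positivity), ← Real.mul_rpow hc0.le (by positivity)]
    refine ENNReal.ofReal_le_ofReal (Real.rpow_le_rpow_of_nonpos (by positivity) ?_ (by linarith))
    rw [hc, div_mul_eq_mul_div, div_le_iff₀ (by positivity)]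
    have h1 := le_max_left ‖z + b‖ u
    have h2 := le_max_right ‖z + b‖ u
    nlinarith
  have hJfin : J < ⊤ := by
    refine ENNReal.mul_lt_top ENNReal.ofReal_lt_top ?_
    have := (integrable_one_add_norm (μ := (volume : Measure E)) hs).lintegral_lt_top
    exact this
  refine ⟨J, hJfin, fun β => ?_⟩
  have hmeas : ∀ j, Measurable fun z : E => ENNReal.ofReal ((max ‖z + β j‖ u) ^ (-r)) := by
    intro j; fun_prop
  calc ∫⁻ z : E, ENNReal.ofReal ((∏ j, max ‖z + β j‖ u) ^ (-s))
      = ∫⁻ z : E, ∏ j : Fin n, ENNReal.ofReal ((max ‖z + β j‖ u) ^ (-r)) ^ ((n : ℝ)⁻¹) := by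
        refine lintegral_congr fun z => ?_
        rw [← Real.finsetProd_rpow _ _ (fun j _ => by positivity),
          ENNReal.ofReal_prod_of_nonneg (fun j _ => by positivity)]
        refine prod_congr rfl fun j _ => ?_
        rw [ENNReal.ofReal_rpow_of_nonneg (by positivity) (by positivity),
          ← Real.rpow_mul (by positivity)]
        congr 2
        rw [hr]
        field_simp
    _ ≤ ∏ j : Fin n, (∫⁻ z : E, ENNReal.ofReal ((max ‖z + β j‖ u) ^ (-r))) ^ ((n : ℝ)⁻¹) := by
        refine ENNReal.lintegral_prod_norm_pow_le _ (fun j _ => (hmeas j).aemeasurable) ?_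
          (fun j _ => by positivity)
        simp [hn0.ne']
    _ ≤ ∏ j : Fin n, J ^ ((n : ℝ)⁻¹) := by
        refine prod_le_prod' fun j _ => ?_
        exact ENNReal.rpow_le_rpow (hone _) (by positivity)
    _ = J := by
        rw [prod_const, card_univ, Fintype.card_fin, ← ENNReal.rpow_natCast,
          ← ENNReal.rpow_mul, inv_mul_cancel₀ hn0.ne', ENNReal.rpow_one]

variable {n : ℕ}

theorem sqn_add_le (p q : Fin n → ℂ) : sqn (p + q) ≤ 2 * sqn p + 2 * sqn q := by
  simp only [sqn, mul_sum, ← sum_add_distrib, Pi.add_apply]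
  refine sum_le_sum fun i _ => ?_
  have := norm_add_le (p i) (q i)
  nlinarith [norm_nonneg (p i + q i), sq_nonneg (‖p i‖ - ‖q i‖)]

theorem qf_mul_conjTranspose (A : 𝕄 n) (v : Fin n → ℂ) : qf (A * Aᴴ) v = (sqn (Aᴴ *ᵥ v) : ℂ) := by
  rw [← qf_one, qf_mulVec]
  simp

theorem qf_conjTranspose_mul (A : 𝕄 n) (v : Fin n → ℂ) : qf (Aᴴ * A) v = (sqn (A *ᵥ v) : ℂ) := by
  rw [← qf_one, qf_mulVec]
  simp

theorem sq_mul_sqn_le {u : ℝ} (hu : 0 < u) {A : 𝕄 n} (hA : ∀ v, u * sqn v ≤ (qf A v).im)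
    (v : Fin n → ℂ) : u ^ 2 * sqn v ≤ sqn (Aᴴ *ᵥ v) := by
  have h1 : qf A v = ∑ i, conj ((Aᴴ *ᵥ v) i) * v i := by
    rw [qf_apply, sum_comm]
    refine sum_congr rfl fun j _ => ?_
    rw [mulVec, dotProduct, map_sum, sum_mul]
    refine sum_congr rfl fun i _ => ?_
    rw [map_mul, conjTranspose_apply, star_def, conj_conj]
    ring
  have h2 : (u * sqn v) ^ 2 ≤ sqn (Aᴴ *ᵥ v) * sqn v := by
    have h3 : u * sqn v ≤ ∑ i, ‖(Aᴴ *ᵥ v) i‖ * ‖v i‖ := by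
      refine (hA v).trans ((im_le_norm _).trans ?_)
      rw [h1]
      refine (norm_sum_le _ _).trans (le_of_eq ?_)
      simp
    calc (u * sqn v) ^ 2 ≤ (∑ i, ‖(Aᴴ *ᵥ v) i‖ * ‖v i‖) ^ 2 := by
          have := sqn_nonneg v
          gcongr
      _ ≤ _ := sum_mul_sq_le_sq_mul_sq _ _ _
  rcases (sqn_nonneg v).eq_or_lt with h0 | h0
  · rw [← h0, mul_zero]; exact sqn_nonneg _
  · have : u ^ 2 * sqn v * sqn v ≤ sqn (Aᴴ *ᵥ v) * sqn v := by nlinarith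
    exact le_of_mul_le_mul_right this h0

/-- The lower bound `det (Y Y^* + W W^*) ≥ 2⁻ⁿ ∏ max(|ω_k|, u)^2` with the eigenvalues `ω_k` of
`W`, when the imaginary part of `Y` is at least `u`. -/
theorem prod_max_sq_le_norm_det {u : ℝ} (hu : 0 < u) {Y W : 𝕄 n} (hY : ∀ v, u * sqn v ≤ (qf Y v).im)
    {ω : Fin n → ℂ} (hω : ∀ x : ℂ, (x • 1 + W).det = ∏ j, (x + ω j)) :
    (2 : ℝ)⁻¹ ^ n * (∏ k, max ‖ω k‖ u) ^ 2 ≤ ‖(Y * Yᴴ + W * Wᴴ).det‖ := by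
  obtain ⟨η, hη, hprod⟩ := exists_prod_max_le_prod ω hu
  set V : 𝕄 n := (η * u) • 1 + W with hV
  have hVdet : ‖V.det‖ = ∏ k, ‖ω k + η * u‖ := by
    rw [hV, hω, norm_prod]
    exact prod_congr rfl fun k _ => by rw [add_comm]
  have hpos : 0 < ∏ k, max ‖ω k‖ u := prod_pos fun k _ => lt_max_of_lt_right hu
  have hV0 : V.det ≠ 0 := by
    rw [← norm_pos_iff, hVdet]
    exact lt_of_lt_of_le hpos hprod
  have hP : ((2 : ℂ)⁻¹ • (V * Vᴴ)).PosDef := by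
    have h1 : (V * Vᴴ).PosDef := by
      refine PosDef.of_dotProduct_mulVec_pos (isHermitian_mul_conjTranspose_self V) fun x hx => ?_
      change 0 < qf (V * Vᴴ) x
      rw [qf_mul_conjTranspose]
      have hne : Vᴴ *ᵥ x ≠ 0 := by
        intro h0
        apply hx
        have : IsUnit Vᴴ.det := by
          rw [det_conjTranspose]
          exact (isUnit_iff_ne_zero.mpr hV0).star
        have h2 := congrArg (Vᴴ⁻¹ *ᵥ ·) h0
        simpa [mulVec_mulVec, nonsing_inv_mul _ this] using h2
      have : 0 < sqn (Vᴴ *ᵥ x) := by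
        refine lt_of_lt_of_le ?_ (norm_sq_le_sqn _)
        have := norm_pos_iff.mpr hne
        positivity
      exact_mod_cast this
    exact h1.smul (by norm_num)
  have h2 : ∀ v, (qf ((2 : ℂ)⁻¹ • (V * Vᴴ)) v).re ≤ (qf (Y * Yᴴ + W * Wᴴ) v).re := by
    intro v
    rw [qf_smul, qf_add, qf_mul_conjTranspose, qf_mul_conjTranspose, qf_mul_conjTranspose]
    have e1 : Vᴴ *ᵥ v = (conj η * u) • v + Wᴴ *ᵥ v := by
      rw [hV, conjTranspose_add, add_mulVec, conjTranspose_smul,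
        conjTranspose_one, smul_mulVec, one_mulVec]
      simp
    have e2 : sqn ((conj η * (u : ℂ)) • v) = u ^ 2 * sqn v := by
      simp [sqn, mul_sum, hη, mul_pow]
    have e3 := sqn_add_le ((conj η * (u : ℂ)) • v) (Wᴴ *ᵥ v)
    have e4 := sq_mul_sqn_le hu hY v
    rw [e1]
    have : ((2 : ℂ)⁻¹ * (sqn ((conj η * (u : ℂ)) • v + Wᴴ *ᵥ v) : ℂ)).re =
        2⁻¹ * sqn ((conj η * (u : ℂ)) • v + Wᴴ *ᵥ v) := by
      rw [show (2 : ℂ)⁻¹ = ((2⁻¹ : ℝ) : ℂ) by push_cast; rfl, ← ofReal_mul, ofReal_re]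
    rw [this, add_re, ofReal_re, ofReal_re]
    rw [e2] at e3
    linarith
  have h3 := norm_det_le_of_re_qf_le hP h2
  refine le_trans ?_ h3
  rw [det_smul, Fintype.card_fin, det_mul, det_conjTranspose, norm_mul,
    norm_mul, norm_pow, norm_inv, norm_star, hVdet, ← pow_two]
  rw [show ‖(2 : ℂ)‖ = 2 by simp]
  gcongr

theorem im_eigenvalue_ge {m : Type*} [Fintype m] [DecidableEq m] {u : ℝ} {A : Matrix m m ℂ}
    (hA : ∀ v, u * sqn v ≤ (qf A v).im) {μ : ℂ} {v : m → ℂ} (hv : v ≠ 0) (h : A *ᵥ v = μ • v) :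
    u ≤ μ.im := by
  have h1 : qf A v = μ * sqn v := by
    rw [← qf_one, ← qf_smul, qf, qf, h, smul_mulVec, one_mulVec]
  have h2 : 0 < sqn v := by
    refine lt_of_lt_of_le ?_ (norm_sq_le_sqn _)
    have := norm_pos_iff.mpr hv
    positivity
  have h3 := hA v
  rw [h1, mul_im, ofReal_re, ofReal_im, mul_zero, zero_add] at h3
  exact le_of_mul_le_mul_right h3 h2

theorem max_abs_re_le_norm {u : ℝ} {μ : ℂ} (h : u ≤ μ.im) (x : ℝ) :
    max |x + μ.re| u ≤ ‖(x : ℂ) + μ‖ := by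
  refine max_le ?_ (h.trans ?_)
  · simpa using abs_re_le_norm ((x : ℂ) + μ)
  · simpa using im_le_norm ((x : ℂ) + μ)

/-- Interpolation between two lower bounds: the quantity `q` is eliminated with weight `t`. -/
theorem interpolation_bound {n : ℕ} {u D E F q t : ℝ} (hu : 0 < u) (hD : 0 < D) (hE : 0 < E)
    (hF : 0 < F) (ht : 0 < t) (ht2 : t ≤ 1 / 2) (h1 : u ^ n * q ≤ D) (h2 : 1 ≤ q)
    (h3 : (2 : ℝ)⁻¹ ^ n * E ^ 2 ≤ F ^ 2 * q) :
    (F * D)⁻¹ ≤ (u ^ n) ^ (-(1 - t)) * ((2 : ℝ)⁻¹ ^ n) ^ (-t) *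
      (D ^ (-t) * E ^ (-(2 * t)) * F ^ (-(1 - 2 * t))) := by
  have hq : 0 < q := by linarith
  have hun : 0 < u ^ n := by positivity
  have hD1 : D ^ (-(1 - t)) ≤ (u ^ n) ^ (-(1 - t)) * q ^ (-t) := by
    calc D ^ (-(1 - t)) ≤ (u ^ n * q) ^ (-(1 - t)) :=
          Real.rpow_le_rpow_of_nonpos (by positivity) h1 (by linarith)
      _ = (u ^ n) ^ (-(1 - t)) * q ^ (-(1 - t)) := Real.mul_rpow hun.le hq.le
      _ ≤ _ := by
          gcongr
          linarith
  have hq1 : q ^ (-t) ≤ ((2 : ℝ)⁻¹ ^ n) ^ (-t) * (E ^ (-(2 * t)) * F ^ (2 * t)) := by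
    have h4 : (2 : ℝ)⁻¹ ^ n * E ^ 2 / F ^ 2 ≤ q := by
      rw [div_le_iff₀ (by positivity)]; linarith
    calc q ^ (-t) ≤ ((2 : ℝ)⁻¹ ^ n * E ^ 2 / F ^ 2) ^ (-t) :=
          Real.rpow_le_rpow_of_nonpos (by positivity) h4 (by linarith)
      _ = ((2 : ℝ)⁻¹ ^ n) ^ (-t) * ((E ^ 2) ^ (-t) * ((F ^ 2) ^ (-t))⁻¹) := by
          rw [Real.div_rpow (by positivity) (by positivity), Real.mul_rpow (by positivity)
            (by positivity), div_eq_mul_inv, mul_assoc]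
      _ = _ := by
          have e : ∀ z : ℝ, 0 < z → (z ^ 2) ^ (-t) = z ^ (-(2 * t)) := by
            intro z hz
            rw [← Real.rpow_natCast, ← Real.rpow_mul hz.le]
            congr 1
            push_cast
            ring
          rw [e E hE, e F hF, ← Real.rpow_neg hF.le, neg_neg]
  have hDD : D⁻¹ = D ^ (-t) * D ^ (-(1 - t)) := by
    rw [← Real.rpow_add hD, ← Real.rpow_neg_one]
    congr 1
    ring
  have hFF : F ^ (-(1 - 2 * t)) = F⁻¹ * F ^ (2 * t) := by
    rw [← Real.rpow_neg_one, ← Real.rpow_add hF]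
    congr 1
    ring
  rw [mul_inv, hDD, hFF]
  calc F⁻¹ * (D ^ (-t) * D ^ (-(1 - t)))
      ≤ F⁻¹ * (D ^ (-t) * ((u ^ n) ^ (-(1 - t)) *
        (((2 : ℝ)⁻¹ ^ n) ^ (-t) * (E ^ (-(2 * t)) * F ^ (2 * t))))) := by
        gcongr
        exact hD1.trans (by gcongr)
    _ = _ := by ring

end InverseDet

section InverseDetTwo

variable {n : ℕ}

theorem sqn_sumElim {m k : Type*} [Fintype m] [Fintype k] (v : m → ℂ) (w : k → ℂ) :
    sqn (Sum.elim v w) = sqn v + sqn w := by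
  simp [sqn, Fintype.sum_sum_type]

theorem qf_fromBlocks {m k : Type*} [Fintype m] [Fintype k] (a : Matrix m m ℂ) (b : Matrix m k ℂ)
    (b' : Matrix k m ℂ) (c : Matrix k k ℂ) (v : m → ℂ) (w : k → ℂ) :
    qf (fromBlocks a b b' c) (Sum.elim v w) =
      star v ⬝ᵥ (a *ᵥ v + b *ᵥ w) + star w ⬝ᵥ (b' *ᵥ v + c *ᵥ w) := by
  rw [qf, fromBlocks_mulVec, dotProduct, Fintype.sum_sum_type]
  rfl

theorem qf_im_real_add (x : ℝ) (A : 𝕄 n) (v : Fin n → ℂ) :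
    (qf ((x : ℂ) • 1 + A) v).im = (qf A v).im := by
  rw [qf_add, qf_smul, qf_one]
  simp [← ofReal_mul]

theorem det_ne_zero_of_im_ge {m : Type*} [Fintype m] [DecidableEq m] {u : ℝ} (hu : 0 < u)
    {A : Matrix m m ℂ} (hA : ∀ v, u * sqn v ≤ (qf A v).im) : A.det ≠ 0 := by
  intro h
  obtain ⟨v, hv, h0⟩ := exists_mulVec_eq_zero_iff.mpr h
  have h1 := im_eigenvalue_ge hA hv (μ := 0) (by simpa using h0)
  simp at h1
  linarith

/-- The Schur complement of a block matrix with imaginary part at least `u` gains the imaginary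
part of the eliminated components. -/
theorem im_qf_schur_ge {m k : Type*} [Fintype m] [Fintype k] [DecidableEq k] {u : ℝ} (hu : 0 < u)
    {a : Matrix m m ℂ} {b : Matrix m k ℂ} {b' : Matrix k m ℂ} {c : Matrix k k ℂ}
    (hK : ∀ φ, u * sqn φ ≤ (qf (fromBlocks a b b' c) φ).im) :
    (∀ v, u * sqn v ≤ (qf c v).im) ∧
    ∀ v, u * (sqn v + sqn ((c⁻¹ * b') *ᵥ v)) ≤ (qf (a - b * (c⁻¹ * b')) v).im := by
  have hc : ∀ v, u * sqn v ≤ (qf c v).im := by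
    intro v
    have h := hK (Sum.elim 0 v)
    rw [qf_fromBlocks, sqn_sumElim] at h
    simpa [sqn, qf] using h
  refine ⟨hc, fun v => ?_⟩
  have hdet := det_ne_zero_of_im_ge hu hc
  have h := hK (Sum.elim v (-((c⁻¹ * b') *ᵥ v)))
  rw [qf_fromBlocks, sqn_sumElim] at h
  have e1 : b' *ᵥ v + c *ᵥ (-((c⁻¹ * b') *ᵥ v)) = 0 := by
    rw [mulVec_neg, mulVec_mulVec, mul_nonsing_inv_cancel_left _ _ (Ne.isUnit hdet), add_neg_cancel]
  have e2 : a *ᵥ v + b *ᵥ (-((c⁻¹ * b') *ᵥ v)) = (a - b * (c⁻¹ * b')) *ᵥ v := by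
    rw [mulVec_neg, mulVec_mulVec, sub_mulVec, sub_eq_add_neg]
  have e3 : sqn (-((c⁻¹ * b') *ᵥ v)) = sqn ((c⁻¹ * b') *ᵥ v) := by simp [sqn]
  rw [e1, e2, e3, dotProduct_zero, add_zero] at h
  exact h

/-- The pointwise bound behind the integrability of the inverse determinant: `x`, `w` and `y` are
separated at the cost of translations that depend on the other variables. -/
theorem inv_norm_det_le {u t : ℝ} (hu : 0 < u) (ht : 0 < t) (ht2 : t ≤ 1 / 2) {a b b' c : 𝕄 n}
    (hK : ∀ φ, u * sqn φ ≤ (qf (fromBlocks a b b' c) φ).im) :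
    ∃ β : Fin n → ℂ, ∃ γ : Fin n → ℝ, ∀ (y : ℝ) (w : ℂ), ∃ κ : Fin n → ℝ, ∀ x : ℝ,
      ‖(fromBlocks ((x : ℂ) • 1 + a) (w • 1 + b) (conj w • 1 + b') ((y : ℂ) • 1 + c)).det‖⁻¹ ≤
        (u ^ n) ^ (-(1 - t)) * ((2 : ℝ)⁻¹ ^ n) ^ (-t) *
          ((∏ j, max ‖x + κ j‖ u) ^ (-t) * (∏ j, max ‖w + β j‖ u) ^ (-(2 * t)) *
            (∏ j, max ‖y + γ j‖ u) ^ (-(1 - 2 * t))) := by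
  obtain ⟨β, hβ, -⟩ := exists_det_add_smul_eq_prod b'
  obtain ⟨γ, hγ, hγv⟩ := exists_det_add_smul_eq_prod c
  have hc := (im_qf_schur_ge hu hK).1
  refine ⟨fun j => conj (β j), fun j => (γ j).re, fun y w => ?_⟩
  set Y := (y : ℂ) • 1 + c with hY
  set W := conj w • 1 + b' with hW
  set N := Y⁻¹ * W with hN
  set S := a - (w • 1 + b) * N with hS
  have hK' : ∀ φ, u * sqn φ ≤ (qf (fromBlocks a (w • 1 + b) W Y) φ).im := by
    intro φ
    refine (hK φ).trans (le_of_eq ?_)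
    have : fromBlocks a (w • 1 + b) W Y = fromBlocks 0 (w • 1) (conj w • 1) ((y : ℂ) • 1) +
          fromBlocks a b b' c := by
      rw [fromBlocks_add, zero_add]
    rw [this, qf_add, add_im, right_eq_add, qf_im_of_isHermitian]
    rw [IsHermitian, fromBlocks_conjTranspose]
    simp
  obtain ⟨hYim, hSim⟩ := im_qf_schur_ge hu hK'
  have hY0 := det_ne_zero_of_im_ge hu hYim
  obtain ⟨κ, hκ, hκv⟩ := exists_det_add_smul_eq_prod S
  have hSim' : ∀ v, u * sqn v ≤ (qf S v).im := fun v =>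
    le_trans (by have := sqn_nonneg ((Y⁻¹ * W) *ᵥ v); nlinarith [sqn_nonneg v]) (hSim v)
  refine ⟨fun j => (κ j).re, fun x => ?_⟩
  have hYW : W = Y * N := by
    rw [hN, ← mul_assoc, mul_nonsing_inv _ (Ne.isUnit hY0), one_mul]
  have hdet : (fromBlocks ((x : ℂ) • 1 + a) (w • 1 + b) W Y).det =
      Y.det * ((x : ℂ) • 1 + S).det := by
    let := invertibleOfIsUnitDet Y (Ne.isUnit hY0)
    rw [det_fromBlocks₂₂, invOf_eq_nonsing_inv, hS, hN, ← mul_assoc, add_sub_assoc]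
  -- `q` measures the coupling of the blocks: it increases the Schur complement (`hD`), and when
  -- it is small the off-diagonal block is controlled by `Y` (`hF`)
  set q := ‖(1 + Nᴴ * N).det‖ with hq
  have hqf : ∀ v, qf (1 + Nᴴ * N) v = ((sqn v + sqn (N *ᵥ v) : ℝ) : ℂ) := by
    intro v
    rw [qf_add, qf_one, qf_conjTranspose_mul]
    push_cast
    rfl
  have hPD : ∀ r : ℝ, 0 < r → ((r : ℂ) • (1 + Nᴴ * N)).PosDef := by
    intro r hr
    refine PosDef.smul ?_ (by exact_mod_cast hr)
    exact PosDef.one.add_posSemidef (posSemidef_conjTranspose_mul_self N)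
  have hq1 : 1 ≤ q := by
    have := norm_det_le_of_re_qf_le (P := (1 : 𝕄 n)) (M := 1 + Nᴴ * N) PosDef.one fun v => by
        rw [hqf, qf_one, ofReal_re, ofReal_re]
        linarith [sqn_nonneg (N *ᵥ v)]
    simpa using this
  have hD : u ^ n * q ≤ ‖((x : ℂ) • 1 + S).det‖ := by
    have := norm_det_le_of_re_qf_le (M := (-I) • ((x : ℂ) • 1 + S)) (hPD u hu) fun v => by
        rw [qf_smul, hqf, qf_smul, ← ofReal_mul, ofReal_re]
        have e : (-I * qf ((x : ℂ) • 1 + S) v).re = (qf S v).im := by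
          rw [← qf_im_real_add x S v]
          simp
        rw [e]
        exact hSim v
    rw [det_smul, det_smul, norm_mul, norm_mul, Fintype.card_fin] at this
    simpa [abs_of_pos hu] using this
  have hF : (2 : ℝ)⁻¹ ^ n * (∏ k, max ‖w + conj (β k)‖ u) ^ 2 ≤ ‖Y.det‖ ^ 2 * q := by
    have h1 := prod_max_sq_le_norm_det hu hYim (W := W) (ω := fun k => conj w + β k) fun z => by
      rw [hW, ← add_assoc, ← add_smul, hβ]
      exact prod_congr rfl fun k _ => by ring
    have h2 : Y * Yᴴ + W * Wᴴ = Y * (1 + N * Nᴴ) * Yᴴ := by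
      rw [hYW, conjTranspose_mul]
      noncomm_ring
    rw [h2, det_mul, det_mul, det_one_add_mul_comm,
      det_conjTranspose, norm_mul, norm_mul, norm_star] at h1
    have h3 : ∀ k, ‖w + conj (β k)‖ = ‖conj w + β k‖ := by
      intro k
      rw [← norm_conj (conj w + β k), map_add, conj_conj]
    simp only [h3]
    refine h1.trans (le_of_eq ?_)
    rw [hq]
    ring
  have hE0 : 0 < ∏ k, max ‖w + conj (β k)‖ u := prod_pos fun k _ => lt_max_of_lt_right hu
  have hD0 : 0 < ‖((x : ℂ) • 1 + S).det‖ := lt_of_lt_of_le (mul_pos (pow_pos hu n) (by linarith)) hD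
  have key := interpolation_bound hu hD0 hE0 (norm_pos_iff.mpr hY0) ht ht2 hD hq1 hF
  rw [hdet, norm_mul]
  refine key.trans ?_
  have hDlow : ∏ j, max ‖x + (κ j).re‖ u ≤ ‖((x : ℂ) • 1 + S).det‖ := by
    rw [hκ, norm_prod]
    refine Finset.prod_le_prod (fun j _ => by positivity) fun j _ => ?_
    obtain ⟨v, hv, hv2⟩ := hκv j
    exact max_abs_re_le_norm (im_eigenvalue_ge hSim' hv hv2) x
  have hFlow : ∏ j, max ‖y + (γ j).re‖ u ≤ ‖Y.det‖ := by
    rw [hY, hγ, norm_prod]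
    refine Finset.prod_le_prod (fun j _ => by positivity) fun j _ => ?_
    obtain ⟨v, hv, hv2⟩ := hγv j
    exact max_abs_re_le_norm (im_eigenvalue_ge hc hv hv2) y
  have hpos : ∀ f : Fin n → ℝ, 0 < ∏ j, max (f j) u := fun f =>
    prod_pos fun k _ => lt_max_of_lt_right hu
  gcongr ?_ * (?_ * _ * ?_)
  · exact Real.rpow_le_rpow_of_nonpos (hpos _) hDlow (by linarith)
  · exact Real.rpow_le_rpow_of_nonpos (hpos _) hFlow (by linarith)

/-- For `4 ≤ n` the inverse determinant of the translates of a block matrix by Hermitian `2 × 2`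
matrices is integrable, uniformly over the matrices with imaginary part at least `u`. -/
theorem exists_lintegral_inv_det_fromBlocks_le (hn : 4 ≤ n) {u : ℝ} (hu : 0 < u) :
    ∃ J : ENNReal, J < ⊤ ∧ ∀ a b b' c : 𝕄 n, (∀ φ, u * sqn φ ≤ (qf (fromBlocks a b b' c) φ).im) →
      ∫⁻ p : Herm2, ENNReal.ofReal ‖(fromBlocks ((p.1 : ℂ) • 1 + a) (p.2.2 • 1 + b)
        (conj p.2.2 • 1 + b') ((p.2.1 : ℂ) • 1 + c)).det‖⁻¹ ≤ J := by
  have hn' : (4 : ℝ) ≤ n := by exact_mod_cast hn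
  have hn0 : n ≠ 0 := by omega
  -- the exponents `t n = 5 / 4`, `2 t n = 5 / 2` and `(1 - 2 t) n = n - 5 / 2` exceed the
  -- dimensions `1`, `2` and `1`
  set t : ℝ := 5 / (4 * n) with ht
  have htn : t * n = 5 / 4 := by rw [ht]; field_simp
  have ht0 : 0 < t := by positivity
  have ht2 : t ≤ 1 / 2 := by rw [ht, div_le_iff₀ (by positivity)]; linarith
  obtain ⟨J₁, hJ₁, hb₁⟩ := exists_lintegral_prod_max_le (E := ℝ) hn0 (s := t) hu
    (by rw [htn]; norm_num)
  obtain ⟨J₂, hJ₂, hb₂⟩ := exists_lintegral_prod_max_le (E := ℂ) hn0 (s := 2 * t) hu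
    (by rw [mul_assoc, htn, finrank_real_complex]; norm_num)
  obtain ⟨J₃, hJ₃, hb₃⟩ := exists_lintegral_prod_max_le (E := ℝ) hn0 (s := 1 - 2 * t) hu
    (by rw [sub_mul, mul_assoc, htn]; norm_num; linarith)
  set C : ℝ := (u ^ n) ^ (-(1 - t)) * ((2 : ℝ)⁻¹ ^ n) ^ (-t)
  have hC0 : 0 ≤ C := by positivity
  refine ⟨ENNReal.ofReal C * J₁ * (J₃ * J₂), by
    exact ENNReal.mul_lt_top (ENNReal.mul_lt_top ENNReal.ofReal_lt_top hJ₁)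
      (ENNReal.mul_lt_top hJ₃ hJ₂), fun a b b' c hK => ?_⟩
  obtain ⟨β, γ, hbd⟩ := inv_norm_det_le hu ht0 ht2 hK
  choose κ hκ using hbd
  have hmeas : Measurable fun p : Herm2 => ENNReal.ofReal
      ‖(fromBlocks ((p.1 : ℂ) • 1 + a) (p.2.2 • 1 + b)
        (conj p.2.2 • 1 + b') ((p.2.1 : ℂ) • 1 + c)).det‖⁻¹ := by
    have : Continuous fun p : Herm2 => (fromBlocks ((p.1 : ℂ) • 1 + a) (p.2.2 • 1 + b)
        (conj p.2.2 • 1 + b') ((p.2.1 : ℂ) • 1 + c)).det := by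
      refine Continuous.matrix_det (Continuous.matrix_fromBlocks ?_ ?_ ?_ ?_) <;> fun_prop
    exact this.norm.measurable.inv.ennreal_ofReal
  have hpos : ∀ f : Fin n → ℝ, 0 < ∏ j, max (f j) u := fun f =>
    prod_pos fun k _ => lt_max_of_lt_right hu
  rw [Measure.volume_eq_prod, lintegral_prod_symm _ hmeas.aemeasurable]
  calc ∫⁻ q : ℝ × ℂ, ∫⁻ x : ℝ, _
      ≤ ∫⁻ q : ℝ × ℂ, ENNReal.ofReal C * J₁ *
          (ENNReal.ofReal ((∏ j, max ‖q.1 + γ j‖ u) ^ (-(1 - 2 * t))) *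
            ENNReal.ofReal ((∏ j, max ‖q.2 + β j‖ u) ^ (-(2 * t)))) := by
        refine lintegral_mono fun q => ?_
        have h1 : ∀ x : ℝ, ENNReal.ofReal ‖(fromBlocks ((x : ℂ) • 1 + a) (q.2 • 1 + b)
              (conj q.2 • 1 + b') ((q.1 : ℂ) • 1 + c)).det‖⁻¹ ≤
            ENNReal.ofReal C * (ENNReal.ofReal ((∏ j, max ‖q.1 + γ j‖ u) ^ (-(1 - 2 * t))) *
              ENNReal.ofReal ((∏ j, max ‖q.2 + β j‖ u) ^ (-(2 * t)))) *
            ENNReal.ofReal ((∏ j, max ‖x + κ q.1 q.2 j‖ u) ^ (-t)) := by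
          intro x
          have p1 := Real.rpow_nonneg (hpos fun j => ‖q.1 + γ j‖).le (-(1 - 2 * t))
          have p2 := Real.rpow_nonneg (hpos fun j => ‖q.2 + β j‖).le (-(2 * t))
          rw [← ENNReal.ofReal_mul p1, ← ENNReal.ofReal_mul hC0,
            ← ENNReal.ofReal_mul (mul_nonneg hC0 (mul_nonneg p1 p2))]
          refine ENNReal.ofReal_le_ofReal ((hκ q.1 q.2 x).trans (le_of_eq ?_))
          ring
        refine (lintegral_mono h1).trans ?_
        rw [lintegral_const_mul' _ _ (by finiteness)]
        refine (mul_le_mul_right (hb₁ (κ q.1 q.2)) _).trans (le_of_eq ?_)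
        ring
    _ = ENNReal.ofReal C * J₁ * ((∫⁻ y : ℝ, ENNReal.ofReal
          ((∏ j, max ‖y + γ j‖ u) ^ (-(1 - 2 * t)))) *
            ∫⁻ w : ℂ, ENNReal.ofReal ((∏ j, max ‖w + β j‖ u) ^ (-(2 * t)))) := by
        rw [lintegral_const_mul' _ _ (ENNReal.mul_lt_top ENNReal.ofReal_lt_top hJ₁).ne,
          Measure.volume_eq_prod]
        congr 1
        exact lintegral_prod_mul
          (f := fun y : ℝ => ENNReal.ofReal ((∏ j, max ‖y + γ j‖ u) ^ (-(1 - 2 * t))))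
          (g := fun w : ℂ => ENNReal.ofReal ((∏ j, max ‖w + β j‖ u) ^ (-(2 * t))))
          (Measurable.aemeasurable (by fun_prop)) (Measurable.aemeasurable (by fun_prop))
    _ ≤ _ := by
        gcongr
        · exact hb₃ γ
        · exact hb₂ β

end InverseDetTwo

section InverseDetBlock

variable {n : ℕ}

/-- The splitting of `ℂ² ⊗ ℂⁿ` into two copies of `ℂⁿ`. -/
def finTwoProdEquiv (n : ℕ) : Fin n ⊕ Fin n ≃ Fin 2 × Fin n :=
  ((Equiv.boolProdEquivSum (Fin n)).symm).trans (Equiv.prodCongr finTwoEquiv.symm (Equiv.refl _))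

theorem finTwoProdEquiv_inl (i : Fin n) : finTwoProdEquiv n (.inl i) = (0, i) := rfl

theorem finTwoProdEquiv_inr (i : Fin n) : finTwoProdEquiv n (.inr i) = (1, i) := rfl

theorem qf_submatrix {m k : Type*} [Fintype m] [Fintype k] (e : m ≃ k) (K : Matrix k k ℂ)
    (φ : m → ℂ) : qf (K.submatrix e e) φ = qf K (φ ∘ e.symm) := by
  rw [qf_apply, qf_apply, ← e.sum_comp]
  refine sum_congr rfl fun i _ => ?_
  rw [← e.sum_comp]
  simp

theorem sqn_comp_equiv {m k : Type*} [Fintype m] [Fintype k] (e : m ≃ k) (φ : k → ℂ) :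
    sqn (φ ∘ e) = sqn φ := e.sum_comp fun i => ‖φ i‖ ^ 2

theorem exists_lintegral_inv_det_kronecker_le (hn : 4 ≤ n) {u : ℝ} (hu : 0 < u) :
    ∃ J : ENNReal, J < ⊤ ∧ ∀ K : Matrix (Fin 2 × Fin n) (Fin 2 × Fin n) ℂ,
      (∀ φ, u * sqn φ ≤ (qf K φ).im) →
      ∫⁻ p : Herm2, ENNReal.ofReal ‖(p.mat ⊗ₖ (1 : 𝕄 n) + K).det‖⁻¹ ≤ J := by
  obtain ⟨J, hJ, h⟩ := exists_lintegral_inv_det_fromBlocks_le hn hu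
  refine ⟨J, hJ, fun K hK => ?_⟩
  have hK2 : K.submatrix (finTwoProdEquiv n) (finTwoProdEquiv n) = fromBlocks
      (of fun i j => K (0, i) (0, j)) (of fun i j => K (0, i) (1, j))
      (of fun i j => K (1, i) (0, j)) (of fun i j => K (1, i) (1, j)) := by
    ext (i | i) (j | j) <;> rfl
  refine le_trans (le_of_eq ?_) (h _ _ _ _ (fun φ => by
    rw [← hK2, qf_submatrix, ← sqn_comp_equiv (finTwoProdEquiv n).symm]
    exact hK _))
  refine lintegral_congr fun p => ?_
  rw [← det_submatrix_equiv_self (finTwoProdEquiv n)]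
  congr 4
  ext (i | i) (j | j) <;>
    simp [kroneckerMap_apply, Herm2.mat, finTwoProdEquiv_inl, finTwoProdEquiv_inr]

theorem Herm2.isHermitian_mat (p : Herm2) : p.mat.IsHermitian := by
  ext i j
  fin_cases i <;> fin_cases j <;> simp [Herm2.mat]

theorem Herm2.continuous_mat : Continuous Herm2.mat := by
  refine continuous_matrix fun i j => ?_
  fin_cases i <;> fin_cases j <;> simp only [Herm2.mat] <;> simp <;> fun_prop

theorem Herm2.mat_add (p q : Herm2) : (p + q).mat = p.mat + q.mat := by
  ext i j
  fin_cases i <;> fin_cases j <;> simp [Herm2.mat]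

theorem Herm2.mat_smul (c : ℝ) (p : Herm2) : (c • p).mat = (c : ℂ) • p.mat := by
  ext i j
  fin_cases i <;> fin_cases j <;> simp [Herm2.mat]

theorem Herm2.mat_neg (p : Herm2) : (-p).mat = -p.mat := by
  ext i j
  fin_cases i <;> fin_cases j <;> simp [Herm2.mat]

theorem Herm2.mat_sub (p q : Herm2) : (p - q).mat = p.mat - q.mat := by
  rw [sub_eq_add_neg, Herm2.mat_add, Herm2.mat_neg, sub_eq_add_neg]

theorem Herm2.mat_injective : Function.Injective Herm2.mat := by
  intro p q h
  have h1 := congrFun (congrFun h 0) 0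
  have h2 := congrFun (congrFun h 0) 1
  have h3 := congrFun (congrFun h 1) 1
  simp [Herm2.mat] at h1 h2 h3
  exact Prod.ext h1 (Prod.ext h3 h2)

/-- The block matrix on the contour: its real part is `u`. -/
theorem accr_hermX (Az : 𝕄 n) (ξ X₁ X₂ : 𝕄 2) (u : ℝ) : accr u (hermX Az ξ X₁ X₂) =
      -blockB Az ξ ((I * u) • 1 + X₁) ((I * u) • 1 + X₂) := by
  have h : ∀ X : 𝕄 2, -(I • (((I * u) • 1 + X) ⊗ₖ (1 : 𝕄 n))) =
      (u : ℂ) • 1 + I • -(X ⊗ₖ (1 : 𝕄 n)) := by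
    intro X
    rw [add_kronecker, smul_kronecker, one_kronecker_one, smul_add, smul_smul,
      ← mul_assoc, I_mul_I, neg_one_mul, neg_add, neg_smul, neg_neg, smul_neg]
  rw [blockB, fromBlocks_neg, h, h, accr, hermX, fromBlocks_smul,
    ← fromBlocks_one, fromBlocks_smul, fromBlocks_add]
  simp

theorem blockB_eq_smul (Az : 𝕄 n) (ξ X₁ X₂ : 𝕄 2) : blockB Az ξ X₁ X₂ = I • fromBlocks
      (X₁ ⊗ₖ (1 : 𝕄 n)) (calA Az ξ) (calA Az ξ)ᴴ
      (X₂ ⊗ₖ (1 : 𝕄 n)) := by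
  rw [fromBlocks_smul]; rfl

theorem det_accr_hermX (Az : 𝕄 n) (ξ X₁ X₂ : 𝕄 2) (u : ℝ) : (accr u (hermX Az ξ X₁ X₂)).det =
      (blockB Az ξ ((I * u) • 1 + X₁) ((I * u) • 1 + X₂)).det := by
  rw [accr_hermX, det_neg]
  have : Even (Fintype.card (Blk n)) := by
    simp only [Fintype.card_sum]
    exact ⟨_, rfl⟩
  rw [this.neg_one_pow, one_mul]

theorem continuous_hermX (Az : 𝕄 n) (ξ : 𝕄 2) :
    Continuous fun x : Herm2 × Herm2 => hermX Az ξ x.1.mat x.2.mat := by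
  unfold hermX
  refine Continuous.matrix_fromBlocks ?_ continuous_const continuous_const ?_
  · refine continuous_matrix fun i j => ?_
    simp only [Matrix.neg_apply, kroneckerMap_apply]
    have := (Herm2.continuous_mat.comp (continuous_fst (X := Herm2) (Y := Herm2))).matrix_elem
        i.1 j.1
    exact (this.mul continuous_const).neg
  · refine continuous_matrix fun i j => ?_
    simp only [Matrix.neg_apply, kroneckerMap_apply]
    have := (Herm2.continuous_mat.comp (continuous_snd (X := Herm2) (Y := Herm2))).matrix_elem
        i.1 j.1
    exact (this.mul continuous_const).neg

theorem continuous_accr_hermX (Az : 𝕄 n) (ξ : 𝕄 2) (u : ℝ) :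
    Continuous fun x : Herm2 × Herm2 => accr u (hermX Az ξ x.1.mat x.2.mat) := by
  unfold accr
  exact continuous_const.add ((continuous_hermX Az ξ).const_smul I)

/-- The inverse determinant is integrable over pairs of Hermitian `2 × 2` matrices, uniformly in
the deformation and in the source, by applying the bound for one matrix to the Schur complement
and then to the eliminated block. -/
theorem exists_lintegral_inv_det_accr_le (hn : 4 ≤ n) {u : ℝ} (hu : 0 < u) :
    ∃ J : ENNReal, J < ⊤ ∧ ∀ (Az : 𝕄 n) (ξ : 𝕄 2), ∫⁻ x : Herm2 × Herm2,
        ENNReal.ofReal ‖(accr u (hermX Az ξ x.1.mat x.2.mat)).det‖⁻¹ ≤ J := by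
  obtain ⟨J, hJ, h⟩ := exists_lintegral_inv_det_kronecker_le hn hu
  refine ⟨J * J, ENNReal.mul_lt_top hJ hJ, fun Az ξ => ?_⟩
  have hmeas : Measurable fun x : Herm2 × Herm2 =>
      ENNReal.ofReal ‖(accr u (hermX Az ξ x.1.mat x.2.mat)).det‖⁻¹ :=
    (continuous_accr_hermX Az ξ u).matrix_det.norm.measurable.inv.ennreal_ofReal
  set A := calA Az ξ
  set V : Matrix (Fin 2 × Fin n) (Fin 2 × Fin n) ℂ := (I * u) • 1 with hV
  have hVim : ∀ φ, u * sqn φ ≤ (qf V φ).im := by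
    intro φ
    rw [hV, qf_smul, qf_one]
    simp
  -- the imaginary part of the block matrix is `u`
  have him : ∀ X₁ X₂ : Herm2, ∀ φ, u * sqn φ ≤ (qf (fromBlocks (X₁.mat ⊗ₖ (1 : 𝕄 n) + V) A Aᴴ
      (X₂.mat ⊗ₖ (1 : 𝕄 n) + V)) φ).im := by
    intro X₁ X₂ φ
    have : fromBlocks (X₁.mat ⊗ₖ (1 : 𝕄 n) + V) A Aᴴ (X₂.mat ⊗ₖ (1 : 𝕄 n) + V) = (I * u) • 1 +
        fromBlocks (X₁.mat ⊗ₖ (1 : 𝕄 n)) A Aᴴ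
      (X₂.mat ⊗ₖ (1 : 𝕄 n)) := by
      rw [← fromBlocks_one, fromBlocks_smul, fromBlocks_add]
      simp [hV, add_comm]
    rw [this, qf_add, qf_smul, qf_one, add_im, qf_im_of_isHermitian]
    · simp
    · rw [IsHermitian, fromBlocks_conjTranspose, conjTranspose_kronecker,
        conjTranspose_kronecker, X₁.isHermitian_mat.eq, X₂.isHermitian_mat.eq]
      simp
  -- elimination of the second block
  have hnorm : ∀ X₁ X₂ : Herm2, ‖(accr u (hermX Az ξ X₁.mat X₂.mat)).det‖ =
      ‖(X₂.mat ⊗ₖ (1 : 𝕄 n) + V).det‖ *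
      ‖(X₁.mat ⊗ₖ (1 : 𝕄 n) + (V - A * ((X₂.mat ⊗ₖ (1 : 𝕄 n) + V)⁻¹ * Aᴴ))).det‖ := by
    intro X₁ X₂
    have hk : ∀ X : 𝕄 2, ((I * u) • 1 + X) ⊗ₖ (1 : 𝕄 n) = X ⊗ₖ (1 : 𝕄 n) + V := by
      intro X
      rw [add_kronecker, smul_kronecker, one_kronecker_one, add_comm]
    rw [det_accr_hermX, blockB_eq_smul, det_smul, norm_mul, norm_pow, norm_I,
      one_pow, one_mul, hk, hk]
    let := invertibleOfIsUnitDet _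
      (Ne.isUnit (det_ne_zero_of_im_ge hu (im_qf_schur_ge hu (him X₁ X₂)).1))
    rw [det_fromBlocks₂₂, invOf_eq_nonsing_inv, norm_mul, add_sub_assoc, Matrix.mul_assoc]
  rw [Measure.volume_eq_prod, lintegral_prod_symm _ hmeas.aemeasurable]
  calc ∫⁻ X₂ : Herm2, ∫⁻ X₁ : Herm2,
        ENNReal.ofReal ‖(accr u (hermX Az ξ X₁.mat X₂.mat)).det‖⁻¹
      ≤ ∫⁻ X₂ : Herm2, ENNReal.ofReal ‖(X₂.mat ⊗ₖ (1 : 𝕄 n) + V).det‖⁻¹ * J := by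
        refine lintegral_mono fun X₂ => ?_
        have h1 : ∀ X₁ : Herm2, ENNReal.ofReal ‖(accr u (hermX Az ξ X₁.mat X₂.mat)).det‖⁻¹ =
            ENNReal.ofReal ‖(X₂.mat ⊗ₖ (1 : 𝕄 n) + V).det‖⁻¹ *
            ENNReal.ofReal ‖(X₁.mat ⊗ₖ (1 : 𝕄 n) +
              (V - A * ((X₂.mat ⊗ₖ (1 : 𝕄 n) + V)⁻¹ * Aᴴ))).det‖⁻¹ := by
          intro X₁
          rw [hnorm, mul_inv, ENNReal.ofReal_mul (by positivity)]
        simp only [h1]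
        rw [lintegral_const_mul' _ _ ENNReal.ofReal_ne_top]
        refine mul_le_mul_right (h _ fun φ => ?_) _
        have h2 := (im_qf_schur_ge hu (him 0 X₂)).2 φ
        have h0 : (0 : Herm2).mat = 0 := by
          ext i j
          fin_cases i <;> fin_cases j <;> simp [Herm2.mat]
        rw [h0, zero_kronecker, zero_add] at h2
        refine le_trans ?_ h2
        have := sqn_nonneg (((X₂.mat ⊗ₖ (1 : 𝕄 n) + V)⁻¹ * Aᴴ) *ᵥ φ)
        nlinarith
    _ = (∫⁻ X₂ : Herm2, ENNReal.ofReal ‖(X₂.mat ⊗ₖ (1 : 𝕄 n) + V).det‖⁻¹) * J :=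
        lintegral_mul_const' _ _ hJ.ne
    _ ≤ J * J := mul_le_mul_left (h V hVim) J

/-- The inverse of a matrix with real part `u` has entries of size at most `1 / u`. -/
theorem norm_inv_accr_apply_le {κ : Type*} [Fintype κ] [DecidableEq κ] {u : ℝ} (hu : 0 < u)
    {X : Matrix κ κ ℂ} (hX : X.IsHermitian) (i j : κ) : ‖(accr u X)⁻¹ i j‖ ≤ u⁻¹ := by
  set v : κ → ℂ := (accr u X)⁻¹ *ᵥ Pi.single j 1 with hv
  have hdet : IsUnit (accr u X).det := Ne.isUnit (det_accr_ne_zero hu hX)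
  have hAv : accr u X *ᵥ v = Pi.single j 1 := by
    rw [hv, mulVec_mulVec, mul_nonsing_inv _ hdet, one_mulVec]
  have h1 : u * sqn v ≤ ‖v j‖ := by
    rw [← qf_accr_re u hX, qf, hAv]
    refine (re_le_norm _).trans (le_of_eq ?_)
    simp
  have hle : ∀ k, ‖v k‖ ^ 2 ≤ sqn v := fun k => by
    refine le_trans ?_ (norm_sq_le_sqn v)
    gcongr
    exact norm_le_pi_norm v k
  have h2 : ‖v j‖ ≤ u⁻¹ := by
    by_contra! hlt
    have h3 : u * ‖v j‖ ^ 2 ≤ ‖v j‖ := (mul_le_mul_of_nonneg_left (hle j) hu.le).trans h1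
    have h5 : 1 < ‖v j‖ * u := by rwa [inv_lt_iff_one_lt_mul₀ hu] at hlt
    nlinarith
  have h6 : ‖v i‖ ^ 2 ≤ (u⁻¹) ^ 2 := by
    refine (hle i).trans ?_
    have : sqn v ≤ u⁻¹ * ‖v j‖ := by
      rw [← div_eq_inv_mul, le_div_iff₀ hu, mul_comm]
      exact h1
    refine this.trans ?_
    rw [pow_two]
    gcongr
  have h7 : (accr u X)⁻¹ i j = v i := by rw [hv]; simp
  rw [h7]
  exact le_of_sq_le_sq h6 (by positivity)

instance isAddHaarMeasure_volume_herm2 : (volume : Measure Herm2).IsAddHaarMeasure :=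
  have : (volume : Measure (ℝ × ℂ)).IsAddHaarMeasure :=
    inferInstanceAs ((volume : Measure ℝ).prod (volume : Measure ℂ)).IsAddHaarMeasure
  inferInstanceAs ((volume : Measure ℝ).prod (volume : Measure (ℝ × ℂ))).IsAddHaarMeasure

/-- The change of variables `X₁ = T + S`, `X₂ = T - S`. -/
theorem map_add_sub_volume : Measure.map (fun x : Herm2 × Herm2 => (x.1 + x.2, x.1 - x.2))
    volume = ENNReal.ofReal (1 / 16) • volume := by
  have hfin : Module.finrank ℝ Herm2 = 4 := by
    simp [Herm2, finrank_real_complex]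
  have h1 : MeasurePreserving (fun x : Herm2 × Herm2 => (x.1 + x.2, x.2))
      (volume.prod volume) (volume.prod volume) := measurePreserving_add_prod _ _
  have h2 : Measure.map (fun x : Herm2 × Herm2 => (x.1, (-2 : ℝ) • x.2)) (volume.prod volume) =
      ENNReal.ofReal (1 / 16) • ((volume : Measure Herm2).prod (volume : Measure Herm2)) := by
    have := Measure.map_prod_map (volume : Measure Herm2) (volume : Measure Herm2)
      measurable_id (g := fun x : Herm2 => (-2 : ℝ) • x) (by fun_prop)
    rw [Measure.map_addHaar_smul _ (by norm_num), Measure.map_id, hfin, Measure.prod_smul_right]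
      at this
    rw [show |((-2 : ℝ) ^ 4)⁻¹| = 1 / 16 by norm_num] at this
    exact this.symm
  have h3 : MeasurePreserving (fun x : Herm2 × Herm2 => (x.1, x.1 + x.2))
      (volume.prod volume) (volume.prod volume) := measurePreserving_prod_add _ _
  have e : (fun x : Herm2 × Herm2 => (x.1 + x.2, x.1 - x.2)) =
      (fun x : Herm2 × Herm2 => (x.1, x.1 + x.2)) ∘ (fun x => (x.1, (-2 : ℝ) • x.2)) ∘
        fun x => (x.1 + x.2, x.2) := by
    funext x
    simp only [Function.comp_apply, Prod.mk.injEq, true_and]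
    module
  rw [Measure.volume_eq_prod, e, ← Measure.map_map h3.measurable (by fun_prop),
    ← Measure.map_map (by fun_prop) h1.measurable, h1.map_eq, h2, Measure.map_smul, h3.map_eq]

end InverseDetBlock

/-! ### The density of the image of a complex measure -/

section FourierDensity

/-- If the characteristic function `Ψ` of the image under `ρ` of the complex measure `g μ` is
integrable, then this image has the density given by the inverse Fourier integral of `Ψ`. -/
theorem integral_mul_comp_eq_fourier {V : Type*} [NormedAddCommGroup V] [InnerProductSpace ℝ V]
    [FiniteDimensional ℝ V] [MeasurableSpace V] [BorelSpace V] {Φ : Type*} [MeasurableSpace Φ]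
    {μ : Measure Φ} [SFinite μ] {g : Φ → ℂ} (hg : Integrable g μ) {ρ : Φ → V} (hρ : Measurable ρ)
    {Ψ : V → ℂ} (hΨ : ∀ w, Ψ w = ∫ φ, g φ * exp ((2 * Real.pi * inner ℝ w (ρ φ) : ℝ) * I) ∂μ)
    (hΨi : Integrable Ψ) {θ : V → ℂ} (hθ : ContDiff ℝ (⊤ : ℕ∞) θ)
    (hc : HasCompactSupport θ) :
    ∫ φ, g φ * θ (ρ φ) ∂μ = ∫ r, θ r * ∫ w, Ψ w * exp (-((2 * Real.pi * inner ℝ w r : ℝ) * I)) := by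
  have hθi : Integrable θ := hθ.continuous.integrable_of_hasCompactSupport hc
  set θS : SchwartzMap V ℂ := hc.toSchwartzMap hθ
  have hF : FourierTransform.fourier θ = (FourierTransform.fourier θS : SchwartzMap V ℂ) := by
    rw [SchwartzMap.fourier_coe]; rfl
  have hFi : Integrable (FourierTransform.fourier θ) := by
    rw [hF]; exact SchwartzMap.integrable _
  -- the test function is a superposition of characters
  have hinv : ∀ r, θ r = ∫ w, exp ((2 * Real.pi * inner ℝ w r : ℝ) * I) *
      FourierTransform.fourier θ w := by
    intro r
    conv_lhs => rw [← hθ.continuous.fourierInv_fourier_eq hθi hFi]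
    rw [Real.fourierInv_eq']
    rfl
  have hmeas : Measurable fun x : Φ × V =>
      exp ((2 * Real.pi * inner ℝ x.2 (ρ x.1) : ℝ) * I) := by fun_prop
  calc ∫ φ, g φ * θ (ρ φ) ∂μ
      = ∫ φ, ∫ w, g φ * (exp ((2 * Real.pi * inner ℝ w (ρ φ) : ℝ) * I) *
          FourierTransform.fourier θ w) ∂volume ∂μ := by
        refine integral_congr_ae (.of_forall fun φ => ?_)
        dsimp only
        rw [hinv, integral_const_mul]
    _ = ∫ w, ∫ φ, g φ * (exp ((2 * Real.pi * inner ℝ w (ρ φ) : ℝ) * I) *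
          FourierTransform.fourier θ w) ∂μ := by
        refine integral_integral_swap ?_
        refine (hg.mul_prod hFi).mono ?_ (.of_forall fun x => ?_)
        · refine hg.aestronglyMeasurable.comp_fst.mul
            (hmeas.aestronglyMeasurable.mul hFi.aestronglyMeasurable.comp_snd)
        · simp only [Function.uncurry, norm_mul, norm_exp_ofReal_mul_I, one_mul, le_refl]
    _ = ∫ w, FourierTransform.fourier θ w • Ψ w := by
        refine integral_congr_ae (.of_forall fun w => ?_)
        dsimp only
        rw [hΨ, smul_eq_mul, ← integral_const_mul]
        refine integral_congr_ae (.of_forall fun φ => ?_)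
        dsimp only
        ring
    _ = ∫ r, θ r • FourierTransform.fourier Ψ r := by
        simpa using! (VectorFourier.integral_fourierIntegral_smul_eq_flip (L := innerₗ V)
          Real.continuous_fourierChar continuous_inner hθi hΨi)
    _ = _ := by
        refine integral_congr_ae (.of_forall fun r => ?_)
        dsimp only
        rw [Real.fourier_eq', smul_eq_mul]
        congr 1
        refine integral_congr_ae (.of_forall fun w => ?_)
        dsimp only
        rw [smul_eq_mul, mul_comm]
        congr 2
        push_cast
        ring

/-- The space of Hermitian `2 × 2` matrices with a Euclidean norm in the coordinates. -/
abbrev Herm2L2 : Type := WithLp 2 (ℝ × WithLp 2 (ℝ × ℂ))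

/-- The coordinates, as a linear equivalence. -/
def herm2Equiv : Herm2L2 ≃ₗ[ℝ] Herm2 :=
  (WithLp.linearEquiv 2 ℝ (ℝ × WithLp 2 (ℝ × ℂ))).trans
    (LinearEquiv.prodCongr (LinearEquiv.refl ℝ ℝ) (WithLp.linearEquiv 2 ℝ (ℝ × ℂ)))

theorem measurePreserving_herm2Equiv : MeasurePreserving herm2Equiv :=
  ((MeasurePreserving.id (volume : Measure ℝ)).prod
    (WithLp.volume_preserving_ofLp ℝ ℂ)).comp (WithLp.volume_preserving_ofLp ℝ (WithLp 2 (ℝ × ℂ)))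

/-- The coordinates of a pair of Hermitian matrices, as a linear equivalence. -/
def herm2PairEquiv : WithLp 2 (Herm2L2 × Herm2L2) ≃L[ℝ] Herm2 × Herm2 :=
  ((WithLp.linearEquiv 2 ℝ (Herm2L2 × Herm2L2)).trans
    (LinearEquiv.prodCongr herm2Equiv herm2Equiv)).toContinuousLinearEquiv

theorem measurePreserving_herm2PairEquiv : MeasurePreserving herm2PairEquiv :=
  (measurePreserving_herm2Equiv.prod measurePreserving_herm2Equiv).comp
    (WithLp.volume_preserving_ofLp Herm2L2 Herm2L2)

/-- The pairing `Tr X R` of Hermitian matrices. -/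
def hermPair (X R : Herm2) : ℝ := X.1 * R.1 + X.2.1 * R.2.1 + 2 * (X.2.2 * conj R.2.2).re

theorem trace_mat_mul_mat (X R : Herm2) : (X.mat * R.mat).trace = (hermPair X R : ℂ) := by
  simp [trace, Herm2.mat, hermPair, Fin.sum_univ_two]
  apply Complex.ext <;> simp <;> ring

/-- The pairing of pairs of Hermitian matrices. -/
def hermPair₂ (X R : Herm2 × Herm2) : ℝ := hermPair X.1 R.1 + hermPair X.2 R.2

theorem continuous_hermPair₂ : Continuous fun x : (Herm2 × Herm2) × (Herm2 × Herm2) =>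
    hermPair₂ x.1 x.2 := by
  have : Continuous fun z : ℂ => conj z := continuous_conj
  unfold hermPair₂ hermPair
  fun_prop

/-- The scaling that turns the Euclidean inner product of the coordinates into a multiple of
`Tr X R`. -/
def hermScale (a : ℝ) (p : Herm2) : Herm2 := (a • p.1, a • p.2.1, (2 * a) • p.2.2)

theorem map_hermScale {a : ℝ} (ha : 0 < a) :
    Measure.map (hermScale a) volume = ENNReal.ofReal ((4 * a ^ 4)⁻¹) • volume := by
  have h1 := Measure.map_prod_map (volume : Measure ℝ) (volume : Measure ℂ)
    (f := fun x : ℝ => a • x) (g := fun x : ℂ => (2 * a) • x) (by fun_prop) (by fun_prop)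
  have h2 := Measure.map_prod_map (volume : Measure ℝ) (volume : Measure (ℝ × ℂ))
    (f := fun x : ℝ => a • x) (g := Prod.map (fun x : ℝ => a • x) fun x : ℂ => (2 * a) • x)
    (by fun_prop) (by fun_prop)
  have e : hermScale a = Prod.map (fun x : ℝ => a • x)
      (Prod.map (fun x : ℝ => a • x) fun x : ℂ => (2 * a) • x) := rfl
  have hv1 : (volume : Measure (ℝ × ℂ)) = (volume : Measure ℝ).prod (volume : Measure ℂ) := rfl
  have hv2 : (volume : Measure Herm2) = (volume : Measure ℝ).prod (volume : Measure (ℝ × ℂ)) := rfl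
  have ha0 : a ≠ 0 := ha.ne'
  rw [e, hv2, ← h2, hv1, ← h1, Measure.map_addHaar_smul _ ha0,
    Measure.map_addHaar_smul _ (by positivity), Module.finrank_self, finrank_real_complex]
  simp only [Measure.prod_smul_left, Measure.prod_smul_right, smul_smul]
  rw [← ENNReal.ofReal_mul (by positivity), ← ENNReal.ofReal_mul (by positivity)]
  congr 2
  rw [abs_of_pos (by positivity), abs_of_pos (by positivity)]
  field_simp
  norm_num

/-- `hermScale` as a linear equivalence of pairs. -/
def hermScaleEquiv (a : ℝ) (ha : a ≠ 0) : (Herm2 × Herm2) ≃L[ℝ] (Herm2 × Herm2) :=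
  LinearEquiv.toContinuousLinearEquiv
    { toFun := Prod.map (hermScale a) (hermScale a)
      invFun := fun p => ((a⁻¹ • p.1.1, a⁻¹ • p.1.2.1, (2 * a)⁻¹ • p.1.2.2),
        (a⁻¹ • p.2.1, a⁻¹ • p.2.2.1, (2 * a)⁻¹ • p.2.2.2))
      map_add' := fun x y => by
        ext <;> simp [hermScale, Prod.map] <;> ring
      map_smul' := fun c x => by
        ext <;> simp [hermScale] <;> ring
      left_inv := fun x => by
        have : 2 * a ≠ 0 := by positivity
        change ((a⁻¹ • a • _, a⁻¹ • a • _, (2 * a)⁻¹ • (2 * a) • _),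
          (a⁻¹ • a • _, a⁻¹ • a • _, (2 * a)⁻¹ • (2 * a) • _)) = _
        rw [inv_smul_smul₀ ha, inv_smul_smul₀ ha, inv_smul_smul₀ ha, inv_smul_smul₀ ha,
          inv_smul_smul₀ this, inv_smul_smul₀ this]
      right_inv := fun x => by
        have : 2 * a ≠ 0 := by positivity
        change ((a • a⁻¹ • _, a • a⁻¹ • _, (2 * a) • (2 * a)⁻¹ • _),
          (a • a⁻¹ • _, a • a⁻¹ • _, (2 * a) • (2 * a)⁻¹ • _)) = _
        rw [smul_inv_smul₀ ha, smul_inv_smul₀ ha, smul_inv_smul₀ ha, smul_inv_smul₀ ha,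
          smul_inv_smul₀ this, smul_inv_smul₀ this] }

/-- The density of the image of a complex measure in the space of pairs of Hermitian matrices, in
terms of the pairing `n Tr X R`. -/
theorem integral_mul_comp_eq_hermPair {Φ : Type*} [MeasurableSpace Φ] {μ : Measure Φ} [SFinite μ]
    {g : Φ → ℂ} (hg : Integrable g μ) {ρ : Φ → Herm2 × Herm2} (hρ : Measurable ρ) {n : ℝ}
    (hn : 0 < n) {Ψ : Herm2 × Herm2 → ℂ}
    (hΨ : ∀ X, Ψ X = ∫ φ, g φ * exp ((n * hermPair₂ X (ρ φ) : ℝ) * I) ∂μ) (hΨi : Integrable Ψ)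
    {θ : Herm2 × Herm2 → ℂ} (hθ : ContDiff ℝ (⊤ : ℕ∞) θ) (hc : HasCompactSupport θ) :
    ∫ φ, g φ * θ (ρ φ) ∂μ = ∫ R, θ R * ((n ^ 8 / (16 * Real.pi ^ 8) : ℝ) * ∫ X, Ψ X *
      exp (-((n * hermPair₂ X R : ℝ) * I))) := by
  set a : ℝ := n / (2 * Real.pi) with ha
  have ha0 : 0 < a := by positivity
  set e := herm2PairEquiv with he
  set D := hermScaleEquiv a ha0.ne'
  have hemp : MeasurePreserving e := measurePreserving_herm2PairEquiv
  have hemb : MeasurableEmbedding e := e.toHomeomorph.measurableEmbedding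
  have hin : ∀ (w : WithLp 2 (Herm2L2 × Herm2L2)) (R : Herm2 × Herm2),
      2 * Real.pi * inner ℝ w (e.symm (D R)) = n * hermPair₂ (e w) R := by
    intro w R
    obtain ⟨r, rfl⟩ : ∃ r, r = e.symm (D R) := ⟨_, rfl⟩
    have h1 : (inner ℝ w (e.symm (D R)) : ℝ) = (e w).1.1 * (D R).1.1 +
        ((e w).1.2.1 * (D R).1.2.1 + ((e w).1.2.2 * conj (D R).1.2.2).re) +
        ((e w).2.1 * (D R).2.1 + ((e w).2.2.1 * (D R).2.2.1 +
          ((e w).2.2.2 * conj (D R).2.2.2).re)) := by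
      rw [WithLp.prod_inner_apply, WithLp.prod_inner_apply, WithLp.prod_inner_apply,
        WithLp.prod_inner_apply, WithLp.prod_inner_apply]
      simp only [real_inner_eq_re_inner]
      have h2 : D R = e (e.symm (D R)) := (e.apply_symm_apply _).symm
      rw [h2]
      generalize e.symm (D R) = r
      simp [he, herm2PairEquiv, herm2Equiv]
      ring
    have h3 : D R = (hermScale a R.1, hermScale a R.2) := rfl
    rw [h1, h3, hermPair₂, hermPair, hermPair]
    simp only [hermScale, smul_eq_mul, real_smul, map_mul, conj_ofReal,
      mul_re, mul_im, ofReal_re, ofReal_im]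
    rw [ha]
    field_simp
    ring
  set ρ' : Φ → WithLp 2 (Herm2L2 × Herm2L2) := fun φ => e.symm (D (ρ φ)) with hρ'
  set θ' : WithLp 2 (Herm2L2 × Herm2L2) → ℂ := fun r => θ (D.symm (e r)) with hθ'
  have key := integral_mul_comp_eq_fourier hg (ρ := ρ')
    ((e.symm.continuous.measurable.comp D.continuous.measurable).comp hρ)
    (Ψ := fun w => Ψ (e w)) (fun w => by simp only [hΨ, hρ', hin])
    ((hemp.integrable_comp_emb hemb).mpr hΨi) (θ := θ')
    (hθ.comp (D.symm.contDiff.comp e.contDiff))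
    (hc.comp_homeomorph (e.toHomeomorph.trans D.symm.toHomeomorph))
  have hθρ : ∀ φ, θ' (ρ' φ) = θ (ρ φ) := fun φ => by simp [hθ', hρ']
  simp only [hθρ] at key
  rw [key]
  have hD2 : Measure.map D volume = ENNReal.ofReal (16 * a ^ 8)⁻¹ • volume := by
    have h1 := Measure.map_prod_map (volume : Measure Herm2) (volume : Measure Herm2)
      (f := hermScale a) (g := hermScale a) (by unfold hermScale; fun_prop)
      (by unfold hermScale; fun_prop)
    have hv : (volume : Measure (Herm2 × Herm2)) =
      (volume : Measure Herm2).prod (volume : Measure Herm2) := rfl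
    have hDe : (D : Herm2 × Herm2 → Herm2 × Herm2) = Prod.map (hermScale a) (hermScale a) := rfl
    rw [hDe, hv, ← h1, map_hermScale ha0, Measure.prod_smul_left, Measure.prod_smul_right,
      smul_smul, ← ENNReal.ofReal_mul (by positivity)]
    congr 2
    field_simp
    norm_num
  have hDemb : MeasurableEmbedding D := D.toHomeomorph.measurableEmbedding
  set f : Herm2 × Herm2 → ℂ := fun R => ∫ X, Ψ X * exp (-((n * hermPair₂ X R : ℝ) * I)) with hf
  have h4 : ∀ r, (θ' r * ∫ w, Ψ (e w) * exp (-((2 * Real.pi * inner ℝ w r : ℝ) * I))) =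
      θ (D.symm (e r)) * f (D.symm (e r)) := by
    intro r
    rw [hf, hθ']
    dsimp only
    congr 1
    rw [← hemp.integral_comp hemb]
    refine integral_congr_ae (.of_forall fun w => ?_)
    dsimp only
    rw [← hin, D.apply_symm_apply, e.symm_apply_apply]
  simp only [h4]
  rw [hemp.integral_comp hemb (fun s => θ (D.symm s) * f (D.symm s))]
  have h5 : ∫ R, θ R * f R = (16 * a ^ 8)⁻¹ • ∫ s, θ (D.symm s) * f (D.symm s) := by
    have := hDemb.integral_map (μ := volume) (fun s => θ (D.symm s) * f (D.symm s))
    rw [hD2, integral_smul_measure, ENNReal.toReal_ofReal (by positivity)] at this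
    rw [this]
    simp
  have h6 : ∀ R, θ R * ((n ^ 8 / (16 * Real.pi ^ 8) : ℝ) * f R) =
      (n ^ 8 / (16 * Real.pi ^ 8) : ℝ) * (θ R * f R) := fun R => by ring
  change _ = ∫ R, θ R * ((n ^ 8 / (16 * Real.pi ^ 8) : ℝ) * f R)
  simp only [h6]
  rw [integral_const_mul, h5, real_smul, ← mul_assoc, ← ofReal_mul]
  have h7 : n ^ 8 / (16 * Real.pi ^ 8) * (16 * a ^ 8)⁻¹ = 1 := by
    rw [ha]
    field_simp
    norm_num
  rw [h7, ofReal_one, one_mul]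

end FourierDensity

/-! ### The density of the Gram matrices of the bosonic variables -/

section GramDensity

variable {n : ℕ}

/-- The normalized Gram matrix `n⁻¹ ψ ψ^*` of two vectors of `ℂⁿ`. -/
def gramOf (ψ : Fin 2 × Fin n → ℂ) : Herm2 :=
  ((n : ℝ)⁻¹ * ∑ α, ‖ψ (0, α)‖ ^ 2, (n : ℝ)⁻¹ * ∑ α, ‖ψ (1, α)‖ ^ 2,
    (n : ℂ)⁻¹ * ∑ α, ψ (0, α) * conj (ψ (1, α)))

/-- The Gram matrices of the two families of bosonic variables. -/
def gram (φ : Blk n → ℂ) : Herm2 × Herm2 :=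
  (gramOf fun p => φ (.inl p), gramOf fun p => φ (.inr p))

theorem continuous_gram : Continuous (gram : (Blk n → ℂ) → Herm2 × Herm2) := by
  have : Continuous fun z : ℂ => conj z := continuous_conj
  unfold gram gramOf
  fun_prop

theorem gramOf_mat_apply (ψ : Fin 2 × Fin n → ℂ) (k l : Fin 2) :
    (gramOf ψ).mat k l = (n : ℂ)⁻¹ * ∑ α, ψ (k, α) * conj (ψ (l, α)) := by
  fin_cases k <;> fin_cases l <;> simp [gramOf, Herm2.mat, mul_conj', mul_comm]

theorem qf_kronecker_one (hn : n ≠ 0) (X : Herm2) (ψ : Fin 2 × Fin n → ℂ) :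
    qf (X.mat ⊗ₖ (1 : 𝕄 n)) ψ = (n * hermPair X (gramOf ψ) : ℝ) := by
  have hn' : (n : ℂ) ≠ 0 := by exact_mod_cast hn
  rw [ofReal_mul, ← trace_mat_mul_mat, trace, qf_apply]
  simp only [diag_apply, Matrix.mul_apply, gramOf_mat_apply, Fintype.sum_prod_type,
    kroneckerMap_apply, Matrix.one_apply]
  rw [mul_sum]
  refine sum_congr rfl fun k _ => ?_
  simp only [ofReal_natCast, mul_sum]
  rw [sum_comm]
  refine sum_congr rfl fun l _ => ?_
  refine sum_congr rfl fun α _ => ?_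
  simp only [mul_ite, ite_mul, mul_one, mul_zero, zero_mul, sum_ite_eq, mem_univ, if_true]
  field_simp

/-- The trace of a Hermitian matrix. -/
def hermTr (R : Herm2) : ℝ := R.1 + R.2.1

theorem sqn_eq_gram (hn : n ≠ 0) (φ : Blk n → ℂ) :
    sqn φ = n * (hermTr (gram φ).1 + hermTr (gram φ).2) := by
  have hn' : (n : ℝ) ≠ 0 := by exact_mod_cast hn
  simp only [sqn, Fintype.sum_sum_type, Fintype.sum_prod_type, Fin.sum_univ_two, gram, gramOf,
    hermTr]
  field_simp

theorem qf_hermX (hn : n ≠ 0) (Az : 𝕄 n) (ξ : 𝕄 2) (X : Herm2 × Herm2) (φ : Blk n → ℂ) :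
    qf (hermX Az ξ X.1.mat X.2.mat) φ = qf (hermX Az ξ 0 0) φ - (n * hermPair₂ X (gram φ) : ℝ) := by
  have h1 : hermX Az ξ X.1.mat X.2.mat = hermX Az ξ 0 0 + -fromBlocks (X.1.mat ⊗ₖ (1 : 𝕄 n)) 0 0
      (X.2.mat ⊗ₖ (1 : 𝕄 n)) := by
    rw [hermX, hermX, fromBlocks_neg, fromBlocks_add]
    simp
  have h2 : φ = Sum.elim (fun p => φ (.inl p)) (fun p => φ (.inr p)) := by
    ext (a | a) <;> rfl
  rw [h1, qf_add, qf_neg, ← sub_eq_add_neg]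
  congr 1
  conv_lhs => rw [h2]
  rw [qf_fromBlocks, zero_mulVec, zero_mulVec, add_zero, zero_add, ← qf, ← qf,
    qf_kronecker_one hn, qf_kronecker_one hn, hermPair₂, gram, mul_add, ofReal_add]

/-- The oscillating bosonic integrand without convergence factor. -/
def bosonOsc (Az : 𝕄 n) (C : Matrix (Blk n) (Blk n) ℂ) (ξ : 𝕄 2) (φ : Blk n → ℂ) : ℂ :=
  (C - (n : ℂ)⁻¹ • bilPert uCoef vCoef φ).det * exp (-qf (accr 0 (hermX Az ξ 0 0)) φ)

theorem accr_hermX_split (hn : n ≠ 0) (Az : 𝕄 n) (ξ : 𝕄 2) (u : ℝ) (X : Herm2 × Herm2)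
    (φ : Blk n → ℂ) :
    -qf (accr u (hermX Az ξ X.1.mat X.2.mat)) φ = -qf (accr 0 (hermX Az ξ 0 0)) φ +
      ((-(u * sqn φ) : ℝ) : ℂ) + (n * hermPair₂ X (gram φ) : ℝ) * I := by
  rw [accr, accr, qf_add, qf_add, qf_smul, qf_smul, qf_smul, qf_smul, qf_one, qf_hermX hn]
  push_cast
  ring

/-- The bosonic integral with sources `X` for the Gram matrices. -/
def bosonChar (Az : 𝕄 n) (C : Matrix (Blk n) (Blk n) ℂ) (ξ : 𝕄 2) (u : ℝ) (X : Herm2 × Herm2) : ℂ :=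
  (Real.pi : ℂ) ^ Fintype.card (Blk n) * ((accr u (hermX Az ξ X.1.mat X.2.mat)).det⁻¹ *
    superSum (n : ℂ)⁻¹ uCoef vCoef C (-(accr u (hermX Az ξ X.1.mat X.2.mat))⁻¹))

theorem bosonChar_eq_integral (hn : n ≠ 0) (Az : 𝕄 n) (C : Matrix (Blk n) (Blk n) ℂ) (ξ : 𝕄 2)
    {u : ℝ} (hu : 0 < u) (X : Herm2 × Herm2) :
    bosonChar Az C ξ u X = ∫ φ : Blk n → ℂ, bosonOsc Az C ξ φ * exp (-(u * sqn φ) : ℝ) *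
      exp ((n * hermPair₂ X (gram φ) : ℝ) * I) := by
  rw [bosonChar, ← integral_det_sub_bilinear _ _ _ C hu
    (isHermitian_hermX Az ξ X.1.isHermitian_mat X.2.isHermitian_mat)]
  refine integral_congr_ae (.of_forall fun φ => ?_)
  dsimp only
  rw [accr_hermX_split hn, exp_add, exp_add, bosonOsc]
  ring

theorem integrable_bosonOsc_mul_exp (Az : 𝕄 n) (C : Matrix (Blk n) (Blk n) ℂ) (ξ : 𝕄 2) {u : ℝ}
    (hu : 0 < u) :
    Integrable fun φ : Blk n → ℂ => bosonOsc Az C ξ φ * exp (-(u * sqn φ) : ℝ) := by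
  have hX := isHermitian_hermX Az ξ (isHermitian_zero (n := Fin 2) (α := ℂ))
    (isHermitian_zero (n := Fin 2) (α := ℂ))
  refine (integrable_wick (expGrowth_det_bilPert (n : ℂ)⁻¹ uCoef vCoef C) hu hX).congr
    (.of_forall fun φ => ?_)
  dsimp only
  rw [bosonOsc, mul_assoc, ← exp_add]
  congr 2
  rw [accr, accr, qf_add, qf_add, qf_smul, qf_smul, qf_smul, qf_one]
  push_cast
  ring

theorem continuous_bosonOsc (Az : 𝕄 n) (C : Matrix (Blk n) (Blk n) ℂ) (ξ : 𝕄 2) :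
    Continuous (bosonOsc Az C ξ) :=
  (expGrowth_det_bilPert (n : ℂ)⁻¹ uCoef vCoef C).continuous.mul
    (continuous_exp.comp (continuous_qf _).neg)

theorem continuous_inv_accr_hermX (Az : 𝕄 n) (ξ : 𝕄 2) {u : ℝ} (hu : 0 < u) :
    Continuous fun X : Herm2 × Herm2 => (accr u (hermX Az ξ X.1.mat X.2.mat))⁻¹ := by
  have h := continuous_accr_hermX Az ξ u
  have h2 : ∀ X : Herm2 × Herm2, (accr u (hermX Az ξ X.1.mat X.2.mat)).det ≠ 0 := fun X =>
    det_accr_ne_zero hu (isHermitian_hermX Az ξ X.1.isHermitian_mat X.2.isHermitian_mat)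
  simp only [Matrix.inv_def, Ring.inverse_eq_inv']
  exact (h.matrix_det.inv₀ h2).smul h.matrix_adjugate

theorem continuous_bosonChar (Az : 𝕄 n) (C : Matrix (Blk n) (Blk n) ℂ) (ξ : 𝕄 2) {u : ℝ}
    (hu : 0 < u) :
    Continuous (bosonChar Az C ξ u) := by
  have h2 : ∀ X : Herm2 × Herm2, (accr u (hermX Az ξ X.1.mat X.2.mat)).det ≠ 0 := fun X =>
    det_accr_ne_zero hu (isHermitian_hermX Az ξ X.1.isHermitian_mat X.2.isHermitian_mat)
  have h3 : Continuous fun X : Herm2 × Herm2 => superSum (n : ℂ)⁻¹ uCoef vCoef C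
      (-(accr u (hermX Az ξ X.1.mat X.2.mat))⁻¹) :=
    Continuous.comp (g := fun x : Matrix (Blk n) (Blk n) ℂ × Matrix (Blk n) (Blk n) ℂ =>
        superSum (n : ℂ)⁻¹ uCoef vCoef x.1 x.2)
      (f := fun X : Herm2 × Herm2 => (C, -(accr u (hermX Az ξ X.1.mat X.2.mat))⁻¹))
      (continuous_superSum (n : ℂ)⁻¹ uCoef vCoef)
      (continuous_const.prodMk (continuous_inv_accr_hermX Az ξ hu).neg)
  have h4 : Continuous fun X : Herm2 × Herm2 => (accr u (hermX Az ξ X.1.mat X.2.mat)).det⁻¹ :=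
    (continuous_accr_hermX Az ξ u).matrix_det.inv₀ h2
  exact continuous_const.mul (h4.mul h3)

theorem exists_norm_superSum_le (n : ℕ) {u : ℝ} (hu : 0 < u) : ∃ K : ℝ, 0 ≤ K ∧
    ∀ (Az : 𝕄 n) (C : Matrix (Blk n) (Blk n) ℂ) (ξ : 𝕄 2) (X : Herm2 × Herm2) (a : ℝ), 1 ≤ a →
      (∀ i j, ‖C i j‖ ≤ a) →
      ‖superSum (n : ℂ)⁻¹ uCoef vCoef C (-(accr u (hermX Az ξ X.1.mat X.2.mat))⁻¹)‖ ≤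
        K * a ^ Fintype.card (Blk n) := by
  obtain ⟨K, hK, h⟩ := exists_bound_superSum (n : ℂ)⁻¹ (uCoef (n := n)) vCoef
  refine ⟨K * (max 1 u⁻¹) ^ Fintype.card (Blk n), by positivity, fun Az C ξ X a ha hC => ?_⟩
  refine (h C _ a (max 1 u⁻¹) ha (le_max_left _ _) hC fun i j => ?_).trans (le_of_eq (by ring))
  rw [Matrix.neg_apply, norm_neg]
  exact (norm_inv_accr_apply_le hu
    (isHermitian_hermX Az ξ X.1.isHermitian_mat X.2.isHermitian_mat) i j).trans (le_max_right _ _)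

/-- The characteristic function of the Gram matrices is integrable, uniformly in the source. -/
theorem exists_integral_bosonChar_le (hn : 4 ≤ n) (C : Matrix (Blk n) (Blk n) ℂ) {u : ℝ}
    (hu : 0 < u) : ∃ K : ℝ, ∀ (Az : 𝕄 n) (ξ : 𝕄 2),
      Integrable (bosonChar Az C ξ u) ∧ ∫ X, ‖bosonChar Az C ξ u X‖ ≤ K := by
  obtain ⟨J, hJ, hb⟩ := exists_lintegral_inv_det_accr_le hn hu
  obtain ⟨K, hK, hs⟩ := exists_norm_superSum_le n hu
  set a : ℝ := 1 + ∑ i, ∑ j, ‖C i j‖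
  have ha1 : 1 ≤ a := le_add_of_nonneg_right (by positivity)
  have haC : ∀ i j, ‖C i j‖ ≤ a := fun i j => by
    have h1 : ‖C i j‖ ≤ ∑ j, ‖C i j‖ :=
      single_le_sum (f := fun j => ‖C i j‖) (fun _ _ => norm_nonneg _) (mem_univ j)
    have h2 : ∑ j, ‖C i j‖ ≤ ∑ i, ∑ j, ‖C i j‖ :=
      single_le_sum (f := fun i => ∑ j, ‖C i j‖) (fun _ _ => by positivity) (mem_univ i)
    linarith
  set L : ℝ := Real.pi ^ Fintype.card (Blk n) * (K * a ^ Fintype.card (Blk n)) with hL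
  have hL0 : 0 ≤ L := by have := Real.pi_pos; positivity
  have hpt : ∀ Az ξ X, ‖bosonChar Az C ξ u X‖ ≤
      L * ‖(accr u (hermX Az ξ X.1.mat X.2.mat)).det‖⁻¹ := by
    intro Az ξ X
    rw [bosonChar, norm_mul, norm_mul, norm_pow, norm_inv, norm_real,
      Real.norm_of_nonneg Real.pi_pos.le, hL]
    have := hs Az C ξ X a ha1 haC
    calc _ ≤ Real.pi ^ Fintype.card (Blk n) *
          (‖(accr u (hermX Az ξ X.1.mat X.2.mat)).det‖⁻¹ * (K * a ^ Fintype.card (Blk n))) := by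
          gcongr
      _ = _ := by ring
  refine ⟨(ENNReal.ofReal L * J).toReal, fun Az ξ => ?_⟩
  have hlin : ∫⁻ X, ENNReal.ofReal ‖bosonChar Az C ξ u X‖ ≤ ENNReal.ofReal L * J := by
    refine (lintegral_mono fun X => ENNReal.ofReal_le_ofReal (hpt Az ξ X)).trans ?_
    simp only [ENNReal.ofReal_mul hL0]
    rw [lintegral_const_mul' _ _ ENNReal.ofReal_ne_top]
    gcongr
    exact hb Az ξ
  have htop : ENNReal.ofReal L * J < ⊤ := ENNReal.mul_lt_top ENNReal.ofReal_lt_top hJ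
  have hi : Integrable (bosonChar Az C ξ u) := by
    refine ⟨(continuous_bosonChar Az C ξ hu).aestronglyMeasurable, ?_⟩
    rw [hasFiniteIntegral_iff_norm]
    exact hlin.trans_lt htop
  refine ⟨hi, ?_⟩
  rw [integral_eq_lintegral_of_nonneg_ae (.of_forall fun _ => norm_nonneg _)
    hi.norm.aestronglyMeasurable]
  exact ENNReal.toReal_mono htop.ne hlin

/-- The density of the image of the bosonic integrand under the Gram map. -/
def gramDensity (Az : 𝕄 n) (C : Matrix (Blk n) (Blk n) ℂ) (ξ : 𝕄 2) (u : ℝ) (R : Herm2 × Herm2) :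
    ℂ :=
  exp ((u * (n * (hermTr R.1 + hermTr R.2)) : ℝ)) *
    (((n : ℝ) ^ 8 / (16 * Real.pi ^ 8) : ℝ) * ∫ X, bosonChar Az C ξ u X *
      exp (-((n * hermPair₂ X R : ℝ) * I)))

/-- `gramDensity` is the density of the image of the oscillating integrand under the Gram map. The
weight `exp (-u |φ|²)` makes the integrand integrable and is compensated in the compactly supported
test function. -/
theorem integral_bosonOsc_gram (hn : 4 ≤ n) (Az : 𝕄 n) (C : Matrix (Blk n) (Blk n) ℂ) (ξ : 𝕄 2)
    {u : ℝ} (hu : 0 < u) {θ : Herm2 × Herm2 → ℂ} (hθ : ContDiff ℝ (⊤ : ℕ∞) θ)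
    (hc : HasCompactSupport θ) :
    ∫ φ : Blk n → ℂ, bosonOsc Az C ξ φ * θ (gram φ) = ∫ R, θ R * gramDensity Az C ξ u R := by
  have hn0 : n ≠ 0 := by omega
  obtain ⟨K, hK⟩ := exists_integral_bosonChar_le hn C hu
  have hexp : ContDiff ℝ (⊤ : ℕ∞) fun R : Herm2 × Herm2 =>
      exp ((u * (n * (hermTr R.1 + hermTr R.2)) : ℝ)) := by
    have h1 : ContDiff ℝ (⊤ : ℕ∞) fun R : Herm2 × Herm2 =>
        u * (n * (R.1.1 + R.1.2.1 + (R.2.1 + R.2.2.1))) := by fun_prop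
    exact contDiff_exp.comp (ofRealCLM.contDiff.comp h1)
  have key := integral_mul_comp_eq_hermPair (integrable_bosonOsc_mul_exp Az C ξ hu)
    continuous_gram.measurable (n := (n : ℝ)) (by positivity)
    (fun X => bosonChar_eq_integral hn0 Az C ξ hu X) (hK Az ξ).1 (hθ.mul hexp) (hc.mul_right)
  calc ∫ φ : Blk n → ℂ, bosonOsc Az C ξ φ * θ (gram φ)
      = ∫ φ : Blk n → ℂ, bosonOsc Az C ξ φ * exp (-(u * sqn φ) : ℝ) * (θ (gram φ) * exp
            ((u * (n * (hermTr (gram φ).1 + hermTr (gram φ).2)) : ℝ))) := by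
        refine integral_congr_ae (.of_forall fun φ => ?_)
        dsimp only
        rw [← sqn_eq_gram hn0, ofReal_neg, Complex.exp_neg]
        field_simp [exp_ne_zero]
    _ = _ := by
        rw [key]
        refine integral_congr_ae (.of_forall fun R => ?_)
        dsimp only
        rw [gramDensity]
        ring

theorem continuous_gramDensity (hn : 4 ≤ n) (Az : 𝕄 n) (C : Matrix (Blk n) (Blk n) ℂ) (ξ : 𝕄 2)
    {u : ℝ} (hu : 0 < u) :
    Continuous (gramDensity Az C ξ u) := by
  obtain ⟨K, hK⟩ := exists_integral_bosonChar_le hn C hu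
  have hp := continuous_hermPair₂
  unfold gramDensity
  refine Continuous.mul (by unfold hermTr; fun_prop) (continuous_const.mul ?_)
  refine continuous_of_dominated (bound := fun X => ‖bosonChar Az C ξ u X‖) (fun R => ?_)
    (fun R => .of_forall fun X => ?_) (hK Az ξ).1.norm
    (.of_forall fun X => ?_)
  · have h1 : Continuous fun X : Herm2 × Herm2 => hermPair₂ X R :=
      hp.comp (continuous_id.prodMk continuous_const)
    have := continuous_bosonChar Az C ξ hu
    exact Continuous.aestronglyMeasurable (by fun_prop)
  · rw [norm_mul, ← neg_mul, ← ofReal_neg, norm_exp_ofReal_mul_I, mul_one]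
  · have h1 : Continuous fun R : Herm2 × Herm2 => hermPair₂ X R :=
      hp.comp (continuous_const.prodMk continuous_id)
    fun_prop

theorem exists_norm_gramDensity_le (hn : 4 ≤ n) (C : Matrix (Blk n) (Blk n) ℂ) {u : ℝ}
    (hu : 0 < u) : ∃ K : ℝ, 0 ≤ K ∧ ∀ (Az : 𝕄 n)
      (ξ : 𝕄 2) (R : Herm2 × Herm2), ‖gramDensity Az C ξ u R‖ ≤
        K * Real.exp (u * (n * (hermTr R.1 + hermTr R.2))) := by
  obtain ⟨K, hK⟩ := exists_integral_bosonChar_le hn C hu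
  have hK0 : 0 ≤ K := le_trans (integral_nonneg fun _ => norm_nonneg _) (hK 0 0).2
  have hc : (0 : ℝ) ≤ (n : ℝ) ^ 8 / (16 * Real.pi ^ 8) := by have := Real.pi_pos; positivity
  refine ⟨(n : ℝ) ^ 8 / (16 * Real.pi ^ 8) * K, mul_nonneg hc hK0, fun Az ξ R => ?_⟩
  rw [gramDensity, norm_mul, norm_mul, norm_exp, ofReal_re, norm_real,
    Real.norm_of_nonneg hc, mul_comm]
  gcongr
  refine (norm_integral_le_integral_norm _).trans (le_trans (le_of_eq ?_) (hK Az ξ).2)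
  refine integral_congr_ae (.of_forall fun X => ?_)
  dsimp only
  rw [norm_mul, ← neg_mul, ← ofReal_neg, norm_exp_ofReal_mul_I, mul_one]

end GramDensity

/-! ### Integration over positive definite `2 × 2` matrices -/

section PositiveDefinite

theorem Herm2.posDef_iff (p : Herm2) :
    p.mat.PosDef ↔ 0 < p.1 ∧ 0 < p.2.1 ∧ ‖p.2.2‖ ^ 2 < p.1 * p.2.1 := by
  have hdet : p.mat.det = ((p.1 * p.2.1 - ‖p.2.2‖ ^ 2 : ℝ) : ℂ) := by
    simp [det_fin_two, Herm2.mat, mul_conj']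
  constructor
  · intro h
    have h0 := h.diag_pos (i := 0)
    have h1 := h.diag_pos (i := 1)
    have h2 := h.det_pos
    rw [hdet] at h2
    simp only [Herm2.mat, of_apply, cons_val_zero, cons_val_one] at h0 h1
    refine ⟨by exact_mod_cast h0, by exact_mod_cast h1, ?_⟩
    have : 0 < p.1 * p.2.1 - ‖p.2.2‖ ^ 2 := by exact_mod_cast h2
    linarith
  · rintro ⟨ha, hb, hw⟩
    refine PosDef.of_dotProduct_mulVec_pos p.isHermitian_mat fun x hx => ?_
    -- completing the square
    have e : star x ⬝ᵥ p.mat *ᵥ x = ((p.1⁻¹ * (‖(p.1 : ℂ) * x 0 + p.2.2 * x 1‖ ^ 2 +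
        (p.1 * p.2.1 - ‖p.2.2‖ ^ 2) * ‖x 1‖ ^ 2) : ℝ) : ℂ) := by
      push_cast
      simp only [← mul_conj', dotProduct, mulVec, Fin.sum_univ_two, Herm2.mat,
        of_apply, cons_val_zero, cons_val_one, map_add, map_mul,
        conj_ofReal, Pi.star_apply, star_def]
      field_simp
      ring
    rw [e]
    have hpos : 0 < p.1⁻¹ * (‖(p.1 : ℂ) * x 0 + p.2.2 * x 1‖ ^ 2 +
        (p.1 * p.2.1 - ‖p.2.2‖ ^ 2) * ‖x 1‖ ^ 2) := by
      refine mul_pos (inv_pos.mpr ha) ?_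
      by_cases h1 : x 1 = 0
      · have h0 : x 0 ≠ 0 := by
          intro h0
          apply hx
          ext i
          fin_cases i
          · exact h0
          · exact h1
        have : 0 < ‖(p.1 : ℂ) * x 0 + p.2.2 * x 1‖ := by
          rw [h1, mul_zero, add_zero, norm_pos_iff]
          exact mul_ne_zero (by exact_mod_cast ha.ne') h0
        positivity
      · have : 0 < ‖x 1‖ := norm_pos_iff.mpr h1
        positivity
    exact_mod_cast hpos

theorem Herm2.det_mat (p : Herm2) : p.mat.det = ((p.1 * p.2.1 - ‖p.2.2‖ ^ 2 : ℝ) : ℂ) := by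
  simp [det_fin_two, Herm2.mat, mul_conj']

theorem Herm2.trace_mat (p : Herm2) : p.mat.trace = (hermTr p : ℂ) := by
  simp [trace_fin_two, Herm2.mat, hermTr]

/-- The determinant of a Hermitian matrix. -/
def hermDet (p : Herm2) : ℝ := p.1 * p.2.1 - ‖p.2.2‖ ^ 2

/-- The set of positive definite matrices. -/
def pdSet : Set Herm2 := {p | p.mat.PosDef}

theorem pdSet_eq : pdSet = {p | 0 < p.1 ∧ 0 < p.2.1 ∧ ‖p.2.2‖ ^ 2 < p.1 * p.2.1} :=
  Set.ext fun p => p.posDef_iff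

theorem isOpen_pdSet : IsOpen pdSet := by
  rw [pdSet_eq]
  have h1 : Continuous fun p : Herm2 => p.2.1 := by fun_prop
  have h2 : Continuous fun p : Herm2 => ‖p.2.2‖ ^ 2 := by fun_prop
  exact (isOpen_lt continuous_const continuous_fst).inter
    ((isOpen_lt continuous_const h1).inter (isOpen_lt h2 (continuous_fst.mul h1)))

theorem measurableSet_pdSet : MeasurableSet pdSet := isOpen_pdSet.measurableSet

theorem lintegral_norm_sq {k : ℝ → ENNReal} (hk : Measurable k) :
    ∫⁻ t : ℂ, k (‖t‖ ^ 2) = ENNReal.ofReal Real.pi * ∫⁻ s in Set.Ioi (0 : ℝ), k s := by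
  have h1 : ∫⁻ s in Set.Ioi (0 : ℝ), k s =
      ∫⁻ r in Set.Ioi (0 : ℝ), ENNReal.ofReal (2 * r) * k (r ^ 2) := by
    have himg : (fun r : ℝ => r ^ 2) '' Set.Ioi 0 = Set.Ioi 0 := by
      ext s
      constructor
      · rintro ⟨r, hr, rfl⟩
        exact pow_pos (Set.mem_Ioi.mp hr) 2
      · intro hs
        exact ⟨Real.sqrt s, Real.sqrt_pos.mpr hs, Real.sq_sqrt (le_of_lt hs)⟩
    have := lintegral_image_eq_lintegral_deriv_mul_of_monotoneOn (f := fun r : ℝ => r ^ 2)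
      (f' := fun r => 2 * r) measurableSet_Ioi (fun r _ => by
        simpa using (hasDerivAt_pow 2 r).hasDerivWithinAt)
      (fun a ha b hb hab => by
        have ha' : (0 : ℝ) < a := ha
        dsimp only
        gcongr) k
    rw [himg] at this
    exact this
  have hkm : Measurable fun r : ℝ => ENNReal.ofReal r * k (r ^ 2) := by fun_prop
  rw [← Complex.lintegral_comp_polarCoord_symm, polarCoord_target, Measure.volume_eq_prod,
    ← Measure.prod_restrict]
  have h2 : ∀ p : ℝ × ℝ, ENNReal.ofReal p.1 • k (‖Complex.polarCoord.symm p‖ ^ 2) =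
      ENNReal.ofReal p.1 * k (p.1 ^ 2) := by
    intro p
    rw [norm_polarCoord_symm, sq_abs, smul_eq_mul]
  simp only [h2]
  rw [lintegral_prod _ (by fun_prop)]
  simp only [lintegral_const, Measure.restrict_apply MeasurableSet.univ, Set.univ_inter,
    Real.volume_Ioo]
  rw [lintegral_mul_const _ hkm, h1]
  simp only [ENNReal.ofReal_mul (zero_le_two (α := ℝ)), mul_assoc]
  rw [lintegral_const_mul _ hkm, sub_neg_eq_add, ← two_mul, ENNReal.ofReal_mul zero_le_two]
  ring

theorem lintegral_finTwo {F : (Fin 2 → ℂ) → ENNReal} (hF : Measurable F) :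
    ∫⁻ z, F z = ∫⁻ z₀ : ℂ, ∫⁻ z₁ : ℂ, F ![z₀, z₁] := by
  have h := (volume_preserving_finTwoArrow ℂ).symm
  rw [← h.lintegral_comp hF, Measure.volume_eq_prod, lintegral_prod]
  · rfl
  · exact (hF.comp (MeasurableEquiv.finTwoArrow (α := ℂ)).symm.measurable).aemeasurable

theorem lintegral_sqn_finTwo {k : ℝ → ENNReal} (hk : Measurable k) :
    ∫⁻ x : Fin 2 → ℂ, k (sqn x) = ENNReal.ofReal (Real.pi ^ 2) *
      ∫⁻ a in Set.Ioi (0 : ℝ), ENNReal.ofReal a * k a := by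
  have hsq : Measurable (sqn : (Fin 2 → ℂ) → ℝ) := continuous_sqn.measurable
  rw [lintegral_finTwo (F := fun x => k (sqn x)) (hk.comp hsq)]
  simp only [sqn, Fin.sum_univ_two, cons_val_zero, cons_val_one]
  have h1 : ∀ z₀ : ℂ, ∫⁻ z₁ : ℂ, k (‖z₀‖ ^ 2 + ‖z₁‖ ^ 2) =
      ENNReal.ofReal Real.pi * ∫⁻ t in Set.Ioi (0 : ℝ), k (‖z₀‖ ^ 2 + t) := fun z₀ =>
    lintegral_norm_sq (k := fun t => k (‖z₀‖ ^ 2 + t)) (by fun_prop)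
  simp only [h1]
  have hm : Measurable fun s : ℝ => ∫⁻ t in Set.Ioi (0 : ℝ), k (s + t) :=
    Measurable.lintegral_prod_right' (f := fun x : ℝ × ℝ => k (x.1 + x.2)) (by fun_prop)
  rw [lintegral_norm_sq (k := fun s => ENNReal.ofReal Real.pi *
    ∫⁻ t in Set.Ioi (0 : ℝ), k (s + t)) (hm.const_mul _), lintegral_const_mul _ hm, ← mul_assoc,
    ← ENNReal.ofReal_mul Real.pi_pos.le, ← pow_two]
  congr 1
  have h2 : ∀ s : ℝ, ∫⁻ t in Set.Ioi (0 : ℝ), k (s + t) = ∫⁻ a, (Set.Ioi s).indicator k a := by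
    intro s
    rw [← lintegral_indicator measurableSet_Ioi,
      ← lintegral_add_left_eq_self (fun a => (Set.Ioi s).indicator k a) s]
    refine lintegral_congr fun t => ?_
    simp [Set.indicator_apply]
  have hm2 : Measurable fun x : ℝ × ℝ => (Set.Ioi x.1).indicator k x.2 := by
    have : (fun x : ℝ × ℝ => (Set.Ioi x.1).indicator k x.2) =
        {x : ℝ × ℝ | x.1 < x.2}.indicator fun x => k x.2 := by
      ext x
      simp [Set.indicator_apply]
    rw [this]
    exact Measurable.indicator (by fun_prop) (measurableSet_lt measurable_fst measurable_snd)
  simp only [h2]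
  rw [lintegral_lintegral_swap hm2.aemeasurable, ← lintegral_indicator measurableSet_Ioi]
  refine lintegral_congr fun a => ?_
  have h3 : ∀ s : ℝ, (Set.Ioi s).indicator k a = (Set.Iio a).indicator (fun _ => k a) s := by
    intro s
    simp [Set.indicator_apply]
  simp only [h3]
  rw [lintegral_indicator measurableSet_Iio, lintegral_const, Measure.restrict_restrict
    measurableSet_Iio, Measure.restrict_apply MeasurableSet.univ, Set.univ_inter, Set.inter_comm,
    Set.Ioi_inter_Iio, Real.volume_Ioo, sub_zero, mul_comm, Set.indicator_apply]
  split_ifs with ha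
  · rfl
  · rw [ENNReal.ofReal_of_nonpos (not_lt.mp ha), zero_mul]

/-- Integration over a vector of `ℂ²` in terms of its norm and its scalar product with a fixed
vector. -/
theorem lintegral_sqn_inner (x : Fin 2 → ℂ) (hx : x ≠ 0) {F : ℝ × ℂ → ENNReal} (hF : Measurable F) :
    ∫⁻ y : Fin 2 → ℂ, F (sqn y, ∑ j, x j * conj (y j)) = ENNReal.ofReal (Real.pi * (sqn x)⁻¹) *
        ∫⁻ p : ℝ × ℂ, {p : ℝ × ℂ | ‖p.2‖ ^ 2 < sqn x * p.1}.indicator F p := by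
  set r := Real.sqrt (sqn x)
  have hs : 0 < sqn x := by
    refine lt_of_lt_of_le ?_ (norm_sq_le_sqn x)
    have := norm_pos_iff.mpr hx
    positivity
  have hr0 : 0 < r := Real.sqrt_pos.mpr hs
  have hr2 : r ^ 2 = sqn x := Real.sq_sqrt hs.le
  have hx2 : x 0 * conj (x 0) + x 1 * conj (x 1) = (r : ℂ) ^ 2 := by
    rw [← ofReal_pow, hr2, sqn, Fin.sum_univ_two, mul_conj', mul_conj']
    push_cast
    rfl
  -- the unitary matrix whose first row is `x / |x|`, up to conjugation
  set A : 𝕄 2 :=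
    !![(r : ℂ)⁻¹ * conj (x 0), (r : ℂ)⁻¹ * conj (x 1); -((r : ℂ)⁻¹ * x 1), (r : ℂ)⁻¹ * x 0] with hA
  have hAdet : A.det = 1 := by
    rw [hA, det_fin_two_of]
    field_simp
    linear_combination hx2
  have hAA : Aᴴ * A = 1 := by
    ext i j
    fin_cases i <;> fin_cases j <;> simp [hA, Matrix.mul_apply, Fin.sum_univ_two] <;> field_simp <;>
      first | ring1 | linear_combination hx2
  have hAy : ∀ y, sqn (A *ᵥ y) = sqn y := by
    intro y
    have : ((sqn (A *ᵥ y) : ℝ) : ℂ) = sqn y := by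
      rw [← qf_one, qf_mulVec, mul_one, hAA, qf_one]
    exact_mod_cast this
  have hA0 : ∀ y, ∑ j, x j * conj (y j) = r * conj ((A *ᵥ y) 0) := by
    intro y
    simp [hA, mulVec, dotProduct, Fin.sum_univ_two]
    field_simp
  have hmeas1 : Measurable fun z : Fin 2 → ℂ => F (sqn z, r * conj (z 0)) := by
    have := continuous_sqn (κ := Fin 2)
    refine hF.comp (Continuous.measurable ?_)
    fun_prop
  have h1 : ∫⁻ y : Fin 2 → ℂ, F (sqn y, ∑ j, x j * conj (y j)) =
      ∫⁻ z : Fin 2 → ℂ, F (sqn z, r * conj (z 0)) := by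
    rw [← (measurePreserving_mulVec A (by rw [hAdet, norm_one])).lintegral_comp hmeas1]
    refine lintegral_congr fun y => ?_
    rw [hA0, hAy]
  have hsqn : ∀ z₀ z₁ : ℂ, sqn ![z₀, z₁] = ‖z₀‖ ^ 2 + ‖z₁‖ ^ 2 := fun z₀ z₁ => by simp [sqn]
  rw [h1, lintegral_finTwo hmeas1]
  simp only [hsqn, cons_val_zero]
  have h2 : ∀ z₀ : ℂ, ∫⁻ z₁ : ℂ, F (‖z₀‖ ^ 2 + ‖z₁‖ ^ 2, r * conj z₀) =
      ENNReal.ofReal Real.pi * ∫⁻ t in Set.Ioi (0 : ℝ), F (‖z₀‖ ^ 2 + t, r * conj z₀) :=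
    fun z₀ => lintegral_norm_sq (k := fun t => F (‖z₀‖ ^ 2 + t, r * conj z₀)) (by fun_prop)
  have h3 : ∀ z₀ : ℂ, ∫⁻ t in Set.Ioi (0 : ℝ), F (‖z₀‖ ^ 2 + t, r * conj z₀) =
      ∫⁻ b : ℝ, {p : ℝ × ℂ | ‖p.2‖ ^ 2 < sqn x * p.1}.indicator F (b, r • conj z₀) := by
    intro z₀
    rw [← lintegral_indicator measurableSet_Ioi, ← lintegral_add_left_eq_self
      (fun b => {p : ℝ × ℂ | ‖p.2‖ ^ 2 < sqn x * p.1}.indicator F (b, r • conj z₀)) (‖z₀‖ ^ 2)]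
    refine lintegral_congr fun t => ?_
    rw [Set.indicator_apply, Set.indicator_apply, real_smul]
    have : t ∈ Set.Ioi (0 : ℝ) ↔ ((‖z₀‖ ^ 2 + t, (r : ℂ) * conj z₀) : ℝ × ℂ) ∈
        {p : ℝ × ℂ | ‖p.2‖ ^ 2 < sqn x * p.1} := by
      simp only [Set.mem_Ioi, Set.mem_ofPred_eq, norm_mul, RCLike.norm_conj, norm_real,
        mul_pow, Real.norm_of_nonneg hr0.le, hr2]
      constructor
      · intro h; nlinarith
      · intro h
        by_contra! h'
        nlinarith
    simp only [this]
  set g : ℂ → ENNReal := fun w =>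
    ∫⁻ b : ℝ, {p : ℝ × ℂ | ‖p.2‖ ^ 2 < sqn x * p.1}.indicator F (b, w)
  have hFi : Measurable ({p : ℝ × ℂ | ‖p.2‖ ^ 2 < sqn x * p.1}.indicator F) :=
    hF.indicator (measurableSet_lt (by fun_prop) (by fun_prop))
  have hgm : Measurable g := Measurable.lintegral_prod_left' hFi
  simp only [h2, h3]
  change ∫⁻ z₀ : ℂ, ENNReal.ofReal Real.pi * g (r • conj z₀) = _
  have h4 : ∫⁻ z₀ : ℂ, g (r • conj z₀) = ENNReal.ofReal ((sqn x)⁻¹) * ∫⁻ w, g w := by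
    have e1 : ∫⁻ z₀ : ℂ, g (r • conj z₀) = ∫⁻ z₀ : ℂ, g (r • z₀) :=
      (conjLIE.measurePreserving).lintegral_comp (f := fun z : ℂ => g (r • z)) (by fun_prop)
    have e2 : ∫⁻ z₀ : ℂ, g (r • z₀) = ∫⁻ w, g w ∂(Measure.map (fun z : ℂ => r • z) volume) :=
      (lintegral_map hgm (by fun_prop)).symm
    rw [e1, e2, Measure.map_addHaar_smul _ hr0.ne', finrank_real_complex,
      lintegral_smul_measure, hr2, abs_of_pos (inv_pos.mpr hs), smul_eq_mul]
  rw [lintegral_const_mul _ (by fun_prop), h4, ← mul_assoc, ← ENNReal.ofReal_mul Real.pi_pos.le,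
    Measure.volume_eq_prod, lintegral_prod_symm _ hFi.aemeasurable]

/-- The Gram matrix `Q Q^*`. -/
def rowGram (q : Fin 2 × Fin 2 → ℂ) : Herm2 :=
  (sqn fun j => q (0, j), sqn fun j => q (1, j), ∑ j, q (0, j) * conj (q (1, j)))

theorem continuous_rowGram : Continuous rowGram := by
  have : Continuous fun z : ℂ => conj z := continuous_conj
  have h := continuous_sqn (κ := Fin 2)
  unfold rowGram
  fun_prop

theorem lintegral_finTwo_prod {F : (Fin 2 × Fin 2 → ℂ) → ENNReal} (hF : Measurable F) :
    ∫⁻ q, F q = ∫⁻ x : Fin 2 → ℂ, ∫⁻ y : Fin 2 → ℂ, F (fun p => ![x, y] p.1 p.2) := by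
  have h := ((volume_measurePreserving_sumPiEquivProdPi (fun _ : Fin 2 ⊕ Fin 2 => ℂ)).symm).trans
    (volume_measurePreserving_piCongrLeft (fun _ : Fin 2 × Fin 2 => ℂ) (finTwoProdEquiv 2))
  have e : ∀ x y : Fin 2 → ℂ, (((MeasurableEquiv.sumPiEquivProdPi
      (fun _ : Fin 2 ⊕ Fin 2 => ℂ)).symm.trans (MeasurableEquiv.piCongrLeft
      (fun _ : Fin 2 × Fin 2 => ℂ) (finTwoProdEquiv 2))) (x, y)) = fun p => ![x, y] p.1 p.2 := by
    intro x y
    ext p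
    obtain ⟨a, rfl⟩ := (finTwoProdEquiv 2).surjective p
    change (Equiv.piCongrLeft (fun _ : Fin 2 × Fin 2 => ℂ) (finTwoProdEquiv 2)
      ((MeasurableEquiv.sumPiEquivProdPi (fun _ : Fin 2 ⊕ Fin 2 => ℂ)).symm (x, y)))
        (finTwoProdEquiv 2 a) = _
    rw [Equiv.piCongrLeft_apply_apply]
    rcases a with a | a <;> rfl
  rw [← h.lintegral_comp hF, Measure.volume_eq_prod, lintegral_prod]
  · simp only [e]
  · exact (hF.comp (MeasurableEquiv.measurable _)).aemeasurable

/-- The image of the Lebesgue measure under `Q ↦ Q Q^*`. -/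
theorem lintegral_rowGram {G : Herm2 → ENNReal} (hG : Measurable G) :
    ∫⁻ q, G (rowGram q) = ENNReal.ofReal (Real.pi ^ 3) * ∫⁻ W in pdSet, G W := by
  rw [lintegral_finTwo_prod (F := fun q => G (rowGram q)) (hG.comp continuous_rowGram.measurable)]
  have hGi : Measurable (pdSet.indicator G) := hG.indicator measurableSet_pdSet
  set K : ℝ → ENNReal := fun a => ENNReal.ofReal (Real.pi * a⁻¹) *
    ∫⁻ p : ℝ × ℂ, pdSet.indicator G (a, p) with hK
  have hKi : Measurable fun a => ∫⁻ p : ℝ × ℂ, pdSet.indicator G (a, p) :=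
    Measurable.lintegral_prod_right' hGi
  have hKm : Measurable K := by rw [hK]; fun_prop
  have h1 : ∫⁻ x : Fin 2 → ℂ, ∫⁻ y : Fin 2 → ℂ, G (rowGram fun p => ![x, y] p.1 p.2) =
      ∫⁻ x : Fin 2 → ℂ, K (sqn x) := by
    have hne : ∀ᵐ x : Fin 2 → ℂ, x ≠ 0 := compl_mem_ae_iff.mpr (measure_singleton 0)
    refine lintegral_congr_ae (hne.mono fun x hx => ?_)
    dsimp only
    have hs : 0 < sqn x := by
      refine lt_of_lt_of_le ?_ (norm_sq_le_sqn x)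
      have := norm_pos_iff.mpr hx
      positivity
    have e := lintegral_sqn_inner x hx (F := fun p => G (sqn x, p)) (by fun_prop)
    refine e.trans ?_
    rw [hK]
    dsimp only
    congr 1
    refine lintegral_congr fun p => ?_
    have : p ∈ {p : ℝ × ℂ | ‖p.2‖ ^ 2 < sqn x * p.1} ↔ ((sqn x, p) : Herm2) ∈ pdSet := by
      rw [pdSet_eq]
      simp only [Set.mem_ofPred_eq, hs, true_and]
      refine ⟨fun h => ⟨?_, h⟩, fun h => h.2⟩
      have := (sq_nonneg ‖p.2‖).trans_lt h
      exact pos_of_mul_pos_right this hs.le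
    by_cases hp : p ∈ {p : ℝ × ℂ | ‖p.2‖ ^ 2 < sqn x * p.1}
    · rw [Set.indicator_of_mem hp, Set.indicator_of_mem (this.mp hp)]
    · rw [Set.indicator_of_notMem hp, Set.indicator_of_notMem (fun h => hp (this.mpr h))]
  have h2 : ∀ a ∈ Set.Ioi (0 : ℝ), ENNReal.ofReal a * K a =
      ENNReal.ofReal Real.pi * ∫⁻ p : ℝ × ℂ, pdSet.indicator G (a, p) := by
    intro a ha
    have ha' : (0 : ℝ) < a := ha
    rw [hK]
    dsimp only
    rw [← mul_assoc, ← ENNReal.ofReal_mul ha'.le]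
    congr 2
    field_simp
  rw [h1, lintegral_sqn_finTwo hKm, setLIntegral_congr_fun measurableSet_Ioi h2,
    lintegral_const_mul _ hKi, ← mul_assoc,
    ← ENNReal.ofReal_mul (by have := Real.pi_pos; positivity),
    ← pow_succ, ← lintegral_indicator measurableSet_pdSet]
  have hv : (volume : Measure Herm2) = (volume : Measure ℝ).prod (volume : Measure (ℝ × ℂ)) := rfl
  rw [hv, lintegral_prod _ hGi.aemeasurable, ← lintegral_indicator measurableSet_Ioi]
  congr 1
  refine lintegral_congr fun a => ?_
  rw [Set.indicator_apply]
  split_ifs with ha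
  · rfl
  · symm
    rw [lintegral_eq_zero_iff (by fun_prop)]
    refine .of_forall fun p => ?_
    dsimp only
    rw [Set.indicator_of_notMem]
    · rfl
    · rw [pdSet_eq]
      exact fun h => ha h.1

theorem ae_rowGram_mem_pdSet : ∀ᵐ q, rowGram q ∈ pdSet := by
  have h := lintegral_rowGram (G := pdSetᶜ.indicator 1) (measurable_one.indicator
    measurableSet_pdSet.compl)
  have h0 : ∫⁻ W in pdSet, pdSetᶜ.indicator (1 : Herm2 → ENNReal) W = 0 := by
    rw [← lintegral_indicator measurableSet_pdSet]
    simp [Set.indicator_indicator]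
  rw [h0, mul_zero] at h
  refine ((lintegral_eq_zero_iff (f := fun q => pdSetᶜ.indicator 1 (rowGram q))
    ((measurable_one.indicator measurableSet_pdSet.compl).comp
      continuous_rowGram.measurable)).mp h).mono fun q hq => ?_
  by_contra hn
  simp [hn] at hq

end PositiveDefinite

/-! ### Congruences and squares of Hermitian `2 × 2` matrices -/

section Congruence

/-- The coordinates of a Hermitian matrix. -/
def ofHerm (M : 𝕄 2) : Herm2 := ((M 0 0).re, (M 1 1).re, M 0 1)

theorem mat_ofHerm {M : 𝕄 2} (hM : M.IsHermitian) : (ofHerm M).mat = M := by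
  ext i j
  have h := fun i j => congrFun (congrFun hM.eq i) j
  simp only [conjTranspose_apply, star_def] at h
  fin_cases i <;> fin_cases j
  · simpa [ofHerm, Herm2.mat] using conj_eq_iff_re.mp (h 0 0)
  · simp [ofHerm, Herm2.mat]
  · simpa [ofHerm, Herm2.mat] using h 1 0
  · simpa [ofHerm, Herm2.mat] using conj_eq_iff_re.mp (h 1 1)

theorem continuous_ofHerm : Continuous ofHerm := by
  unfold ofHerm
  fun_prop

/-- The congruence `p ↦ K p K^*`. -/
def congrH (K : 𝕄 2) (p : Herm2) : Herm2 := ofHerm (K * p.mat * Kᴴ)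

theorem mat_congrH (K : 𝕄 2) (p : Herm2) : (congrH K p).mat = K * p.mat * Kᴴ :=
  mat_ofHerm (isHermitian_mul_mul_conjTranspose K p.isHermitian_mat)

theorem continuous_congrH (K : 𝕄 2) : Continuous (congrH K) :=
  continuous_ofHerm.comp ((continuous_const.mul Herm2.continuous_mat).mul continuous_const)

theorem congrH_mem_pdSet {K : 𝕄 2} (hK : K.det ≠ 0) {p : Herm2} :
    congrH K p ∈ pdSet ↔ p ∈ pdSet := by
  have hu : IsUnit K := (isUnit_iff_isUnit_det _).mpr (Ne.isUnit hK)
  change (congrH K p).mat.PosDef ↔ p.mat.PosDef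
  rw [mat_congrH]
  exact IsUnit.posDef_star_right_conjugate_iff hu

theorem mat_rowGram (q : Fin 2 × Fin 2 → ℂ) : (rowGram q).mat =
    (of fun i j => q (i, j)) * (of fun i j => q (i, j))ᴴ := by
  ext i j
  fin_cases i <;> fin_cases j <;>
    simp [rowGram, Herm2.mat, Matrix.mul_apply, sqn, mul_conj', mul_comm]

theorem rowGram_mulVec (K : 𝕄 2) (q : Fin 2 × Fin 2 → ℂ) :
    rowGram ((K ⊗ₖ (1 : 𝕄 2)) *ᵥ q) = congrH K (rowGram q) := by
  apply Herm2.mat_injective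
  have h : (of fun i j => ((K ⊗ₖ (1 : 𝕄 2)) *ᵥ q) (i, j)) = K * of fun i j => q (i, j) := by
    ext i j
    simp [mulVec, dotProduct, Matrix.mul_apply, Fintype.sum_prod_type,
      kroneckerMap_apply, Matrix.one_apply]
  rw [mat_congrH, mat_rowGram, mat_rowGram, h, conjTranspose_mul]
  simp only [Matrix.mul_assoc]

/-- The Jacobian of a congruence is `|det K|^4`. -/
theorem lintegral_congrH {K : 𝕄 2} (hK : K.det ≠ 0) {G : Herm2 → ENNReal} (hG : Measurable G) :
    ∫⁻ W in pdSet, G (congrH K W) = ENNReal.ofReal ((‖K.det‖ ^ 4)⁻¹) * ∫⁻ W in pdSet, G W := by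
  have hKm := (continuous_congrH K).measurable
  have hpi : ENNReal.ofReal (Real.pi ^ 3) ≠ 0 := by
    have := Real.pi_pos
    simp only [ne_eq, ENNReal.ofReal_eq_zero, not_le]
    positivity
  have hdet : (K ⊗ₖ (1 : 𝕄 2)).det = K.det ^ 2 := by
    rw [det_kronecker]
    simp
  have hmv : Measurable fun q : Fin 2 × Fin 2 → ℂ => (K ⊗ₖ (1 : 𝕄 2)) *ᵥ q :=
    (toLin' (K ⊗ₖ (1 : 𝕄 2))).continuous_of_finiteDimensional.measurable
  rw [← ENNReal.mul_right_inj hpi ENNReal.ofReal_ne_top,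
    ← lintegral_rowGram (G := fun W => G (congrH K W)) (hG.comp hKm), mul_left_comm,
    ← lintegral_rowGram hG]
  simp only [← rowGram_mulVec]
  rw [← lintegral_map (f := fun q => G (rowGram q)) (g := fun q => (K ⊗ₖ (1 : 𝕄 2)) *ᵥ q)
    (hG.comp continuous_rowGram.measurable) hmv, map_mulVec_volume _ (by rw [hdet]; positivity),
    lintegral_smul_measure, hdet, smul_eq_mul, norm_pow, ← pow_mul]

theorem map_congrH {K : 𝕄 2} (hK : K.det ≠ 0) : Measure.map (congrH K) (volume.restrict pdSet) =
      ENNReal.ofReal ((‖K.det‖ ^ 4)⁻¹) • (volume : Measure Herm2).restrict pdSet := by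
  refine Measure.ext_of_lintegral _ fun G hG => ?_
  rw [lintegral_map hG (continuous_congrH K).measurable, lintegral_congrH hK hG,
    lintegral_smul_measure, smul_eq_mul]

end Congruence

section Squaring

theorem map_add_sub_real : Measure.map (fun x : ℝ × ℝ => (x.1 + x.2, x.1 - x.2)) volume =
    ENNReal.ofReal (1 / 2) • volume := by
  have h1 : MeasurePreserving (fun x : ℝ × ℝ => (x.1 + x.2, x.2))
      (volume.prod volume) (volume.prod volume) := measurePreserving_add_prod _ _
  have h2 : Measure.map (fun x : ℝ × ℝ => (x.1, (-2 : ℝ) • x.2)) (volume.prod volume) =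
      ENNReal.ofReal (1 / 2) • ((volume : Measure ℝ).prod (volume : Measure ℝ)) := by
    have := Measure.map_prod_map (volume : Measure ℝ) (volume : Measure ℝ)
      measurable_id (g := fun x : ℝ => (-2 : ℝ) • x) (by fun_prop)
    rw [Measure.map_addHaar_smul _ (by norm_num), Measure.map_id, Module.finrank_self,
      Measure.prod_smul_right] at this
    rw [show |((-2 : ℝ) ^ 1)⁻¹| = 1 / 2 by norm_num] at this
    exact this.symm
  have h3 : MeasurePreserving (fun x : ℝ × ℝ => (x.1, x.1 + x.2))
      (volume.prod volume) (volume.prod volume) := measurePreserving_prod_add _ _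
  have e : (fun x : ℝ × ℝ => (x.1 + x.2, x.1 - x.2)) =
      (fun x : ℝ × ℝ => (x.1, x.1 + x.2)) ∘ (fun x => (x.1, (-2 : ℝ) • x.2)) ∘
        fun x => (x.1 + x.2, x.2) := by
    funext x
    simp only [Function.comp_apply, Prod.mk.injEq, true_and, smul_eq_mul]
    ring
  rw [Measure.volume_eq_prod, e, ← Measure.map_map h3.measurable (by fun_prop),
    ← Measure.map_map (by fun_prop) h1.measurable, h1.map_eq, h2, Measure.map_smul, h3.map_eq]

/-- The coordinates `M₁₁ + M₂₂`, `M₁₁ - M₂₂`, `M₁₂` of a Hermitian matrix. -/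
theorem lintegral_sum_diff {F : ℝ × ℝ × ℂ → ENNReal} (hF : Measurable F) :
    ∫⁻ p : Herm2, F (p.1 + p.2.1, p.1 - p.2.1, p.2.2) =
      ENNReal.ofReal (1 / 2) * ∫⁻ p : ℝ × ℝ × ℂ, F p := by
  have h1 : ∀ {f : ℝ × ℝ × ℂ → ENNReal}, Measurable f → ∫⁻ p : ℝ × ℝ × ℂ, f p =
      ∫⁻ x : ℝ × ℝ, ∫⁻ w : ℂ, f (x.1, x.2, w) := by
    intro f hf
    rw [← (volume_preserving_prodAssoc (α₁ := ℝ) (β₁ := ℝ) (γ₁ := ℂ)).lintegral_comp hf,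
      Measure.volume_eq_prod, lintegral_prod]
    · rfl
    · exact (hf.comp (MeasurableEquiv.measurable _)).aemeasurable
  rw [h1 (by fun_prop), h1 hF]
  have hm : Measurable fun x : ℝ × ℝ => ∫⁻ w : ℂ, F (x.1, x.2, w) :=
    Measurable.lintegral_prod_right' (f := fun y : (ℝ × ℝ) × ℂ => F (y.1.1, y.1.2, y.2))
      (by fun_prop)
  have h2 := lintegral_map (μ := volume) hm
    (g := fun x : ℝ × ℝ => (x.1 + x.2, x.1 - x.2)) (by fun_prop)
  rw [map_add_sub_real, lintegral_smul_measure, smul_eq_mul] at h2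
  exact h2.symm

/-- The substitution `T = (s² + c / s²) / 2`, which is a bijection where `c < s⁴`. -/
theorem lintegral_add_div_sq {c : ℝ} (hc : 0 ≤ c) (k : ℝ → ENNReal) :
    ∫⁻ s in {s : ℝ | 0 < s ∧ c < s ^ 4}, ENNReal.ofReal (s - c / s ^ 3) *
        k ((s ^ 2 + c / s ^ 2) / 2) =
      ∫⁻ T in {T : ℝ | 0 < T ∧ c < T ^ 2}, k T := by
  have hmeas : MeasurableSet {s : ℝ | 0 < s ∧ c < s ^ 4} :=
    (measurableSet_lt measurable_const measurable_id).inter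
      (measurableSet_lt measurable_const (measurable_id.pow_const 4))
  have himg : (fun s : ℝ => (s ^ 2 + c / s ^ 2) / 2) '' {s : ℝ | 0 < s ∧ c < s ^ 4} =
      {T : ℝ | 0 < T ∧ c < T ^ 2} := by
    ext T
    constructor
    · rintro ⟨s, ⟨hs, hcs⟩, rfl⟩
      have h1 : 0 < (s ^ 2 - c / s ^ 2) / 2 := by
        have : c / s ^ 2 < s ^ 2 := by rw [div_lt_iff₀ (by positivity)]; nlinarith
        linarith
      refine ⟨by positivity, ?_⟩
      have h2 : ((s ^ 2 + c / s ^ 2) / 2) ^ 2 - c = ((s ^ 2 - c / s ^ 2) / 2) ^ 2 := by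
        field_simp
        ring
      dsimp only
      nlinarith [pow_pos h1 2]
    · rintro ⟨hT, hcT⟩
      set ρ := Real.sqrt (T ^ 2 - c)
      have hρ2 : ρ ^ 2 = T ^ 2 - c := Real.sq_sqrt (by linarith)
      have hρ0 : 0 ≤ ρ := Real.sqrt_nonneg _
      have hTρ : 0 < T + ρ := by linarith
      have hs2 : Real.sqrt (T + ρ) ^ 2 = T + ρ := Real.sq_sqrt hTρ.le
      refine ⟨Real.sqrt (T + ρ), ⟨Real.sqrt_pos.mpr hTρ, ?_⟩, ?_⟩
      · rw [show Real.sqrt (T + ρ) ^ 4 = (Real.sqrt (T + ρ) ^ 2) ^ 2 by ring, hs2]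
        nlinarith
      · dsimp only
        rw [hs2]
        have : c / (T + ρ) = T - ρ := by
          rw [div_eq_iff hTρ.ne']
          linarith
        rw [this]
        ring
  rw [← himg]
  symm
  refine lintegral_image_eq_lintegral_deriv_mul_of_monotoneOn hmeas (fun s hs => ?_)
    (fun a ha b hb hab => ?_) k
  · have hs0 : s ≠ 0 := hs.1.ne'
    refine HasDerivAt.hasDerivWithinAt ?_
    have h1 := ((hasDerivAt_pow 2 s).add (((hasDerivAt_pow 2 s).inv (by positivity)).const_mul
      c)).div_const 2
    refine h1.congr_deriv ?_
    simp only [Nat.cast_ofNat, Nat.add_one_sub_one, pow_one]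
    field_simp
    ring
  · have ha0 := ha.1
    have hb0 := hb.1
    have hab2 : a ^ 2 ≤ b ^ 2 := by gcongr
    have h1 : c ≤ a ^ 2 * b ^ 2 := by
      have := ha.2
      nlinarith [sq_nonneg a]
    have h2 : (b ^ 2 + c / b ^ 2) / 2 - (a ^ 2 + c / a ^ 2) / 2 =
        (b ^ 2 - a ^ 2) * (a ^ 2 * b ^ 2 - c) / (2 * (a ^ 2 * b ^ 2)) := by
      field_simp
      ring
    have h3 : 0 ≤ (b ^ 2 - a ^ 2) * (a ^ 2 * b ^ 2 - c) / (2 * (a ^ 2 * b ^ 2)) :=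
      div_nonneg (mul_nonneg (by linarith) (by linarith)) (by positivity)
    linarith

/-- The square of a Hermitian matrix. -/
def sqH (p : Herm2) : Herm2 :=
  (p.1 ^ 2 + ‖p.2.2‖ ^ 2, p.2.1 ^ 2 + ‖p.2.2‖ ^ 2, ((p.1 + p.2.1 : ℝ) : ℂ) * p.2.2)

theorem mat_sqH (p : Herm2) : (sqH p).mat = p.mat ^ 2 := by
  ext i j
  fin_cases i <;> fin_cases j <;>
    simp [sqH, Herm2.mat, pow_two, Matrix.mul_apply, mul_conj, conj_mul',
      normSq_eq_norm_sq] <;> ring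

theorem continuous_sqH : Continuous sqH := by
  unfold sqH
  fun_prop

/-- The Jacobian of the square of a positive definite matrix is `4 det Λ (Tr Λ)^2`. -/
theorem lintegral_sqH {G : Herm2 → ENNReal} (hG : Measurable G) :
    ∫⁻ Λ in pdSet, ENNReal.ofReal (4 * hermDet Λ * hermTr Λ ^ 2) * G (sqH Λ) =
      ∫⁻ W in pdSet, G W := by
  -- in the coordinates `(s, v)` with `s` the trace, the square is
  -- `(s, v) ↦ ((s^2 + N v) / 2, s v)` with a quadratic form `N`
  set N : ℝ × ℂ → ℝ := fun v => v.1 ^ 2 + 4 * ‖v.2‖ ^ 2 with hN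
  have hNm : Measurable N := by rw [hN]; fun_prop
  have hN0 : ∀ v, 0 ≤ N v := fun v => by rw [hN]; positivity
  have hNs : ∀ (s : ℝ) v, N (s • v) = s ^ 2 * N v := by
    intro s v
    simp only [hN, Prod.smul_fst, Prod.smul_snd, smul_eq_mul, norm_smul, mul_pow, Real.norm_eq_abs,
      sq_abs]
    ring
  set H : ℝ × ℝ × ℂ → ENNReal := fun x => G ((x.1 + x.2.1) / 2, (x.1 - x.2.1) / 2, x.2.2) with hH
  have hHm : Measurable H := by rw [hH]; fun_prop
  set P : Set (ℝ × ℝ × ℂ) := {x | 0 < x.1 ∧ N x.2 < x.1 ^ 2} with hP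
  have hPm : MeasurableSet P := (measurableSet_lt measurable_const measurable_fst).inter
    (measurableSet_lt (hNm.comp measurable_snd) (by fun_prop))
  have hmem : ∀ p : Herm2, p ∈ pdSet ↔ ((p.1 + p.2.1, p.1 - p.2.1, p.2.2) : ℝ × ℝ × ℂ) ∈ P := by
    intro p
    rw [pdSet_eq, hP]
    simp only [Set.mem_ofPred_eq, hN]
    have := sq_nonneg ‖p.2.2‖
    constructor
    · rintro ⟨h1, h2, h3⟩
      exact ⟨by linarith, by nlinarith⟩
    · rintro ⟨h1, h2⟩
      have h3 : ‖p.2.2‖ ^ 2 < p.1 * p.2.1 := by nlinarith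
      have h4 : 0 < p.1 * p.2.1 := by linarith
      have h5 : 0 < p.1 := by
        by_contra! h
        nlinarith
      exact ⟨h5, pos_of_mul_pos_right h4 h5.le, h3⟩
  have hL : ∫⁻ Λ in pdSet, ENNReal.ofReal (4 * hermDet Λ * hermTr Λ ^ 2) * G (sqH Λ) =
      ENNReal.ofReal (1 / 2) * ∫⁻ x, P.indicator (fun x => ENNReal.ofReal
        ((x.1 ^ 2 - N x.2) * x.1 ^ 2) * H ((x.1 ^ 2 + N x.2) / 2, x.1 • x.2)) x := by
    rw [← lintegral_sum_diff (Measurable.indicator (by fun_prop) hPm),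
      ← lintegral_indicator measurableSet_pdSet]
    refine lintegral_congr fun p => ?_
    by_cases hp : p ∈ pdSet
    · rw [Set.indicator_of_mem hp, Set.indicator_of_mem ((hmem p).mp hp), hH]
      dsimp only
      congr 2
      · simp only [hermDet, hermTr, hN]
        ring
      · simp only [sqH, hN, Prod.smul_mk, smul_eq_mul, real_smul, Prod.mk.injEq]
        refine ⟨?_, ?_, trivial⟩ <;> ring
    · rw [Set.indicator_of_notMem hp, Set.indicator_of_notMem (fun h => hp ((hmem p).mpr h))]
  have hR : ∫⁻ W in pdSet, G W = ENNReal.ofReal (1 / 2) * ∫⁻ x, P.indicator H x := by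
    rw [← lintegral_sum_diff (hHm.indicator hPm), ← lintegral_indicator measurableSet_pdSet]
    refine lintegral_congr fun p => ?_
    by_cases hp : p ∈ pdSet
    · rw [Set.indicator_of_mem hp, Set.indicator_of_mem ((hmem p).mp hp), hH]
      dsimp only
      congr 1
      refine Prod.ext ?_ (Prod.ext ?_ rfl) <;> dsimp only <;> ring
    · rw [Set.indicator_of_notMem hp, Set.indicator_of_notMem (fun h => hp ((hmem p).mpr h))]
  rw [hL, hR]
  congr 1
  -- the function obtained by scaling `v` by `1 / s`
  set k : ℝ × ℝ × ℂ → ENNReal := {x : ℝ × ℝ × ℂ | 0 < x.1 ∧ N x.2 < x.1 ^ 4}.indicator fun x =>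
    ENNReal.ofReal ((x.1 ^ 2 - N x.2 / x.1 ^ 2) * x.1 ^ 2) *
      H ((x.1 ^ 2 + N x.2 / x.1 ^ 2) / 2, x.2) with hk
  have hSm : MeasurableSet {x : ℝ × ℝ × ℂ | 0 < x.1 ∧ N x.2 < x.1 ^ 4} :=
    (measurableSet_lt measurable_const measurable_fst).inter
      (measurableSet_lt (hNm.comp measurable_snd) (by fun_prop))
  have hk1 : ∀ s v, P.indicator (fun x => ENNReal.ofReal
        ((x.1 ^ 2 - N x.2) * x.1 ^ 2) * H ((x.1 ^ 2 + N x.2) / 2, x.1 • x.2)) (s, v) =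
      k (s, s • v) := by
    intro s v
    by_cases hp : (s, v) ∈ P
    · have hs : 0 < s := hp.1
      have h4 : (s, s • v) ∈ {x : ℝ × ℝ × ℂ | 0 < x.1 ∧ N x.2 < x.1 ^ 4} := by
        refine ⟨hs, ?_⟩
        have h5 : N v < s ^ 2 := hp.2
        dsimp only
        rw [hNs]
        nlinarith [pow_pos hs 2]
      rw [Set.indicator_of_mem hp, hk, Set.indicator_of_mem h4]
      dsimp only
      rw [hNs, mul_div_cancel_left₀ _ (by positivity)]
    · have h4 : (s, s • v) ∉ {x : ℝ × ℝ × ℂ | 0 < x.1 ∧ N x.2 < x.1 ^ 4} := by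
        rintro ⟨hs, h5⟩
        dsimp only at hs h5
        rw [hNs] at h5
        refine hp ⟨hs, ?_⟩
        dsimp only
        by_contra! h6
        nlinarith [pow_pos hs 2]
      rw [Set.indicator_of_notMem hp, hk, Set.indicator_of_notMem h4]
  have hfin : Module.finrank ℝ (ℝ × ℂ) = 3 := by simp [finrank_real_complex]
  have hk2 : ∀ s, ∫⁻ v, k (s, s • v) = ∫⁻ v, {x : ℝ × ℝ × ℂ | 0 < x.1 ∧ N x.2 < x.1 ^ 4}.indicator
      (fun x => ENNReal.ofReal (x.1 - N x.2 / x.1 ^ 3) *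
        H ((x.1 ^ 2 + N x.2 / x.1 ^ 2) / 2, x.2)) (s, v) := by
    intro s
    by_cases hs : 0 < s
    · have : (volume : Measure (ℝ × ℂ)).IsAddHaarMeasure :=
        inferInstanceAs ((volume : Measure ℝ).prod (volume : Measure ℂ)).IsAddHaarMeasure
      have h1 := lintegral_map (μ := (volume : Measure (ℝ × ℂ))) (f := fun v => k (s, v))
        (g := fun v => s • v) (by fun_prop) (by fun_prop)
      rw [Measure.map_addHaar_smul _ hs.ne', hfin, lintegral_smul_measure, smul_eq_mul,
        abs_of_pos (by positivity), ← lintegral_const_mul _ (by fun_prop)] at h1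
      rw [← h1]
      refine lintegral_congr fun v => ?_
      by_cases hv : (s, v) ∈ {x : ℝ × ℝ × ℂ | 0 < x.1 ∧ N x.2 < x.1 ^ 4}
      · rw [hk, Set.indicator_of_mem hv, Set.indicator_of_mem hv, ← mul_assoc,
          ← ENNReal.ofReal_mul (by positivity)]
        congr 2
        dsimp only
        field_simp
      · rw [hk, Set.indicator_of_notMem hv, Set.indicator_of_notMem hv, mul_zero]
    · refine lintegral_congr fun v => ?_
      rw [hk, Set.indicator_of_notMem (fun h => hs h.1), Set.indicator_of_notMem (fun h => hs h.1)]
  have hv : (volume : Measure (ℝ × ℝ × ℂ)) =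
    (volume : Measure ℝ).prod (volume : Measure (ℝ × ℂ)) := rfl
  rw [hv, lintegral_prod _ (Measurable.aemeasurable (Measurable.indicator (by fun_prop) hPm)),
    lintegral_prod_symm _ (hHm.indicator hPm).aemeasurable]
  simp only [hk1, hk2]
  rw [lintegral_lintegral_swap (f := fun s v =>
    {x : ℝ × ℝ × ℂ | 0 < x.1 ∧ N x.2 < x.1 ^ 4}.indicator
      (fun x => ENNReal.ofReal (x.1 - N x.2 / x.1 ^ 3) *
        H ((x.1 ^ 2 + N x.2 / x.1 ^ 2) / 2, x.2)) (s, v))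
    (Measurable.aemeasurable (f := {x : ℝ × ℝ × ℂ | 0 < x.1 ∧ N x.2 < x.1 ^ 4}.indicator
      (fun x => ENNReal.ofReal (x.1 - N x.2 / x.1 ^ 3) *
        H ((x.1 ^ 2 + N x.2 / x.1 ^ 2) / 2, x.2))) (Measurable.indicator (by fun_prop) hSm))]
  refine lintegral_congr fun v => ?_
  have hm1 : MeasurableSet {s : ℝ | 0 < s ∧ N v < s ^ 4} :=
    (measurableSet_lt measurable_const measurable_id).inter
      (measurableSet_lt measurable_const (measurable_id.pow_const 4))
  have hm2 : MeasurableSet {T : ℝ | 0 < T ∧ N v < T ^ 2} :=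
    (measurableSet_lt measurable_const measurable_id).inter
      (measurableSet_lt measurable_const (measurable_id.pow_const 2))
  have h1 := lintegral_add_div_sq (hN0 v) fun T => H (T, v)
  rw [← lintegral_indicator hm1, ← lintegral_indicator hm2] at h1
  exact h1

end Squaring

/-! ### The polar decomposition of complex `2 × 2` matrices -/

section PolarDecomposition

/-- The positive square root of a positive definite `2 × 2` matrix, by the Cayley-Hamilton
theorem. -/
def sqrtH (p : Herm2) : Herm2 :=
  let δ := Real.sqrt (hermDet p)
  let τ := Real.sqrt (hermTr p + 2 * δ)
  (τ⁻¹ * (p.1 + δ), τ⁻¹ * (p.2.1 + δ), ((τ⁻¹ : ℝ) : ℂ) * p.2.2)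

theorem measurable_sqrtH : Measurable sqrtH := by
  unfold sqrtH hermDet hermTr
  fun_prop

theorem hermDet_pos {p : Herm2} (hp : p ∈ pdSet) : 0 < hermDet p := by
  rw [pdSet_eq] at hp
  have := hp.2.2
  rw [hermDet]
  linarith

theorem hermTr_pos {p : Herm2} (hp : p ∈ pdSet) : 0 < hermTr p := by
  rw [pdSet_eq] at hp
  have := hp.1
  have := hp.2.1
  rw [hermTr]
  linarith

theorem mem_pdSet_of_det_of_tr {p : Herm2} (h : 0 < hermDet p) (h' : 0 < hermTr p) : p ∈ pdSet := by
  rw [pdSet_eq]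
  rw [hermDet] at h
  rw [hermTr] at h'
  have h1 : 0 < p.1 * p.2.1 := by nlinarith [sq_nonneg ‖p.2.2‖]
  have h2 : 0 < p.1 := by
    by_contra! h3
    nlinarith
  exact ⟨h2, pos_of_mul_pos_right h1 h2.le, by linarith⟩

theorem hermDet_sqH (p : Herm2) : hermDet (sqH p) = hermDet p ^ 2 := by
  simp only [hermDet, sqH, norm_mul, norm_real, mul_pow, Real.norm_eq_abs, sq_abs]
  ring

theorem hermTr_sqH (p : Herm2) : hermTr (sqH p) = hermTr p ^ 2 - 2 * hermDet p := by
  simp only [hermDet, hermTr, sqH]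
  ring

theorem sqrtH_sqH {p : Herm2} (hp : p ∈ pdSet) : sqrtH (sqH p) = p := by
  have h1 : Real.sqrt (hermDet (sqH p)) = hermDet p := by
    rw [hermDet_sqH, Real.sqrt_sq (hermDet_pos hp).le]
  have h2 : Real.sqrt (hermTr (sqH p) + 2 * hermDet p) = hermTr p := by
    rw [hermTr_sqH, sub_add_cancel, Real.sqrt_sq (hermTr_pos hp).le]
  have h3 := (hermTr_pos hp).ne'
  rw [sqrtH, h1, h2]
  refine Prod.ext ?_ (Prod.ext ?_ ?_)
  · simp only [sqH, hermDet, hermTr] at *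
    field_simp
    ring
  · simp only [sqH, hermDet, hermTr] at *
    field_simp
    ring
  · have h4 : ((hermTr p : ℝ) : ℂ) ≠ 0 := by exact_mod_cast h3
    change (((hermTr p)⁻¹ : ℝ) : ℂ) * ((hermTr p : ℂ) * p.2.2) = p.2.2
    rw [ofReal_inv, inv_mul_cancel_left₀ h4]

/-- `sqrtH p` is the positive definite square root of `p`. -/
theorem sqrtH_spec {p : Herm2} (hp : p ∈ pdSet) : sqrtH p ∈ pdSet ∧ sqH (sqrtH p) = p := by
  set δ := Real.sqrt (hermDet p)
  set τ := Real.sqrt (hermTr p + 2 * δ)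
  have hd := hermDet_pos hp
  have ht := hermTr_pos hp
  have hδ0 : 0 < δ := Real.sqrt_pos.mpr hd
  have hδ2 : δ ^ 2 = hermDet p := Real.sq_sqrt hd.le
  have hτ0 : 0 < τ := Real.sqrt_pos.mpr (by linarith)
  have hτ2 : τ ^ 2 = hermTr p + 2 * δ := Real.sq_sqrt (by linarith)
  have e : sqrtH p = (τ⁻¹ * (p.1 + δ), τ⁻¹ * (p.2.1 + δ), ((τ⁻¹ : ℝ) : ℂ) * p.2.2) := rfl
  have htr : hermTr (sqrtH p) = τ := by
    rw [e, hermTr]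
    dsimp only
    rw [hermTr] at hτ2
    field_simp
    linarith
  have hdet : hermDet (sqrtH p) = δ := by
    rw [e, hermDet]
    dsimp only
    rw [norm_mul, norm_real, mul_pow, Real.norm_eq_abs, sq_abs]
    rw [hermDet] at hδ2
    rw [hermTr] at hτ2
    field_simp
    rw [hτ2]
    linear_combination -hδ2
  refine ⟨mem_pdSet_of_det_of_tr (by rw [hdet]; exact hδ0) (by rw [htr]; exact hτ0), ?_⟩
  have h1 : (sqrtH p).1 = τ⁻¹ * (p.1 + δ) := rfl
  have h2 : (sqrtH p).2.1 = τ⁻¹ * (p.2.1 + δ) := rfl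
  have h3 : (sqrtH p).2.2 = ((τ⁻¹ : ℝ) : ℂ) * p.2.2 := rfl
  have hτc : (τ : ℂ) ≠ 0 := by exact_mod_cast hτ0.ne'
  rw [hermDet] at hdet
  rw [hermTr] at htr
  refine Prod.ext ?_ (Prod.ext ?_ ?_)
  · have : (sqH (sqrtH p)).1 = (sqrtH p).1 * ((sqrtH p).1 + (sqrtH p).2.1) - δ := by
      rw [← hdet, sqH]
      ring
    rw [this, htr, h1]
    field_simp
    ring
  · have : (sqH (sqrtH p)).2.1 = (sqrtH p).2.1 * ((sqrtH p).1 + (sqrtH p).2.1) - δ := by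
      rw [← hdet, sqH]
      ring
    rw [this, htr, h2]
    field_simp
    ring
  · rw [sqH]
    dsimp only
    rw [htr, h3, ofReal_inv, mul_inv_cancel_left₀ hτc]

theorem msqrt_sq {S : 𝕄 2} (hS : S.PosDef) : msqrt (S ^ 2) = S := by
  have hsa : IsSelfAdjoint S := hS.isHermitian
  have h1 : cfc (fun x : ℝ => Real.sqrt (x ^ 2)) S = cfc Real.sqrt (S ^ 2) :=
    cfc_comp_pow Real.sqrt 2 S (Real.continuous_sqrt.continuousOn) hsa
  rw [msqrt, ← h1]
  have h2 : cfc (fun x : ℝ => Real.sqrt (x ^ 2)) S = cfc (fun x : ℝ => x) S := by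
    refine cfc_congr fun x hx => ?_
    obtain ⟨i, rfl⟩ := hS.isHermitian.spectrum_real_eq_range_eigenvalues ▸ hx
    exact Real.sqrt_sq (hS.eigenvalues_pos i).le
  rw [h2, cfc_id' ℝ S hsa]

theorem msqrt_mat {p : Herm2} (hp : p ∈ pdSet) : msqrt p.mat = (sqrtH p).mat := by
  conv_lhs => rw [← (sqrtH_spec hp).2, mat_sqH]
  exact msqrt_sq (sqrtH_spec hp).1

instance isProbabilityMeasure_haarU2 : IsProbabilityMeasure haarU2 :=
  ⟨by
    rw [haarU2]
    exact Measure.haarMeasure_self (K₀ := (⊤ : TopologicalSpace.PositiveCompacts U2))⟩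

instance isMulLeftInvariant_haarU2 : haarU2.IsMulLeftInvariant :=
  inferInstanceAs (Measure.haarMeasure _).IsMulLeftInvariant

theorem measurable_coe_U2 (i j : Fin 2) : Measurable fun U : U2 => (U : 𝕄 2) i j :=
  (measurable_pi_apply j).comp ((measurable_pi_apply i).comp measurable_subtype_coe)

theorem measurable_matrix_of_entries {α m k : Type*} [MeasurableSpace α] {f : α → Matrix m k ℂ}
    (h : ∀ i j, Measurable fun x => f x i j) : Measurable f :=
  measurable_pi_iff.mpr fun i => measurable_pi_iff.mpr fun j => h i j

theorem measurable_mul_U2 {α : Type*} [MeasurableSpace α] {f : α → 𝕄 2}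
    (h : ∀ i j, Measurable fun x => f x i j) :
    Measurable fun x : α × U2 => f x.1 * (x.2 : 𝕄 2) := by
  refine measurable_matrix_of_entries fun i j => ?_
  simp only [Matrix.mul_apply]
  exact Finset.measurable_fun_sum _ fun k _ =>
    ((h i k).comp measurable_fst).mul ((measurable_coe_U2 k j).comp measurable_snd)

theorem measurable_herm2_mat (i j : Fin 2) : Measurable fun p : Herm2 => p.mat i j :=
  (Herm2.continuous_mat.matrix_elem i j).measurable

theorem measurable_of_apply (i j : Fin 2) : Measurable fun q : Fin 2 × Fin 2 → ℂ =>
    (of fun i j => q (i, j) : 𝕄 2) i j :=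
  measurable_pi_apply (i, j)

theorem measurable_of : Measurable fun q : Fin 2 × Fin 2 → ℂ =>
    (of fun i j => q (i, j) : 𝕄 2) :=
  measurable_matrix_of_entries measurable_of_apply

theorem norm_det_U2 (U : U2) : ‖(U : 𝕄 2).det‖ = 1 := by
  have h : star (U : 𝕄 2).det * (U : 𝕄 2).det = 1 := (det_of_mem_unitary U.2).1
  have h2 := congrArg norm h
  rw [norm_mul, norm_star, norm_one, ← pow_two] at h2
  exact (pow_eq_one_iff_of_nonneg (norm_nonneg _) two_ne_zero).mp h2

theorem of_mulVec_one_kronecker (M : 𝕄 2) (q : Fin 2 × Fin 2 → ℂ) :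
    (of fun i j => (((1 : 𝕄 2) ⊗ₖ Mᵀ) *ᵥ q) (i, j)) = (of fun i j => q (i, j)) * M := by
  ext i j
  simp [mulVec, dotProduct, Matrix.mul_apply, Fintype.sum_prod_type,
    kroneckerMap_apply, Matrix.one_apply, mul_comm]

/-- Right multiplication by a unitary matrix preserves the volume. -/
theorem lintegral_mul_unitary {F : 𝕄 2 → ENNReal} (hF : Measurable F) (U : U2) :
    ∫⁻ q : Fin 2 × Fin 2 → ℂ, F (of fun i j => q (i, j)) =
      ∫⁻ q : Fin 2 × Fin 2 → ℂ, F ((of fun i j => q (i, j)) * (U : 𝕄 2)) := by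
  have hdet : ‖((1 : 𝕄 2) ⊗ₖ (U : 𝕄 2)ᵀ).det‖ = 1 := by
    rw [det_kronecker, det_one, det_transpose, one_pow, one_mul, norm_pow, norm_det_U2, one_pow]
  have h := (measurePreserving_mulVec _ hdet).lintegral_comp
    (f := fun q => F (of fun i j => q (i, j))) (hF.comp measurable_of)
  rw [← h]
  refine lintegral_congr fun q => ?_
  rw [of_mulVec_one_kronecker]

/-- Integration in the polar decomposition `Q = Λ U`. -/
theorem lintegral_polar {F : 𝕄 2 → ENNReal} (hF : Measurable F) :
    ∫⁻ q : Fin 2 × Fin 2 → ℂ, F (of fun i j => q (i, j)) =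
      ENNReal.ofReal (Real.pi ^ 3) * ∫⁻ Λ in pdSet, ENNReal.ofReal (4 * hermDet Λ * hermTr Λ ^ 2) *
          ∫⁻ U : U2, F (Λ.mat * (U : 𝕄 2)) ∂haarU2 := by
  set Φ : Herm2 → ENNReal := fun W =>
    ∫⁻ U : U2, F ((sqrtH W).mat * (U : 𝕄 2)) ∂haarU2 with hΦ
  have hSe : ∀ i j, Measurable fun p : Herm2 => (sqrtH p).mat i j := fun i j =>
    (measurable_herm2_mat i j).comp measurable_sqrtH
  have hΦm : Measurable Φ := Measurable.lintegral_prod_right'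
    (f := fun x : Herm2 × U2 => F ((sqrtH x.1).mat * (x.2 : 𝕄 2)))
    (hF.comp (measurable_mul_U2 (f := fun p : Herm2 => (sqrtH p).mat) hSe))
  have h1 := lintegral_mul_unitary hF
  -- averaging over right multiplications leaves a function of `Q Q^*` alone
  have h2 : ∫⁻ q : Fin 2 × Fin 2 → ℂ, F (of fun i j => q (i, j)) =
      ∫⁻ U : U2, ∫⁻ q : Fin 2 × Fin 2 → ℂ, F ((of fun i j => q (i, j)) *
        (U : 𝕄 2)) ∂volume ∂haarU2 := by
    simp only [← h1, lintegral_const, measure_univ, mul_one]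
  have h3 : ∀ q : Fin 2 × Fin 2 → ℂ, rowGram q ∈ pdSet →
      ∫⁻ U : U2, F ((of fun i j => q (i, j)) * (U : 𝕄 2)) ∂haarU2 = Φ (rowGram q) := by
    intro q hq
    set S := (sqrtH (rowGram q)).mat with hS
    obtain ⟨hpd, hsq⟩ := sqrtH_spec hq
    have hSpd : S.PosDef := hpd
    have hSu : IsUnit S.det := (isUnit_iff_isUnit_det _).mp hSpd.isUnit
    set Q : 𝕄 2 := of fun i j => q (i, j)
    have hQQ : Q * Qᴴ = S * S := by
      rw [← pow_two, hS, ← mat_sqH, hsq, mat_rowGram]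
    have hV : S⁻¹ * Q ∈ unitaryGroup (Fin 2) ℂ := by
      rw [mem_unitaryGroup_iff, star_eq_conjTranspose, conjTranspose_mul,
        conjTranspose_nonsing_inv, hSpd.isHermitian.eq, Matrix.mul_assoc,
        ← Matrix.mul_assoc Q, hQQ, Matrix.mul_assoc S, mul_nonsing_inv _ hSu, mul_one,
        nonsing_inv_mul _ hSu]
    rw [hΦ]
    dsimp only
    rw [← lintegral_mul_left_eq_self (fun U : U2 => F (S * (U : 𝕄 2))) ⟨S⁻¹ * Q, hV⟩]
    refine lintegral_congr fun U => ?_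
    rw [Submonoid.coe_mul, Matrix.mul_assoc, mul_nonsing_inv_cancel_left _ _ hSu]
  have hswap : Measurable fun x : (Fin 2 × Fin 2 → ℂ) × U2 =>
      F ((of fun i j => x.1 (i, j)) * (x.2 : 𝕄 2)) :=
    hF.comp (measurable_mul_U2 (f := fun q : Fin 2 × Fin 2 → ℂ => (of fun i j => q (i, j)))
      measurable_of_apply)
  rw [h2, ← lintegral_lintegral_swap (f := fun (q : Fin 2 × Fin 2 → ℂ) (U : U2) =>
    F ((of fun i j => q (i, j)) * (U : 𝕄 2))) hswap.aemeasurable,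
    lintegral_congr_ae (ae_rowGram_mem_pdSet.mono h3), lintegral_rowGram hΦm, ← lintegral_sqH hΦm]
  congr 1
  refine setLIntegral_congr_fun measurableSet_pdSet fun Λ hΛ => ?_
  rw [hΦ]
  dsimp only
  rw [sqrtH_sqH hΛ]

end PolarDecomposition

/-! ### Covariance of the density of the Gram matrices -/

section Covariance

variable {n : ℕ}

/-- The set of positive semidefinite matrices. -/
def psdSet : Set Herm2 := {p | 0 ≤ p.1 ∧ 0 ≤ p.2.1 ∧ ‖p.2.2‖ ^ 2 ≤ p.1 * p.2.1}

theorem isClosed_psdSet : IsClosed psdSet := by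
  have h1 : Continuous fun p : Herm2 => p.2.1 := by fun_prop
  have h2 : Continuous fun p : Herm2 => ‖p.2.2‖ ^ 2 := by fun_prop
  exact (isClosed_le continuous_const continuous_fst).inter
    ((isClosed_le continuous_const h1).inter (isClosed_le h2 (continuous_fst.mul h1)))

theorem gramOf_mem_psdSet (ψ : Fin 2 × Fin n → ℂ) : gramOf ψ ∈ psdSet := by
  refine ⟨by unfold gramOf; positivity, by unfold gramOf; positivity, ?_⟩
  have h1 : ‖∑ α, ψ (0, α) * conj (ψ (1, α))‖ ≤ ∑ α, ‖ψ (0, α)‖ * ‖ψ (1, α)‖ := by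
    refine (norm_sum_le _ _).trans (le_of_eq ?_)
    simp
  have h2 : (∑ α, ‖ψ (0, α)‖ * ‖ψ (1, α)‖) ^ 2 ≤
      (∑ α, ‖ψ (0, α)‖ ^ 2) * ∑ α, ‖ψ (1, α)‖ ^ 2 := sum_mul_sq_le_sq_mul_sq _ _ _
  simp only [gramOf, norm_mul, norm_inv, Complex.norm_natCast, mul_pow]
  calc ((n : ℝ)⁻¹) ^ 2 * ‖∑ α, ψ (0, α) * conj (ψ (1, α))‖ ^ 2
      ≤ ((n : ℝ)⁻¹) ^ 2 * ((∑ α, ‖ψ (0, α)‖ ^ 2) * ∑ α, ‖ψ (1, α)‖ ^ 2) := by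
        gcongr
        refine le_trans ?_ h2
        gcongr
    _ = _ := by ring

theorem gram_mem_psdSet (φ : Blk n → ℂ) : gram φ ∈ psdSet ×ˢ psdSet :=
  Set.mk_mem_prod (gramOf_mem_psdSet _) (gramOf_mem_psdSet _)

theorem volume_hermDet_eq_zero : volume {p : Herm2 | p.1 * p.2.1 = ‖p.2.2‖ ^ 2} = 0 := by
  have hm : MeasurableSet {p : Herm2 | p.1 * p.2.1 = ‖p.2.2‖ ^ 2} :=
    measurableSet_eq_fun (by fun_prop) (by fun_prop)
  have hv : (volume : Measure Herm2) = (volume : Measure ℝ).prod (volume : Measure (ℝ × ℂ)) := rfl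
  have hv2 : (volume : Measure (ℝ × ℂ)) = (volume : Measure ℝ).prod (volume : Measure ℂ) := rfl
  rw [hv, Measure.measure_prod_null hm]
  refine .of_forall fun a => ?_
  dsimp only
  rw [hv2]
  refine (Measure.measure_prod_null (measurable_prodMk_left hm)).mpr (.of_forall fun b => ?_)
  refine measure_mono_null (t := Metric.sphere (0 : ℂ) (Real.sqrt (a * b))) (fun w hw => ?_)
    (Measure.addHaar_sphere _ _ _)
  have hw' : a * b = ‖w‖ ^ 2 := hw
  rw [mem_sphere_zero_iff_norm, hw', Real.sqrt_sq (norm_nonneg _)]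

theorem ae_mem_pdSet_of_mem_psdSet : ∀ᵐ p : Herm2, p ∈ psdSet → p ∈ pdSet := by
  have h : ∀ᵐ p : Herm2, ¬ (p.1 * p.2.1 = ‖p.2.2‖ ^ 2) :=
    measure_eq_zero_iff_ae_notMem.mp volume_hermDet_eq_zero
  refine h.mono fun p hp hps => ?_
  obtain ⟨h1, h2, h3⟩ := hps
  have h4 : ‖p.2.2‖ ^ 2 < p.1 * p.2.1 := lt_of_le_of_ne h3 (Ne.symm hp)
  have h5 : 0 < p.1 * p.2.1 := (sq_nonneg _).trans_lt h4
  rw [pdSet_eq]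
  refine ⟨lt_of_le_of_ne h1 fun h => ?_, lt_of_le_of_ne h2 fun h => ?_, h4⟩
  · rw [← h, zero_mul] at h5
    exact lt_irrefl _ h5
  · rw [← h, mul_zero] at h5
    exact lt_irrefl _ h5

/-- The density vanishes off the cone of pairs of positive definite matrices. -/
theorem ae_gramDensity_eq_zero (hn : 4 ≤ n) (Az : 𝕄 n) (C : Matrix (Blk n) (Blk n) ℂ) (ξ : 𝕄 2)
    {u : ℝ} (hu : 0 < u) :
    ∀ᵐ R : Herm2 × Herm2, R ∉ pdSet ×ˢ pdSet → gramDensity Az C ξ u R = 0 := by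
  have hU : IsOpen (psdSet ×ˢ psdSet)ᶜ := (isClosed_psdSet.prod isClosed_psdSet).isOpen_compl
  have hcont := continuous_gramDensity hn Az C ξ hu
  -- Gram matrices are positive semidefinite, so test functions off the closed cone integrate to
  -- zero; the boundary of the cone is a null set
  have h1 := hU.ae_eq_zero_of_integral_contDiff_smul_eq_zero
    (f := gramDensity Az C ξ u) (μ := (volume : Measure (Herm2 × Herm2)))
    (hcont.locallyIntegrable.locallyIntegrableOn _) (fun g hg hc hsupp => by
      have h2 := integral_bosonOsc_gram hn Az C ξ hu (θ := fun R => (g R : ℂ))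
        (ofRealCLM.contDiff.comp hg) (hc.comp_left ofReal_zero)
      simp only [real_smul]
      rw [← h2]
      refine integral_eq_zero_of_ae (.of_forall fun φ => ?_)
      have h3 : g (gram φ) = 0 := by
        by_contra h
        have hmem : gram φ ∈ (psdSet ×ˢ psdSet)ᶜ := hsupp (subset_tsupport g h)
        exact hmem (gram_mem_psdSet φ)
      simp [h3])
  have h2 : ∀ᵐ R : Herm2 × Herm2, R.1 ∈ psdSet → R.1 ∈ pdSet :=
    Measure.quasiMeasurePreserving_fst.ae ae_mem_pdSet_of_mem_psdSet
  have h3 : ∀ᵐ R : Herm2 × Herm2, R.2 ∈ psdSet → R.2 ∈ pdSet :=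
    Measure.quasiMeasurePreserving_snd.ae ae_mem_pdSet_of_mem_psdSet
  filter_upwards [h1, h2, h3] with R e1 e2 e3 hR
  exact e1 fun h => hR ⟨e2 h.1, e3 h.2⟩

/-- The block diagonal transformation of the bosonic variables by `(K^*)⁻¹` and `K`. -/
def bosonAct (n : ℕ) (K : 𝕄 2) : Matrix (Blk n) (Blk n) ℂ :=
  fromBlocks ((K⁻¹)ᴴ ⊗ₖ (1 : 𝕄 n)) 0 0 (K ⊗ₖ (1 : 𝕄 n))

theorem norm_det_bosonAct {K : 𝕄 2} (hK : K.det ≠ 0) : ‖(bosonAct n K).det‖ = 1 := by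
  have h0 : ‖K.det‖ ≠ 0 := norm_ne_zero_iff.mpr hK
  rw [bosonAct, det_fromBlocks_zero₂₁, det_kronecker, det_kronecker,
    det_conjTranspose, det_nonsing_inv, Ring.inverse_eq_inv']
  simp only [det_one, one_pow, mul_one, norm_mul, norm_pow, norm_star, norm_inv]
  rw [← mul_pow, inv_mul_cancel₀ h0, one_pow]

theorem bosonAct_mulVec (K : 𝕄 2) (φ : Blk n → ℂ) : bosonAct n K *ᵥ φ =
    Sum.elim (((K⁻¹)ᴴ ⊗ₖ (1 : 𝕄 n)) *ᵥ fun p => φ (.inl p))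
      ((K ⊗ₖ (1 : 𝕄 n)) *ᵥ fun p => φ (.inr p)) := by
  have h2 : φ = Sum.elim (fun p => φ (.inl p)) (fun p => φ (.inr p)) := by
    ext (a | a) <;> rfl
  conv_lhs => rw [h2]
  rw [bosonAct, fromBlocks_mulVec]
  simp

theorem kronecker_one_mulVec_apply (K : 𝕄 2) (ψ : Fin 2 × Fin n → ℂ) (k : Fin 2) (α : Fin n) :
    ((K ⊗ₖ (1 : 𝕄 n)) *ᵥ ψ) (k, α) = ∑ l, K k l * ψ (l, α) := by
  simp [mulVec, dotProduct, Fintype.sum_prod_type, kroneckerMap_apply, Matrix.one_apply]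

theorem gramOf_mulVec (K : 𝕄 2) (ψ : Fin 2 × Fin n → ℂ) :
    gramOf ((K ⊗ₖ (1 : 𝕄 n)) *ᵥ ψ) = congrH K (gramOf ψ) := by
  apply Herm2.mat_injective
  have h : ∀ ψ : Fin 2 × Fin n → ℂ, (gramOf ψ).mat = (n : ℂ)⁻¹ •
      ((of fun i j => ψ (i, j)) * (of fun i j => ψ (i, j))ᴴ) := by
    intro ψ
    ext k l
    rw [gramOf_mat_apply]
    simp [Matrix.mul_apply]
  have h2 : (of fun i j => ((K ⊗ₖ (1 : 𝕄 n)) *ᵥ ψ) (i, j)) = K * of fun i j => ψ (i, j) := by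
    ext k α
    simp [kronecker_one_mulVec_apply, Matrix.mul_apply]
  rw [mat_congrH, h, h, h2, conjTranspose_mul, Matrix.mul_smul, smul_mul]
  simp only [Matrix.mul_assoc]

theorem gram_bosonAct (K : 𝕄 2) (φ : Blk n → ℂ) :
    gram (bosonAct n K *ᵥ φ) = (congrH (K⁻¹)ᴴ (gram φ).1, congrH K (gram φ).2) := by
  rw [gram, bosonAct_mulVec]
  simp only [Sum.elim_inl, Sum.elim_inr, gramOf_mulVec, gram]

theorem sum_bosonAct {K : 𝕄 2} (hK : K.det ≠ 0) (φ : Blk n → ℂ) (α β : Fin n) :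
    ∑ k, (bosonAct n K *ᵥ φ) (.inl (k, α)) *
        conj ((bosonAct n K *ᵥ φ) (.inr (k, β))) =
      ∑ k, φ (.inl (k, α)) * conj (φ (.inr (k, β))) := by
  have h1 : K⁻¹ * K = 1 := nonsing_inv_mul _ (Ne.isUnit hK)
  have h : ∀ x y : Fin 2 → ℂ, ((K⁻¹)ᴴ *ᵥ x) ⬝ᵥ star (K *ᵥ y) = x ⬝ᵥ star y := by
    intro x y
    rw [star_mulVec, dotProduct_comm, ← dotProduct_mulVec, mulVec_mulVec,
      ← conjTranspose_mul, h1, conjTranspose_one, one_mulVec, dotProduct_comm]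
  rw [bosonAct_mulVec]
  simp only [Sum.elim_inl, Sum.elim_inr, kronecker_one_mulVec_apply]
  exact h (fun l => φ (.inl (l, α))) (fun l => φ (.inr (l, β)))

theorem bilPert_bosonAct {K : 𝕄 2} (hK : K.det ≠ 0) (φ : Blk n → ℂ) :
    bilPert uCoef vCoef (bosonAct n K *ᵥ φ) = bilPert uCoef vCoef φ := by
  have h2 : ∀ α β : Fin n, ∑ k, (bosonAct n K *ᵥ φ) (.inr (k, α)) *
        conj ((bosonAct n K *ᵥ φ) (.inl (k, β))) =
      ∑ k, φ (.inr (k, α)) * conj (φ (.inl (k, β))) := by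
    intro α β
    have := congrArg conj (sum_bosonAct hK φ β α)
    simp only [map_sum, map_mul, conj_conj] at this
    simpa only [mul_comm] using this
  ext a b
  rw [bilPert_apply, bilPert_apply]
  rcases a with a | a <;> rcases b with b | b <;> simp only [sum_bosonAct hK, h2]

theorem conj_hermX {K : 𝕄 2} (hK : K.det ≠ 0) (Az : 𝕄 n) (ξ : 𝕄 2) :
    (bosonAct n K)ᴴ * hermX Az ξ 0 0 * bosonAct n K = hermX Az (K⁻¹ * ξ * K) 0 0 := by
  have h1 : K⁻¹ * K = 1 := nonsing_inv_mul _ (Ne.isUnit hK)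
  have hA : (K⁻¹ ⊗ₖ (1 : 𝕄 n)) * calA Az ξ * (K ⊗ₖ (1 : 𝕄 n)) = calA Az (K⁻¹ * ξ * K) := by
    simp only [calA, Matrix.mul_sub, Matrix.sub_mul, Matrix.mul_smul, smul_mul,
      ← mul_kronecker_mul, mul_one, one_mul, h1]
  have hA2 := congrArg conjTranspose hA
  rw [conjTranspose_mul, conjTranspose_mul] at hA2
  simp only [hermX, bosonAct, fromBlocks_conjTranspose, fromBlocks_multiply,
    conjTranspose_zero, zero_kronecker, Matrix.mul_zero, Matrix.zero_mul, add_zero,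
    zero_add, neg_zero, Matrix.mul_neg, Matrix.neg_mul]
  congr 2
  · rw [← hA, conjTranspose_kronecker, conjTranspose_conjTranspose, conjTranspose_one]
  · rw [← hA2, conjTranspose_kronecker, conjTranspose_kronecker,
      conjTranspose_one, Matrix.mul_assoc]

theorem bosonOsc_bosonAct {K : 𝕄 2} (hK : K.det ≠ 0) (Az : 𝕄 n) (C : Matrix (Blk n) (Blk n) ℂ)
    (ξ : 𝕄 2) (φ : Blk n → ℂ) :
    bosonOsc Az C ξ (bosonAct n K *ᵥ φ) = bosonOsc Az C (K⁻¹ * ξ * K) φ := by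
  rw [bosonOsc, bosonOsc, bilPert_bosonAct hK, accr, accr, qf_add, qf_add, qf_smul, qf_smul,
    qf_smul, qf_smul, ofReal_zero, zero_mul, zero_mul, qf_mulVec, conj_hermX hK]

/-- A congruence as a linear equivalence. -/
def congrEquiv (K : 𝕄 2) (hK : K.det ≠ 0) : Herm2 ≃L[ℝ] Herm2 :=
  LinearEquiv.toContinuousLinearEquiv
    { toFun := congrH K
      invFun := congrH K⁻¹
      map_add' := fun p q => Herm2.mat_injective (by
        simp only [mat_congrH, Herm2.mat_add, Matrix.mul_add, Matrix.add_mul])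
      map_smul' := fun c p => Herm2.mat_injective (by
        simp only [mat_congrH, Herm2.mat_smul, Matrix.mul_smul, smul_mul, RingHom.id_apply])
      left_inv := fun p => Herm2.mat_injective (by
        have h1 : K⁻¹ * K = 1 := nonsing_inv_mul _ (Ne.isUnit hK)
        rw [mat_congrH, mat_congrH, Matrix.mul_assoc K⁻¹, Matrix.mul_assoc, Matrix.mul_assoc,
          ← conjTranspose_mul, h1, conjTranspose_one, mul_one, ← Matrix.mul_assoc,
          h1, one_mul])
      right_inv := fun p => Herm2.mat_injective (by
        have h1 : K * K⁻¹ = 1 := mul_nonsing_inv _ (Ne.isUnit hK)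
        rw [mat_congrH, mat_congrH, Matrix.mul_assoc K, Matrix.mul_assoc, Matrix.mul_assoc,
          ← conjTranspose_mul, h1, conjTranspose_one, mul_one, ← Matrix.mul_assoc,
          h1, one_mul]) }

/-- The action of `K` on the pairs of Gram matrices. -/
def gramAct (K : 𝕄 2) (hK : K.det ≠ 0) :
    (Herm2 × Herm2) ≃L[ℝ] (Herm2 × Herm2) :=
  (congrEquiv (K⁻¹)ᴴ (by
    rw [det_conjTranspose, det_nonsing_inv, Ring.inverse_eq_inv']
    exact star_ne_zero.mpr (inv_ne_zero hK))).prodCongr (congrEquiv K hK)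

theorem gramAct_apply {K : 𝕄 2} (hK : K.det ≠ 0) (R : Herm2 × Herm2) :
    gramAct K hK R = (congrH (K⁻¹)ᴴ R.1, congrH K R.2) := rfl

theorem measurePreserving_gramAct {K : 𝕄 2} (hK : K.det ≠ 0) :
    MeasurePreserving (gramAct K hK) (volume.restrict (pdSet ×ˢ pdSet))
      (volume.restrict (pdSet ×ˢ pdSet)) := by
  refine ⟨(gramAct K hK).continuous.measurable, ?_⟩
  have hK' : ((K⁻¹)ᴴ).det ≠ 0 := by
    rw [det_conjTranspose, det_nonsing_inv, Ring.inverse_eq_inv']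
    exact star_ne_zero.mpr (inv_ne_zero hK)
  have h1 := Measure.map_prod_map ((volume : Measure Herm2).restrict pdSet)
    ((volume : Measure Herm2).restrict pdSet) (continuous_congrH (K⁻¹)ᴴ).measurable
    (continuous_congrH K).measurable
  rw [Measure.volume_eq_prod, ← Measure.prod_restrict]
  change Measure.map (Prod.map (congrH (K⁻¹)ᴴ) (congrH K)) _ = _
  rw [← h1, map_congrH hK, map_congrH hK', Measure.prod_smul_left, Measure.prod_smul_right,
    smul_smul, ← ENNReal.ofReal_mul (by positivity), det_conjTranspose, norm_star,
    det_nonsing_inv, Ring.inverse_eq_inv', norm_inv]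
  have : (‖K.det‖⁻¹ ^ 4)⁻¹ * (‖K.det‖ ^ 4)⁻¹ = 1 := by field_simp
  rw [this, ENNReal.ofReal_one, one_smul]

/-- The linear substitution of the bosonic variables acts on the density by congruence, and on the
source `ξ` by conjugation. -/
theorem gramDensity_covariant (hn : 4 ≤ n) (Az : 𝕄 n) (C : Matrix (Blk n) (Blk n) ℂ) (ξ : 𝕄 2)
    {u : ℝ} (hu : 0 < u) {K : 𝕄 2} (hK : K.det ≠ 0) {R : Herm2 × Herm2} (hR : R ∈ pdSet ×ˢ pdSet) :
    gramDensity Az C ξ u (gramAct K hK R) = gramDensity Az C (K⁻¹ * ξ * K) u R := by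
  set a := gramAct K hK with ha
  have hU : IsOpen (pdSet ×ˢ pdSet) := isOpen_pdSet.prod isOpen_pdSet
  have hc1 := continuous_gramDensity hn Az C ξ hu
  have hc2 := continuous_gramDensity hn Az C (K⁻¹ * ξ * K) hu
  have hc1' : Continuous fun R => gramDensity Az C ξ u (a R) := hc1.comp a.continuous
  have hmp := measurePreserving_gramAct hK
  have hemb : MeasurableEmbedding a := a.toHomeomorph.measurableEmbedding
  -- integration against a density only sees the cone
  have hcone : ∀ ξ (θ : Herm2 × Herm2 → ℂ), ∫ R, θ R * gramDensity Az C ξ u R =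
      ∫ R in pdSet ×ˢ pdSet, θ R * gramDensity Az C ξ u R := by
    intro ξ θ
    symm
    refine setIntegral_eq_integral_of_ae_compl_eq_zero ?_
    filter_upwards [ae_gramDensity_eq_zero hn Az C ξ hu] with R h1 h2
    rw [h1 h2, mul_zero]
  -- both densities are tested against functions supported in the cone, where the substitution of
  -- `φ` can be carried out under the integral
  have hzero := hU.ae_eq_zero_of_integral_contDiff_smul_eq_zero
    (f := fun R => gramDensity Az C ξ u (a R) - gramDensity Az C (K⁻¹ * ξ * K) u R)
    (μ := (volume : Measure (Herm2 × Herm2)))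
    ((hc1'.sub hc2).locallyIntegrable.locallyIntegrableOn _) (fun g hg hc hsupp => by
      have hgc : ContDiff ℝ (⊤ : ℕ∞) fun R => (g R : ℂ) := ofRealCLM.contDiff.comp hg
      have hcc : HasCompactSupport fun R => (g R : ℂ) := hc.comp_left ofReal_zero
      have e1 : ∫ R, (g R : ℂ) * gramDensity Az C (K⁻¹ * ξ * K) u R =
          ∫ φ : Blk n → ℂ, bosonOsc Az C (K⁻¹ * ξ * K) φ * (g (gram φ) : ℂ) :=
        (integral_bosonOsc_gram hn Az C (K⁻¹ * ξ * K) hu hgc hcc).symm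
      have e2 : ∫ φ : Blk n → ℂ, bosonOsc Az C ξ φ * (g (a.symm (gram φ)) : ℂ) =
          ∫ R, (g (a.symm R) : ℂ) * gramDensity Az C ξ u R :=
        integral_bosonOsc_gram hn Az C ξ hu (θ := fun R => (g (a.symm R) : ℂ))
          (hgc.comp a.symm.contDiff) (hcc.comp_homeomorph a.symm.toHomeomorph)
      have e3 : ∫ φ : Blk n → ℂ, bosonOsc Az C ξ φ * (g (a.symm (gram φ)) : ℂ) =
          ∫ φ : Blk n → ℂ, bosonOsc Az C (K⁻¹ * ξ * K) φ * (g (gram φ) : ℂ) := by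
        have hdet : (bosonAct n K).det ≠ 0 := by
          rw [← norm_ne_zero_iff, norm_det_bosonAct hK]
          exact one_ne_zero
        have h4 := (measurePreserving_mulVec (bosonAct n K) (norm_det_bosonAct hK)).integral_comp
          (mulVecHomeo (bosonAct n K) hdet).measurableEmbedding
          (fun φ : Blk n → ℂ => bosonOsc Az C ξ φ * (g (a.symm (gram φ)) : ℂ))
        rw [← h4]
        refine integral_congr_ae (.of_forall fun φ => ?_)
        dsimp only
        have h5 : a.symm (gram (bosonAct n K *ᵥ φ)) = gram φ := by
          rw [gram_bosonAct, ← gramAct_apply hK, ← ha, a.symm_apply_apply]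
        rw [bosonOsc_bosonAct hK, h5]
      have e4 : ∫ R, (g (a.symm R) : ℂ) * gramDensity Az C ξ u R =
          ∫ R in pdSet ×ˢ pdSet, (g R : ℂ) * gramDensity Az C ξ u (a R) := by
        rw [hcone, ← hmp.integral_comp hemb (fun R => (g (a.symm R) : ℂ) * gramDensity Az C ξ u R)]
        refine integral_congr_ae (.of_forall fun R => ?_)
        exact congrArg (fun t => (g t : ℂ) * gramDensity Az C ξ u (a R)) (a.symm_apply_apply R)
      have e5 : ∫ R, g R • (gramDensity Az C ξ u (a R) - gramDensity Az C (K⁻¹ * ξ * K) u R) =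
          ∫ R in pdSet ×ˢ pdSet, ((g R : ℂ) * gramDensity Az C ξ u (a R) -
              (g R : ℂ) * gramDensity Az C (K⁻¹ * ξ * K) u R) := by
        rw [setIntegral_eq_integral_of_forall_compl_eq_zero]
        · simp only [real_smul, mul_sub]
        · intro R hR
          have : g R = 0 := by
            by_contra h
            exact hR (hsupp (subset_tsupport _ h))
          simp [this]
      have hgcont : Continuous fun R => (g R : ℂ) := hgc.continuous
      rw [e5, integral_sub, ← e4, ← e2, e3, ← e1, hcone, sub_self]
      · exact ((hgcont.mul hc1').integrable_of_hasCompactSupport hcc.mul_right).integrableOn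
      · exact ((hgcont.mul hc2).integrable_of_hasCompactSupport hcc.mul_right).integrableOn)
  -- equality almost everywhere extends to the open cone by continuity
  have heq : Set.EqOn (fun R => gramDensity Az C ξ u (a R))
      (gramDensity Az C (K⁻¹ * ξ * K) u) (pdSet ×ˢ pdSet) := by
    have : (volume : Measure (Herm2 × Herm2)).IsAddHaarMeasure :=
      Measure.prod.instIsAddHaarMeasure (volume : Measure Herm2) (volume : Measure Herm2)
    refine Measure.eqOn_open_of_ae_eq (μ := (volume : Measure (Herm2 × Herm2))) ?_ hU
      hc1'.continuousOn hc2.continuousOn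
    rw [EventuallyEq, ae_restrict_iff' hU.measurableSet]
    filter_upwards [hzero] with R h1 h2
    exact sub_eq_zero.mp (h1 h2)
  exact heq hR

end Covariance

/-! ### The bosonic integral as an integral over Gram matrices -/

section BosonIntegral

variable {n : ℕ}

theorem sqn_hop (hn : n ≠ 0) (φ : Blk n → ℂ) :
    (n : ℝ)⁻¹ * sqn (hop φ) = n * hermPair (gram φ).1 (gram φ).2 := by
  have hn' : (n : ℂ) ≠ 0 := by exact_mod_cast hn
  apply ofReal_injective
  rw [ofReal_mul, ofReal_mul, ← trace_mat_mul_mat, trace, sqn]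
  push_cast
  simp only [diag_apply, Matrix.mul_apply, gram, gramOf_mat_apply, Fintype.sum_prod_type,
    ← mul_conj', hop, Fin.sum_univ_two, map_add, map_mul, conj_conj]
  have h : ∀ a b : ℂ, ((n : ℂ)⁻¹ * a) * ((n : ℂ)⁻¹ * b) = (n : ℂ)⁻¹ ^ 2 * (a * b) := fun a b => by
    ring
  simp only [h, ← mul_add, sum_mul_sum, ← sum_add_distrib]
  rw [← mul_assoc, show (n : ℂ) * (n : ℂ)⁻¹ ^ 2 = (n : ℂ)⁻¹ by field_simp]
  congr 1
  refine sum_congr rfl fun α _ => sum_congr rfl fun β _ => ?_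
  ring

/-- The decaying part of the bosonic weight, as a function of the Gram matrices. -/
def gramWeight (n : ℕ) (c : ℝ) (R : Herm2 × Herm2) : ℂ :=
  exp ((-(c * (hermTr R.1 + hermTr R.2) + n * hermPair R.1 R.2) : ℝ))

theorem contDiff_gramWeight (n : ℕ) (c : ℝ) :
    ContDiff ℝ (⊤ : ℕ∞) (gramWeight n c) := by
  have h0 : ContDiff ℝ (⊤ : ℕ∞) fun R : Herm2 × Herm2 =>
      (R.1.2.2 * conjCLE R.2.2.2).re :=
    reCLM.contDiff.comp (ContDiff.mul (by fun_prop) (conjCLE.contDiff.comp (by fun_prop)))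
  have h1 : ContDiff ℝ (⊤ : ℕ∞) fun R : Herm2 × Herm2 =>
      -(c * (R.1.1 + R.1.2.1 + (R.2.1 + R.2.2.1)) +
        n * (R.1.1 * R.2.1 + R.1.2.1 * R.2.2.1 + 2 * (R.1.2.2 * conjCLE R.2.2.2).re)) := by
    fun_prop
  exact contDiff_exp.comp (ofRealCLM.contDiff.comp h1)

theorem norm_gramWeight (n : ℕ) (c : ℝ) (R : Herm2 × Herm2) : ‖gramWeight n c R‖ =
    Real.exp (-(c * (hermTr R.1 + hermTr R.2) + n * hermPair R.1 R.2)) := by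
  rw [gramWeight, norm_exp, ofReal_re]

theorem bosonWeight_mul_det (hn : n ≠ 0) (Az : 𝕄 n) (C : Matrix (Blk n) (Blk n) ℂ) (ξ : 𝕄 2) (s : ℝ)
    (φ : Blk n → ℂ) :
    bosonWeight Az ξ s φ * (C - (n : ℂ)⁻¹ • bilPert uCoef vCoef φ).det =
      bosonOsc Az C ξ φ * gramWeight n (n * s) (gram φ) := by
  have h1 : (n * s) * (hermTr (gram φ).1 + hermTr (gram φ).2) = s * sqn φ := by
    rw [sqn_eq_gram hn]
    ring
  rw [gramWeight, h1, ← sqn_hop hn, bosonOsc, bosonWeight, mul_comm, mul_assoc, ← exp_add]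
  congr 2
  rw [accr, accr, qf_add, qf_add, qf_smul, qf_smul, qf_smul, qf_one]
  push_cast
  ring

theorem norm_gramWeight_gram_le (hn : n ≠ 0) (s : ℝ) (φ : Blk n → ℂ) :
    ‖gramWeight n (n * s) (gram φ)‖ ≤ Real.exp (-(s * sqn φ)) := by
  have h1 : (n * s) * (hermTr (gram φ).1 + hermTr (gram φ).2) = s * sqn φ := by
    rw [sqn_eq_gram hn]
    ring
  rw [norm_gramWeight, h1, ← sqn_hop hn]
  have := sqn_nonneg (hop φ)
  gcongr
  exact le_add_of_nonneg_right (by positivity)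

theorem det_mat_ne_zero {p : Herm2} (hp : p ∈ pdSet) : p.mat.det ≠ 0 := by
  rw [Herm2.det_mat]
  exact ofReal_ne_zero.mpr (hermDet_pos hp).ne'

/-- The congruence by `J` maps the diagonal pair `(R, R)` to the pair
`(R₂^{-1/2} R² R₂^{-1/2}, R₂)`. -/
theorem congrH_matJ {R R₂ : Herm2} (hR : R ∈ pdSet) (hR₂ : R₂ ∈ pdSet) :
    (matJ R.mat R₂.mat).det ≠ 0 ∧
    congrH ((matJ R.mat R₂.mat)⁻¹)ᴴ R = congrH ((sqrtH R₂).mat)⁻¹ (sqH R) ∧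
    congrH (matJ R.mat R₂.mat) R = R₂ := by
  obtain ⟨h1, h2⟩ := sqrtH_spec hR
  obtain ⟨h3, h4⟩ := sqrtH_spec hR₂
  set S := sqrtH R
  set S₂ := sqrtH R₂
  have hd := (Ne.isUnit (det_mat_ne_zero h1))
  have hd₂ := (Ne.isUnit (det_mat_ne_zero h3))
  have hJ : matJ R.mat R₂.mat = S₂.mat * S.mat⁻¹ := by
    rw [matJ, msqrt_mat hR, msqrt_mat hR₂]
  have hJi : (S₂.mat * S.mat⁻¹)⁻¹ = S.mat * S₂.mat⁻¹ := by
    rw [Matrix.mul_inv_rev, nonsing_inv_nonsing_inv _ hd]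
  have hR' : R.mat = S.mat * S.mat := by rw [← pow_two, ← mat_sqH, h2]
  have hR₂' : R₂.mat = S₂.mat * S₂.mat := by rw [← pow_two, ← mat_sqH, h4]
  have e1 := S.isHermitian_mat.eq
  have e2 := S₂.isHermitian_mat.eq
  rw [hJ]
  refine ⟨?_, Herm2.mat_injective ?_, Herm2.mat_injective ?_⟩
  · rw [det_mul, det_nonsing_inv, Ring.inverse_eq_inv']
    exact mul_ne_zero hd₂.ne_zero (inv_ne_zero hd.ne_zero)
  · rw [mat_congrH, mat_congrH, hJi, mat_sqH, conjTranspose_conjTranspose,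
      conjTranspose_mul, conjTranspose_nonsing_inv, e1, e2, hR']
    simp only [pow_two, Matrix.mul_assoc]
  · rw [mat_congrH, conjTranspose_mul, conjTranspose_nonsing_inv, e1, e2, hR', hR₂']
    simp only [Matrix.mul_assoc]
    rw [nonsing_inv_mul_cancel_left _ _ hd, mul_nonsing_inv_cancel_left _ _ hd]

/-- The pair of Gram matrices in the coordinates `(R, R₂)`. -/
def gramCoord (x : Herm2 × Herm2) : Herm2 × Herm2 :=
  (congrH ((sqrtH x.2).mat)⁻¹ (sqH x.1), x.2)

theorem gramDensity_gramCoord (hn : 4 ≤ n) (Az : 𝕄 n) (C : Matrix (Blk n) (Blk n) ℂ)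
    (ζ' : Fin 2 → ℂ) {u : ℝ} (hu : 0 < u) {x : Herm2 × Herm2} (hx : x ∈ pdSet ×ˢ pdSet) :
    gramDensity Az C (diagonal ζ') u (gramCoord x) =
      gramDensity Az C (zetaJ ζ' x.1.mat x.2.mat) u (x.1, x.1) := by
  obtain ⟨h1, h2, h3⟩ := congrH_matJ hx.1 hx.2
  have h := gramDensity_covariant hn Az C (diagonal ζ') hu h1 (R := (x.1, x.1)) ⟨hx.1, hx.1⟩
  rw [zetaJ, ← h, gramAct_apply, h2, h3, gramCoord]

theorem hermPair_gramCoord {x : Herm2 × Herm2} (hx : x ∈ pdSet ×ˢ pdSet) :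
    hermPair (gramCoord x).1 (gramCoord x).2 = hermTr (sqH x.1) := by
  obtain ⟨h3, h4⟩ := sqrtH_spec hx.2
  have hd₂ := (Ne.isUnit (det_mat_ne_zero h3))
  apply ofReal_injective
  have hR₂' : x.2.mat = (sqrtH x.2).mat * (sqrtH x.2).mat := by rw [← pow_two, ← mat_sqH, h4]
  rw [← trace_mat_mul_mat, ← Herm2.trace_mat, gramCoord, mat_congrH,
    conjTranspose_nonsing_inv, (sqrtH x.2).isHermitian_mat.eq]
  dsimp only
  rw [hR₂', Matrix.mul_assoc, nonsing_inv_mul_cancel_left _ _ hd₂, Matrix.mul_assoc,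
    trace_mul_comm, Matrix.mul_assoc, mul_nonsing_inv _ hd₂, mul_one]

theorem hermTr_gramCoord {x : Herm2 × Herm2} (hx : x ∈ pdSet ×ˢ pdSet) :
    (hermTr (gramCoord x).1 : ℂ) = (x.2.mat⁻¹ * x.1.mat ^ 2).trace := by
  obtain ⟨h3, h4⟩ := sqrtH_spec hx.2
  have hR₂' : x.2.mat = (sqrtH x.2).mat * (sqrtH x.2).mat := by rw [← pow_two, ← mat_sqH, h4]
  rw [← Herm2.trace_mat, gramCoord, mat_congrH,
    conjTranspose_nonsing_inv, (sqrtH x.2).isHermitian_mat.eq, mat_sqH]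
  rw [hR₂', Matrix.mul_inv_rev, trace_mul_comm, Matrix.mul_assoc]

/-- Every pair of positive definite matrices has coordinates `(R, R₂)`. -/
theorem exists_gramCoord {y : Herm2 × Herm2} (hy : y ∈ pdSet ×ˢ pdSet) :
    ∃ x ∈ pdSet ×ˢ pdSet, gramCoord x = y := by
  obtain ⟨h3, h4⟩ := sqrtH_spec hy.2
  have hdet := det_mat_ne_zero h3
  have hd₂ := Ne.isUnit hdet
  have hm : congrH (sqrtH y.2).mat y.1 ∈ pdSet := (congrH_mem_pdSet hdet).mpr hy.1
  obtain ⟨h5, h6⟩ := sqrtH_spec hm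
  refine ⟨(sqrtH (congrH (sqrtH y.2).mat y.1), y.2), ⟨h5, hy.2⟩, ?_⟩
  rw [gramCoord]
  dsimp only
  rw [h6]
  refine Prod.ext (Herm2.mat_injective ?_) rfl
  rw [mat_congrH, mat_congrH, conjTranspose_nonsing_inv, (sqrtH y.2).isHermitian_mat.eq]
  simp only [Matrix.mul_assoc]
  rw [mul_nonsing_inv _ hd₂, mul_one, nonsing_inv_mul_cancel_left _ _ hd₂]

theorem sq_hermTr_le {p : Herm2} : hermTr p ^ 2 / 2 ≤ hermTr (sqH p) := by
  simp only [hermTr, sqH]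
  nlinarith [sq_nonneg (p.1 - p.2.1), sq_nonneg ‖p.2.2‖]

/-- The growth of the density along the orbit of the diagonal pair `(R, R)` is compensated by the
Gaussian factor `exp (-n Tr R²)`. -/
theorem exists_norm_gramWeight_mul_gramDensity_le (hn : 4 ≤ n) (C : Matrix (Blk n) (Blk n) ℂ)
    {u : ℝ} (hu : 0 < u) : ∃ K : ℝ, 0 ≤ K ∧ ∀ (Az : 𝕄 n) (ζ' : Fin 2 → ℂ)
      (c : ℝ), ∀ R ∈ pdSet ×ˢ pdSet, ‖gramWeight n c R * gramDensity Az C (diagonal ζ') u R‖ ≤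
          K * Real.exp (-(c * (hermTr R.1 + hermTr R.2))) := by
  obtain ⟨K, hK, h⟩ := exists_norm_gramDensity_le hn C hu
  refine ⟨K * Real.exp (2 * n * u ^ 2), by positivity, fun Az ζ' c R hR => ?_⟩
  obtain ⟨x, hx, rfl⟩ := exists_gramCoord hR
  rw [norm_mul, gramDensity_gramCoord hn Az C ζ' hu hx, norm_gramWeight, hermPair_gramCoord hx]
  have h1 := h Az (zetaJ ζ' x.1.mat x.2.mat) (x.1, x.1)
  dsimp only at h1
  refine (mul_le_mul_of_nonneg_left h1 (Real.exp_nonneg _)).trans ?_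
  rw [mul_left_comm, ← Real.exp_add, mul_assoc, ← Real.exp_add]
  refine mul_le_mul_of_nonneg_left (Real.exp_le_exp.mpr ?_) hK
  have h2 := sq_hermTr_le (p := x.1)
  have h3 : (0 : ℝ) ≤ n := Nat.cast_nonneg n
  nlinarith [mul_le_mul_of_nonneg_left h2 h3, mul_nonneg h3 (sq_nonneg (hermTr x.1 - 2 * u))]

theorem integrableOn_exp_neg_hermTr {c : ℝ} (hc : 0 < c) :
    IntegrableOn (fun p : Herm2 => Real.exp (-(c * hermTr p))) pdSet := by
  have hm : Measurable fun p : Herm2 => Real.exp (-(c * hermTr p)) := by unfold hermTr; fun_prop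
  have h1 := lintegral_rowGram (G := fun p => ENNReal.ofReal (Real.exp (-(c * hermTr p))))
    hm.ennreal_ofReal
  have h2 : ∀ q, hermTr (rowGram q) = sqn q := fun q => by
    simp only [hermTr, rowGram, sqn, Fintype.sum_prod_type, Fin.sum_univ_two]
  simp only [h2] at h1
  have h3 := (integrable_exp_neg_sqn (κ := Fin 2 × Fin 2) hc).lintegral_lt_top
  refine ⟨hm.aestronglyMeasurable, ?_⟩
  rw [hasFiniteIntegral_iff_ofReal (.of_forall fun _ => Real.exp_nonneg _)]
  by_contra hcon
  rw [not_lt, top_le_iff] at hcon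
  rw [hcon, ENNReal.mul_top] at h1
  · simp only [neg_mul] at h3
    exact absurd h1 h3.ne
  · have := Real.pi_pos
    simp only [ne_eq, ENNReal.ofReal_eq_zero, not_le]
    positivity

theorem integrableOn_exp_neg_hermTr_prod {c : ℝ} (hc : 0 < c) :
    IntegrableOn (fun R : Herm2 × Herm2 => Real.exp (-(c * (hermTr R.1 + hermTr R.2))))
      (pdSet ×ˢ pdSet) := by
  have h := (integrableOn_exp_neg_hermTr hc).mul_prod (integrableOn_exp_neg_hermTr hc)
  rw [IntegrableOn, Measure.volume_eq_prod, ← Measure.prod_restrict]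
  refine h.congr (.of_forall fun R => ?_)
  dsimp only
  rw [← Real.exp_add]
  ring_nf

theorem integrable_bosonOsc_mul_gramWeight (hn : n ≠ 0) (Az : 𝕄 n) (C : Matrix (Blk n) (Blk n) ℂ)
    (ξ : 𝕄 2) {s : ℝ} (hs : 0 < s) :
    Integrable fun φ : Blk n → ℂ => bosonOsc Az C ξ φ * gramWeight n (n * s) (gram φ) := by
  refine (integrable_bosonOsc_mul_exp Az C ξ hs).mono ?_ (.of_forall fun φ => ?_)
  · exact ((continuous_bosonOsc Az C ξ).mul
      ((contDiff_gramWeight n _).continuous.comp continuous_gram)).aestronglyMeasurable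
  · rw [norm_mul, norm_mul, norm_exp, ofReal_re]
    gcongr
    exact norm_gramWeight_gram_le hn s φ

/-- The bosonic integral is the integral of the weight against the density of the Gram matrices:
the smooth compactly supported test functions are removed by dominated convergence. -/
theorem integral_bosonWeight_eq_gramDensity (hn : 4 ≤ n) (Az : 𝕄 n) (C : Matrix (Blk n) (Blk n) ℂ)
    (ζ' : Fin 2 → ℂ) {u s : ℝ} (hu : 0 < u) (hs : 0 < s) :
    ∫ φ : Blk n → ℂ, bosonWeight Az (diagonal ζ') s φ *
        (C - (n : ℂ)⁻¹ • bilPert uCoef vCoef φ).det =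
      ∫ R in pdSet ×ˢ pdSet, gramWeight n (n * s) R * gramDensity Az C (diagonal ζ') u R := by
  have hn0 : n ≠ 0 := by omega
  have hns : 0 < (n : ℝ) * s := by positivity
  simp only [bosonWeight_mul_det hn0]
  -- smooth cutoffs, equal to `1` on balls of growing radius
  set θ : ℕ → ContDiffBump (0 : Herm2 × Herm2) := fun k =>
    ⟨k + 1, k + 2, by positivity, by linarith⟩ with hθ
  have hθs : ∀ k, ContDiff ℝ (⊤ : ℕ∞) fun R => ((θ k R : ℝ) : ℂ) := fun k =>
    ofRealCLM.contDiff.comp (θ k).contDiff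
  have hθt : ∀ R, Tendsto (fun k => ((θ k R : ℝ) : ℂ)) atTop (nhds 1) := by
    intro R
    refine tendsto_const_nhds.congr' ?_
    obtain ⟨m, hm⟩ := exists_nat_ge ‖R‖
    filter_upwards [eventually_ge_atTop m] with k hk
    have h1 : R ∈ Metric.closedBall (0 : Herm2 × Herm2) (θ k).rIn := by
      rw [mem_closedBall_zero_iff]
      have : (m : ℝ) ≤ k := by exact_mod_cast hk
      exact hm.trans (this.trans (by simp [hθ]))
    rw [(θ k).one_of_mem_closedBall h1, ofReal_one]
  have hθn : ∀ k R, ‖((θ k R : ℝ) : ℂ)‖ ≤ 1 := fun k R => by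
    rw [norm_real, Real.norm_of_nonneg (θ k).nonneg]
    exact (θ k).le_one
  have hgw := contDiff_gramWeight n (n * s)
  have hcF := continuous_gramDensity hn Az C (diagonal ζ') hu
  have hkey : ∀ k, ∫ φ : Blk n → ℂ, ((θ k (gram φ) : ℝ) : ℂ) *
        (bosonOsc Az C (diagonal ζ') φ * gramWeight n (n * s) (gram φ)) =
      ∫ R in pdSet ×ˢ pdSet, ((θ k R : ℝ) : ℂ) * (gramWeight n (n * s) R *
        gramDensity Az C (diagonal ζ') u R) := by
    intro k
    have h1 := integral_bosonOsc_gram hn Az C (diagonal ζ') hu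
      (θ := fun R => ((θ k R : ℝ) : ℂ) * gramWeight n (n * s) R) ((hθs k).mul hgw)
      (((θ k).hasCompactSupport.comp_left ofReal_zero).mul_right)
    rw [setIntegral_eq_integral_of_ae_compl_eq_zero]
    · simp only [← mul_assoc]
      rw [← h1]
      refine integral_congr_ae (.of_forall fun φ => ?_)
      dsimp only
      ring
    · filter_upwards [ae_gramDensity_eq_zero hn Az C (diagonal ζ') hu] with R h2 h3
      rw [h2 h3, mul_zero, mul_zero]
  obtain ⟨K, hK, hb⟩ := exists_norm_gramWeight_mul_gramDensity_le hn C hu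
  have hL := tendsto_integral_of_dominated_convergence
    (F := fun k (φ : Blk n → ℂ) => ((θ k (gram φ) : ℝ) : ℂ) *
        (bosonOsc Az C (diagonal ζ') φ * gramWeight n (n * s) (gram φ)))
    (f := fun φ => bosonOsc Az C (diagonal ζ') φ * gramWeight n (n * s) (gram φ))
    (fun φ => ‖bosonOsc Az C (diagonal ζ') φ * gramWeight n (n * s) (gram φ)‖)
    (fun k => (((hθs k).continuous.comp continuous_gram).mul
      ((continuous_bosonOsc Az C _).mul
        (hgw.continuous.comp continuous_gram))).aestronglyMeasurable)
    (integrable_bosonOsc_mul_gramWeight hn0 Az C _ hs).norm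
    (fun k => .of_forall fun φ => by
      rw [norm_mul]
      exact mul_le_of_le_one_left (norm_nonneg _) (hθn k _))
    (.of_forall fun φ => by
      simpa using (hθt (gram φ)).mul_const
        (bosonOsc Az C (diagonal ζ') φ * gramWeight n (n * s) (gram φ)))
  have hR := tendsto_integral_of_dominated_convergence
    (μ := (volume : Measure (Herm2 × Herm2)).restrict (pdSet ×ˢ pdSet))
    (F := fun k R => ((θ k R : ℝ) : ℂ) * (gramWeight n (n * s) R *
        gramDensity Az C (diagonal ζ') u R))
    (f := fun R => gramWeight n (n * s) R * gramDensity Az C (diagonal ζ') u R)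
    (fun R => K * Real.exp (-((n * s) * (hermTr R.1 + hermTr R.2))))
    (fun k => ((hθs k).continuous.mul (hgw.continuous.mul hcF)).aestronglyMeasurable)
    ((integrableOn_exp_neg_hermTr_prod hns).const_mul K)
    (fun k => ae_restrict_of_forall_mem (measurableSet_pdSet.prod measurableSet_pdSet) fun R h => by
      rw [norm_mul]
      exact (mul_le_of_le_one_left (norm_nonneg _) (hθn k _)).trans (hb Az ζ' _ R h))
    (.of_forall fun R => by
      simpa using (hθt R).mul_const (gramWeight n (n * s) R * gramDensity Az C (diagonal ζ') u R))
  simp only [hkey] at hL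
  exact tendsto_nhds_unique hL hR

end BosonIntegral

/-! ### The coordinates `(R, R₂)` on pairs of positive definite matrices -/

section GramCoordinates

variable {n : ℕ}

section ChangeOfVariables

variable {α β : Type*} [MeasurableSpace α] [MeasurableSpace β] {μ : Measure α} {ν : Measure β}
  {f : α → β} {w : α → ℝ}

theorem eq_map_withDensity_of_lintegral_eq (hf : Measurable f) (hw : Measurable w)
    (h : ∀ G : β → ENNReal, Measurable G → ∫⁻ y, G y ∂ν = ∫⁻ x, ENNReal.ofReal (w x) * G (f x) ∂μ) :
    ν = Measure.map f (μ.withDensity fun x => ENNReal.ofReal (w x)) := by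
  refine Measure.ext_of_lintegral _ fun G hG => ?_
  rw [h G hG, lintegral_map hG hf]
  exact (lintegral_withDensity_eq_lintegral_mul _ hw.ennreal_ofReal (hG.comp hf)).symm

theorem integral_eq_of_lintegral_eq (hf : Measurable f) (hw : Measurable w) (hw0 : ∀ᵐ x ∂μ, 0 ≤ w x)
    (h : ∀ G : β → ENNReal, Measurable G → ∫⁻ y, G y ∂ν = ∫⁻ x, ENNReal.ofReal (w x) * G (f x) ∂μ)
    {F : β → ℂ} (hF : AEStronglyMeasurable F ν) :
    ∫ y, F y ∂ν = ∫ x, (w x : ℂ) * F (f x) ∂μ := by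
  have hν := eq_map_withDensity_of_lintegral_eq hf hw h
  have hF' := hF
  rw [hν] at hF' ⊢
  rw [integral_map hf.aemeasurable hF', integral_withDensity_eq_integral_toReal_smul
    hw.ennreal_ofReal (.of_forall fun _ => ENNReal.ofReal_lt_top)]
  refine integral_congr_ae (hw0.mono fun x hx => ?_)
  dsimp only
  rw [ENNReal.toReal_ofReal hx, real_smul]

theorem integrable_iff_of_lintegral_eq (hf : Measurable f) (hw : Measurable w)
    (hw0 : ∀ᵐ x ∂μ, 0 ≤ w x)
    (h : ∀ G : β → ENNReal, Measurable G → ∫⁻ y, G y ∂ν = ∫⁻ x, ENNReal.ofReal (w x) * G (f x) ∂μ)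
    {F : β → ℂ} (hF : AEStronglyMeasurable F ν) :
    Integrable F ν ↔ Integrable (fun x => (w x : ℂ) * F (f x)) μ := by
  have hν := eq_map_withDensity_of_lintegral_eq hf hw h
  have hF' := hF
  rw [hν] at hF' ⊢
  rw [integrable_map_measure hF' hf.aemeasurable, integrable_withDensity_iff_integrable_smul'
    hw.ennreal_ofReal (.of_forall fun _ => ENNReal.ofReal_lt_top)]
  refine integrable_congr (hw0.mono fun x hx => ?_)
  dsimp only [Function.comp_apply]
  rw [ENNReal.toReal_ofReal hx, real_smul]

end ChangeOfVariables

theorem measurable_matrix_mul {α : Type*} [MeasurableSpace α] {f g : α → 𝕄 2}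
    (hf : ∀ i j, Measurable fun x => f x i j) (hg : ∀ i j, Measurable fun x => g x i j)
    (i j : Fin 2) : Measurable fun x => (f x * g x) i j := by
  simp only [Matrix.mul_apply]
  exact Finset.measurable_fun_sum _ fun k _ => (hf i k).mul (hg k j)

theorem measurable_matrix_inv {α : Type*} [MeasurableSpace α] {f : α → 𝕄 2}
    (hf : ∀ i j, Measurable fun x => f x i j) (i j : Fin 2) :
    Measurable fun x => (f x)⁻¹ i j := by
  have hdet : Measurable fun x => (f x).det := by
    simp only [det_fin_two]
    exact ((hf 0 0).mul (hf 1 1)).sub ((hf 0 1).mul (hf 1 0))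
  simp only [Matrix.inv_def, Ring.inverse_eq_inv', Matrix.smul_apply, smul_eq_mul, adjugate_fin_two]
  refine hdet.inv.mul ?_
  fin_cases i <;> fin_cases j
  · exact hf 1 1
  · exact (hf 0 1).neg
  · exact (hf 1 0).neg
  · exact hf 0 0

theorem measurable_sqrtH_mat (i j : Fin 2) : Measurable fun p : Herm2 => (sqrtH p).mat i j :=
  (measurable_herm2_mat i j).comp measurable_sqrtH

theorem measurable_gramCoord : Measurable gramCoord := by
  have hK : ∀ i j, Measurable fun x : Herm2 × Herm2 => ((sqrtH x.2).mat)⁻¹ i j := fun i j =>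
    (measurable_matrix_inv measurable_sqrtH_mat i j).comp measurable_snd
  have hKs : ∀ i j, Measurable fun x : Herm2 × Herm2 => (((sqrtH x.2).mat)⁻¹)ᴴ i j := fun i j =>
    continuous_conj.measurable.comp (hK j i)
  have hR : ∀ i j, Measurable fun x : Herm2 × Herm2 => (sqH x.1).mat i j := fun i j =>
    (measurable_herm2_mat i j).comp (continuous_sqH.measurable.comp measurable_fst)
  have hM := fun i j => measurable_matrix_mul (measurable_matrix_mul hK hR) hKs i j
  refine Measurable.prodMk ?_ measurable_snd
  exact (measurable_re.comp (hM 0 0)).prodMk ((measurable_re.comp (hM 1 1)).prodMk (hM 0 1))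

/-- The Jacobian of the coordinates `(R, R₂)`. -/
def gramJac (x : Herm2 × Herm2) : ℝ := 4 * hermDet x.1 * hermTr x.1 ^ 2 / hermDet x.2 ^ 2

theorem measurable_gramJac : Measurable gramJac := by
  unfold gramJac hermDet hermTr
  fun_prop

theorem gramJac_nonneg {x : Herm2 × Herm2} (hx : x ∈ pdSet ×ˢ pdSet) : 0 ≤ gramJac x := by
  have := hermDet_pos hx.1
  rw [gramJac]
  positivity

/-- The change of variables from pairs of positive definite matrices to `(R, R₂)`. -/
theorem lintegral_gramCoord {G : Herm2 × Herm2 → ENNReal} (hG : Measurable G) :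
    ∫⁻ y in pdSet ×ˢ pdSet, G y =
      ∫⁻ x in pdSet ×ˢ pdSet, ENNReal.ofReal (gramJac x) * G (gramCoord x) := by
  have hG' : Measurable fun x : Herm2 × Herm2 =>
      ENNReal.ofReal (gramJac x) * G (gramCoord x) :=
    measurable_gramJac.ennreal_ofReal.mul (hG.comp measurable_gramCoord)
  rw [Measure.volume_eq_prod, ← Measure.prod_restrict, lintegral_prod_symm' _ hG,
    lintegral_prod_symm' _ hG']
  refine setLIntegral_congr_fun measurableSet_pdSet fun p hp => ?_
  obtain ⟨h3, h4⟩ := sqrtH_spec hp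
  have hdet := det_mat_ne_zero h3
  have hp0 := hermDet_pos hp
  have hK : ((sqrtH p).mat)⁻¹.det ≠ 0 := by
    rw [det_nonsing_inv, Ring.inverse_eq_inv']
    exact inv_ne_zero hdet
  have hKd : (‖((sqrtH p).mat)⁻¹.det‖ ^ 4)⁻¹ = hermDet p ^ 2 := by
    rw [det_nonsing_inv, Ring.inverse_eq_inv', Herm2.det_mat, norm_inv, norm_real]
    have h5 : hermDet p = hermDet (sqrtH p) ^ 2 := by rw [← hermDet_sqH, h4]
    change (‖hermDet (sqrtH p)‖⁻¹ ^ 4)⁻¹ = _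
    rw [h5, Real.norm_of_nonneg (hermDet_pos h3).le, inv_pow, inv_inv]
    ring
  have hGp : Measurable fun W => G (W, p) := hG.comp measurable_prodMk_right
  have hGc : Measurable fun W => G (congrH ((sqrtH p).mat)⁻¹ W, p) :=
    hGp.comp (continuous_congrH _).measurable
  have h1 := lintegral_congrH hK hGp
  rw [hKd, ← lintegral_sqH hGc] at h1
  have h2 : ∫⁻ W in pdSet, G (W, p) = ENNReal.ofReal ((hermDet p ^ 2)⁻¹) *
      (ENNReal.ofReal (hermDet p ^ 2) * ∫⁻ W in pdSet, G (W, p)) := by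
    rw [← mul_assoc, ← ENNReal.ofReal_mul (by positivity), inv_mul_cancel₀ (by positivity),
      ENNReal.ofReal_one, one_mul]
  rw [h2, ← h1, ← lintegral_const_mul']
  · refine lintegral_congr fun Λ => ?_
    rw [← mul_assoc, ← ENNReal.ofReal_mul (by positivity), gramJac, div_eq_inv_mul, gramCoord]
  · exact ENNReal.ofReal_ne_top

theorem ae_gramJac_nonneg :
    ∀ᵐ x ∂(volume : Measure (Herm2 × Herm2)).restrict (pdSet ×ˢ pdSet), 0 ≤ gramJac x :=
  ae_restrict_of_forall_mem (measurableSet_pdSet.prod measurableSet_pdSet) fun _ => gramJac_nonneg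

/-- The bosonic part of the integrand, in the coordinates `x = (R, R₂)` and `y = (T', S)`. -/
def bosonPart (Az : 𝕄 n) (C : Matrix (Blk n) (Blk n) ℂ) (ζ' : Fin 2 → ℂ) (c u : ℝ)
    (x y : Herm2 × Herm2) : ℂ :=
  gramJac x * (gramWeight n c (gramCoord x) * exp ((u * (n * (hermTr x.1 + hermTr x.1)) : ℝ))) *
    (bosonChar Az C (zetaJ ζ' x.1.mat x.2.mat) u (y.1 + y.2, y.1 - y.2) *
      exp (-((n * hermPair₂ (y.1 + y.2, y.1 - y.2) (x.1, x.1) : ℝ) * I)))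

theorem integral_comp_add_sub {F : Herm2 × Herm2 → ℂ} (hF : Continuous F) :
    ∫ X, F X = 16 * ∫ y : Herm2 × Herm2, F (y.1 + y.2, y.1 - y.2) := by
  have hf : Measurable fun y : Herm2 × Herm2 => (y.1 + y.2, y.1 - y.2) := by fun_prop
  have h := integral_map (μ := (volume : Measure (Herm2 × Herm2))) hf.aemeasurable
    (f := F) hF.aestronglyMeasurable
  rw [← h, map_add_sub_volume, integral_smul_measure,
    ENNReal.toReal_ofReal (by norm_num), real_smul]
  push_cast
  ring

/-- The bosonic integral in the coordinates `(R, R₂)`: along the orbit of `(R, R)` the covariance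
of the density conjugates the source, and the density is written as a Fourier integral over
`(T', S)`. -/
theorem integral_bosonWeight_eq_bosonPart (hn : 4 ≤ n) (Az : 𝕄 n) (C : Matrix (Blk n) (Blk n) ℂ)
    (ζ' : Fin 2 → ℂ) {u s : ℝ} (hu : 0 < u) (hs : 0 < s) :
    ∫ φ : Blk n → ℂ, bosonWeight Az (diagonal ζ') s φ *
        (C - (n : ℂ)⁻¹ • bilPert uCoef vCoef φ).det =
      ((n : ℝ) ^ 8 / Real.pi ^ 8 : ℝ) *
        ∫ x in pdSet ×ˢ pdSet, ∫ y, bosonPart Az C ζ' (n * s) u x y := by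
  have hcF := continuous_gramDensity hn Az C (diagonal ζ') hu
  rw [integral_bosonWeight_eq_gramDensity hn Az C ζ' hu hs,
    integral_eq_of_lintegral_eq measurable_gramCoord measurable_gramJac ae_gramJac_nonneg
      (fun G hG => lintegral_gramCoord hG)
      (F := fun R => gramWeight n (n * s) R * gramDensity Az C (diagonal ζ') u R)
      ((contDiff_gramWeight n _).continuous.mul hcF).aestronglyMeasurable, ← integral_const_mul]
  refine setIntegral_congr_fun (measurableSet_pdSet.prod measurableSet_pdSet) fun x hx => ?_
  have hp := continuous_hermPair₂
  have h2 := continuous_bosonChar Az C (zetaJ ζ' x.1.mat x.2.mat) hu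
  rw [gramDensity_gramCoord hn Az C ζ' hu hx, gramDensity, integral_comp_add_sub (by fun_prop)]
  simp only [bosonPart]
  rw [integral_const_mul]
  push_cast
  ring

/-- The weight of the bosonic part in the variables `(R, R₂)` is integrable. -/
theorem integrableOn_gramJac_mul {c : ℝ} (hc : 0 < c) (n : ℕ) (u : ℝ) :
    IntegrableOn (fun x : Herm2 × Herm2 => (gramJac x : ℂ) * (gramWeight n c (gramCoord x) *
      exp ((u * (n * (hermTr x.1 + hermTr x.1)) : ℝ)))) (pdSet ×ˢ pdSet) := by
  have h1 : Integrable (fun R : Herm2 × Herm2 =>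
      (Real.exp (-(c * (hermTr R.1 + hermTr R.2))) : ℂ))
      ((volume : Measure (Herm2 × Herm2)).restrict (pdSet ×ˢ pdSet)) := by
    exact (integrableOn_exp_neg_hermTr_prod hc).ofReal
  rw [integrable_iff_of_lintegral_eq measurable_gramCoord measurable_gramJac ae_gramJac_nonneg
      (fun G hG => lintegral_gramCoord hG) h1.aestronglyMeasurable] at h1
  refine (h1.const_mul (Real.exp (2 * n * u ^ 2) : ℂ)).mono ?_ ?_
  · have h3 : Measurable fun x : Herm2 × Herm2 =>
        exp ((u * (n * (hermTr x.1 + hermTr x.1)) : ℝ)) := by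
      unfold hermTr
      fun_prop
    exact ((measurable_ofReal.comp measurable_gramJac).mul
      (((contDiff_gramWeight n c).continuous.measurable.comp measurable_gramCoord).mul
        h3)).aestronglyMeasurable
  · refine ae_restrict_of_forall_mem (measurableSet_pdSet.prod measurableSet_pdSet) fun x hx => ?_
    rw [norm_mul, norm_mul, norm_mul, norm_mul, norm_gramWeight, hermPair_gramCoord hx,
      ← ofReal_exp, norm_real, norm_real, norm_real,
      norm_real, Real.norm_of_nonneg (Real.exp_nonneg _),
      Real.norm_of_nonneg (Real.exp_nonneg _), Real.norm_of_nonneg (Real.exp_nonneg _),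
      mul_left_comm (Real.exp (2 * n * u ^ 2)), ← Real.exp_add, ← Real.exp_add]
    refine mul_le_mul_of_nonneg_left (Real.exp_le_exp.mpr ?_) (norm_nonneg _)
    have h2 := sq_hermTr_le (p := x.1)
    have h3 : (0 : ℝ) ≤ n := Nat.cast_nonneg n
    nlinarith [mul_le_mul_of_nonneg_left h2 h3, mul_nonneg h3 (sq_nonneg (hermTr x.1 - 2 * u))]

end GramCoordinates

/-! ### The auxiliary complex matrix in polar coordinates -/

section FermionicPart

variable {n : ℕ}

theorem bilPert_eq_fromBlocks (φ : Blk n → ℂ) : bilPert uCoef vCoef φ = fromBlocks 0 ((1 : 𝕄 2) ⊗ₖ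
        of fun α β => ∑ k, φ (.inl (k, α)) * conj (φ (.inr (k, β))))
      ((1 : 𝕄 2) ⊗ₖ of fun α β => ∑ k, φ (.inr (k, α)) * conj (φ (.inl (k, β)))) 0 := by
  ext a b
  rw [bilPert_apply]
  rcases a with a | a <;> rcases b with b | b <;> simp [kroneckerMap_apply, Matrix.one_apply]

/-- The unitary factor of the polar decomposition is moved from the diagonal blocks to the
source. -/
theorem det_blockC_polar (Az : 𝕄 n) (ζ : Fin 2 → ℂ) (L : 𝕄 2) (hL : L.IsHermitian) (U : U2)
    (φ : Blk n → ℂ) :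
    (blockC Az (diagonal ζ) (diagonal ζ) (-(L * (U : 𝕄 2))) (-(L * (U : 𝕄 2))ᴴ) -
        (n : ℂ)⁻¹ • bilPert uCoef vCoef φ).det =
      (blockC Az (diagonal ζ) (zetaU ζ U) L L - (n : ℂ)⁻¹ • bilPert uCoef vCoef φ).det := by
  obtain ⟨U, hU⟩ := U
  have h1 : U * Uᴴ = 1 := mem_unitaryGroup_iff.mp hU
  set E : 𝕄 n := 1 with hI
  set Z : 𝕄 2 := diagonal ζ with hZ
  have hA : (U ⊗ₖ E) * (calA Az Z)ᴴ * (Uᴴ ⊗ₖ E) = (calA Az (U * Z * Uᴴ))ᴴ := by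
    have h2 : (U ⊗ₖ E) * calA Az Z * (Uᴴ ⊗ₖ E) = calA Az (U * Z * Uᴴ) := by
      simp only [calA, Matrix.mul_sub, Matrix.sub_mul, Matrix.mul_smul, smul_mul,
        ← mul_kronecker_mul, ← hI]
      simp only [hI, mul_one, one_mul, h1]
    rw [← h2, conjTranspose_mul, conjTranspose_mul, conjTranspose_kronecker,
      conjTranspose_kronecker, conjTranspose_conjTranspose, hI,
      conjTranspose_one, Matrix.mul_assoc]
  have hp : ∀ p : 𝕄 n, (U ⊗ₖ E) * ((1 : 𝕄 2) ⊗ₖ p) * (Uᴴ ⊗ₖ E) = (1 : 𝕄 2) ⊗ₖ p := by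
    intro p
    rw [← mul_kronecker_mul, ← mul_kronecker_mul, mul_one, h1, hI, one_mul, mul_one]
  have hL1 : (L * U) ⊗ₖ E * (Uᴴ ⊗ₖ E) = L ⊗ₖ E := by
    rw [← mul_kronecker_mul, Matrix.mul_assoc, h1, mul_one, hI, mul_one]
  have hL2 : (U ⊗ₖ E) * ((L * U)ᴴ ⊗ₖ E) = L ⊗ₖ E := by
    rw [← mul_kronecker_mul, conjTranspose_mul, hL.eq, ← Matrix.mul_assoc, h1, one_mul, hI, mul_one]
  set D₁ : Matrix (Blk n) (Blk n) ℂ := fromBlocks 1 0 0 (-(U ⊗ₖ E)) with hD₁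
  set D₂ : Matrix (Blk n) (Blk n) ℂ := fromBlocks (-(Uᴴ ⊗ₖ E)) 0 0 1 with hD₂
  have hdet : D₁.det * D₂.det = 1 := by
    rw [hD₁, hD₂, det_fromBlocks_zero₂₁, det_fromBlocks_zero₂₁, det_one,
      one_mul, mul_one, ← det_mul, neg_mul_neg, ← mul_kronecker_mul, h1, hI,
      one_mul, one_kronecker_one, det_one]
  have hneg : ∀ X : 𝕄 2, (-X) ⊗ₖ E = -(X ⊗ₖ E) := by
    intro X
    ext a b
    simp [kroneckerMap_apply]
  rw [bilPert_eq_fromBlocks]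
  set p := of fun α β : Fin n => ∑ k, φ (.inl (k, α)) * conj (φ (.inr (k, β)))
  set p' := of fun α β : Fin n => ∑ k, φ (.inr (k, α)) * conj (φ (.inl (k, β)))
  have key : D₁ * (blockC Az Z Z (-(L * U)) (-(L * U)ᴴ) - (n : ℂ)⁻¹ • fromBlocks 0
      ((1 : 𝕄 2) ⊗ₖ p) ((1 : 𝕄 2) ⊗ₖ p') 0) * D₂ =
      blockC Az Z (zetaU ζ ⟨U, hU⟩) L L - (n : ℂ)⁻¹ • fromBlocks 0
      ((1 : 𝕄 2) ⊗ₖ p) ((1 : 𝕄 2) ⊗ₖ p') 0 := by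
    simp only [blockC, fromBlocks_smul, sub_eq_add_neg, fromBlocks_neg,
      fromBlocks_add, hD₁, hD₂, fromBlocks_multiply, smul_zero, neg_zero, add_zero,
      zero_add, Matrix.zero_mul, Matrix.mul_zero, Matrix.one_mul, Matrix.mul_one, zetaU, ← hI]
    simp only [← hZ, hneg, hL1, hL2, neg_mul, mul_neg, neg_neg, Matrix.mul_add,
      Matrix.add_mul, Matrix.mul_smul, smul_mul, hA, hp]
  rw [← key, det_mul, det_mul, mul_right_comm, hdet, one_mul]

/-- The weight of the Hermitian factor of the auxiliary complex matrix. -/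
def polarJac (x : Herm2 × U2) : ℝ := Real.pi ^ 3 * (4 * hermDet x.1 * hermTr x.1 ^ 2)

theorem measurable_polarJac : Measurable polarJac := by
  unfold polarJac hermDet hermTr
  fun_prop

theorem ae_polarJac_nonneg :
    ∀ᵐ x ∂((volume : Measure Herm2).restrict pdSet).prod haarU2, 0 ≤ polarJac x := by
  have h : ∀ᵐ p ∂(volume : Measure Herm2).restrict pdSet, p ∈ pdSet :=
    ae_restrict_mem measurableSet_pdSet
  filter_upwards [Measure.quasiMeasurePreserving_fst.ae h] with x hx
  have := hermDet_pos hx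
  have := Real.pi_pos
  rw [polarJac]
  positivity

theorem lintegral_map_of_eq_polar (G : 𝕄 2 → ENNReal) (hG : Measurable G) :
    ∫⁻ M, G M ∂Measure.map (fun q : Fin 2 × Fin 2 → ℂ =>
        (of fun i j => q (i, j) : 𝕄 2)) volume =
      ∫⁻ x, ENNReal.ofReal (polarJac x) * G (x.1.mat * (x.2 : 𝕄 2))
        ∂((volume : Measure Herm2).restrict pdSet).prod haarU2 := by
  have hm : Measurable fun x : Herm2 × U2 => G (x.1.mat * (x.2 : 𝕄 2)) :=
    hG.comp (measurable_mul_U2 (f := fun p : Herm2 => p.mat) measurable_herm2_mat)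
  have hm' : Measurable fun x : Herm2 × U2 => ENNReal.ofReal (polarJac x) *
      G (x.1.mat * (x.2 : 𝕄 2)) := measurable_polarJac.ennreal_ofReal.mul hm
  rw [lintegral_map hG measurable_of, lintegral_polar hG,
    lintegral_prod _ hm'.aemeasurable, ← lintegral_const_mul' _ _ ENNReal.ofReal_ne_top]
  refine lintegral_congr fun Λ => ?_
  have h3 : (0 : ℝ) ≤ Real.pi ^ 3 := by have := Real.pi_pos; positivity
  rw [← mul_assoc, ← ENNReal.ofReal_mul h3, ← lintegral_const_mul' _ _ ENNReal.ofReal_ne_top]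
  rfl

/-- Integration over complex `2 × 2` matrices in polar coordinates. -/
theorem integral_polar {F : 𝕄 2 → ℂ} (hF : Measurable F) :
    ∫ q : Fin 2 × Fin 2 → ℂ, F (of fun i j => q (i, j)) =
      ∫ x, (polarJac x : ℂ) * F (x.1.mat * (x.2 : 𝕄 2))
        ∂((volume : Measure Herm2).restrict pdSet).prod haarU2 := by
  rw [← integral_eq_of_lintegral_eq
    (measurable_mul_U2 (f := fun p : Herm2 => p.mat) measurable_herm2_mat) measurable_polarJac
    ae_polarJac_nonneg lintegral_map_of_eq_polar hF.aestronglyMeasurable]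
  exact (integral_map measurable_of.aemeasurable hF.aestronglyMeasurable).symm

/-- The Gaussian weight of the auxiliary matrix, centred at the sources `ε`. -/
def fermWeight (n : ℕ) (ε : Fin 2 → ℝ) (M : 𝕄 2) : ℂ :=
  exp (-(n : ℂ) * ((M + diagonal fun j => (ε j / n : ℂ)) *
    (M + diagonal fun j => (ε j / n : ℂ))ᴴ).trace)

theorem fermWeight_mul_U2 (hn : n ≠ 0) (ε : Fin 2 → ℝ) {L : 𝕄 2} (hL : L.IsHermitian) (U : U2) :
    fermWeight n ε (L * (U : 𝕄 2)) =
      exp (-(n : ℂ) * (L ^ 2).trace) * exp (-(L * (U : 𝕄 2) * (diagonal fun j => (ε j : ℂ)) +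
          (diagonal fun j => (ε j : ℂ)) * (U : 𝕄 2)ᴴ * L).trace -
          (n : ℂ)⁻¹ * ((diagonal fun j => (ε j : ℂ)) ^ 2).trace) := by
  obtain ⟨U, hU⟩ := U
  have h1 : U * Uᴴ = 1 := mem_unitaryGroup_iff.mp hU
  have hn' : (n : ℂ) ≠ 0 := by exact_mod_cast hn
  set D : 𝕄 2 := diagonal fun j => (ε j : ℂ) with hD
  have hDh : Dᴴ = D := by
    rw [hD, diagonal_conjTranspose]
    congr 1
    ext j
    simp
  have h2 : (diagonal fun j => (ε j / n : ℂ)) = (n : ℂ)⁻¹ • D := by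
    rw [hD, ← diagonal_smul]
    congr 1
    ext j
    simp [div_eq_inv_mul]
  have h3 : star ((n : ℂ)⁻¹) = (n : ℂ)⁻¹ := by simp
  rw [fermWeight, h2, ← exp_add]
  congr 1
  have h4 : (L * U) * (L * U)ᴴ = L ^ 2 := by
    rw [conjTranspose_mul, hL.eq, Matrix.mul_assoc, ← Matrix.mul_assoc U, h1, one_mul, pow_two]
  rw [conjTranspose_add, conjTranspose_smul, hDh, h3, Matrix.add_mul,
    Matrix.mul_add, Matrix.mul_add, h4]
  rw [conjTranspose_mul, hL.eq]
  simp only [trace_add, Matrix.mul_smul, smul_mul, trace_smul, smul_eq_mul,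
    pow_two, Matrix.mul_assoc]
  field_simp
  ring

theorem sqn_eq_trace (q : Fin 2 × Fin 2 → ℂ) : (sqn q : ℂ) = ((of fun i j => q (i, j) : 𝕄 2) *
      (of fun i j => q (i, j))ᴴ).trace := by
  rw [← mat_rowGram, Herm2.trace_mat]
  simp only [hermTr, rowGram, sqn, Fintype.sum_prod_type, Fin.sum_univ_two]

end FermionicPart

/-! ### The averaged ratio in the coordinates of the integral representation -/

section Representation

variable {n : ℕ}

/-- The bosonic integral as a function of the fermionic block matrix. -/
def bosonInt (Az : 𝕄 n) (ζ' : Fin 2 → ℂ) (s : ℝ) (C : Matrix (Blk n) (Blk n) ℂ) : ℂ :=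
  ∫ φ : Blk n → ℂ, bosonWeight Az (diagonal ζ') s φ * (C - (n : ℂ)⁻¹ • bilPert uCoef vCoef φ).det

theorem continuous_bosonWeight (Az : 𝕄 n) (ξ : 𝕄 2) (s : ℝ) : Continuous (bosonWeight Az ξ s) := by
  have h1 : Continuous fun φ : Blk n → ℂ => hop φ := continuous_pi fun p => continuous_hop p
  have h2 : Continuous fun φ : Blk n → ℂ => sqn (hop φ) := continuous_sqn.comp h1
  have h3 := continuous_qf (accr s (hermX Az ξ 0 0))
  unfold bosonWeight
  fun_prop

instance secondCountableTopology_matrix {m k : Type*} [Countable m] [Countable k] :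
    SecondCountableTopology (Matrix m k ℂ) :=
  inferInstanceAs (SecondCountableTopology (m → k → ℂ))

theorem continuous_bilPert : Continuous fun φ : Blk n → ℂ => bilPert uCoef vCoef φ := by
  refine continuous_matrix fun a b => ?_
  simp only [bilPert_apply]
  have : Continuous fun z : ℂ => conj z := continuous_conj
  rcases a with a | a <;> rcases b with b | b <;> dsimp only <;> try split_ifs
  all_goals fun_prop

theorem stronglyMeasurable_bosonInt (Az : 𝕄 n) (ζ' : Fin 2 → ℂ) (s : ℝ) :
    StronglyMeasurable (bosonInt Az ζ' s) := by
  have h1 := continuous_bosonWeight Az (diagonal ζ') s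
  have h3 : Continuous fun x : Matrix (Blk n) (Blk n) ℂ × (Blk n → ℂ) =>
      bilPert uCoef vCoef x.2 := continuous_bilPert.comp continuous_snd
  have h4 : Continuous fun x : Matrix (Blk n) (Blk n) ℂ × (Blk n → ℂ) =>
      (n : ℂ)⁻¹ • bilPert uCoef vCoef x.2 := continuous_matrix fun i j =>
    continuous_const.mul (h3.matrix_elem i j)
  have h2 : Continuous fun x : Matrix (Blk n) (Blk n) ℂ × (Blk n → ℂ) =>
      bosonWeight Az (diagonal ζ') s x.2 * (x.1 - (n : ℂ)⁻¹ • bilPert uCoef vCoef x.2).det :=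
    (h1.comp continuous_snd).mul (Continuous.matrix_det (continuous_fst.sub h4))
  exact h2.stronglyMeasurable.integral_prod_right'

/-- The fermionic block matrix at `Λ` and `U`. -/
def fermC (Az : 𝕄 n) (ζ : Fin 2 → ℂ) (x : Herm2 × U2) :
    Matrix (Blk n) (Blk n) ℂ :=
  blockC Az (diagonal ζ) (zetaU ζ x.2) x.1.mat x.1.mat

theorem bosonInt_polar (Az : 𝕄 n) (ζ ζ' : Fin 2 → ℂ) (s : ℝ) (x : Herm2 × U2) :
    bosonInt Az ζ' s (blockC Az (diagonal ζ) (diagonal ζ) (-(x.1.mat * (x.2 : 𝕄 2)))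
        (-(x.1.mat * (x.2 : 𝕄 2))ᴴ)) =
      bosonInt Az ζ' s (fermC Az ζ x) := by
  unfold bosonInt fermC
  simp only [det_blockC_polar Az ζ x.1.mat x.1.isHermitian_mat x.2]

theorem continuous_fermWeight (n : ℕ) (ε : Fin 2 → ℝ) : Continuous (fermWeight n ε) := by
  unfold fermWeight
  fun_prop

theorem continuous_blockC_neg (Az : 𝕄 n) (ξ ξ' : 𝕄 2) :
    Continuous fun M : 𝕄 2 => blockC Az ξ ξ' (-M) (-Mᴴ) := by
  have h3 : ∀ i j, Continuous fun M : 𝕄 2 => M i j := fun i j =>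
    continuous_id.matrix_elem i j
  unfold blockC
  refine Continuous.matrix_fromBlocks (continuous_matrix fun i j => ?_) continuous_const
    continuous_const (continuous_matrix fun i j => ?_)
  · exact (h3 _ _).neg.mul continuous_const
  · exact (continuous_conj.comp (h3 _ _)).neg.mul continuous_const

theorem measurable_fermWeight_mul_bosonInt (Az : 𝕄 n) (ζ ζ' : Fin 2 → ℂ) (ε : Fin 2 → ℝ) (s : ℝ) :
    Measurable fun M => fermWeight n ε M *
      bosonInt Az ζ' s (blockC Az (diagonal ζ) (diagonal ζ) (-M) (-Mᴴ)) :=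
  (continuous_fermWeight n ε).measurable.mul ((stronglyMeasurable_bosonInt Az ζ' s).measurable.comp
    (continuous_blockC_neg Az _ _).measurable)

/-- The averaged ratio in polar coordinates of the auxiliary matrix, which is recentred at the
regularization `ε`. -/
theorem genZ_eq_integral_polar {Ω : Type*} [MeasurableSpace Ω] (P : Measure Ω)
    [IsProbabilityMeasure P] (hn : n ≠ 0) {H₀ : Ω → 𝕄 n} (hH₀ : IsGinibre P H₀) (A₀ : 𝕄 n) (z₀ : ℂ)
    (ζ ζ' : Fin 2 → ℂ) (ε : Fin 2 → ℝ) {s : ℝ} (hs : 0 < s) :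
    genZ P H₀ A₀ z₀ ζ ζ' (fun j => ε j / n) s =
      ((n / Real.pi : ℝ) : ℂ) ^ 4 * ((Real.pi : ℂ) ^ Fintype.card (Blk n))⁻¹ *
        ∫ x, (polarJac x : ℂ) * (fermWeight n ε (x.1.mat * (x.2 : 𝕄 2)) *
          bosonInt (A₀ - z₀ • 1) ζ' s (fermC (A₀ - z₀ • 1) ζ x))
          ∂((volume : Measure Herm2).restrict pdSet).prod haarU2 := by
  set Az := A₀ - z₀ • 1 with hAz
  set D : 𝕄 2 := diagonal fun j => (ε j / n : ℂ) with hD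
  have hDh : Dᴴ = D := by
    rw [hD, diagonal_conjTranspose]
    congr 1
    ext j
    simp
  have hDe : (diagonal fun j => ((ε j / n : ℝ) : ℂ)) = D := by
    rw [hD]
    push_cast
    rfl
  set F : 𝕄 2 → ℂ := fun M => fermWeight n ε M *
    bosonInt Az ζ' s (blockC Az (diagonal ζ) (diagonal ζ) (-M) (-Mᴴ)) with hF
  have hFm : Measurable F := measurable_fermWeight_mul_bosonInt Az ζ ζ' ε s
  rw [genZ_eq_integral P hn hH₀ A₀ z₀ ζ ζ' _ hs]
  congr 1
  set d : Fin 2 × Fin 2 → ℂ := fun p => -D p.1 p.2 with hd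
  have h1 : ∀ q : Fin 2 × Fin 2 → ℂ, F (of fun i j => (d - q) (i, j)) =
      exp (-(n * sqn q : ℝ)) * bosonInt Az ζ' s
        (blockC Az (diagonal ζ) (diagonal ζ) (D + of fun i j => q (i, j))
          (D + (of fun i j => q (i, j))ᴴ)) := by
    intro q
    have h2 : (of fun i j => (d - q) (i, j)) = -(D + of fun i j => q (i, j)) := by
      ext i j
      simp only [hd, of_apply, Pi.sub_apply, Matrix.neg_apply, Matrix.add_apply]
      ring
    rw [hF, h2]
    dsimp only
    rw [conjTranspose_neg, neg_neg, neg_neg, conjTranspose_add, hDh, fermWeight,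
      ← hD, neg_add, neg_add_cancel_comm, conjTranspose_neg, neg_mul_neg, ← sqn_eq_trace]
    push_cast
    ring_nf
  calc _ = ∫ q : Fin 2 × Fin 2 → ℂ,
        F (of fun i j => (d - q) (i, j)) := by
        simp only [h1, bosonInt, hDe, hAz]
    _ = ∫ q : Fin 2 × Fin 2 → ℂ, F (of fun i j => q (i, j)) :=
        integral_sub_left_eq_self (fun q : Fin 2 × Fin 2 → ℂ => F (of fun i j => q (i, j))) volume d
    _ = _ := by
        rw [integral_polar hFm]
        simp only [hF, bosonInt_polar]

/-- The whole integrand on the cone, in grouped variables. -/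
theorem integrand_eq (hn : n ≠ 0) (Az : 𝕄 n) (ζ ζ' : Fin 2 → ℂ) (ε : Fin 2 → ℝ) (c : ℝ) {u : ℝ}
    (hu : 0 < u) {y : Herm2 × Herm2} (hy : y ∈ pdSet ×ˢ pdSet) (z : Herm2 × Herm2) (x : Herm2 × U2)
    :
    (polarJac x : ℂ) * (fermWeight n ε (x.1.mat * (x.2 : 𝕄 2)) *
        bosonPart Az (fermC Az ζ x) ζ' c u y z) =
      16 * (Real.pi : ℂ) ^ 3 * (Real.pi : ℂ) ^ Fintype.card (Blk n) *
        integrand Az ζ ζ' ε c u ⟨y.1, y.2, z.1, z.2, x.1, x.2⟩ := by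
  obtain ⟨R, R₂⟩ := y
  obtain ⟨T', S⟩ := z
  obtain ⟨Λ, U⟩ := x
  set ξ := zetaJ ζ' R.mat R₂.mat with hξ
  have hTS : (I * (u : ℂ)) • (1 : 𝕄 2) + T'.mat + S.mat =
      (I * u) • 1 + (T' + S).mat := by rw [Herm2.mat_add, add_assoc]
  have hTS' : (I * (u : ℂ)) • (1 : 𝕄 2) + T'.mat - S.mat =
      (I * u) • 1 + (T' - S).mat := by rw [Herm2.mat_sub, add_sub_assoc]
  have hM := accr_hermX Az ξ (T' + S).mat (T' - S).mat u
  have hMd := det_accr_hermX Az ξ (T' + S).mat (T' - S).mat u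
  have hM0 := det_accr_ne_zero hu (isHermitian_hermX Az ξ (T' + S).isHermitian_mat
    (T' - S).isHermitian_mat)
  have hInv : -(accr u (hermX Az ξ (T' + S).mat (T' - S).mat))⁻¹ =
      (blockB Az ξ ((I * u) • 1 + (T' + S).mat) ((I * u) • 1 + (T' - S).mat))⁻¹ := by
    rw [hM, inv_eq_right_inv (B := -(blockB Az ξ ((I * u) • 1 + (T' + S).mat)
      ((I * u) • 1 + (T' - S).mat))⁻¹), neg_neg]
    rw [neg_mul_neg, mul_nonsing_inv _ (Ne.isUnit (hMd ▸ hM0))]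
  rw [hMd] at hM0
  rw [integrand]
  dsimp only
  rw [berezin_expL Az ζ ζ' _ _ _ _ _ _ (by rw [hTS, hTS']; exact hM0), hTS, hTS', ← hξ,
    bosonPart, bosonChar, fermC]
  dsimp only
  rw [hInv, hMd, fermWeight_mul_U2 hn ε Λ.isHermitian_mat U, gramWeight,
    hermPair_gramCoord hy, Estar1, Estar2, polarJac, gramJac]
  dsimp only
  have e1 : (R.mat ^ 2 + (2 * I) • (R.mat * ((I * (u : ℂ)) • 1 + T'.mat)) +
      Λ.mat ^ 2).trace = (hermTr (sqH R) : ℂ) - 2 * u * hermTr R +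
        2 * I * hermPair T' R + (Λ.mat ^ 2).trace := by
    rw [trace_add, trace_add, trace_smul, Matrix.mul_add, trace_add,
      Matrix.mul_smul, trace_smul, mul_one, trace_mul_comm R.mat T'.mat,
      trace_mat_mul_mat, Herm2.trace_mat, ← mat_sqH, Herm2.trace_mat, smul_eq_mul, smul_eq_mul]
    linear_combination (2 * u * hermTr R : ℂ) * I_mul_I
  have e2 : ((c : ℂ) • R₂.mat + (c : ℂ) • (R₂.mat⁻¹ * R.mat ^ 2)).trace =
      c * (hermTr (gramCoord (R, R₂)).1 + hermTr (gramCoord (R, R₂)).2) := by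
    rw [trace_add, trace_smul, trace_smul, hermTr_gramCoord hy,
      Herm2.trace_mat, smul_eq_mul, smul_eq_mul, gramCoord]
    ring
  have e3 : hermPair₂ (T' + S, T' - S) (R, R) = 2 * hermPair T' R := by
    simp only [hermPair₂, hermPair, Prod.fst_add, Prod.snd_add, Prod.fst_sub, Prod.snd_sub,
      add_mul, sub_mul, add_re, sub_re]
    ring
  have d : ∀ p : Herm2, p.mat.det = (hermDet p : ℂ) := fun p => Herm2.det_mat p
  rw [e1, e2, e3, d, d, d, Herm2.trace_mat, Herm2.trace_mat, ← ofReal_add]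
  generalize (-(Λ.mat * (U : 𝕄 2) * (diagonal fun j => (ε j : ℂ)) +
    (diagonal fun j => (ε j : ℂ)) * (U : 𝕄 2)ᴴ * Λ.mat).trace -
    (n : ℂ)⁻¹ * ((diagonal fun j => (ε j : ℂ)) ^ 2).trace) = b
  generalize (superSum (n : ℂ)⁻¹ uCoef vCoef (blockC Az (diagonal ζ) (zetaU ζ U) Λ.mat Λ.mat)
    (blockB Az ξ ((I * u) • 1 + (T' + S).mat) ((I * u) • 1 + (T' - S).mat))⁻¹) = σ
  generalize (blockB Az ξ ((I * u) • 1 + (T' + S).mat) ((I * u) • 1 + (T' - S).mat)).det⁻¹ = δ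
  generalize (Λ.mat ^ 2).trace = t
  generalize hermTr (gramCoord (R, R₂)).1 + hermTr (gramCoord (R, R₂)).2 = g
  have hexp : exp (-n * t) * (exp (-(c * g + n * hermTr (sqH R)) : ℝ) *
      exp ((u * (n * (hermTr R + hermTr R)) : ℝ))) *
      exp (-((n * (2 * hermPair T' R) : ℝ) * I)) =
      exp (-n * (hermTr (sqH R) - 2 * u * hermTr R + 2 * I * hermPair T' R + t)) *
      exp (-(c * g)) := by
    simp only [← exp_add]
    congr 1
    push_cast
    ring
  have c1 : ((Real.pi ^ 3 * (4 * hermDet Λ * hermTr Λ ^ 2) : ℝ) : ℂ) =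
      (Real.pi : ℂ) ^ 3 * (4 * hermDet Λ * hermTr Λ ^ 2) := by push_cast; rfl
  have c2 : ((4 * hermDet R * hermTr R ^ 2 / hermDet R₂ ^ 2 : ℝ) : ℂ) =
      4 * hermDet R * hermTr R ^ 2 / hermDet R₂ ^ 2 := by push_cast; rfl
  rw [c1, c2]
  linear_combination (16 * (Real.pi : ℂ) ^ 3 * (Real.pi : ℂ) ^ Fintype.card (Blk n) * δ * σ *
    hermDet Λ * hermTr Λ ^ 2 * hermDet R * hermTr R ^ 2 / hermDet R₂ ^ 2 * exp b) * hexp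

end Representation

/-! ### Absolute convergence -/

section Convergence

variable {n : ℕ}

/-- The conjugated source `J⁻¹ ζ' J`, with explicit square roots. -/
def zetaH (ζ' : Fin 2 → ℂ) (y : Herm2 × Herm2) : 𝕄 2 :=
  ((sqrtH y.2).mat * (sqrtH y.1).mat⁻¹)⁻¹ * diagonal ζ' * ((sqrtH y.2).mat * (sqrtH y.1).mat⁻¹)

theorem zetaJ_eq_zetaH (ζ' : Fin 2 → ℂ) {y : Herm2 × Herm2} (hy : y ∈ pdSet ×ˢ pdSet) :
    zetaJ ζ' y.1.mat y.2.mat = zetaH ζ' y := by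
  rw [zetaJ, matJ, msqrt_mat hy.1, msqrt_mat hy.2, zetaH]

theorem measurable_zetaH (ζ' : Fin 2 → ℂ) : Measurable (zetaH ζ') := by
  have h1 : ∀ i j, Measurable fun y : Herm2 × Herm2 => (sqrtH y.2).mat i j := fun i j =>
    (measurable_sqrtH_mat i j).comp measurable_snd
  have h2 : ∀ i j, Measurable fun y : Herm2 × Herm2 => (sqrtH y.1).mat⁻¹ i j := fun i j =>
    (measurable_matrix_inv measurable_sqrtH_mat i j).comp measurable_fst
  have h3 := measurable_matrix_mul h1 h2
  exact measurable_matrix_of_entries (measurable_matrix_mul (measurable_matrix_mul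
    (measurable_matrix_inv h3) fun i j => measurable_const) h3)

theorem continuous_calA (Az : 𝕄 n) : Continuous (calA Az) := by
  have h1 : ∀ i j, Continuous fun M : 𝕄 2 => M i j := fun i j =>
    continuous_id.matrix_elem i j
  refine continuous_matrix fun i j => ?_
  simp only [calA, Matrix.sub_apply, Matrix.smul_apply, kroneckerMap_apply, smul_eq_mul]
  exact continuous_const.sub (continuous_const.mul ((h1 _ _).mul continuous_const))

/-- A source and a pair of Hermitian matrices. -/
abbrev SourcePair : Type := 𝕄 2 × (Herm2 × Herm2)

theorem continuous_accr_hermX_joint (Az : 𝕄 n) (u : ℝ) :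
    Continuous fun p : SourcePair => accr u (hermX Az p.1 p.2.1.mat p.2.2.mat) := by
  have h1 : Continuous fun p : SourcePair => calA Az p.1 := (continuous_calA Az).comp continuous_fst
  have h2 : ∀ i j, Continuous fun p : SourcePair => p.2.1.mat i j := fun i j =>
    (Herm2.continuous_mat.matrix_elem i j).comp (continuous_fst.comp continuous_snd)
  have h3 : ∀ i j, Continuous fun p : SourcePair => p.2.2.mat i j := fun i j =>
    (Herm2.continuous_mat.matrix_elem i j).comp (continuous_snd.comp continuous_snd)
  have h4 : Continuous fun p : SourcePair => hermX Az p.1 p.2.1.mat p.2.2.mat := by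
    unfold hermX
    refine Continuous.matrix_fromBlocks (continuous_matrix fun i j => ?_) h1.neg
      h1.matrix_conjTranspose.neg (continuous_matrix fun i j => ?_)
    · exact ((h2 _ _).mul continuous_const).neg
    · exact ((h3 _ _).mul continuous_const).neg
  unfold accr
  exact continuous_const.add (h4.const_smul I)

theorem det_accr_hermX_ne_zero (Az : 𝕄 n) {u : ℝ} (hu : 0 < u) (p : SourcePair) :
    (accr u (hermX Az p.1 p.2.1.mat p.2.2.mat)).det ≠ 0 :=
  det_accr_ne_zero hu (isHermitian_hermX Az p.1 p.2.1.isHermitian_mat p.2.2.isHermitian_mat)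

theorem continuous_bosonChar_joint (Az : 𝕄 n) {u : ℝ} (hu : 0 < u) :
    Continuous fun p : Matrix (Blk n) (Blk n) ℂ × SourcePair =>
      bosonChar Az p.1 p.2.1 u p.2.2 := by
  have h := continuous_accr_hermX_joint Az u
  have h2 := det_accr_hermX_ne_zero Az hu
  have h3 : Continuous fun p : SourcePair => (accr u (hermX Az p.1 p.2.1.mat p.2.2.mat))⁻¹ := by
    simp only [Matrix.inv_def, Ring.inverse_eq_inv']
    exact (h.matrix_det.inv₀ h2).smul h.matrix_adjugate
  have h4 : Continuous fun p : Matrix (Blk n) (Blk n) ℂ × SourcePair =>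
      superSum (n : ℂ)⁻¹ uCoef vCoef p.1 (-(accr u (hermX Az p.2.1 p.2.2.1.mat p.2.2.2.mat))⁻¹) :=
    Continuous.comp (g := fun x : Matrix (Blk n) (Blk n) ℂ × Matrix (Blk n) (Blk n) ℂ =>
        superSum (n : ℂ)⁻¹ uCoef vCoef x.1 x.2)
      (f := fun p : Matrix (Blk n) (Blk n) ℂ × SourcePair =>
        (p.1, -(accr u (hermX Az p.2.1 p.2.2.1.mat p.2.2.2.mat))⁻¹))
      (continuous_superSum (n : ℂ)⁻¹ uCoef vCoef)
      (continuous_fst.prodMk (h3.comp continuous_snd).neg)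
  have h5 : Continuous fun p : Matrix (Blk n) (Blk n) ℂ × SourcePair =>
      (accr u (hermX Az p.2.1 p.2.2.1.mat p.2.2.2.mat)).det⁻¹ :=
    (h.matrix_det.inv₀ h2).comp continuous_snd
  exact continuous_const.mul (h5.mul h4)

/-- The variables `(R, R₂)` and `(T', S)`. -/
abbrev BosonVars : Type := (Herm2 × Herm2) × (Herm2 × Herm2)

/-- The measure on the variables `(R, R₂)` and `(T', S)`. -/
def bosonMeasure : Measure BosonVars :=
  ((volume : Measure (Herm2 × Herm2)).restrict (pdSet ×ˢ pdSet)).prod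
    (volume : Measure (Herm2 × Herm2))

instance sFinite_bosonMeasure : SFinite bosonMeasure := by
  exact Measure.prod.instSFinite

theorem ae_mem_pdSet_bosonMeasure : ∀ᵐ w ∂bosonMeasure, w.1 ∈ pdSet ×ˢ pdSet :=
  Measure.quasiMeasurePreserving_fst.ae
    (ae_restrict_mem (measurableSet_pdSet.prod measurableSet_pdSet))

/-- The source and the pair of Hermitian matrices in terms of the integration variables. -/
def sourcePair (ζ' : Fin 2 → ℂ) (w : BosonVars) : SourcePair :=
  (zetaH ζ' w.1, (w.2.1 + w.2.2, w.2.1 - w.2.2))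

theorem measurable_sourcePair (ζ' : Fin 2 → ℂ) : Measurable (sourcePair ζ') :=
  ((measurable_zetaH ζ').comp measurable_fst).prodMk (by fun_prop)

/-- The factor of the bosonic part that only depends on `(R, R₂)`. -/
def bosonFactor (n : ℕ) (c u : ℝ) (y : Herm2 × Herm2) : ℂ :=
  gramJac y * (gramWeight n c (gramCoord y) * exp ((u * (n * (hermTr y.1 + hermTr y.1)) : ℝ)))

theorem measurable_bosonFactor (n : ℕ) (c u : ℝ) : Measurable (bosonFactor n c u) := by
  have h3 : Measurable fun x : Herm2 × Herm2 =>
      exp ((u * (n * (hermTr x.1 + hermTr x.1)) : ℝ)) := by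
    unfold hermTr
    fun_prop
  exact (measurable_ofReal.comp measurable_gramJac).mul
    (((contDiff_gramWeight n c).continuous.measurable.comp measurable_gramCoord).mul h3)

theorem bosonPart_eq (Az : 𝕄 n) (C : Matrix (Blk n) (Blk n) ℂ) (ζ' : Fin 2 → ℂ) (c u : ℝ)
    {w : BosonVars} (hw : w.1 ∈ pdSet ×ˢ pdSet) :
    bosonPart Az C ζ' c u w.1 w.2 = bosonFactor n c u w.1 *
      (bosonChar Az C (sourcePair ζ' w).1 u (sourcePair ζ' w).2 *
        exp (-((n * hermPair₂ (sourcePair ζ' w).2 (w.1.1, w.1.1) : ℝ) * I))) := by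
  rw [bosonPart, zetaJ_eq_zetaH ζ' hw]
  rfl

/-- The measurable version of the bosonic part. -/
def bosonMeas (Az : 𝕄 n) (ζ' : Fin 2 → ℂ) (c u : ℝ) (p : Matrix (Blk n) (Blk n) ℂ × BosonVars) :
    ℂ :=
  bosonFactor n c u p.2.1 * (bosonChar Az p.1 (sourcePair ζ' p.2).1 u (sourcePair ζ' p.2).2 *
        exp (-((n * hermPair₂ (sourcePair ζ' p.2).2 (p.2.1.1, p.2.1.1) : ℝ) * I)))

theorem measurable_bosonChar_joint (Az : 𝕄 n) {u : ℝ} (hu : 0 < u) :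
    Measurable fun p : Matrix (Blk n) (Blk n) ℂ × SourcePair => bosonChar Az p.1 p.2.1 u p.2.2 := by
  have : BorelSpace SourcePair := inferInstance
  exact (continuous_bosonChar_joint Az hu).measurable

theorem measurable_prodMk_sourcePair (n : ℕ) (ζ' : Fin 2 → ℂ) :
    Measurable fun p : Matrix (Blk n) (Blk n) ℂ × BosonVars => (p.1, sourcePair ζ' p.2) :=
  measurable_fst.prodMk ((measurable_sourcePair ζ').comp measurable_snd)

theorem measurable_phase (n : ℕ) (ζ' : Fin 2 → ℂ) : Measurable fun w : BosonVars =>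
    exp (-((n * hermPair₂ (sourcePair ζ' w).2 (w.1.1, w.1.1) : ℝ) * I)) := by
  have h2 : Measurable fun w : BosonVars => ((sourcePair ζ' w).2, (w.1.1, w.1.1)) :=
    (measurable_snd.comp (measurable_sourcePair ζ')).prodMk (by fun_prop)
  have h3 : Measurable fun w : BosonVars => hermPair₂ (sourcePair ζ' w).2 (w.1.1, w.1.1) :=
    Measurable.comp (g := fun x : (Herm2 × Herm2) × (Herm2 × Herm2) => hermPair₂ x.1 x.2)
      continuous_hermPair₂.measurable h2
  fun_prop

theorem measurable_bosonMeas (Az : 𝕄 n) (ζ' : Fin 2 → ℂ) (c : ℝ) {u : ℝ} (hu : 0 < u) :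
    Measurable (bosonMeas Az ζ' c u) := by
  have h1 : Measurable fun p : Matrix (Blk n) (Blk n) ℂ × BosonVars => bosonFactor n c u p.2.1 :=
    (measurable_bosonFactor n c u).comp (measurable_fst.comp measurable_snd)
  exact h1.mul (((measurable_bosonChar_joint Az hu).comp (measurable_prodMk_sourcePair n ζ')).mul
    ((measurable_phase n ζ').comp measurable_snd))

/-- The modulus of the inverse of the bosonic determinant, in the variables `(T', S)`. -/
def invDet (Az : 𝕄 n) (u : ℝ) (ξ : 𝕄 2) (x : Herm2 × Herm2) :
    ℝ := ‖(accr u (hermX Az ξ x.1.mat x.2.mat)).det‖⁻¹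

theorem measurable_invDet (Az : 𝕄 n) (u : ℝ) (ξ : 𝕄 2) : Measurable (invDet Az u ξ) :=
  (continuous_accr_hermX Az ξ u).matrix_det.norm.measurable.inv

theorem invDet_nonneg (Az : 𝕄 n) (u : ℝ) (ξ : 𝕄 2) (x : Herm2 × Herm2) : 0 ≤ invDet Az u ξ x := by
  unfold invDet
  positivity

/-- The dominating function of the bosonic part. -/
def bosonDom (Az : 𝕄 n) (ζ' : Fin 2 → ℂ) (c u : ℝ) (w : BosonVars) : ℝ :=
  ‖bosonFactor n c u w.1‖ * invDet Az u (sourcePair ζ' w).1 (sourcePair ζ' w).2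

theorem measurable_bosonDom (Az : 𝕄 n) (ζ' : Fin 2 → ℂ) (c u : ℝ) :
    Measurable (bosonDom Az ζ' c u) :=
  ((measurable_bosonFactor n c u).comp measurable_fst).norm.mul
    ((continuous_accr_hermX_joint Az u).matrix_det.measurable.comp
      (measurable_sourcePair ζ')).norm.inv

theorem exists_norm_bosonMeas_le (n : ℕ) {u : ℝ} (hu : 0 < u) : ∃ K : ℝ, 0 ≤ K ∧
    ∀ (Az : 𝕄 n) (ζ' : Fin 2 → ℂ) (c : ℝ)
      (p : Matrix (Blk n) (Blk n) ℂ × BosonVars) (a : ℝ), 1 ≤ a → (∀ i j, ‖p.1 i j‖ ≤ a) →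
      ‖bosonMeas Az ζ' c u p‖ ≤ bosonDom Az ζ' c u p.2 * (K * a ^ Fintype.card (Blk n)) := by
  obtain ⟨K, hK, h⟩ := exists_norm_superSum_le n hu
  have hpi := Real.pi_pos
  refine ⟨Real.pi ^ Fintype.card (Blk n) * K, by positivity, fun Az ζ' c p a ha hp => ?_⟩
  have h1 := h Az p.1 (sourcePair ζ' p.2).1 (sourcePair ζ' p.2).2 a ha hp
  rw [bosonMeas, norm_mul, norm_mul, ← neg_mul, ← ofReal_neg,
    norm_exp_ofReal_mul_I, mul_one, bosonChar, norm_mul, norm_mul, norm_pow,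
    norm_real, Real.norm_of_nonneg hpi.le, norm_inv, bosonDom, invDet]
  calc _ ≤ ‖bosonFactor n c u p.2.1‖ * (Real.pi ^ Fintype.card (Blk n) *
        (‖(accr u (hermX Az (sourcePair ζ' p.2).1 (sourcePair ζ' p.2).2.1.mat
          (sourcePair ζ' p.2).2.2.mat)).det‖⁻¹ * (K * a ^ Fintype.card (Blk n)))) := by gcongr
    _ = _ := by ring

theorem exists_integral_inv_det_accr_le (hn : 4 ≤ n) {u : ℝ} (hu : 0 < u) :
    ∃ J : ℝ, ∀ (Az : 𝕄 n) (ξ : 𝕄 2),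
      Integrable (fun z : Herm2 × Herm2 => invDet Az u ξ (z.1 + z.2, z.1 - z.2)) ∧
      ∫ z : Herm2 × Herm2, invDet Az u ξ (z.1 + z.2, z.1 - z.2) ≤ J := by
  obtain ⟨J, hJ, h⟩ := exists_lintegral_inv_det_accr_le hn hu
  refine ⟨J.toReal, fun Az ξ => ?_⟩
  have hf : Measurable fun z : Herm2 × Herm2 => (z.1 + z.2, z.1 - z.2) := by fun_prop
  have hg := measurable_invDet Az u ξ
  have hgf : Measurable fun z : Herm2 × Herm2 => invDet Az u ξ (z.1 + z.2, z.1 - z.2) := hg.comp hf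
  have h1 : ∫⁻ z : Herm2 × Herm2, ENNReal.ofReal (invDet Az u ξ (z.1 + z.2, z.1 - z.2)) ≤ J := by
    have h2 := lintegral_map (μ := (volume : Measure (Herm2 × Herm2))) hg.ennreal_ofReal hf
    rw [← h2, map_add_sub_volume, lintegral_smul_measure, smul_eq_mul]
    have h4 : ENNReal.ofReal (1 / 16) ≤ 1 := ENNReal.ofReal_le_one.mpr (by norm_num)
    exact (mul_le_of_le_one_left zero_le h4).trans (h Az ξ)
  have h0 : ∀ᵐ z : Herm2 × Herm2, 0 ≤ invDet Az u ξ (z.1 + z.2, z.1 - z.2) :=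
    .of_forall fun _ => invDet_nonneg _ _ _ _
  refine ⟨⟨hgf.aestronglyMeasurable, ?_⟩, ?_⟩
  · rw [hasFiniteIntegral_iff_ofReal h0]
    exact h1.trans_lt hJ
  · rw [integral_eq_lintegral_of_nonneg_ae h0 hgf.aestronglyMeasurable]
    exact ENNReal.toReal_mono hJ.ne h1

/-- The dominating function is integrable: the inverse determinant is integrable in `(T', S)`
uniformly in the source, so that only the integrability in `(R, R₂)` of the remaining factor
is needed. -/
theorem integrable_bosonDom (hn : 4 ≤ n) (Az : 𝕄 n) (ζ' : Fin 2 → ℂ) {c u : ℝ} (hc : 0 < c)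
    (hu : 0 < u) : Integrable (bosonDom Az ζ' c u) bosonMeasure := by
  obtain ⟨J, h3⟩ := exists_integral_inv_det_accr_le hn hu
  have hm := measurable_bosonDom Az ζ' c u
  rw [bosonMeasure, integrable_prod_iff hm.aestronglyMeasurable]
  refine ⟨.of_forall fun y => (h3 Az (zetaH ζ' y)).1.const_mul ‖bosonFactor n c u y‖, ?_⟩
  refine ((integrableOn_gramJac_mul hc n u).norm.mul_const J).mono'
    hm.aestronglyMeasurable.norm.integral_prod_right' (.of_forall fun y => ?_)
  rw [Real.norm_of_nonneg (integral_nonneg fun _ => norm_nonneg _)]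
  have h4 : ∀ z, ‖bosonDom Az ζ' c u (y, z)‖ = ‖bosonFactor n c u y‖ *
      invDet Az u (zetaH ζ' y) (z.1 + z.2, z.1 - z.2) := fun z =>
    Real.norm_of_nonneg (mul_nonneg (norm_nonneg _) (invDet_nonneg _ _ _ _))
  simp only [h4]
  rw [integral_const_mul]
  exact mul_le_mul_of_nonneg_left (h3 Az _).2 (norm_nonneg _)

end Convergence

section Assembly

variable {n : ℕ}

theorem ExpGrowth.ofReal_norm {X : Type*} [NormedAddCommGroup X] {F : X → ℂ} (hF : ExpGrowth F) :
    ExpGrowth fun x => ((‖F x‖ : ℝ) : ℂ) := by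
  obtain ⟨C, b, hC, hb, h⟩ := hF.bound
  exact ⟨continuous_ofReal.comp hF.continuous.norm, C, b, hC, hb, fun x => by simpa using h x⟩

/-- The measure on the variables `Λ` and `U`. -/
def fermMeasure : Measure (Herm2 × U2) := ((volume : Measure Herm2).restrict pdSet).prod haarU2

instance sFinite_fermMeasure : SFinite fermMeasure := by
  unfold fermMeasure
  infer_instance

/-- The sum of the moduli of the entries. -/
def entrySum (M : 𝕄 2) : ℝ := ∑ k, ∑ l, ‖M k l‖

theorem norm_entry_le_entrySum (M : 𝕄 2) (k l : Fin 2) : ‖M k l‖ ≤ entrySum M :=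
  (single_le_sum (f := fun l => ‖M k l‖) (fun _ _ => norm_nonneg _) (mem_univ l)).trans
    (single_le_sum (f := fun k => ∑ l, ‖M k l‖)
      (fun _ _ => sum_nonneg fun _ _ => norm_nonneg _) (mem_univ k))

theorem continuous_entrySum : Continuous entrySum := by
  unfold entrySum
  fun_prop

theorem norm_le_entrySum_mul_U2 (L : 𝕄 2) (U : U2) (k l : Fin 2) :
    ‖L k l‖ ≤ entrySum (L * (U : 𝕄 2)) := by
  obtain ⟨U, hU⟩ := U
  have h1 : U * Uᴴ = 1 := mem_unitaryGroup_iff.mp hU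
  have h2 : L = (L * U) * Uᴴ := by rw [Matrix.mul_assoc, h1, mul_one]
  have h3 : ∀ i j, ‖U i j‖ ≤ 1 := entry_norm_bound_of_unitary hU
  conv_lhs => rw [h2]
  rw [Matrix.mul_apply]
  refine (norm_sum_le _ _).trans ?_
  refine le_trans (sum_le_sum (g := fun m => ‖(L * U) k m‖) fun m _ => ?_)
    (single_le_sum (f := fun k => ∑ l, ‖(L * U) k l‖)
      (fun _ _ => sum_nonneg fun _ _ => norm_nonneg _) (mem_univ k))
  rw [norm_mul, conjTranspose_apply, norm_star]
  exact mul_le_of_le_one_right (norm_nonneg _) (h3 l m)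

theorem continuous_zetaU (ζ : Fin 2 → ℂ) : Continuous (zetaU ζ) := by
  have h : Continuous fun U : U2 => (U : 𝕄 2) := continuous_subtype_val
  exact (h.mul continuous_const).mul h.matrix_conjTranspose

theorem exists_norm_fermC_le (Az : 𝕄 n) (ζ : Fin 2 → ℂ) :
    ∃ a : ℝ, 1 ≤ a ∧ ∀ (x : Herm2 × U2) (i j : Blk n),
      ‖fermC Az ζ x i j‖ ≤ a + entrySum (x.1.mat * (x.2 : 𝕄 2)) := by
  have hcont : Continuous fun U : U2 => ∑ i, ∑ j, ‖calA Az (zetaU ζ U) i j‖ := by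
    have h : ∀ i j, Continuous fun U : U2 => calA Az (zetaU ζ U) i j := fun i j =>
      ((continuous_calA Az).comp (continuous_zetaU ζ)).matrix_elem i j
    fun_prop
  obtain ⟨b, hb⟩ := (isCompact_univ (X := U2)).exists_bound_of_continuousOn hcont.continuousOn
  have hs : ∀ (M : Matrix (Fin 2 × Fin n) (Fin 2 × Fin n) ℂ) i j, ‖M i j‖ ≤ ∑ i, ∑ j, ‖M i j‖ :=
    fun M i j => (single_le_sum (f := fun j => ‖M i j‖) (fun _ _ => norm_nonneg _)
      (mem_univ j)).trans (single_le_sum (f := fun i => ∑ j, ‖M i j‖)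
        (fun _ _ => sum_nonneg fun _ _ => norm_nonneg _) (mem_univ i))
  set b₀ : ℝ := ∑ i, ∑ j, ‖calA Az (diagonal ζ) i j‖
  have hb₀0 : 0 ≤ b₀ := sum_nonneg fun _ _ => sum_nonneg fun _ _ => norm_nonneg _
  refine ⟨1 + |b| + b₀, by linarith [abs_nonneg b], fun x i j => ?_⟩
  have he : 0 ≤ entrySum (x.1.mat * (x.2 : 𝕄 2)) :=
    (norm_nonneg _).trans (norm_entry_le_entrySum _ 0 0)
  have hL : ∀ i j : Fin 2 × Fin n, ‖(x.1.mat ⊗ₖ (1 : 𝕄 n)) i j‖ ≤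
      entrySum (x.1.mat * (x.2 : 𝕄 2)) := by
    intro i j
    rw [kroneckerMap_apply, Matrix.one_apply]
    split_ifs
    · rw [mul_one]
      exact norm_le_entrySum_mul_U2 _ x.2 _ _
    · rw [mul_zero, norm_zero]
      exact he
  have hU : ∀ i j, ‖calA Az (zetaU ζ x.2) i j‖ ≤ |b| := fun i j =>
    (hs _ i j).trans ((le_abs_self _).trans ((hb x.2 (Set.mem_univ _)).trans (le_abs_self b)))
  have hab := abs_nonneg b
  rcases i with i | i <;> rcases j with j | j
  · have := hL i j
    simp only [fermC, blockC, fromBlocks_apply₁₁]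
    linarith
  · have := hs (calA Az (diagonal ζ)) i j
    simp only [fermC, blockC, fromBlocks_apply₁₂, Matrix.smul_apply, norm_smul, norm_I, one_mul]
    linarith
  · have := hU j i
    simp only [fermC, blockC, fromBlocks_apply₂₁, Matrix.smul_apply, norm_smul,
      norm_I, one_mul, conjTranspose_apply, norm_star]
    linarith
  · have := hL i j
    simp only [fermC, blockC, fromBlocks_apply₂₂]
    linarith

theorem measurable_fermC (Az : 𝕄 n) (ζ : Fin 2 → ℂ) : Measurable (fermC Az ζ) := by
  have hU : ∀ i j, Measurable fun x : Herm2 × U2 => calA Az (zetaU ζ x.2) i j := by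
    intro i j
    have h3 : Measurable fun M => calA Az M i j := ((continuous_calA Az).matrix_elem i j).measurable
    exact h3.comp ((continuous_zetaU ζ).measurable.comp measurable_snd)
  have hL : ∀ i j : Fin 2 × Fin n, Measurable fun x : Herm2 × U2 =>
      (x.1.mat ⊗ₖ (1 : 𝕄 n)) i j := fun i j =>
    ((measurable_herm2_mat i.1 j.1).comp measurable_fst).mul_const _
  refine measurable_matrix_of_entries fun i j => ?_
  rcases i with i | i <;> rcases j with j | j
  · exact hL i j
  · exact measurable_const
  · exact (continuous_conj.measurable.comp (hU j i)).const_mul I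
  · exact hL i j

theorem integrable_fermWeight_mul_pow (hn : n ≠ 0) (ε : Fin 2 → ℝ) (a : ℝ) (N : ℕ) :
    Integrable (fun x => (polarJac x : ℂ) * (fermWeight n ε (x.1.mat * (x.2 : 𝕄 2)) *
        ((a + entrySum (x.1.mat * (x.2 : 𝕄 2)) : ℝ) : ℂ) ^ N)) fermMeasure := by
  set F : 𝕄 2 → ℂ := fun M =>
    fermWeight n ε M * ((a + entrySum M : ℝ) : ℂ) ^ N with hF
  have hFm : Continuous F := (continuous_fermWeight n ε).mul
    ((continuous_ofReal.comp (continuous_const.add continuous_entrySum)).pow N)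
  have hiff := integrable_iff_of_lintegral_eq
    (measurable_mul_U2 (f := fun p : Herm2 => p.mat) measurable_herm2_mat) measurable_polarJac
    ae_polarJac_nonneg lintegral_map_of_eq_polar (F := F) hFm.measurable.aestronglyMeasurable
  refine hiff.mp ((integrable_map_measure hFm.measurable.aestronglyMeasurable
    measurable_of.aemeasurable).mpr ?_)
  -- centre the Gaussian
  set d : Fin 2 × Fin 2 → ℂ := fun p =>
    (diagonal fun j => (ε j / n : ℂ) : 𝕄 2) p.1 p.2
  have hn0 : (0 : ℝ) < n := by positivity
  have h1 : ExpGrowth fun q : Fin 2 × Fin 2 → ℂ =>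
      ((a + ∑ k, ∑ l, ‖q (k, l) - d (k, l)‖ : ℝ) : ℂ) ^ N := by
    have h2 : ExpGrowth fun q : Fin 2 × Fin 2 → ℂ =>
        (a : ℂ) + ∑ k, ∑ l, ((‖q (k, l) - d (k, l)‖ : ℝ) : ℂ) :=
      (ExpGrowth.const _).add (.sum _ fun k _ => .sum _ fun l _ =>
        ((ExpGrowth.coord (k, l)).sub (.const _)).ofReal_norm)
    have h3 := ExpGrowth.prod (univ : Finset (Fin N)) (fun _ _ => h2)
    simp only [prod_const, card_univ, Fintype.card_fin] at h3
    push_cast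
    exact h3
  have h4 : Continuous fun q : Fin 2 × Fin 2 → ℂ => ((-(n * sqn q) : ℝ) : ℂ) :=
    continuous_ofReal.comp (continuous_const.mul continuous_sqn).neg
  have h5 := integrable_mul_gaussian_of_expGrowth h1 h4 hn0 fun q => by
    rw [ofReal_re, neg_mul]
  have h6 := h5.comp_add_right d
  refine h6.congr (.of_forall fun q => ?_)
  have h7 : (of fun i j => q (i, j)) + (diagonal fun j => (ε j / n : ℂ)) =
      of fun i j => (q + d) (i, j) := by
    ext i j
    rfl
  have h8 : fermWeight n ε (of fun i j => q (i, j)) = exp ((-(n * sqn (q + d)) : ℝ)) := by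
    rw [fermWeight, h7, ← sqn_eq_trace]
    push_cast
    ring_nf
  simp only [hF, Function.comp_apply, h8, entrySum, of_apply, Pi.add_apply, add_sub_cancel_right]
  rw [mul_comm]

/-- The integrand in grouped variables. -/
def groupedIntegrand (Az : 𝕄 n) (ζ ζ' : Fin 2 → ℂ) (ε : Fin 2 → ℝ) (c u : ℝ)
    (p : BosonVars × (Herm2 × U2)) : ℂ :=
  (polarJac p.2 : ℂ) * (fermWeight n ε (p.2.1.mat * (p.2.2 : 𝕄 2)) *
    bosonPart Az (fermC Az ζ p.2) ζ' c u p.1.1 p.1.2)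

theorem measurable_fermWeight_mul (n : ℕ) (ε : Fin 2 → ℝ) : Measurable fun x : Herm2 × U2 =>
    fermWeight n ε (x.1.mat * (x.2 : 𝕄 2)) :=
  (continuous_fermWeight n ε).measurable.comp
    (measurable_mul_U2 (f := fun p : Herm2 => p.mat) measurable_herm2_mat)

theorem integrable_bosonPart (hn : 4 ≤ n) (Az : 𝕄 n) (C : Matrix (Blk n) (Blk n) ℂ) (ζ' : Fin 2 → ℂ)
    {c u : ℝ} (hc : 0 < c) (hu : 0 < u) :
    Integrable (fun w : BosonVars => bosonPart Az C ζ' c u w.1 w.2) bosonMeasure := by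
  obtain ⟨K, hK, h⟩ := exists_norm_bosonMeas_le n hu
  have hm : Measurable fun w : BosonVars => bosonMeas Az ζ' c u (C, w) :=
    (measurable_bosonMeas Az ζ' c hu).comp measurable_prodMk_left
  set a : ℝ := 1 + ∑ i, ∑ j, ‖C i j‖
  have ha1 : 1 ≤ a := le_add_of_nonneg_right (by positivity)
  have haC : ∀ i j, ‖C i j‖ ≤ a := fun i j => by
    have h1 : ‖C i j‖ ≤ ∑ i, ∑ j, ‖C i j‖ :=
      (single_le_sum (f := fun j => ‖C i j‖) (fun _ _ => norm_nonneg _)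
        (mem_univ j)).trans (single_le_sum (f := fun i => ∑ j, ‖C i j‖)
          (fun _ _ => sum_nonneg fun _ _ => norm_nonneg _) (mem_univ i))
    linarith
  have h1 : Integrable (fun w : BosonVars => bosonMeas Az ζ' c u (C, w)) bosonMeasure :=
    ((integrable_bosonDom hn Az ζ' hc hu).mul_const _).mono' hm.aestronglyMeasurable
      (.of_forall fun w => h Az ζ' c (C, w) a ha1 haC)
  refine h1.congr (ae_mem_pdSet_bosonMeasure.mono fun w hw => ?_)
  exact (bosonPart_eq Az C ζ' c u hw).symm

/-- The integrand is dominated by a product of an integrable function of the bosonic variables and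
a Gaussian with polynomial growth in `Λ`. -/
theorem integrable_groupedIntegrand (hn : 4 ≤ n) (Az : 𝕄 n) (ζ ζ' : Fin 2 → ℂ) (ε : Fin 2 → ℝ)
    {c u : ℝ} (hc : 0 < c) (hu : 0 < u) :
    Integrable (groupedIntegrand Az ζ ζ' ε c u) (bosonMeasure.prod fermMeasure) := by
  obtain ⟨K, hK, h⟩ := exists_norm_bosonMeas_le n hu
  obtain ⟨a, ha, hC⟩ := exists_norm_fermC_le Az ζ
  have hdom := (integrable_bosonDom hn Az ζ' hc hu).mul_prod
    ((integrable_fermWeight_mul_pow (by omega : n ≠ 0) ε a (Fintype.card (Blk n))).norm.mul_const K)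
  have hm1 : Measurable fun p : BosonVars × (Herm2 × U2) =>
      bosonMeas Az ζ' c u (fermC Az ζ p.2, p.1) :=
    (measurable_bosonMeas Az ζ' c hu).comp
      (((measurable_fermC Az ζ).comp measurable_snd).prodMk measurable_fst)
  have hm2 : Measurable fun p : BosonVars × (Herm2 × U2) => (polarJac p.2 : ℂ) :=
    measurable_ofReal.comp (measurable_polarJac.comp measurable_snd)
  have hm : Measurable fun p : BosonVars × (Herm2 × U2) => (polarJac p.2 : ℂ) *
      (fermWeight n ε (p.2.1.mat * (p.2.2 : 𝕄 2)) * bosonMeas Az ζ' c u (fermC Az ζ p.2, p.1)) :=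
    hm2.mul (((measurable_fermWeight_mul n ε).comp measurable_snd).mul hm1)
  have h1 := hdom.mono' hm.aestronglyMeasurable (.of_forall fun p => ?_)
  · refine h1.congr ?_
    filter_upwards [Measure.quasiMeasurePreserving_fst.ae ae_mem_pdSet_bosonMeasure] with p hp
    rw [groupedIntegrand, bosonPart_eq Az _ ζ' c u hp]
    rfl
  · obtain ⟨w, x⟩ := p
    have he : 0 ≤ entrySum (x.1.mat * (x.2 : 𝕄 2)) :=
      (norm_nonneg _).trans (norm_entry_le_entrySum _ 0 0)
    have h2 := h Az ζ' c (fermC Az ζ x, w) _ (by linarith) (hC x)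
    dsimp only at h2 ⊢
    rw [norm_mul, norm_mul, norm_mul, norm_mul, norm_pow, norm_real (a + _),
      Real.norm_of_nonneg (by linarith : 0 ≤ a + entrySum _)]
    calc _ ≤ ‖(polarJac x : ℂ)‖ * (‖fermWeight n ε (x.1.mat * (x.2 : 𝕄 2))‖ *
          (bosonDom Az ζ' c u w * (K * (a + entrySum (x.1.mat * (x.2 :
            𝕄 2))) ^ Fintype.card (Blk n)))) := by gcongr
      _ = _ := by ring

end Assembly

/-! ### The integral representation for a fixed deformation -/

section FixedDeformation

variable {n : ℕ}

/-- The regrouping of the integration variables. -/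
def regroup : BosonVars × (Herm2 × U2) ≃ᵐ Herm2 × Herm2 × Herm2 × Herm2 × Herm2 × U2 :=
  MeasurableEquiv.prodAssoc.trans (MeasurableEquiv.prodAssoc.trans
    ((MeasurableEquiv.refl Herm2).prodCongr ((MeasurableEquiv.refl Herm2).prodCongr
      MeasurableEquiv.prodAssoc)))

theorem reprMeasure_eq : reprMeasure =
    ((volume : Measure Herm2).restrict pdSet).prod (((volume : Measure Herm2).restrict pdSet).prod
      ((volume : Measure Herm2).prod ((volume : Measure Herm2).prod fermMeasure))) := by
  have hset : {x | (Vars.ofTuple x).R.mat.PosDef ∧ (Vars.ofTuple x).R₂.mat.PosDef ∧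
      (Vars.ofTuple x).Λ.mat.PosDef} = pdSet ×ˢ (pdSet ×ˢ ((Set.univ : Set Herm2) ×ˢ
        ((Set.univ : Set Herm2) ×ˢ (pdSet ×ˢ (Set.univ : Set U2))))) := by
    ext x
    simp [Vars.ofTuple, pdSet]
  have i1 : SFinite ((volume : Measure Herm2).prod haarU2) := Measure.prod.instSFinite
  have i4 : SFinite ((volume : Measure Herm2).prod ((volume : Measure Herm2).prod
    ((volume : Measure Herm2).prod ((volume : Measure Herm2).prod haarU2)))) :=
    Measure.prod.instSFinite
  rw [reprMeasure, hset, ← Measure.prod_restrict, ← Measure.prod_restrict, ← Measure.prod_restrict,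
    ← Measure.prod_restrict, ← Measure.prod_restrict]
  simp only [Measure.restrict_univ, fermMeasure]

theorem measurePreserving_regroup :
    MeasurePreserving regroup (bosonMeasure.prod fermMeasure) reprMeasure := by
  set ν : Measure Herm2 := (volume : Measure Herm2).restrict pdSet
  have h1 : bosonMeasure = (ν.prod ν).prod
      ((volume : Measure Herm2).prod (volume : Measure Herm2)) := by
    rw [bosonMeasure, Measure.volume_eq_prod, ← Measure.prod_restrict]
  have i1 : SFinite ((volume : Measure Herm2).prod (volume : Measure Herm2)) :=
    Measure.prod.instSFinite
  rw [reprMeasure_eq, h1]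
  have e1 := measurePreserving_prodAssoc (ν.prod ν)
    ((volume : Measure Herm2).prod (volume : Measure Herm2)) fermMeasure
  have e2 := measurePreserving_prodAssoc ν ν
    (((volume : Measure Herm2).prod (volume : Measure Herm2)).prod fermMeasure)
  have e3 := measurePreserving_prodAssoc (volume : Measure Herm2) (volume : Measure Herm2)
    fermMeasure
  exact (((MeasurePreserving.id ν).prod ((MeasurePreserving.id ν).prod e3)).comp e2).comp e1

theorem groupedIntegrand_eq (hn : n ≠ 0) (Az : 𝕄 n) (ζ ζ' : Fin 2 → ℂ) (ε : Fin 2 → ℝ) (c : ℝ)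
    {u : ℝ} (hu : 0 < u) :
    groupedIntegrand Az ζ ζ' ε c u =ᵐ[bosonMeasure.prod fermMeasure] fun p =>
      16 * (Real.pi : ℂ) ^ 3 * (Real.pi : ℂ) ^ Fintype.card (Blk n) *
        integrand Az ζ ζ' ε c u (Vars.ofTuple (regroup p)) := by
  filter_upwards [Measure.quasiMeasurePreserving_fst.ae ae_mem_pdSet_bosonMeasure] with p hp
  exact integrand_eq hn Az ζ ζ' ε c hu hp p.1.2 p.2

theorem reprIntegrable_of_pos (hn : 4 ≤ n) (Az : 𝕄 n) (ζ ζ' : Fin 2 → ℂ) (ε : Fin 2 → ℝ) {c u : ℝ}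
    (hc : 0 < c) (hu : 0 < u) : ReprIntegrable Az ζ ζ' ε c u := by
  rw [ReprIntegrable, ← measurePreserving_regroup.integrable_comp_emb regroup.measurableEmbedding]
  have h1 := (integrable_groupedIntegrand hn Az ζ ζ' ε hc hu).congr
    (groupedIntegrand_eq (by omega) Az ζ ζ' ε c hu)
  exact (integrable_const_mul_iff (Ne.isUnit (by positivity)) _).mp h1

theorem integral_groupedIntegrand (hn : 4 ≤ n) (Az : 𝕄 n) (ζ ζ' : Fin 2 → ℂ) (ε : Fin 2 → ℝ)
    {s u : ℝ} (hs : 0 < s) (hu : 0 < u) :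
    ∫ p, groupedIntegrand Az ζ ζ' ε (n * s) u p ∂bosonMeasure.prod fermMeasure =
      (Real.pi : ℂ) ^ 8 / (n : ℂ) ^ 8 * ∫ x, (polarJac x : ℂ) *
        (fermWeight n ε (x.1.mat * (x.2 : 𝕄 2)) *
          bosonInt Az ζ' s (fermC Az ζ x)) ∂fermMeasure := by
  have hn0 : n ≠ 0 := by omega
  have hn' : (n : ℂ) ≠ 0 := by exact_mod_cast hn0
  have hc : 0 < (n : ℝ) * s := by positivity
  rw [integral_prod_symm _ (integrable_groupedIntegrand hn Az ζ ζ' ε hc hu), ← integral_const_mul]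
  refine integral_congr_ae (.of_forall fun x => ?_)
  simp only [groupedIntegrand]
  rw [integral_const_mul, integral_const_mul, bosonInt,
    integral_bosonWeight_eq_bosonPart hn Az (fermC Az ζ x) ζ' hu hs, bosonMeasure,
    integral_prod _ (integrable_bosonPart hn Az (fermC Az ζ x) ζ' hc hu)]
  push_cast
  field_simp

/-- The integral representation of the averaged ratio, for every deformation and every shift of
the contour. -/
theorem genZ_eq_reprIntegral {Ω : Type*} [MeasurableSpace Ω] (P : Measure Ω)
    [IsProbabilityMeasure P] (hn : 4 ≤ n) {H₀ : Ω → 𝕄 n} (hH₀ : IsGinibre P H₀) (A₀ : 𝕄 n) (z₀ : ℂ)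
    (ζ ζ' : Fin 2 → ℂ) (ε : Fin 2 → ℝ) {c u : ℝ} (hc : 0 < c) (hu : 0 < u) :
    genZ P H₀ A₀ z₀ ζ ζ' (fun j => ε j / n) (c / n) = reprIntegral (A₀ - z₀ • 1) ζ ζ' ε c u := by
  have hn0 : n ≠ 0 := by omega
  have hn' : (n : ℂ) ≠ 0 := by exact_mod_cast hn0
  have hnr : (n : ℝ) ≠ 0 := by exact_mod_cast hn0
  have hs : 0 < c / n := by positivity
  have h1 := integral_groupedIntegrand hn (A₀ - z₀ • 1) ζ ζ' ε hs hu
  rw [mul_div_cancel₀ c hnr, integral_congr_ae (groupedIntegrand_eq hn0 _ ζ ζ' ε c hu),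
    integral_const_mul, measurePreserving_regroup.integral_comp regroup.measurableEmbedding
      (fun x => integrand (A₀ - z₀ • 1) ζ ζ' ε c u (Vars.ofTuple x))] at h1
  rw [genZ_eq_integral_polar P hn0 hH₀ A₀ z₀ ζ ζ' ε hs, reprIntegral]
  change _ * ∫ x, _ ∂fermMeasure = _
  set I₁ := ∫ x, integrand (A₀ - z₀ • 1) ζ ζ' ε c u (Vars.ofTuple x) ∂reprMeasure
  set I₂ := ∫ x, (polarJac x : ℂ) * (fermWeight n ε (x.1.mat * (x.2 : 𝕄 2)) *
    bosonInt (A₀ - z₀ • 1) ζ' (c / n) (fermC (A₀ - z₀ • 1) ζ x)) ∂fermMeasure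
  have h2 : I₂ = (n : ℂ) ^ 8 / (Real.pi : ℂ) ^ 8 *
      (16 * (Real.pi : ℂ) ^ 3 * (Real.pi : ℂ) ^ Fintype.card (Blk n) * I₁) := by
    rw [h1]
    field_simp
  rw [h2]
  push_cast
  field_simp

end FixedDeformation
/-! ### Random deformations -/

section RandomDeformation

variable {n : ℕ}

theorem re_qf_Yreg (H : 𝕄 n) (z : ℂ) (e : ℝ) (v : Fin n → ℂ) :
    (qf (Yreg H z e) v).re = sqn ((H - z • 1)ᴴ *ᵥ v) + e ^ 2 * sqn v := by
  rw [Yreg, qf_add, qf_smul, qf_one, qf_mul_conjTranspose]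
  simp [← ofReal_pow]

theorem posSemidef_Yreg (H : 𝕄 n) (z : ℂ) (e : ℝ) : (Yreg H z e).PosSemidef := by
  refine (posSemidef_self_mul_conjTranspose _).add (PosSemidef.one.smul ?_)
  rw [← ofReal_pow]
  exact_mod_cast sq_nonneg e

/-- Moving the spectral parameter changes the determinant of `Y(z) + e²` by at most a factor that
does not depend on the matrix. -/
theorem norm_det_Yreg_le (H : 𝕄 n) (z z' : ℂ) (e : ℝ) {s : ℝ} (hs : 0 < s) :
    ‖(Yreg H z e).det‖ ≤ (2 + (2 * ‖z' - z‖ ^ 2 + e ^ 2) / s ^ 2) ^ n * ‖(Yreg H z' s).det‖ := by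
  set k : ℝ := 2 + (2 * ‖z' - z‖ ^ 2 + e ^ 2) / s ^ 2 with hk
  have hk0 : 0 < k := by positivity
  by_cases h0 : (Yreg H z e).det = 0
  · rw [h0, norm_zero]
    positivity
  have hP : (Yreg H z e).PosDef :=
    (posSemidef_Yreg H z e).posDef_iff_isUnit.mpr
      ((isUnit_iff_isUnit_det _).mpr (isUnit_iff_ne_zero.mpr h0))
  have h1 : ∀ v, (qf (Yreg H z e) v).re ≤ (qf ((k : ℂ) • Yreg H z' s) v).re := by
    intro v
    rw [qf_smul, re_ofReal_mul, re_qf_Yreg, re_qf_Yreg]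
    have h2 : (H - z • 1)ᴴ *ᵥ v = (H - z' • 1)ᴴ *ᵥ v + star (z' - z) • v := by
      rw [show H - z • 1 = (H - z' • 1) + (z' - z) • (1 : 𝕄 n) by
        rw [sub_smul]; abel, conjTranspose_add, add_mulVec]
      simp [conjTranspose_smul, smul_mulVec]
    have h3 : sqn (star (z' - z) • v) = ‖z' - z‖ ^ 2 * sqn v := by
      simp only [sqn, Pi.smul_apply, smul_eq_mul, norm_mul, mul_pow, mul_sum, norm_star]
    have h4 := sqn_add_le ((H - z' • 1)ᴴ *ᵥ v) (star (z' - z) • v)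
    rw [← h2, h3] at h4
    have h5 : 2 * sqn ((H - z' • 1)ᴴ *ᵥ v) ≤ k * sqn ((H - z' • 1)ᴴ *ᵥ v) := by
      refine mul_le_mul_of_nonneg_right ?_ (sqn_nonneg _)
      rw [hk, le_add_iff_nonneg_right]
      positivity
    have h6 : (2 * ‖z' - z‖ ^ 2 + e ^ 2) * sqn v ≤ k * s ^ 2 * sqn v := by
      refine mul_le_mul_of_nonneg_right ?_ (sqn_nonneg _)
      rw [hk, add_mul, div_mul_cancel₀ _ (by positivity)]
      nlinarith
    nlinarith
  have h2 := norm_det_le_of_re_qf_le hP h1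
  rwa [det_smul, Fintype.card_fin, norm_mul, norm_pow, norm_real, Real.norm_eq_abs,
    abs_of_pos hk0] at h2

/-- The ratio of determinants is a bounded function of the matrix. -/
theorem exists_norm_detRatio_le (z₀ : ℂ) (ζ ζ' : Fin 2 → ℂ) (ε : Fin 2 → ℝ) {s : ℝ} (hs : 0 < s) :
    ∃ B : ℝ, ∀ H : 𝕄 n, ‖detRatio z₀ ζ ζ' ε s H‖ ≤ B := by
  refine ⟨∏ j : Fin 2, (2 + (2 * ‖point n z₀ ζ' j - point n z₀ ζ j‖ ^ 2 + ε j ^ 2) / s ^ 2) ^ n,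
    fun H => ?_⟩
  rw [detRatio, norm_prod]
  refine Finset.prod_le_prod (fun _ _ => norm_nonneg _) fun j _ => ?_
  rw [norm_div]
  exact div_le_of_le_mul₀ (norm_nonneg _) (by positivity) (norm_det_Yreg_le H _ _ _ hs)

/-- Freezing a variable: if `X` and `Y` are independent, then `E[f(X, Y) | X]` is the
expectation over `Y` alone, evaluated at `X`. -/
theorem condExp_comap_eq_integral_of_indepFun {Ω α β : Type*} [MeasurableSpace Ω]
    [MeasurableSpace α] [MeasurableSpace β] (P : Measure Ω) [IsProbabilityMeasure P] {X : Ω → α}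
    {Y : Ω → β} (hX : Measurable X) (hY : Measurable Y) (hXY : IndepFun X Y P) {f : α × β → ℂ}
    (hf : StronglyMeasurable f) {B : ℝ} (hB : ∀ p, ‖f p‖ ≤ B) :
    P[fun ω => f (X ω, Y ω) | MeasurableSpace.comap X inferInstance] =ᵐ[P]
      fun ω => ∫ ω', f (X ω, Y ω') ∂P := by
  have hle : MeasurableSpace.comap X inferInstance ≤ (inferInstance : MeasurableSpace Ω) :=
    hX.comap_le
  have hYp : IsProbabilityMeasure (P.map Y) := Measure.isProbabilityMeasure_map hY.aemeasurable
  set g : α → ℂ := fun x => ∫ y, f (x, y) ∂(P.map Y) with hg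
  have hgm : StronglyMeasurable g := hf.integral_prod_right'
  have hgB : ∀ x, ‖g x‖ ≤ B := fun x => by
    simpa using norm_integral_le_of_norm_le_const (μ := P.map Y) (.of_forall fun y => hB (x, y))
  have hg' : (fun ω => ∫ ω', f (X ω, Y ω') ∂P) = g ∘ X := by
    funext ω
    exact (integral_map hY.aemeasurable
      (hf.comp_measurable measurable_prodMk_left).aestronglyMeasurable).symm
  have hfi : Integrable f (P.map fun ω => (X ω, Y ω)) := by
    have : IsProbabilityMeasure (P.map fun ω => (X ω, Y ω)) :=
      Measure.isProbabilityMeasure_map (hX.prodMk hY).aemeasurable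
    exact Integrable.of_bound hf.aestronglyMeasurable B (.of_forall hB)
  have hmap := (indepFun_iff_map_prod_eq_prod_map_map hX.aemeasurable hY.aemeasurable).mp hXY
  rw [hg']
  symm
  refine ae_eq_condExp_of_forall_setIntegral_eq hle (hfi.comp_measurable (hX.prodMk hY))
    (fun s _ _ => (Integrable.of_bound (hgm.comp_measurable hX).aestronglyMeasurable B
      (.of_forall fun ω => hgB _)).integrableOn) ?_
    (hgm.comp_measurable (comap_measurable X)).aestronglyMeasurable
  rintro s ⟨t, ht, rfl⟩ -
  change ∫ ω in X ⁻¹' t, g (X ω) ∂P = _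
  rw [← setIntegral_map ht hgm.aestronglyMeasurable hX.aemeasurable,
    show X ⁻¹' t = (fun ω => (X ω, Y ω)) ⁻¹' (t ×ˢ Set.univ) by ext; simp,
    ← setIntegral_map (f := f) (ht.prod .univ) hf.aestronglyMeasurable
      (hX.prodMk hY).aemeasurable, hmap, setIntegral_prod]
  · simp [hg]
  · rw [← hmap]
    exact hfi.integrableOn

/-- Given the deformation, the conditional expectation is the generating functional of the frozen
deformation. -/
theorem condExp_detRatio {Ω : Type*} [MeasurableSpace Ω] (P : Measure Ω) [IsProbabilityMeasure P]
    {A₀ H₀ : Ω → 𝕄 n} (hA : Measurable A₀) (hH : Measurable H₀) (hAH : IndepFun A₀ H₀ P) (z₀ : ℂ)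
    (ζ ζ' : Fin 2 → ℂ) (ε : Fin 2 → ℝ) {s : ℝ} (hs : 0 < s) :
    P[fun ω => detRatio z₀ ζ ζ' ε s (A₀ ω + H₀ ω) | MeasurableSpace.comap A₀ inferInstance]
      =ᵐ[P] fun ω => genZ P H₀ (A₀ ω) z₀ ζ ζ' ε s := by
  obtain ⟨B, hB⟩ := exists_norm_detRatio_le (n := n) z₀ ζ ζ' ε hs
  exact condExp_comap_eq_integral_of_indepFun P hA hH hAH
    (f := fun p => detRatio z₀ ζ ζ' ε s (p.1 + p.2))
    ((measurable_detRatio z₀ ζ ζ' ε s).comp (show Measurable fun p : 𝕄 n × 𝕄 n => p.1 + p.2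
        from (continuous_fst.add continuous_snd).measurable)).stronglyMeasurable
    (fun _ => hB _)

end RandomDeformation

end DeformedGinibre

end

open DeformedGinibre

theorem proposition2 {Ω : Type*} [MeasurableSpace Ω] (P : Measure Ω) [IsProbabilityMeasure P]
    (n : ℕ) (hn : 4 ≤ n)
    (H₀ : Ω → Matrix (Fin n) (Fin n) ℂ) (hH₀ : IsGinibre P H₀)
    (z₀ : ℂ) (ζ ζ' : Fin 2 → ℂ) (ε : Fin 2 → ℝ) (ε' : ℝ) (hε' : 0 < ε') :
    -- for a fixed deformation matrix
    (∀ (A₀ : Matrix (Fin n) (Fin n) ℂ) (u : ℝ), IsUStar (A₀ - z₀ • 1) u →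
      ReprIntegrable (A₀ - z₀ • 1) ζ ζ' ε ε' u ∧
      genZ P H₀ A₀ z₀ ζ ζ' (fun j => ε j / n) (ε' / n) =
        reprIntegral (A₀ - z₀ • 1) ζ ζ' ε ε' u) ∧
    -- for a random deformation matrix independent of the Ginibre matrix, conditionally on it
    (∀ A₀ : Ω → Matrix (Fin n) (Fin n) ℂ, Measurable A₀ → IndepFun A₀ H₀ P →
      ∀ᵐ ω ∂P, ∀ u : ℝ, IsUStar (A₀ ω - z₀ • 1) u →
        ReprIntegrable (A₀ ω - z₀ • 1) ζ ζ' ε ε' u ∧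
        (P[fun ω' => detRatio z₀ ζ ζ' (fun j => ε j / n) (ε' / n) (A₀ ω' + H₀ ω') |
            MeasurableSpace.comap A₀ inferInstance]) ω =
          reprIntegral (A₀ ω - z₀ • 1) ζ ζ' ε ε' u) := by
  refine ⟨fun A₀ u hu => ⟨reprIntegrable_of_pos hn _ ζ ζ' ε hε' hu.1,
    genZ_eq_reprIntegral P hn hH₀ A₀ z₀ ζ ζ' ε hε' hu.1⟩, fun A₀ hA hAH => ?_⟩
  have hs : 0 < ε' / n := div_pos hε' (Nat.cast_pos.mpr (by omega))
  filter_upwards [condExp_detRatio P hA hH₀.measurable hAH z₀ ζ ζ' (fun j => ε j / n) hs]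
    with ω hω u hu
  exact ⟨reprIntegrable_of_pos hn _ ζ ζ' ε hε' hu.1,
    hω.trans (genZ_eq_reprIntegral P hn hH₀ (A₀ ω) z₀ ζ ζ' ε hε' hu.1)⟩
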